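/- Notation. Let $n\ge 3$, let $p=\frac{2n}{n-2}$, $q=\frac{2(n-1)}{n-2}$, and let $\lambda\in[0,1]$. For a smooth compact $n$-dimensional Riemannian manifold $(M,g)$ with (possibly empty) boundary, let $dV_g$, $d\sigma_g$ be the Riemannian measures of $M$ and $\partial M$, $R_g$ the scalar curvature, and $H_g$ the mean curvature of $\partial M$ (the trace, divided by $n-1$, of the second fundamental form with respect to the outward unit normal, so that the Euclidean unit ball has $H=1$). For $u\in H^1(M,g)$ put \[ E_M(u)=\int_M\frac{4(n-1)}{n-2}|\nabla u|_g^2\,dV_g+\int_M R_g u^2\,dV_g+2(n-1)\int_{\partial M}H_g u^2\,d\sigma_g , \] and let the $\lambda$-Yamabe constant be \[ Y_\lambda(M,[g])=\inf\Big\{E_M(u)\;:\;u\in H^1(M,g),\ u>0,\ \lambda\int_M|u|^p\,dV_g+(1-\lambda)\int_{\partial M}|u|^q\,d\sigma_g=1\Big\}\in[-\infty,+\infty] \] (with $\inf\emptyset=+\infty$). The $\lambda$-Yamabe invariant $\sigma_\lambda(M)$ is the supremum of $Y_\lambda(M,[g])$ over all conformal classes $[g]$ of smooth Riemannian metrics on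 $M$. Statement. Let $n\ge3$ and $\lambda\in[0,1]$. (1) Let $(M,g)$ be a closed $n$-dimensional Riemannian manifold, let $k\ge 1$, and let $(M_k,g_k)\to(M,g)$ be a $k$-fold Riemannian covering (a smooth covering map with all fibres of cardinality $k$, for which $g_k$ is the pullback of $g$). Then \[ Y_\lambda(M,[g])\ \ge\ \frac{Y_\lambda(M_k,[g_k])}{k^{2/n}} . \] (2) For the product of the real projective space $\mathbb{RP}^{n-1}$ with the circle and the closed hemisphere $S^n_+$ of the $n$-sphere, \[ \sigma_\lambda(\mathbb{RP}^{n-1}\times S^1)\ \ge\ \sigma_\lambda(S^n_+). \] -/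

import Mathlib

open Set Filter MeasureTheory Module
open scoped Manifold ContDiff Topology Matrix

noncomputable section

/-! ## Riemannian geometry in charts -/

namespace Yamabe

section Coordinates

variable {E : Type*} [NormedAddCommGroup E] [NormedSpace ℝ E]

/-- The Gram matrix `B (v i) (v j)` of a family of vectors for a bilinear form. -/
def gram (B : E →L[ℝ] E →L[ℝ] ℝ) {ι : Type*} (v : ι → E) : Matrix ι ι ℝ :=
  Matrix.of fun i j => B (v i) (v j)

variable [FiniteDimensional ℝ E]

/-- The square of the norm, dual to the inner product `B`, of a covector:
`|α|² = ∑ B^{ij} α_i α_j`. -/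
def dualNormSq (B : E →L[ℝ] E →L[ℝ] ℝ) (α : E →L[ℝ] ℝ) : ℝ :=
  ∑ i, ∑ j, (gram B (finBasis ℝ E))⁻¹ i j * α (finBasis ℝ E i) * α (finBasis ℝ E j)

/-- The `k`-th partial derivative, in the basis `finBasis ℝ E`, of a function on the subset `s` of
`E` (one-sided at the boundary points of `s`). -/
def partialDeriv (s : Set E) (k : Fin (finrank ℝ E)) (f : E → ℝ) (y : E) : ℝ :=
  fderivWithin ℝ f s y (finBasis ℝ E k)

/-- The Christoffel symbol
`Γ^i_{jk} = ½ ∑_l G^{il} (∂_j G_{lk} + ∂_k G_{lj} - ∂_l G_{jk})` of a metric with components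
`G`. -/
def christoffel (s : Set E) (G : E → Matrix (Fin (finrank ℝ E)) (Fin (finrank ℝ E)) ℝ)
    (i j k : Fin (finrank ℝ E)) (y : E) : ℝ :=
  (1 / 2) * ∑ l, (G y)⁻¹ i l *
    (partialDeriv s j (fun z => G z l k) y + partialDeriv s k (fun z => G z l j) y
      - partialDeriv s l (fun z => G z j k) y)

/-- The component
`R_{jk} = ∑_i (∂_i Γ^i_{jk} - ∂_j Γ^i_{ik} + ∑_l (Γ^i_{il} Γ^l_{jk} - Γ^i_{jl} Γ^l_{ik}))`
of the Ricci tensor. -/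
def ricciCoord (s : Set E) (G : E → Matrix (Fin (finrank ℝ E)) (Fin (finrank ℝ E)) ℝ)
    (j k : Fin (finrank ℝ E)) (y : E) : ℝ :=
  ∑ i, (partialDeriv s i (christoffel s G i j k) y - partialDeriv s j (christoffel s G i i k) y
    + ∑ l, (christoffel s G i i l y * christoffel s G l j k y
      - christoffel s G i j l y * christoffel s G l i k y))

/-- The scalar curvature `∑ G^{jk} R_{jk}`. -/
def scalarCurvatureCoord (s : Set E)
    (G : E → Matrix (Fin (finrank ℝ E)) (Fin (finrank ℝ E)) ℝ) (y : E) : ℝ :=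
  ∑ j, ∑ k, (G y)⁻¹ j k * ricciCoord s G j k y

/-- The gradient `N^i = ∑_j G^{ij} ℓ_j` of the linear function `ℓ`. -/
def gradCoord (G : E → Matrix (Fin (finrank ℝ E)) (Fin (finrank ℝ E)) ℝ) (ℓ : E →ₗ[ℝ] ℝ)
    (y : E) (i : Fin (finrank ℝ E)) : ℝ :=
  ∑ j, (G y)⁻¹ i j * ℓ (finBasis ℝ E j)

/-- The mean curvature, at a point `y` of the hyperplane `ℓ = 0`, of the boundary of the half-space
`0 ≤ ℓ`: the trace over the boundary directions, divided by `n - 1`, of the second fundamental form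
`II(X, Y) = g(∇_X ν, Y)`, where `ν = -∇ℓ / |∇ℓ|` is the outward unit normal. As `ℓ` is linear,
`II_{ij} = - (Hess ℓ)_{ij} / |∇ℓ| = ∑_k Γ^k_{ij} ℓ_k / |∇ℓ|`, and the trace over the boundary
directions is taken with `G^{ij} - ν^i ν^j = G^{ij} - N^i N^j / |∇ℓ|²`, `N = ∇ℓ`.
The unit ball has mean curvature `1`. -/
def meanCurvatureCoord (s : Set E) (G : E → Matrix (Fin (finrank ℝ E)) (Fin (finrank ℝ E)) ℝ)
    (ℓ : E →ₗ[ℝ] ℝ) (y : E) : ℝ :=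
  let N := gradCoord G ℓ y
  let normSq := ∑ i, N i * ℓ (finBasis ℝ E i)
  (1 / ((finrank ℝ E : ℝ) - 1)) * ∑ i, ∑ j, ((G y)⁻¹ i j - N i * N j / normSq) *
    ((∑ k, christoffel s G k i j y * ℓ (finBasis ℝ E k)) / Real.sqrt normSq)

end Coordinates

section Manifold

variable {E : Type*} [NormedAddCommGroup E] [NormedSpace ℝ E]
  {H : Type*} [TopologicalSpace H] (I : ModelWithCorners ℝ E H)

/-- Smooth Riemannian metrics on the manifold `M`. -/
abbrev SmoothMetric (M : Type*) [TopologicalSpace M] [ChartedSpace H M] [IsManifold I ∞ M] :=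
  Bundle.ContMDiffRiemannianMetric I ∞ E (fun x : M => TangentSpace I x)

/-- A linear function `ℓ` such that the model `range I` is the half-space `0 ≤ ℓ`; it is unique up
to a positive factor, on which nothing below depends. For a model without boundary, `ℓ = 0`. -/
def boundaryCovector : E →ₗ[ℝ] ℝ :=
  Classical.epsilon fun ℓ : E →ₗ[ℝ] ℝ => Set.range I = {y | 0 ≤ ℓ y}

variable {I} {M : Type*} [TopologicalSpace M] [ChartedSpace H M] [IsManifold I ∞ M]

/-- The inner product of the metric as a bilinear form on the vector space `E`, which underlies
every tangent space. -/
def SmoothMetric.form (g : SmoothMetric I M) (x : M) : E →L[ℝ] E →L[ℝ] ℝ := g.inner x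

/-- The metric written in the chart at `x₀`: the pullback of `g` under the inverse chart. -/
def SmoothMetric.inChart (g : SmoothMetric I M) (x₀ : M) (y v w : E) : ℝ :=
  g.inner ((extChartAt I x₀).symm y)
    (mfderivWithin 𝓘(ℝ, E) I (extChartAt I x₀).symm (Set.range I) y v)
    (mfderivWithin 𝓘(ℝ, E) I (extChartAt I x₀).symm (Set.range I) y w)

variable [FiniteDimensional ℝ E]

/-- The components of the metric in the chart at `x₀`. -/
def SmoothMetric.coord (g : SmoothMetric I M) (x₀ : M) (y : E) :
    Matrix (Fin (finrank ℝ E)) (Fin (finrank ℝ E)) ℝ :=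
  Matrix.of fun i j => g.inChart x₀ y (finBasis ℝ E i) (finBasis ℝ E j)

/-- The scalar curvature `R_g`. -/
def SmoothMetric.scalarCurvature (g : SmoothMetric I M) (x : M) : ℝ :=
  scalarCurvatureCoord (Set.range I) (g.coord x) (extChartAt I x x)

/-- The mean curvature `H_g` of the boundary, at boundary points `x`. -/
def SmoothMetric.meanCurvature (g : SmoothMetric I M) (x : M) : ℝ :=
  meanCurvatureCoord (Set.range I) (g.coord x) (boundaryCovector I) (extChartAt I x x)

/-- The norm of a covector at `x`. -/
def SmoothMetric.dualNorm (g : SmoothMetric I M) (x : M) (α : TangentSpace I x →L[ℝ] ℝ) : ℝ :=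
  Real.sqrt (dualNormSq (g.form x) α)

/-- The differential of a real function. -/
def differential (I : ModelWithCorners ℝ E H) (u : M → ℝ) (x : M) : TangentSpace I x →L[ℝ] ℝ :=
  mfderiv I 𝓘(ℝ, ℝ) u x

variable [MeasurableSpace E] [BorelSpace E] [MeasurableSpace M]

/-- The measure `√(det g_{ij}) dy` of the chart at `x₀`, transported to `M` (it lives on the domain
of that chart). -/
def SmoothMetric.chartVolume (g : SmoothMetric I M) (x₀ : M) : Measure M :=
  Measure.map (extChartAt I x₀).symm
    (((finBasis ℝ E).addHaar.restrict (extChartAt I x₀).target).withDensity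
      fun y => ENNReal.ofReal (Real.sqrt (g.coord x₀ y).det))

/-- The Riemannian measure `dV_g`. The measures of the charts agree on the overlaps of their
domains, and their supremum (in the lattice of measures) is the measure on `M` which restricts to
each of them. -/
def SmoothMetric.volume (g : SmoothMetric I M) : Measure M :=
  ⨆ x₀ : M, g.chartVolume x₀

/-- The measure `√(det g(c_i, c_j)) dz` on the boundary hyperplane `ℓ = 0` of the chart at `x₀`,
where `c` is a basis of the hyperplane and `dz` the Lebesgue measure of this basis, transported to
`M`. -/
def SmoothMetric.chartBoundaryMeasure (g : SmoothMetric I M) (x₀ : M) : Measure M :=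
  Measure.map (fun z : LinearMap.ker (boundaryCovector I) => (extChartAt I x₀).symm (z : E))
    (((finBasis ℝ (LinearMap.ker (boundaryCovector I))).addHaar.restrict
        {z | (z : E) ∈ (extChartAt I x₀).target}).withDensity
      fun z => ENNReal.ofReal (Real.sqrt (Matrix.det (Matrix.of fun i j =>
        g.inChart x₀ (z : E)
          (finBasis ℝ (LinearMap.ker (boundaryCovector I)) i : E)
          (finBasis ℝ (LinearMap.ker (boundaryCovector I)) j : E)))))

/-- The measure `dσ_g` on `∂M` induced by the metric, as a measure on `M` carried by `∂M`. It is
zero if `∂M` is empty. -/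
def SmoothMetric.boundaryMeasure (g : SmoothMetric I M) : Measure M :=
  (⨆ x₀ : M, g.chartBoundaryMeasure x₀).restrict (I.boundary M)

/-! ## The Sobolev space and the Yamabe constants -/

/-- An element of the Sobolev space `H¹(M, g)` of a compact manifold, the completion of `C^∞(M)`
(smooth up to the boundary) in the `H¹`-norm, given by representatives of the function `u`, of its
weak differential `du` and of its trace on `∂M`: there are smooth functions `v_j` on `M` with
`v_j → u` and `d v_j → du` in `L²(M, dV_g)` and `v_j → trace u` in `L²(∂M, dσ_g)`. -/
structure SobolevH1 (g : SmoothMetric I M) where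
  /-- the function -/
  toFun : M → ℝ
  /-- its weak differential -/
  diff : ∀ x : M, TangentSpace I x →L[ℝ] ℝ
  /-- its trace on the boundary -/
  trace : M → ℝ
  exists_approx : ∃ v : ℕ → M → ℝ, (∀ j, ContMDiff I 𝓘(ℝ, ℝ) ∞ (v j)) ∧
    (∀ j, MemLp (fun x => v j x - toFun x) 2 g.volume) ∧
    (∀ j, MemLp (fun x => g.dualNorm x (differential I (v j) x - diff x)) 2 g.volume) ∧
    (∀ j, MemLp (fun x => v j x - trace x) 2 g.boundaryMeasure) ∧
    Tendsto (fun j => eLpNorm (fun x => v j x - toFun x) 2 g.volume) atTop (𝓝 0) ∧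
    Tendsto (fun j => eLpNorm (fun x => g.dualNorm x (differential I (v j) x - diff x)) 2
      g.volume) atTop (𝓝 0) ∧
    Tendsto (fun j => eLpNorm (fun x => v j x - trace x) 2 g.boundaryMeasure) atTop (𝓝 0)

/-- The energy
`E_M(u) = ∫_M 4(n-1)/(n-2) |∇u|² dV_g + ∫_M R_g u² dV_g + 2(n-1) ∫_{∂M} H_g u² dσ_g`,
where `n` is the dimension of `M`. -/
def energy (g : SmoothMetric I M) (u : SobolevH1 g) : ℝ :=
  let n : ℝ := finrank ℝ E
  (∫ x, 4 * (n - 1) / (n - 2) * g.dualNorm x (u.diff x) ^ 2 ∂g.volume)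
    + (∫ x, g.scalarCurvature x * u.toFun x ^ 2 ∂g.volume)
    + 2 * (n - 1) * ∫ x, g.meanCurvature x * u.trace x ^ 2 ∂g.boundaryMeasure

/-- The constraint set `C_{a,b}(M, g)` of the positive `u ∈ H¹(M, g)` with
`a ∫_M |u|^p dV_g + b ∫_{∂M} |u|^q dσ_g = 1`, where `p = 2n/(n-2)` and `q = 2(n-1)/(n-2)`. -/
def constraintSet (a b : ℝ) (g : SmoothMetric I M) : Set (SobolevH1 g) :=
  let n : ℝ := finrank ℝ E
  {u | a * (∫ x, |u.toFun x| ^ (2 * n / (n - 2)) ∂g.volume)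
      + b * (∫ x, |u.trace x| ^ (2 * (n - 1) / (n - 2)) ∂g.boundaryMeasure) = 1 ∧
    ∀ᵐ x ∂g.volume, 0 < u.toFun x}

/-- The generalized Yamabe constant `Y_{a,b}(M, ∂M, [g])`, the infimum of the energy on
`C_{a,b}(M, g)` in the extended reals. -/
def genYamabeConstant (a b : ℝ) (g : SmoothMetric I M) : EReal :=
  ⨅ u ∈ constraintSet a b g, (energy g u : EReal)

/-- The `t`-Yamabe constant `Y_t(M, ∂M, [g]) = Y_{t,1-t}(M, ∂M, [g])`. -/
def yamabeConstant (t : ℝ) (g : SmoothMetric I M) : EReal :=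
  genYamabeConstant t (1 - t) g

variable (I M) in
/-- The `t`-Yamabe invariant, the supremum of the `t`-Yamabe constants over all metrics (and so
over all conformal classes) on `M`. -/
def yamabeInvariant (t : ℝ) : EReal :=
  ⨆ g : SmoothMetric I M, yamabeConstant t g

end Manifold

section Covering

variable {E : Type*} [NormedAddCommGroup E] [NormedSpace ℝ E]
  {H : Type*} [TopologicalSpace H] {I : ModelWithCorners ℝ E H}
  {M : Type*} [TopologicalSpace M] [ChartedSpace H M] [IsManifold I ∞ M]
  {M' : Type*} [TopologicalSpace M'] [ChartedSpace H M'] [IsManifold I ∞ M']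

/-- `π : (M', g') → (M, g)` is a `k`-fold Riemannian covering: a smooth covering map, all of whose
fibres have `k` points, with `π^* g = g'`. -/
structure IsRiemannianCovering (k : ℕ) (π : M' → M) (g' : SmoothMetric I M') (g : SmoothMetric I M) :
    Prop where
  isCoveringMap : IsCoveringMap π
  contMDiff : ContMDiff I I ∞ π
  encard_fiber : ∀ x : M, (π ⁻¹' {x}).encard = k
  isometric : ∀ (y : M') (v w : TangentSpace I y),
    g.inner (π y) (mfderiv I I π y v) (mfderiv I I π y w) = g'.inner y v w

end Covering

end Yamabe

/-! ## Real projective space -/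

/-- The real projective space `ℝP^m` of the lines in `ℝ^{m+1}`. -/
def RealProjectiveSpace (m : ℕ) : Type := Projectivization ℝ (Fin (m + 1) → ℝ)

namespace RealProjectiveSpace

variable {m : ℕ}

/-- The line of a nonzero vector. -/
def mk (v : {v : Fin (m + 1) → ℝ // v ≠ 0}) : RealProjectiveSpace m :=
  Projectivization.mk' ℝ v

/-- The quotient topology. -/
instance : TopologicalSpace (RealProjectiveSpace m) :=
  TopologicalSpace.coinduced mk inferInstance

instance : MeasurableSpace (RealProjectiveSpace m) := borel _

instance : BorelSpace (RealProjectiveSpace m) := ⟨rfl⟩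

theorem mk_surjective : Function.Surjective (mk : _ → RealProjectiveSpace m) := fun x =>
  Quotient.exists_rep x

theorem isQuotientMap_mk : Topology.IsQuotientMap (mk : _ → RealProjectiveSpace m) :=
  ⟨⟨rfl⟩, mk_surjective⟩

theorem mk_eq_iff (v w : {v : Fin (m + 1) → ℝ // v ≠ 0}) :
    mk v = mk w ↔ ∃ a : ℝ, a • (w : Fin (m + 1) → ℝ) = v :=
  Projectivization.mk_eq_mk_iff' ℝ v.1 w.1 v.2 w.2

/-- The affine coordinates `(x_j / x_i)_{j ≠ i}`. -/
def affineCoord (i : Fin (m + 1)) : RealProjectiveSpace m → EuclideanSpace ℝ (Fin m) :=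
  Projectivization.lift (fun v => WithLp.toLp 2 fun j => v.1 (i.succAbove j) / v.1 i) (by
    rintro ⟨a, ha⟩ ⟨b, hb⟩ t (rfl : a = t • b)
    have ht : t ≠ 0 := by rintro rfl; simp at ha
    ext j
    simp [mul_div_mul_left _ _ ht])

/-- The vector with `i`-th coordinate `1` and the other coordinates `y`. -/
def affineVec (i : Fin (m + 1)) (y : EuclideanSpace ℝ (Fin m)) :
    {v : Fin (m + 1) → ℝ // v ≠ 0} :=
  ⟨i.insertNth (α := fun _ => ℝ) 1 y.ofLp, fun h => by
    have := congrFun h i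
    simp at this⟩

/-- The set `x_i ≠ 0`. -/
def affineSource (i : Fin (m + 1)) : Set (RealProjectiveSpace m) :=
  mk '' {v | v.1 i ≠ 0}

theorem affineCoord_mk (i : Fin (m + 1)) (v : {v : Fin (m + 1) → ℝ // v ≠ 0}) :
    affineCoord i (mk v) = WithLp.toLp 2 fun j => v.1 (i.succAbove j) / v.1 i := rfl

theorem mk_mem_affineSource (i : Fin (m + 1)) (v : {v : Fin (m + 1) → ℝ // v ≠ 0}) :
    mk v ∈ affineSource i ↔ v.1 i ≠ 0 := by
  constructor
  · rintro ⟨w, hw, h⟩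
    obtain ⟨a, ha⟩ := (mk_eq_iff w v).1 h
    intro h0
    apply hw
    rw [← ha]
    simp [h0]
  · intro h
    exact ⟨v, h, rfl⟩

theorem isOpen_affineSource (i : Fin (m + 1)) : IsOpen (affineSource (m := m) i) := by
  rw [← isQuotientMap_mk.isOpen_preimage]
  have : mk ⁻¹' affineSource (m := m) i = {v | v.1 i ≠ 0} := by
    ext v; exact mk_mem_affineSource i v
  rw [this]
  exact isOpen_ne_fun ((continuous_apply i).comp continuous_subtype_val) continuous_const

theorem continuous_affineVec (i : Fin (m + 1)) : Continuous (affineVec (m := m) i) := by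
  refine Continuous.subtype_mk ?_ _
  refine continuous_pi fun j => ?_
  rcases Fin.eq_self_or_eq_succAbove i j with rfl | ⟨k, rfl⟩
  · simpa using continuous_const
  · simp only [Fin.insertNth_apply_succAbove]
    fun_prop

/-- The affine chart on `x_i ≠ 0`. -/
def affineChart (i : Fin (m + 1)) :
    OpenPartialHomeomorph (RealProjectiveSpace m) (EuclideanSpace ℝ (Fin m)) where
  toFun := affineCoord i
  invFun y := mk (affineVec i y)
  source := affineSource i
  target := univ
  map_source' _ _ := mem_univ _
  map_target' y _ := (mk_mem_affineSource i _).2 (by simp [affineVec])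
  left_inv' x hx := by
    obtain ⟨v, rfl⟩ := mk_surjective x
    have hv := (mk_mem_affineSource i v).1 hx
    rw [mk_eq_iff]
    refine ⟨(v.1 i)⁻¹, funext fun j => ?_⟩
    rcases Fin.eq_self_or_eq_succAbove i j with rfl | ⟨k, rfl⟩
    · simp [affineVec, hv]
    · simp [affineVec, affineCoord_mk, div_eq_inv_mul]
  right_inv' y _ := by
    rw [affineCoord_mk]
    ext j
    simp [affineVec]
  open_source := isOpen_affineSource i
  open_target := isOpen_univ
  continuousOn_toFun := by
    rw [isQuotientMap_mk.continuousOn_isOpen_iff (isOpen_affineSource i)]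
    have : affineCoord i ∘ mk = fun v : {v : Fin (m + 1) → ℝ // v ≠ 0} =>
      WithLp.toLp 2 fun j => v.1 (i.succAbove j) / v.1 i := rfl
    rw [this]
    refine (PiLp.continuous_toLp 2 _).comp_continuousOn (continuousOn_pi.2 fun j => ?_)
    have hc : ∀ l : Fin (m + 1), Continuous fun v : {v : Fin (m + 1) → ℝ // v ≠ 0} => v.1 l :=
      fun l => (continuous_apply l).comp continuous_subtype_val
    refine ContinuousOn.div (hc _).continuousOn (hc _).continuousOn fun v hv => ?_
    exact (mk_mem_affineSource i v).1 hv
  continuousOn_invFun :=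
    (isQuotientMap_mk.continuous.comp (continuous_affineVec i)).continuousOn

theorem exists_mem_affineSource (x : RealProjectiveSpace m) : ∃ i, x ∈ affineSource i := by
  obtain ⟨v, rfl⟩ := mk_surjective x
  obtain ⟨i, hi⟩ := Function.ne_iff.1 v.2
  exact ⟨i, (mk_mem_affineSource i v).2 hi⟩

/-- The smooth structure of `ℝP^m`, given by the affine charts. -/
instance : ChartedSpace (EuclideanSpace ℝ (Fin m)) (RealProjectiveSpace m) where
  atlas := Set.range affineChart
  chartAt x := affineChart (exists_mem_affineSource x).choose
  mem_chart_source x := (exists_mem_affineSource x).choose_spec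
  chart_mem_atlas _ := mem_range_self _

instance : IsManifold (𝓡 m) ∞ (RealProjectiveSpace m) := by
  apply isManifold_of_contDiffOn
  rintro _ _ ⟨i, rfl⟩ ⟨k, rfl⟩
  simp only [modelWithCornersSelf_coe, modelWithCornersSelf_coe_symm, Function.comp_id,
    Function.id_comp, preimage_id, range_id, inter_univ]
  have hvec : ContDiff ℝ ∞ fun y => (affineVec (m := m) i y).1 := by
    rw [contDiff_pi]
    intro j
    rcases Fin.eq_self_or_eq_succAbove i j with rfl | ⟨l, rfl⟩
    · simpa [affineVec] using contDiff_const
    · simp only [affineVec, Fin.insertNth_apply_succAbove]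
      fun_prop
  have hvec' := fun j => (contDiff_pi.1 hvec) j
  have h : ContDiffOn ℝ ∞ (fun y => (WithLp.toLp 2 fun j =>
      (affineVec i y).1 (k.succAbove j) / (affineVec i y).1 k : EuclideanSpace ℝ (Fin m)))
      {y | (affineVec i y).1 k ≠ 0} := by
    rw [contDiffOn_euclidean]
    intro j
    exact ContDiffOn.div (hvec' _).contDiffOn (hvec' _).contDiffOn fun y hy => hy
  refine h.mono ?_
  rintro y ⟨_, hy⟩
  exact (mk_mem_affineSource k _).1 hy

end RealProjectiveSpace

/-! ## The hemisphere -/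

/-- The closed hemisphere `S^n_+`, in `ℝ^{n+1} = ℝ^n × ℝ`: the points `(z, t)` of the unit sphere
with `0 ≤ z_0`. -/
abbrev Hemisphere (n : ℕ) [NeZero n] : Type :=
  {p : EuclideanSpace ℝ (Fin n) × ℝ // ‖p.1‖ ^ 2 + p.2 ^ 2 = 1 ∧ 0 ≤ p.1 0}

namespace Hemisphere

variable {n : ℕ} [NeZero n]

theorem mul_le_one {ε : ℝ} (hε : ε ^ 2 = 1) (p : Hemisphere n) : ε * p.1.2 ≤ 1 := by
  have h := p.2.1
  nlinarith [sq_nonneg ‖p.1.1‖, sq_nonneg (ε - p.1.2)]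

/-- The stereographic projection `(z, t) ↦ z / (1 - ε t)` from the point `(0, ε)` of the equator,
`ε = ±1`, with values in the half-space `0 ≤ y_0`. -/
def stereoFun (ε : ℝ) (hε : ε ^ 2 = 1) (p : Hemisphere n) : EuclideanHalfSpace n :=
  ⟨(1 - ε * p.1.2)⁻¹ • p.1.1, by
    have h4 : 0 ≤ (1 - ε * p.1.2)⁻¹ := inv_nonneg.2 (by linarith [mul_le_one hε p])
    simpa using mul_nonneg h4 p.2.2⟩

/-- Its inverse `y ↦ (2 y / (|y|² + 1), ε (|y|² - 1) / (|y|² + 1))`. -/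
def stereoInv (ε : ℝ) (hε : ε ^ 2 = 1) (y : EuclideanHalfSpace n) : Hemisphere n :=
  ⟨((2 / (‖y.1‖ ^ 2 + 1)) • y.1, ε * ((‖y.1‖ ^ 2 - 1) / (‖y.1‖ ^ 2 + 1))), by
    have h : (0 : ℝ) < ‖y.1‖ ^ 2 + 1 := by positivity
    refine ⟨?_, ?_⟩
    · simp only [norm_smul, mul_pow, hε, Real.norm_eq_abs, sq_abs]
      field_simp
      ring
    · have := y.2
      simp only [PiLp.smul_apply, smul_eq_mul]
      positivity⟩

/-- The stereographic projection is a chart on the hemisphere without its centre `(0, ε)`, onto the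
half-space. -/
def stereoChart (ε : ℝ) (hε : ε ^ 2 = 1) :
    OpenPartialHomeomorph (Hemisphere n) (EuclideanHalfSpace n) where
  toFun := stereoFun ε hε
  invFun := stereoInv ε hε
  source := {p | ε * p.1.2 ≠ 1}
  target := univ
  map_source' _ _ := mem_univ _
  map_target' y _ := by
    have h : (0 : ℝ) < ‖y.1‖ ^ 2 + 1 := by positivity
    change ε * (ε * ((‖y.1‖ ^ 2 - 1) / (‖y.1‖ ^ 2 + 1))) ≠ 1
    rw [← mul_assoc, ← sq, hε, one_mul, ne_eq, div_eq_one_iff_eq h.ne']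
    linarith
  left_inv' p hp := by
    have hp1 : ε * p.1.2 ≠ 1 := hp
    have hp' : 1 - ε * p.1.2 ≠ 0 := fun h => hp1 (by linarith)
    have h1 : ‖p.1.1‖ ^ 2 = (1 - ε * p.1.2) * (1 + ε * p.1.2) := by
      have := p.2.1
      linear_combination this + p.1.2 ^ 2 * hε
    have hN : ‖(1 - ε * p.1.2)⁻¹ • p.1.1‖ ^ 2 = (1 + ε * p.1.2) / (1 - ε * p.1.2) := by
      rw [norm_smul, mul_pow, h1, Real.norm_eq_abs, sq_abs]
      field_simp
    have h2 : (1 + ε * p.1.2) / (1 - ε * p.1.2) + 1 = 2 / (1 - ε * p.1.2) := by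
      field_simp
      ring
    refine Subtype.ext (Prod.ext ?_ ?_)
    · change (2 / (‖(1 - ε * p.1.2)⁻¹ • p.1.1‖ ^ 2 + 1)) • (1 - ε * p.1.2)⁻¹ • p.1.1 = p.1.1
      rw [hN, h2, smul_smul]
      have : 2 / (2 / (1 - ε * p.1.2)) * (1 - ε * p.1.2)⁻¹ = 1 := by field_simp
      rw [this, one_smul]
    · change ε * ((‖(1 - ε * p.1.2)⁻¹ • p.1.1‖ ^ 2 - 1) /
        (‖(1 - ε * p.1.2)⁻¹ • p.1.1‖ ^ 2 + 1)) = p.1.2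
      rw [hN, h2]
      have h3 : (1 + ε * p.1.2) / (1 - ε * p.1.2) - 1 = 2 * (ε * p.1.2) / (1 - ε * p.1.2) := by
        field_simp
        ring
      have h4 : ε * (2 * (ε * p.1.2) / (1 - ε * p.1.2) / (2 / (1 - ε * p.1.2))) = ε ^ 2 * p.1.2 := by
        field_simp
      rw [h3, h4, hε, one_mul]
  right_inv' y _ := by
    have h : (0 : ℝ) < ‖y.1‖ ^ 2 + 1 := by positivity
    refine Subtype.ext ?_
    change (1 - ε * (ε * ((‖y.1‖ ^ 2 - 1) / (‖y.1‖ ^ 2 + 1))))⁻¹ •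
      (2 / (‖y.1‖ ^ 2 + 1)) • y.1 = y.1
    rw [← mul_assoc, ← sq, hε, one_mul, smul_smul]
    have : (1 - (‖y.1‖ ^ 2 - 1) / (‖y.1‖ ^ 2 + 1))⁻¹ * (2 / (‖y.1‖ ^ 2 + 1)) = 1 := by
      have : 1 - (‖y.1‖ ^ 2 - 1) / (‖y.1‖ ^ 2 + 1) = 2 / (‖y.1‖ ^ 2 + 1) := by
        field_simp
        ring
      rw [this]
      field_simp
    rw [this, one_smul]
  open_source := isOpen_ne_fun (by fun_prop) continuous_const
  open_target := isOpen_univ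
  continuousOn_toFun := by
    refine Topology.IsInducing.subtypeVal.continuousOn_iff.2 ?_
    change ContinuousOn (fun p : Hemisphere n => (1 - ε * p.1.2)⁻¹ • p.1.1) _
    have h : ∀ p ∈ {p : Hemisphere n | ε * p.1.2 ≠ 1}, 1 - ε * p.1.2 ≠ 0 :=
      fun p hp h => hp (by linarith)
    have hc : Continuous fun p : Hemisphere n => 1 - ε * p.1.2 := by fun_prop
    have hc' : Continuous fun p : Hemisphere n => p.1.1 := by fun_prop
    exact (hc.continuousOn.inv₀ h).smul hc'.continuousOn
  continuousOn_invFun := by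
    refine Continuous.continuousOn (Continuous.subtype_mk ?_ _)
    have hc : Continuous fun y : EuclideanHalfSpace n => y.1 := continuous_subtype_val
    have h : ∀ y : EuclideanHalfSpace n, ‖y.1‖ ^ 2 + 1 ≠ 0 := fun y => by positivity
    have h1 : Continuous fun y : EuclideanHalfSpace n => ‖y.1‖ ^ 2 := hc.norm.pow 2
    exact ((continuous_const.div (h1.add continuous_const) h).smul hc).prodMk
      (continuous_const.mul ((h1.sub continuous_const).div (h1.add continuous_const) h))

/-- The sign of the centre of a stereographic projection that is defined at `p`. -/
def centre (p : Hemisphere n) : ℝ := if p.1.2 = 1 then -1 else 1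

theorem centre_sq (p : Hemisphere n) : centre p ^ 2 = 1 := by
  unfold centre; split_ifs <;> norm_num

/-- The smooth structure of the hemisphere as a manifold with boundary, given by the stereographic
projections from the two points `(0, 1)` and `(0, -1)` of the equator. -/
instance : ChartedSpace (EuclideanHalfSpace n) (Hemisphere n) where
  atlas := {c | ∃ (ε : ℝ) (hε : ε ^ 2 = 1), c = stereoChart ε hε}
  chartAt p := stereoChart (centre p) (centre_sq p)
  mem_chart_source p := by
    change centre p * p.1.2 ≠ 1
    unfold centre
    split_ifs with h
    · rw [h]; norm_num
    · simpa using h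
  chart_mem_atlas p := ⟨_, _, rfl⟩

instance : IsManifold (𝓡∂ n) ∞ (Hemisphere n) := by
  apply isManifold_of_contDiffOn
  rintro _ _ ⟨ε, hε, rfl⟩ ⟨δ, hδ, rfl⟩
  have hN : ContDiff ℝ ∞ fun y : EuclideanSpace ℝ (Fin n) => ‖y‖ ^ 2 := contDiff_norm_sq ℝ
  have hpos : ∀ y : EuclideanSpace ℝ (Fin n), ‖y‖ ^ 2 + 1 ≠ 0 := fun y => by positivity
  have hT : ContDiff ℝ ∞ fun y : EuclideanSpace ℝ (Fin n) =>
      1 - δ * (ε * ((‖y‖ ^ 2 - 1) / (‖y‖ ^ 2 + 1))) :=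
    contDiff_const.sub (contDiff_const.mul (contDiff_const.mul
      ((hN.sub contDiff_const).div (hN.add contDiff_const) hpos)))
  have hV : ContDiff ℝ ∞ fun y : EuclideanSpace ℝ (Fin n) => (2 / (‖y‖ ^ 2 + 1)) • y :=
    (contDiff_const.div (hN.add contDiff_const) hpos).smul contDiff_id
  have h : ContDiffOn ℝ ∞ (fun y : EuclideanSpace ℝ (Fin n) =>
      (1 - δ * (ε * ((‖y‖ ^ 2 - 1) / (‖y‖ ^ 2 + 1))))⁻¹ • (2 / (‖y‖ ^ 2 + 1)) • y)
      {y | 1 - δ * (ε * ((‖y‖ ^ 2 - 1) / (‖y‖ ^ 2 + 1))) ≠ 0} :=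
    ContDiffOn.smul (hT.contDiffOn.inv fun y hy => hy) hV.contDiffOn
  refine ContDiffOn.congr (h.mono ?_) ?_
  · rintro y ⟨⟨_, hy⟩, ⟨z, rfl⟩⟩
    have hz : (𝓡∂ n).symm ((𝓡∂ n) z) = z := (𝓡∂ n).left_inv z
    rw [mem_preimage, hz] at hy
    change δ * (ε * ((‖z.1‖ ^ 2 - 1) / (‖z.1‖ ^ 2 + 1))) ≠ 1 at hy
    intro h0
    apply hy
    change 1 - δ * (ε * ((‖z.1‖ ^ 2 - 1) / (‖z.1‖ ^ 2 + 1))) = 0 at h0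
    linarith
  · rintro y ⟨_, ⟨z, rfl⟩⟩
    have hz : (𝓡∂ n).symm ((𝓡∂ n) z) = z := (𝓡∂ n).left_inv z
    simp only [Function.comp_apply, hz]
    rfl

end Hemisphere

end

/-! Write `p = 2n/(n-2)`, `θ = (n-2)/n = 2/p`, `a = 4(n-1)/(n-2)`, and `t` for `λ`.

Coverings. A competitor `u` on `M` lifts to `c · u ∘ π` with `c = k^(-1/p)`. Integrals over the
covering are `k` times integrals over `M` (`IsRiemannianCovering.map_volume`), and there is no
boundary, so the constraint is kept because `c^p k = 1`, while the energy is multiplied by `c² k =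
k^(1-2/p) = k^(2/n)`. The labour lies in the scalar curvature: it is defined at each point through
the preferred chart there, so its invariance under local isometries has to be proved from the
coordinate formulas (`metricTrace_ricciForm_pullback`,
`SmoothMetric.scalarCurvature_eq_of_parametrization`).

Projective space times circle. For `t = 0` the constraint on a closed manifold reads `0 = 1`, and
the invariant of `ℝP^(n-1) × S¹` is `⊤`. For `t > 0` both sides are compared with the Sobolev
inequality of `ℝⁿ` (`SobolevIneq n S`); the sharp value of `S` never enters.

Upper bound for the hemisphere: let `h ≥ 0` be a test function on `ℝⁿ`. Some hyperplane halves `∫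
h^p`, and on one of its sides lies at most half of `∫ |∇h|²` (`exists_half_mass`). That half, moved
by a translation or a reflection to a half-space, shrunk by `δ` and implanted at a boundary point of
the hemisphere, has energy `δ^(n-2)(a ∫ |∇h|² / 2 + o(1))` at most, because the curvature terms and
the boundary integral scale with a higher power of `δ`. As `δ → 0` (`yamabeConstant_le_tilted`),
every real `y ≤ Y_t` gives the Sobolev inequality with `S = 2 y (t/2)^θ`
(`sobolevIneq_of_le_yamabeConstant`).

Lower bound for the product: the map `x ↦ ([x], e^{i log|x|/r})` is a local isometry from `ℝⁿ ∖ 0`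
with the cylinder metric `|dx|²/|x|²`, and an annulus of one period covers the product exactly
twice. The substitution `|x|^(-(n-2)/2) w` turns `∫ |∇h|²` on `ℝⁿ` into the cylinder energy `∫ |∇w|²
+ ((n-2)/2)² w²`, which is the Yamabe energy divided by `a`. A function on the product with a circle
of length `N` is lifted to one period, cut off near the two ends, and inserted in the Sobolev
inequality. The cut may be placed at any of `N` integer positions; summing over them, the loss in
the collars is bounded by a fixed multiple of the energy against a main term growing like `N`
(`SobolevIneq.le_of_smooth`). Letting `N → ∞` yields `Y_t ≥ S (2/t)^θ / 2` in the supremum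
(`SobolevIneq.le_yamabeInvariant`). With the `S` above this is `y`: the double covering exactly
compensates the halving of `ℝⁿ`. -/

set_option maxSynthPendingDepth 3
set_option linter.unusedSectionVars false

noncomputable section

namespace Yamabe

/-! ### Traces with respect to a bilinear form, and independence of the basis. -/

section MetricTrace

variable {E : Type*} [NormedAddCommGroup E] [NormedSpace ℝ E]

theorem gram_apply (B : E →L[ℝ] E →L[ℝ] ℝ) {ι : Type*} (v : ι → E) (i j : ι) :
    gram B v i j = B (v i) (v j) := rfl

theorem gram_sum_smul (B : E →L[ℝ] E →L[ℝ] ℝ) {ι κ : Type*} [Fintype ι] (v : ι → E)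
    (P : Matrix ι κ ℝ) :
    gram B (fun k => ∑ i, P i k • v i) = Pᵀ * gram B v * P := by
  ext k l
  simp only [gram_apply, Matrix.mul_apply, Matrix.transpose_apply, map_sum, map_smul,
    FunLike.coe_sum, Finset.sum_apply, FunLike.coe_smul, Pi.smul_apply, smul_eq_mul,
    Finset.sum_mul]
  simp only [Finset.mul_sum]
  refine Finset.sum_congr rfl fun i _ => Finset.sum_congr rfl fun j _ => by ring

/-- The trace `∑ B^{ij} β(v_i, v_j)` of a bilinear form `β` with respect to `B`. -/
def metricTrace (B : E →L[ℝ] E →L[ℝ] ℝ) (β : E →ₗ[ℝ] E →ₗ[ℝ] ℝ) {ι : Type*} [Fintype ι]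
    [DecidableEq ι] (v : ι → E) : ℝ :=
  ∑ i, ∑ j, (gram B v)⁻¹ i j * β (v i) (v j)

theorem metricTrace_comp_equiv (B : E →L[ℝ] E →L[ℝ] ℝ) (β : E →ₗ[ℝ] E →ₗ[ℝ] ℝ)
    {ι κ : Type*} [Fintype ι] [DecidableEq ι] [Fintype κ] [DecidableEq κ] (v : ι → E)
    (e : κ ≃ ι) : metricTrace B β (v ∘ e) = metricTrace B β v := by
  have h : gram B (v ∘ e) = (gram B v).submatrix e e := rfl
  unfold metricTrace
  rw [h, Matrix.inv_submatrix_equiv, ← e.sum_comp]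
  refine Finset.sum_congr rfl fun i _ => ?_
  rw [← e.sum_comp]
  rfl

theorem metricTrace_eq_trace (B : E →L[ℝ] E →L[ℝ] ℝ) (β : E →ₗ[ℝ] E →ₗ[ℝ] ℝ)
    {ι : Type*} [Fintype ι] [DecidableEq ι] (v : ι → E) :
    metricTrace B β v = ((gram B v)⁻¹ * (Matrix.of fun i j => β (v i) (v j))ᵀ).trace := by
  simp [metricTrace, Matrix.trace, Matrix.mul_apply]

/-- A change of basis `P` replaces both matrices by `Pᵀ · P`, and the trace of (inverse Gram matrix)
times (matrix of `β`) is unchanged by cyclicity. Hence quantities defined through `finBasis` may be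
computed in a basis adapted to the situation, such as an orthonormal one. -/
theorem metricTrace_basis (B : E →L[ℝ] E →L[ℝ] ℝ) (β : E →ₗ[ℝ] E →ₗ[ℝ] ℝ)
    {ι κ : Type*} [Fintype ι] [DecidableEq ι] [Fintype κ] [DecidableEq κ]
    (b : Basis ι ℝ E) (c : Basis κ ℝ E) : metricTrace B β b = metricTrace B β c := by
  have e : κ ≃ ι := c.indexEquiv b
  rw [← metricTrace_comp_equiv B β c e.symm]
  have hc : (c ∘ e.symm : ι → E) = c.reindex e := by ext i; simp
  rw [hc]
  set d := c.reindex e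
  set P := b.toMatrix d
  have hP : IsUnit P.det := by
    have := b.invertibleToMatrix d
    exact (Matrix.isUnit_iff_isUnit_det _).1 (isUnit_of_invertible P)
  have hd : (d : ι → E) = fun k => ∑ i, P i k • b i := by
    ext k; exact (b.sum_toMatrix_smul_self d k).symm
  have hg : gram B d = Pᵀ * gram B b * P := by rw [hd, gram_sum_smul]
  have hβ : (Matrix.of fun i j => β (d i) (d j))
      = Pᵀ * (Matrix.of fun i j => β (b i) (b j)) * P := by
    ext k l
    simp only [Matrix.of_apply, Matrix.mul_apply, Matrix.transpose_apply, hd, map_sum, map_smul,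
      LinearMap.sum_apply, LinearMap.smul_apply, smul_eq_mul, Finset.sum_mul]
    simp only [Finset.mul_sum]
    refine Finset.sum_congr rfl fun i _ => Finset.sum_congr rfl fun j _ => by ring
  rw [metricTrace_eq_trace, metricTrace_eq_trace, hg, hβ, Matrix.mul_inv_rev, Matrix.mul_inv_rev,
    Matrix.transpose_mul, Matrix.transpose_mul, Matrix.transpose_transpose, Matrix.mul_assoc,
    Matrix.mul_assoc, ← Matrix.mul_assoc (Pᵀ)⁻¹,
    Matrix.nonsing_inv_mul _ (by rwa [Matrix.det_transpose]), Matrix.one_mul,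
    Matrix.trace_mul_comm, Matrix.trace_mul_comm P⁻¹]
  simp only [Matrix.mul_assoc]
  rw [Matrix.mul_nonsing_inv _ hP, Matrix.mul_one, Matrix.trace_mul_comm]

/-- The form `α ⊗ α`. -/
def covectorSq (α : E →L[ℝ] ℝ) : E →ₗ[ℝ] E →ₗ[ℝ] ℝ :=
  LinearMap.mk₂ ℝ (fun v w => α v * α w) (by intros; simp [add_mul]) (by intros; simp [mul_assoc])
    (by intros; simp [mul_add]) (by intros; simp [mul_left_comm])

theorem dualNormSq_eq [FiniteDimensional ℝ E] (B : E →L[ℝ] E →L[ℝ] ℝ) (α : E →L[ℝ] ℝ)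
    {ι : Type*} [Fintype ι] [DecidableEq ι] (b : Basis ι ℝ E) :
    dualNormSq B α = ∑ i, ∑ j, (gram B b)⁻¹ i j * α (b i) * α (b j) := by
  have := metricTrace_basis B (covectorSq α) (finBasis ℝ E) b
  simpa [metricTrace, covectorSq, dualNormSq, mul_assoc] using this

/-- The dual norm of a pulled back covector. -/
theorem dualNormSq_pullback {E' : Type*} [NormedAddCommGroup E'] [NormedSpace ℝ E']
    [FiniteDimensional ℝ E] [FiniteDimensional ℝ E']
    (B : E →L[ℝ] E →L[ℝ] ℝ) (B' : E' →L[ℝ] E' →L[ℝ] ℝ) (A : E' ≃ₗ[ℝ] E)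
    (hA : ∀ v w, B' v w = B (A v) (A w)) (α : E →L[ℝ] ℝ) (α' : E' →L[ℝ] ℝ)
    (hα : ∀ v, α' v = α (A v)) : dualNormSq B' α' = dualNormSq B α := by
  rw [dualNormSq_eq B α ((finBasis ℝ E').map A), dualNormSq]
  have : gram B ((finBasis ℝ E').map A) = gram B' (finBasis ℝ E') := by
    ext i j; simp [gram_apply, hA]
  rw [this]
  simp [hα]

end MetricTrace

/-! ### Naturality of the Levi-Civita connection and of curvature on vector spaces. -/

section Curvature

variable {E : Type*} [NormedAddCommGroup E] [NormedSpace ℝ E]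

/-- The endomorphism `u ↦ R(u, v) w` for the connection with Christoffel tensor `Γ`. -/
def curvEnd (Γ : E → E →L[ℝ] E →L[ℝ] E) (y v w : E) : E →ₗ[ℝ] E :=
  ((fderiv ℝ Γ y).flip v).flip w - ((fderiv ℝ Γ y v).flip w)
    + ((Γ y).flip (Γ y v w)) - (Γ y v).comp ((Γ y).flip w)

theorem curvEnd_apply (Γ : E → E →L[ℝ] E →L[ℝ] E) (y u v w : E) :
    curvEnd Γ y v w u = fderiv ℝ Γ y u v w - fderiv ℝ Γ y v u w + Γ y u (Γ y v w)
      - Γ y v (Γ y u w) := rfl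

/-- The Ricci form of the connection with Christoffel tensor `Γ`. -/
def ricciForm (Γ : E → E →L[ℝ] E →L[ℝ] E) (y : E) : E →ₗ[ℝ] E →ₗ[ℝ] ℝ :=
  LinearMap.mk₂ ℝ (fun v w => LinearMap.trace ℝ E (curvEnd Γ y v w))
    (fun v v' w => by
      rw [← map_add]; congr 1; ext u
      simp only [curvEnd_apply, LinearMap.add_apply, map_add, add_apply]
      abel)
    (fun c v w => by
      rw [← map_smul]; congr 1; ext u
      simp only [curvEnd_apply, LinearMap.smul_apply, map_smul, smul_apply]
      simp only [smul_add, smul_sub])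
    (fun v w w' => by
      rw [← map_add]; congr 1; ext u
      simp only [curvEnd_apply, LinearMap.add_apply, map_add]
      abel)
    (fun c v w => by
      rw [← map_smul]; congr 1; ext u
      simp only [curvEnd_apply, LinearMap.smul_apply, map_smul]
      simp only [smul_add, smul_sub])

theorem ricciForm_apply (Γ : E → E →L[ℝ] E →L[ℝ] E) (y v w : E) :
    ricciForm Γ y v w = LinearMap.trace ℝ E (curvEnd Γ y v w) := rfl

/-- The Koszul formula: `Γ` is the Levi-Civita connection of `g` at `y`. -/
def IsLeviCivita (g : E → E →L[ℝ] E →L[ℝ] ℝ) (Γ : E → E →L[ℝ] E →L[ℝ] E) (y : E) : Prop :=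
  ∀ u v w, 2 * g y (Γ y u v) w
    = fderiv ℝ g y u v w + fderiv ℝ g y v u w - fderiv ℝ g y w u v

variable {E' : Type*} [NormedAddCommGroup E'] [NormedSpace ℝ E']

/-- The product rule; the Hessian of `φ` appears once for each of the two slots of the metric. These
are the terms that make the Christoffel tensor transform inhomogeneously. -/
theorem fderiv_pullback {g : E → E →L[ℝ] E →L[ℝ] ℝ} {φ : E' → E} {g' : E' → E' →L[ℝ] E' →L[ℝ] ℝ}
    {y : E'} (hφ : ContDiffAt ℝ 2 φ y) (hg : DifferentiableAt ℝ g (φ y))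
    (hg' : DifferentiableAt ℝ g' y)
    (h : ∀ᶠ z in 𝓝 y, ∀ v w, g' z v w = g (φ z) (fderiv ℝ φ z v) (fderiv ℝ φ z w)) (u v w : E') :
    fderiv ℝ g' y u v w = fderiv ℝ g (φ y) (fderiv ℝ φ y u) (fderiv ℝ φ y v) (fderiv ℝ φ y w)
      + g (φ y) (fderiv ℝ (fderiv ℝ φ) y u v) (fderiv ℝ φ y w)
      + g (φ y) (fderiv ℝ φ y v) (fderiv ℝ (fderiv ℝ φ) y u w) := by
  have hA : HasFDerivAt (fderiv ℝ φ) (fderiv ℝ (fderiv ℝ φ) y) y :=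
    ((hφ.fderiv_right (m := 1) le_rfl).differentiableAt one_ne_zero).hasFDerivAt
  have h1 : HasFDerivAt (fun z => g' z v w) _ y :=
    (hg'.hasFDerivAt.clm_apply (hasFDerivAt_const v y)).clm_apply (hasFDerivAt_const w y)
  have hφ' : HasFDerivAt φ (fderiv ℝ φ y) y := (hφ.differentiableAt two_ne_zero).hasFDerivAt
  have h2 : HasFDerivAt (fun z => g (φ z) (fderiv ℝ φ z v) (fderiv ℝ φ z w)) _ y :=
    ((HasFDerivAt.comp (g := g) y hg.hasFDerivAt hφ').clm_apply
      (hA.clm_apply (hasFDerivAt_const v y))).clm_apply (hA.clm_apply (hasFDerivAt_const w y))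
  have h3 := (h2.congr_of_eventuallyEq (h.mono fun z hz => hz v w)).unique h1
  have := congrArg (fun L : E' →L[ℝ] ℝ => L u) h3
  simp at this
  rw [← this]
  ring

theorem fderiv_fderiv_symm {φ : E' → E} {y : E'} (hφ : ContDiffAt ℝ 2 φ y) (u v : E') :
    fderiv ℝ (fderiv ℝ φ) y u v = fderiv ℝ (fderiv ℝ φ) y v u :=
  (hφ.isSymmSndFDerivAt (by simp)).eq u v

/-- The transformation law of the Christoffel tensor. -/
theorem christoffel_pullback {g : E → E →L[ℝ] E →L[ℝ] ℝ} {Γ : E → E →L[ℝ] E →L[ℝ] E} {φ : E' → E}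
    {g' : E' → E' →L[ℝ] E' →L[ℝ] ℝ} {Γ' : E' → E' →L[ℝ] E' →L[ℝ] E'}
    {y : E'} (hφ : ContDiffAt ℝ 2 φ y) (hg : DifferentiableAt ℝ g (φ y))
    (hg' : DifferentiableAt ℝ g' y)
    (h : ∀ᶠ z in 𝓝 y, ∀ v w, g' z v w = g (φ z) (fderiv ℝ φ z v) (fderiv ℝ φ z w))
    (hΓ : IsLeviCivita g Γ (φ y)) (hΓ' : IsLeviCivita g' Γ' y)
    (hsymm : ∀ v w, g (φ y) v w = g (φ y) w v) (hpos : ∀ v, v ≠ 0 → 0 < g (φ y) v v)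
    (hsurj : Function.Surjective (fderiv ℝ φ y)) (u v : E') :
    fderiv ℝ φ y (Γ' y u v) = Γ (φ y) (fderiv ℝ φ y u) (fderiv ℝ φ y v)
      + fderiv ℝ (fderiv ℝ φ) y u v := by
  rw [← sub_eq_zero]
  -- The defect of the transformation law is a vector in the range of `dφ`, hence of the form `dφ
  -- w`. The two Koszul formulas, tested with this `w`, make its `g`-square zero, against
  -- positivity; after symmetrising the Hessians all but two of the Hessian terms cancel.
  by_contra hne
  obtain ⟨w, hw⟩ := hsurj (fderiv ℝ φ y (Γ' y u v) - (Γ (φ y) (fderiv ℝ φ y u) (fderiv ℝ φ y v)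
      + fderiv ℝ (fderiv ℝ φ) y u v))
  have h0 := hpos _ hne
  rw [← hw] at h0
  nth_rewrite 1 [hw] at h0
  have e1 := hΓ' u v w
  have e2 := hΓ (fderiv ℝ φ y u) (fderiv ℝ φ y v) (fderiv ℝ φ y w)
  rw [h.self_of_nhds, fderiv_pullback hφ hg hg' h, fderiv_pullback hφ hg hg' h,
    fderiv_pullback hφ hg hg' h] at e1
  simp only [map_sub, map_add, sub_apply, add_apply] at h0
  rw [fderiv_fderiv_symm hφ v u, fderiv_fderiv_symm hφ w u, fderiv_fderiv_symm hφ w v,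
    hsymm (fderiv ℝ φ y v), hsymm (fderiv ℝ φ y u) (fderiv ℝ (fderiv ℝ φ) y v w)] at e1
  linarith

/-- The curvature tensor is natural. -/
theorem curvEnd_pullback {g : E → E →L[ℝ] E →L[ℝ] ℝ} {Γ : E → E →L[ℝ] E →L[ℝ] E} {φ : E' → E}
    {g' : E' → E' →L[ℝ] E' →L[ℝ] ℝ} {Γ' : E' → E' →L[ℝ] E' →L[ℝ] E'}
    {y : E'} (hφ : ContDiffAt ℝ 3 φ y)
    (hg : ∀ᶠ z in 𝓝 (φ y), DifferentiableAt ℝ g z ∧ IsLeviCivita g Γ z ∧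
      (∀ v w, g z v w = g z w v) ∧ ∀ v, v ≠ 0 → 0 < g z v v)
    (hg' : ∀ᶠ z in 𝓝 y, DifferentiableAt ℝ g' z ∧ IsLeviCivita g' Γ' z)
    (h : ∀ᶠ z in 𝓝 y, ∀ v w, g' z v w = g (φ z) (fderiv ℝ φ z v) (fderiv ℝ φ z w))
    (hsurj : ∀ᶠ z in 𝓝 y, Function.Surjective (fderiv ℝ φ z))
    (dΓ : DifferentiableAt ℝ Γ (φ y)) (dΓ' : DifferentiableAt ℝ Γ' y) (u v w : E') :
    fderiv ℝ φ y (curvEnd Γ' y v w u)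
      = curvEnd Γ (φ y) (fderiv ℝ φ y v) (fderiv ℝ φ y w) (fderiv ℝ φ y u) := by
  have hφ2 : ContDiffAt ℝ 2 φ y := hφ.of_le (by norm_num)
  -- The transformation law holds in a neighbourhood, so it may be differentiated once more; `D`
  -- below is the result, `T` the law applied twice.
  have key : ∀ᶠ z in 𝓝 y, ∀ u v, fderiv ℝ φ z (Γ' z u v)
      = Γ (φ z) (fderiv ℝ φ z u) (fderiv ℝ φ z v) + fderiv ℝ (fderiv ℝ φ) z u v := by
    filter_upwards [hφ2.eventually (by simp), hφ.continuousAt.eventually hg, hg',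
      h.eventually_nhds, hsurj] with z h1 h2 h3 h4 h5 u v
    exact christoffel_pullback h1 h2.1 h3.1 h4 h2.2.1 h3.2 h2.2.2.1 h2.2.2.2 h5 u v
  have cA : ContDiffAt ℝ 2 (fderiv ℝ φ) y := hφ.fderiv_right (by norm_num)
  have hA : HasFDerivAt (fderiv ℝ φ) (fderiv ℝ (fderiv ℝ φ) y) y :=
    (cA.differentiableAt two_ne_zero).hasFDerivAt
  have hB : HasFDerivAt (fderiv ℝ (fderiv ℝ φ)) (fderiv ℝ (fderiv ℝ (fderiv ℝ φ)) y) y :=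
    ((cA.fderiv_right (m := 1) (by norm_num)).differentiableAt one_ne_zero).hasFDerivAt
  have hφ' : HasFDerivAt φ (fderiv ℝ φ y) y := (hφ.differentiableAt three_ne_zero).hasFDerivAt
  have D : ∀ u v w, fderiv ℝ (fderiv ℝ φ) y u (Γ' y v w) + fderiv ℝ φ y (fderiv ℝ Γ' y u v w)
      = fderiv ℝ Γ (φ y) (fderiv ℝ φ y u) (fderiv ℝ φ y v) (fderiv ℝ φ y w)
        + Γ (φ y) (fderiv ℝ (fderiv ℝ φ) y u v) (fderiv ℝ φ y w)
        + Γ (φ y) (fderiv ℝ φ y v) (fderiv ℝ (fderiv ℝ φ) y u w)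
        + fderiv ℝ (fderiv ℝ (fderiv ℝ φ)) y u v w := by
    intro u v w
    have h1 : HasFDerivAt (fun z => fderiv ℝ φ z (Γ' z v w)) _ y :=
      hA.clm_apply ((dΓ'.hasFDerivAt.clm_apply (hasFDerivAt_const v y)).clm_apply
        (hasFDerivAt_const w y))
    have h2 : HasFDerivAt (fun z => Γ (φ z) (fderiv ℝ φ z v) (fderiv ℝ φ z w)
        + fderiv ℝ (fderiv ℝ φ) z v w) _ y :=
      (((HasFDerivAt.comp (g := Γ) y dΓ.hasFDerivAt hφ').clm_apply
        (hA.clm_apply (hasFDerivAt_const v y))).clm_apply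
          (hA.clm_apply (hasFDerivAt_const w y))).add
        ((hB.clm_apply (hasFDerivAt_const v y)).clm_apply (hasFDerivAt_const w y))
    have h3 := (h2.congr_of_eventuallyEq (key.mono fun z hz => hz v w)).unique h1
    have := congrArg (fun L : E' →L[ℝ] E => L u) h3
    simp at this
    rw [add_comm, ← this]
    abel
  have T : ∀ u v w, fderiv ℝ φ y (Γ' y u (Γ' y v w))
      = Γ (φ y) (fderiv ℝ φ y u) (Γ (φ y) (fderiv ℝ φ y v) (fderiv ℝ φ y w))
        + Γ (φ y) (fderiv ℝ φ y u) (fderiv ℝ (fderiv ℝ φ) y v w)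
        + fderiv ℝ (fderiv ℝ φ) y u (Γ' y v w) := by
    intro u v w
    rw [key.self_of_nhds, key.self_of_nhds, map_add]
  -- Antisymmetrising in `u, v` removes the third derivative of `φ`; the mixed Hessian terms cancel
  -- between `D` and `T`.
  have s2 := fderiv_fderiv_symm hφ2
  have s3 : fderiv ℝ (fderiv ℝ (fderiv ℝ φ)) y u v = fderiv ℝ (fderiv ℝ (fderiv ℝ φ)) y v u :=
    fderiv_fderiv_symm cA u v
  have d1 := D u v w
  have d2 := D v u w
  rw [curvEnd_apply, curvEnd_apply, map_sub, map_add, map_sub, T, T,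
    eq_sub_of_add_eq' d1, eq_sub_of_add_eq' d2, s3, s2 v u]
  abel

/-- The scalar curvature is natural. -/
theorem metricTrace_ricciForm_pullback {g : E → E →L[ℝ] E →L[ℝ] ℝ} {Γ : E → E →L[ℝ] E →L[ℝ] E}
    {φ : E' → E} {g' : E' → E' →L[ℝ] E' →L[ℝ] ℝ} {Γ' : E' → E' →L[ℝ] E' →L[ℝ] E'}
    {y : E'} (hφ : ContDiffAt ℝ 3 φ y)
    (hg : ∀ᶠ z in 𝓝 (φ y), DifferentiableAt ℝ g z ∧ IsLeviCivita g Γ z ∧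
      (∀ v w, g z v w = g z w v) ∧ ∀ v, v ≠ 0 → 0 < g z v v)
    (hg' : ∀ᶠ z in 𝓝 y, DifferentiableAt ℝ g' z ∧ IsLeviCivita g' Γ' z)
    (h : ∀ᶠ z in 𝓝 y, ∀ v w, g' z v w = g (φ z) (fderiv ℝ φ z v) (fderiv ℝ φ z w))
    (hbij : ∀ᶠ z in 𝓝 y, Function.Bijective (fderiv ℝ φ z))
    (dΓ : DifferentiableAt ℝ Γ (φ y)) (dΓ' : DifferentiableAt ℝ Γ' y)
    {ι κ : Type*} [Fintype ι] [DecidableEq ι] [Fintype κ] [DecidableEq κ]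
    (b : Basis ι ℝ E) (c : Basis κ ℝ E') :
    metricTrace (g' y) (ricciForm Γ' y) c = metricTrace (g (φ y)) (ricciForm Γ (φ y)) b := by
  let A : E' ≃ₗ[ℝ] E := LinearEquiv.ofBijective (fderiv ℝ φ y).toLinearMap hbij.self_of_nhds
  have hA : ∀ v, A v = fderiv ℝ φ y v := fun v => rfl
  rw [metricTrace_basis _ _ b (c.map A)]
  have hG : gram (g (φ y)) (c.map A) = gram (g' y) c := by
    ext i j; simp [gram_apply, hA, h.self_of_nhds]
  have hR : ∀ v w, ricciForm Γ (φ y) (A v) (A w) = ricciForm Γ' y v w := by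
    intro v w
    rw [ricciForm_apply, ricciForm_apply, ← LinearMap.trace_conj' (curvEnd Γ' y v w) A]
    congr 1
    ext u
    obtain ⟨u, rfl⟩ := A.surjective u
    rw [LinearEquiv.conj_apply_apply, A.symm_apply_apply, hA, hA, hA, hA]
    exact (curvEnd_pullback hφ hg hg' h (hbij.mono fun z hz => hz.2) dΓ dΓ' u v w).symm
  simp [metricTrace, hG, hR]

end Curvature

/-! ### The coordinate formulas as values of tensors. -/

section CoordinateCurvature

variable {E : Type*} [NormedAddCommGroup E] [NormedSpace ℝ E]

theorem contDiffWithinAt_det {ι : Type*} [Fintype ι] [DecidableEq ι] {G : E → Matrix ι ι ℝ}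
    {s : Set E} {y : E} {n : WithTop ℕ∞} (hG : ∀ i j, ContDiffWithinAt ℝ n (fun z => G z i j) s y) :
    ContDiffWithinAt ℝ n (fun z => (G z).det) s y := by
  simp only [Matrix.det_apply]
  refine ContDiffWithinAt.sum fun σ _ => ContDiffWithinAt.const_smul _ ?_
  exact contDiffWithinAt_prod fun i _ => hG _ _

theorem contDiffWithinAt_inv_entry {ι : Type*} [Fintype ι] [DecidableEq ι] {G : E → Matrix ι ι ℝ}
    {s : Set E} {y : E} {n : WithTop ℕ∞} (hG : ∀ i j, ContDiffWithinAt ℝ n (fun z => G z i j) s y)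
    (hy : (G y).det ≠ 0) (i j : ι) : ContDiffWithinAt ℝ n (fun z => (G z)⁻¹ i j) s y := by
  simp only [Matrix.inv_def, Matrix.smul_apply, Ring.inverse_eq_inv', smul_eq_mul,
    Matrix.adjugate_apply]
  refine ((contDiffWithinAt_det hG).inv hy).mul (contDiffWithinAt_det fun k l => ?_)
  by_cases hk : k = j
  · subst hk; simpa using contDiffWithinAt_const
  · simpa [Matrix.updateRow_ne hk] using hG k l

variable [FiniteDimensional ℝ E]

theorem contDiffWithinAt_partialDeriv {s : Set E} (hs : UniqueDiffOn ℝ s) {f : E → ℝ} {y : E}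
    (hy : y ∈ s) (hf : ContDiffWithinAt ℝ ∞ f s y) (k : Fin (finrank ℝ E)) :
    ContDiffWithinAt ℝ ∞ (partialDeriv s k f) s y :=
  (hf.fderivWithin_right hs (by simp) hy).clm_apply contDiffWithinAt_const

variable {s : Set E} {G : E → Matrix (Fin (finrank ℝ E)) (Fin (finrank ℝ E)) ℝ} {y : E}

theorem contDiffWithinAt_christoffel (hs : UniqueDiffOn ℝ s) (hy : y ∈ s)
    (hG : ∀ i j, ContDiffWithinAt ℝ ∞ (fun z => G z i j) s y) (hdet : (G y).det ≠ 0)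
    (i j k : Fin (finrank ℝ E)) : ContDiffWithinAt ℝ ∞ (christoffel s G i j k) s y := by
  unfold christoffel
  refine contDiffWithinAt_const.mul (ContDiffWithinAt.sum fun l _ => ?_)
  refine (contDiffWithinAt_inv_entry hG hdet i l).mul (ContDiffWithinAt.sub (ContDiffWithinAt.add ?_ ?_) ?_) <;>
  exact contDiffWithinAt_partialDeriv hs hy (hG _ _) _

theorem contDiffWithinAt_scalarCurvatureCoord (hs : UniqueDiffOn ℝ s) (hy : y ∈ s)
    (hG : ∀ i j, ContDiffWithinAt ℝ ∞ (fun z => G z i j) s y) (hdet : (G y).det ≠ 0) :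
    ContDiffWithinAt ℝ ∞ (scalarCurvatureCoord s G) s y := by
  unfold scalarCurvatureCoord ricciCoord
  have hc := contDiffWithinAt_christoffel hs hy hG hdet
  refine ContDiffWithinAt.sum fun j _ => ContDiffWithinAt.sum fun k _ =>
    (contDiffWithinAt_inv_entry hG hdet j k).mul (ContDiffWithinAt.sum fun i _ =>
      ((contDiffWithinAt_partialDeriv hs hy (hc _ _ _) _).sub
        (contDiffWithinAt_partialDeriv hs hy (hc _ _ _) _)).add
        (ContDiffWithinAt.sum fun l _ => ((hc _ _ _).mul (hc _ _ _)).sub ((hc _ _ _).mul (hc _ _ _))))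

theorem contDiffWithinAt_meanCurvatureCoord (hs : UniqueDiffOn ℝ s) (hy : y ∈ s)
    (hG : ∀ i j, ContDiffWithinAt ℝ ∞ (fun z => G z i j) s y) (hdet : (G y).det ≠ 0)
    (ℓ : E →ₗ[ℝ] ℝ) (hℓ : 0 < ∑ i, gradCoord G ℓ y i * ℓ (finBasis ℝ E i)) :
    ContDiffWithinAt ℝ ∞ (meanCurvatureCoord s G ℓ) s y := by
  have hc := contDiffWithinAt_christoffel hs hy hG hdet
  have hN : ∀ i, ContDiffWithinAt ℝ ∞ (fun z => gradCoord G ℓ z i) s y := fun i =>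
    ContDiffWithinAt.sum fun j _ => (contDiffWithinAt_inv_entry hG hdet i j).mul
      contDiffWithinAt_const
  have hn : ContDiffWithinAt ℝ ∞ (fun z => ∑ i, gradCoord G ℓ z i * ℓ (finBasis ℝ E i)) s y :=
    ContDiffWithinAt.sum fun i _ => (hN i).mul contDiffWithinAt_const
  unfold meanCurvatureCoord
  refine contDiffWithinAt_const.mul (ContDiffWithinAt.sum fun i _ => ContDiffWithinAt.sum fun j _ =>
    ((contDiffWithinAt_inv_entry hG hdet i j).sub (((hN i).mul (hN j)).div hn hℓ.ne')).mul
      (ContDiffWithinAt.div (ContDiffWithinAt.sum fun k _ => (hc _ _ _).mul contDiffWithinAt_const)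
        (hn.sqrt hℓ.ne') (Real.sqrt_pos.2 hℓ).ne'))

/-- The tensor `e^j ⊗ e^k ⊗ e_i` of the basis `finBasis ℝ E`. -/
def basisTensor (E : Type*) [NormedAddCommGroup E] [NormedSpace ℝ E] [FiniteDimensional ℝ E]
    (i j k : Fin (finrank ℝ E)) : E →L[ℝ] E →L[ℝ] E :=
  ((finBasis ℝ E).coord j).toContinuousLinearMap.smulRight
    (((finBasis ℝ E).coord k).toContinuousLinearMap.smulRight (finBasis ℝ E i))

/-- The Christoffel symbols as a tensor. -/
def christoffelTensor (G : E → Matrix (Fin (finrank ℝ E)) (Fin (finrank ℝ E)) ℝ) (y : E) :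
    E →L[ℝ] E →L[ℝ] E :=
  ∑ i, ∑ j, ∑ k, christoffel univ G i j k y • basisTensor E i j k

theorem christoffelTensor_basis (j k : Fin (finrank ℝ E)) :
    christoffelTensor G y (finBasis ℝ E j) (finBasis ℝ E k)
      = ∑ i, christoffel univ G i j k y • finBasis ℝ E i := by
  simp only [christoffelTensor, basisTensor, FunLike.coe_sum, Finset.sum_apply, FunLike.coe_smul, Pi.smul_apply,
    ContinuousLinearMap.smulRight_apply, LinearMap.coe_toContinuousLinearMap', Basis.coord_apply,
    Basis.repr_self, Finsupp.single_apply]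
  refine Finset.sum_congr rfl fun i _ => ?_
  rw [Finset.sum_eq_single j _ (by simp), Finset.sum_eq_single k _ (by simp)]
  · simp
  · intro l _ hl; simp [hl.symm]
  · intro l _ hl; simp [hl.symm]

theorem coord_christoffelTensor (i j k : Fin (finrank ℝ E)) :
    (finBasis ℝ E).coord i (christoffelTensor G y (finBasis ℝ E j) (finBasis ℝ E k))
      = christoffel univ G i j k y := by
  rw [christoffelTensor_basis, map_sum]
  simp [Finsupp.single_apply]

theorem differentiableAt_christoffelTensor
    (hG : ∀ i j, ContDiffAt ℝ ∞ (fun z => G z i j) y) (hdet : (G y).det ≠ 0) :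
    DifferentiableAt ℝ (christoffelTensor G) y := by
  have hc := fun i j k => (contDiffWithinAt_christoffel uniqueDiffOn_univ (mem_univ y)
    (fun i j => (hG i j).contDiffWithinAt) hdet i j k).contDiffAt univ_mem
  have h1 : ∀ i j k, DifferentiableAt ℝ (fun z => christoffel univ G i j k z • basisTensor E i j k) y :=
    fun i j k => by
      have h0 : DifferentiableAt ℝ (christoffel univ G i j k) y :=
        (hc i j k).differentiableAt (by simp)
      exact h0.smul_const _
  have h2 : ∀ i j, DifferentiableAt ℝ
      (fun z => ∑ k, christoffel univ G i j k z • basisTensor E i j k) y :=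
    fun i j => DifferentiableAt.fun_sum fun k _ => h1 i j k
  have h3 : ∀ i, DifferentiableAt ℝ
      (fun z => ∑ j, ∑ k, christoffel univ G i j k z • basisTensor E i j k) y :=
    fun i => DifferentiableAt.fun_sum fun j _ => h2 i j
  exact DifferentiableAt.fun_sum fun i _ => h3 i

/-- On basis vectors the Koszul formula is the definition of the Christoffel symbols with the
inverse metric multiplied away. Both sides are linear in each vector, so it extends one slot after
the other. -/
theorem isLeviCivita_christoffelTensor {g : E → E →L[ℝ] E →L[ℝ] ℝ}
    (hg : DifferentiableAt ℝ g y) (hsymm : ∀ᶠ z in 𝓝 y, ∀ v w, g z v w = g z w v)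
    (hdet : (gram (g y) (finBasis ℝ E)).det ≠ 0) :
    IsLeviCivita g (christoffelTensor fun z => gram (g z) (finBasis ℝ E)) y := by
  have hp : ∀ l a b, partialDeriv univ l (fun z => gram (g z) (finBasis ℝ E) a b) y
      = fderiv ℝ g y (finBasis ℝ E l) (finBasis ℝ E a) (finBasis ℝ E b) := by
    intro l a b
    have h1 : HasFDerivAt (fun z => g z (finBasis ℝ E a) (finBasis ℝ E b)) _ y :=
      (hg.hasFDerivAt.clm_apply (hasFDerivAt_const _ y)).clm_apply (hasFDerivAt_const _ y)
    unfold partialDeriv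
    rw [fderivWithin_univ]
    simp only [gram_apply]
    rw [h1.fderiv]
    simp
  have hs : ∀ u v w, fderiv ℝ g y u v w = fderiv ℝ g y u w v := by
    intro u v w
    have h1 : ∀ v w, HasFDerivAt (fun z => g z v w) _ y := fun v w =>
      (hg.hasFDerivAt.clm_apply (hasFDerivAt_const v y)).clm_apply (hasFDerivAt_const w y)
    have := ((h1 w v).congr_of_eventuallyEq (hsymm.mono fun z hz => hz v w)).unique (h1 v w)
    have := congrArg (fun L : E →L[ℝ] ℝ => L u) this
    simpa using this.symm
  have main : ∀ j k m, 2 * g y (christoffelTensor (fun z => gram (g z) (finBasis ℝ E)) y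
      (finBasis ℝ E j) (finBasis ℝ E k)) (finBasis ℝ E m)
      = fderiv ℝ g y (finBasis ℝ E j) (finBasis ℝ E k) (finBasis ℝ E m)
        + fderiv ℝ g y (finBasis ℝ E k) (finBasis ℝ E j) (finBasis ℝ E m)
        - fderiv ℝ g y (finBasis ℝ E m) (finBasis ℝ E j) (finBasis ℝ E k) := by
    intro j k m
    rw [christoffelTensor_basis, map_sum, FunLike.coe_sum, Finset.sum_apply, Finset.mul_sum]
    have h0 : ∀ i, 2 * (g y (christoffel univ (fun z => gram (g z) (finBasis ℝ E)) i j k y •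
        finBasis ℝ E i)) (finBasis ℝ E m) = ∑ l, (gram (g y) (finBasis ℝ E) m i *
          (gram (g y) (finBasis ℝ E))⁻¹ i l) *
          (fderiv ℝ g y (finBasis ℝ E j) (finBasis ℝ E l) (finBasis ℝ E k)
        + fderiv ℝ g y (finBasis ℝ E k) (finBasis ℝ E l) (finBasis ℝ E j)
        - fderiv ℝ g y (finBasis ℝ E l) (finBasis ℝ E j) (finBasis ℝ E k)) := by
      intro i
      rw [map_smul, FunLike.coe_smul, Pi.smul_apply, smul_eq_mul, christoffel]
      simp only [hp]
      rw [hsymm.self_of_nhds (finBasis ℝ E i), ← gram_apply, mul_assoc, ← mul_assoc, ← mul_assoc,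
        Finset.mul_sum, Finset.sum_mul]
      refine Finset.sum_congr rfl fun l _ => by ring
    rw [Finset.sum_congr rfl fun i _ => h0 i, Finset.sum_comm]
    have h1 : ∀ l, ∑ i, gram (g y) (finBasis ℝ E) m i * (gram (g y) (finBasis ℝ E))⁻¹ i l
        = if m = l then 1 else 0 := by
      intro l
      rw [← Matrix.mul_apply, Matrix.mul_nonsing_inv _ (isUnit_iff_ne_zero.2 hdet),
        Matrix.one_apply]
    simp only [← Finset.sum_mul, h1, ite_mul, one_mul, zero_mul, Finset.sum_ite_eq,
      Finset.mem_univ, if_true]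
    rw [hs _ (finBasis ℝ E m), hs _ (finBasis ℝ E m)]
  intro u v w
  set Γ := christoffelTensor (fun z => gram (g z) (finBasis ℝ E)) y
  set D := fderiv ℝ g y
  have e1 : ∀ j k w, 2 * g y (Γ (finBasis ℝ E j) (finBasis ℝ E k)) w = D (finBasis ℝ E j)
      (finBasis ℝ E k) w + D (finBasis ℝ E k) (finBasis ℝ E j) w
      - D w (finBasis ℝ E j) (finBasis ℝ E k) := fun j k w => by
    have : (((2 : ℝ) • g y (Γ (finBasis ℝ E j) (finBasis ℝ E k)) : E →L[ℝ] ℝ) : E →ₗ[ℝ] ℝ)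
        = ((D (finBasis ℝ E j) (finBasis ℝ E k) + D (finBasis ℝ E k) (finBasis ℝ E j)
          - (D.flip (finBasis ℝ E j)).flip (finBasis ℝ E k) : E →L[ℝ] ℝ) : E →ₗ[ℝ] ℝ) :=
      (finBasis ℝ E).ext fun m => main j k m
    exact congrArg (fun L : E →ₗ[ℝ] ℝ => L w) this
  have e2 : ∀ j v w, 2 * g y (Γ (finBasis ℝ E j) v) w = D (finBasis ℝ E j) v w
      + D v (finBasis ℝ E j) w - D w (finBasis ℝ E j) v := fun j v w => by
    have : (((2 : ℝ) • ((g y).flip w).comp (Γ (finBasis ℝ E j)) : E →L[ℝ] ℝ) : E →ₗ[ℝ] ℝ)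
        = (((D (finBasis ℝ E j)).flip w + (D.flip (finBasis ℝ E j)).flip w
          - D w (finBasis ℝ E j) : E →L[ℝ] ℝ) : E →ₗ[ℝ] ℝ) :=
      (finBasis ℝ E).ext fun k => e1 j k w
    exact congrArg (fun L : E →ₗ[ℝ] ℝ => L v) this
  have : (((2 : ℝ) • ((g y).flip w).comp (Γ.flip v) : E →L[ℝ] ℝ) : E →ₗ[ℝ] ℝ)
      = (((D.flip v).flip w + (D v).flip w - (D w).flip v : E →L[ℝ] ℝ) : E →ₗ[ℝ] ℝ) :=
    (finBasis ℝ E).ext fun j => e2 j v w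
  exact congrArg (fun L : E →ₗ[ℝ] ℝ => L u) this

/-- The bridge from the index formula to a basis-free trace: the coordinates of the derivative of
`christoffelTensor` are the partial derivatives of the symbols, and the sum over `i` in `ricciCoord`
is the trace of `curvEnd`. Naturality is only visible on the basis-free side. -/
theorem scalarCurvatureCoord_eq {g : E → E →L[ℝ] E →L[ℝ] ℝ}
    (hG : ∀ i j, ContDiffAt ℝ ∞ (fun z => gram (g z) (finBasis ℝ E) i j) y)
    (hdet : (gram (g y) (finBasis ℝ E)).det ≠ 0) :
    scalarCurvatureCoord univ (fun z => gram (g z) (finBasis ℝ E)) y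
      = metricTrace (g y) (ricciForm (christoffelTensor fun z => gram (g z) (finBasis ℝ E)) y)
        (finBasis ℝ E) := by
  set G := fun z => gram (g z) (finBasis ℝ E) with hGdef
  have dΓ : DifferentiableAt ℝ (christoffelTensor G) y := differentiableAt_christoffelTensor hG hdet
  have hd : ∀ l i j k, partialDeriv univ l (christoffel univ G i j k) y = (finBasis ℝ E).coord i
      (fderiv ℝ (christoffelTensor G) y (finBasis ℝ E l) (finBasis ℝ E j) (finBasis ℝ E k)) := by
    intro l i j k
    have h1 : HasFDerivAt (fun z => (finBasis ℝ E).coord i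
        (christoffelTensor G z (finBasis ℝ E j) (finBasis ℝ E k))) _ y :=
      ((finBasis ℝ E).coord i).toContinuousLinearMap.hasFDerivAt.comp y
        ((dΓ.hasFDerivAt.clm_apply (hasFDerivAt_const _ y)).clm_apply (hasFDerivAt_const _ y))
    simp only [coord_christoffelTensor] at h1
    unfold partialDeriv
    rw [fderivWithin_univ, h1.fderiv]
    simp
  have hR : ∀ j k, ricciCoord univ G j k y
      = ricciForm (christoffelTensor G) y (finBasis ℝ E j) (finBasis ℝ E k) := by
    intro j k
    rw [ricciForm_apply, LinearMap.trace_eq_matrix_trace ℝ (finBasis ℝ E), Matrix.trace]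
    refine Finset.sum_congr rfl fun i _ => ?_
    rw [Matrix.diag_apply, LinearMap.toMatrix_apply, ← Basis.coord_apply, curvEnd_apply, hd, hd,
      map_sub, map_add, map_sub, Finset.sum_sub_distrib, ← add_sub_assoc]
    congr 1
    · congr 1
      rw [christoffelTensor_basis (G := G) (y := y) j k]
      simp only [map_sum, map_smul, coord_christoffelTensor, smul_eq_mul]
      exact Finset.sum_congr rfl fun l _ => mul_comm _ _
    · rw [christoffelTensor_basis (G := G) (y := y) i k]
      simp only [map_sum, map_smul, coord_christoffelTensor, smul_eq_mul]
      exact Finset.sum_congr rfl fun l _ => mul_comm _ _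
  exact Finset.sum_congr rfl fun j _ => Finset.sum_congr rfl fun k _ => by rw [hR]

end CoordinateCurvature

/-! ### Inner products: Gram determinants, orthonormal bases, the dual norm. -/

section Gram

variable {E : Type*} [NormedAddCommGroup E] [NormedSpace ℝ E]

theorem gram_posDef (B : E →L[ℝ] E →L[ℝ] ℝ) (hs : ∀ v w, B v w = B w v)
    (hp : ∀ v, v ≠ 0 → 0 < B v v) {ι : Type*} [Fintype ι] {v : ι → E}
    (hv : LinearIndependent ℝ v) : (gram B v).PosDef := by
  refine Matrix.PosDef.of_dotProduct_mulVec_pos ?_ fun x hx => ?_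
  · ext i j; simp [gram_apply, hs]
  · have h : star x ⬝ᵥ gram B v *ᵥ x = B (∑ i, x i • v i) (∑ i, x i • v i) := by
      simp only [dotProduct, Matrix.mulVec, gram_apply, map_sum, map_smul, FunLike.coe_sum,
        Finset.sum_apply, FunLike.coe_smul, Pi.smul_apply, smul_eq_mul, Finset.mul_sum,
        star_trivial]
      rw [Finset.sum_comm]
      refine Finset.sum_congr rfl fun i _ => Finset.sum_congr rfl fun j _ => by rw [hs]; ring
    rw [h]
    refine hp _ fun h0 => hx ?_
    ext i
    exact Fintype.linearIndependent_iff.1 hv x h0 i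

theorem det_gram_pos (B : E →L[ℝ] E →L[ℝ] ℝ) (hs : ∀ v w, B v w = B w v)
    (hp : ∀ v, v ≠ 0 → 0 < B v v) {ι : Type*} [Fintype ι] [DecidableEq ι] {v : ι → E}
    (hv : LinearIndependent ℝ v) : 0 < (gram B v).det :=
  (gram_posDef B hs hp hv).det_pos

theorem exists_orthonormal_basis [FiniteDimensional ℝ E] (B : E →L[ℝ] E →L[ℝ] ℝ)
    (hs : ∀ v w, B v w = B w v) (hp : ∀ v, v ≠ 0 → 0 < B v v) :
    ∃ e : Basis (Fin (finrank ℝ E)) ℝ E, gram B e = 1 := by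
  let B' : LinearMap.BilinForm ℝ E := LinearMap.mk₂ ℝ (fun v w => B v w) (by simp) (by simp)
    (by simp) (by simp)
  obtain ⟨v, hv⟩ := LinearMap.BilinForm.exists_orthogonal_basis (B := B') ⟨fun x y => hs x y⟩
  have hpos : ∀ i, 0 < B (v i) (v i) := fun i => hp _ (v.ne_zero i)
  have hu : ∀ i, IsUnit ((Real.sqrt (B (v i) (v i)))⁻¹) := fun i =>
    (inv_ne_zero (Real.sqrt_pos.2 (hpos i)).ne').isUnit
  refine ⟨v.isUnitSMul hu, ?_⟩
  ext i j
  simp only [gram_apply, Basis.isUnitSMul_apply, map_smul, FunLike.coe_smul, Pi.smul_apply,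
    smul_eq_mul, Matrix.one_apply]
  split_ifs with h
  · subst h
    have h1 := Real.mul_self_sqrt (hpos i).le
    have h2 := (Real.sqrt_pos.2 (hpos i)).ne'
    field_simp
    rw [sq, h1]
  · have : B (v i) (v j) = 0 := LinearMap.isOrthoᵢ_def.1 hv i j h
    simp [this]

theorem dualNormSq_eq_sum_sq [FiniteDimensional ℝ E] {B : E →L[ℝ] E →L[ℝ] ℝ} {ι : Type*}
    [Fintype ι] [DecidableEq ι] {e : Basis ι ℝ E} (he : gram B e = 1)
    (α : E →L[ℝ] ℝ) : dualNormSq B α = ∑ i, α (e i) ^ 2 := by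
  rw [dualNormSq_eq B α e, he, inv_one]
  simp [Matrix.one_apply, sq]

/-- `B` is an inner product. -/
structure IsPosForm (B : E →L[ℝ] E →L[ℝ] ℝ) : Prop where
  symm : ∀ v w, B v w = B w v
  pos : ∀ v, v ≠ 0 → 0 < B v v

section CovNorm

variable [FiniteDimensional ℝ E]

/-- The norm of covectors dual to `B`. -/
def covNorm (B : E →L[ℝ] E →L[ℝ] ℝ) (α : E →L[ℝ] ℝ) : ℝ := Real.sqrt (dualNormSq B α)

variable {B : E →L[ℝ] E →L[ℝ] ℝ}

/-- Evaluation on a `B`-orthonormal basis is the linear map `L`. Homogeneity and the reverse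
triangle inequality for `covNorm` are then inherited from the Euclidean norm. -/
theorem exists_covNorm_eq (hB : IsPosForm B) :
    ∃ L : (E →L[ℝ] ℝ) →ₗ[ℝ] EuclideanSpace ℝ (Fin (finrank ℝ E)), ∀ α, covNorm B α = ‖L α‖ := by
  obtain ⟨e, he⟩ := exists_orthonormal_basis B hB.symm hB.pos
  refine ⟨{ toFun := fun α => WithLp.toLp 2 fun i => α (e i), map_add' := fun α β => ?_,
            map_smul' := fun c α => ?_ }, fun α => ?_⟩
  · ext i; simp
  · ext i; simp
  · rw [covNorm, dualNormSq_eq_sum_sq he, EuclideanSpace.norm_eq]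
    simp

theorem covNorm_smul (hB : IsPosForm B) (c : ℝ) (α : E →L[ℝ] ℝ) :
    covNorm B (c • α) = |c| * covNorm B α := by
  obtain ⟨L, hL⟩ := exists_covNorm_eq hB
  rw [hL, hL, map_smul, norm_smul, Real.norm_eq_abs]

theorem abs_covNorm_sub_le (hB : IsPosForm B) (α β : E →L[ℝ] ℝ) :
    |covNorm B α - covNorm B β| ≤ covNorm B (α - β) := by
  obtain ⟨L, hL⟩ := exists_covNorm_eq hB
  rw [hL, hL, hL, map_sub]
  exact abs_norm_sub_norm_le _ _

theorem covNorm_zero (hB : IsPosForm B) : covNorm B (0 : E →L[ℝ] ℝ) = 0 := by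
  obtain ⟨L, hL⟩ := exists_covNorm_eq hB
  rw [hL, map_zero, norm_zero]

theorem covNorm_sq (hB : IsPosForm B) (α : E →L[ℝ] ℝ) : covNorm B α ^ 2 = dualNormSq B α := by
  obtain ⟨e, he⟩ := exists_orthonormal_basis B hB.symm hB.pos
  exact Real.sq_sqrt (by rw [dualNormSq_eq_sum_sq he]; positivity)

end CovNorm

end Gram

/-! ### The metric read in charts, and its smoothness. -/

section Chart

variable {E : Type*} [NormedAddCommGroup E] [NormedSpace ℝ E]
  {H : Type*} [TopologicalSpace H] (I : ModelWithCorners ℝ E H)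
  {M : Type*} [TopologicalSpace M] [ChartedSpace H M]

/-- The derivative of the inverse of the chart at `x₀`. -/
def chartSymmDeriv (x₀ : M) (y : E) : E →L[ℝ] E :=
  mfderivWithin 𝓘(ℝ, E) I (extChartAt I x₀).symm (Set.range I) y

/-- The derivative of the chart at `x₀`. -/
def chartDeriv (x₀ : M) (p : M) : E →L[ℝ] E :=
  mfderiv I 𝓘(ℝ, E) (extChartAt I x₀) p

variable [IsManifold I ∞ M]

instance : IsManifold I 1 M := IsManifold.of_le (n := ∞) (by simp)

theorem chartSymmDeriv_chartDeriv {x₀ p : M} (hp : p ∈ (extChartAt I x₀).source) (v : E) :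
    chartSymmDeriv I x₀ (extChartAt I x₀ p) (chartDeriv I x₀ p v) = v :=
  congrArg (fun L : E →L[ℝ] E => L v) (mfderivWithin_extChartAt_symm_comp_mfderiv_extChartAt' hp)

theorem chartDeriv_chartSymmDeriv {x₀ p : M} (hp : p ∈ (extChartAt I x₀).source) (v : E) :
    chartDeriv I x₀ p (chartSymmDeriv I x₀ (extChartAt I x₀ p) v) = v :=
  congrArg (fun L : E →L[ℝ] E => L v) (mfderiv_extChartAt_comp_mfderivWithin_extChartAt_symm' hp)

variable {I}

theorem hasFDerivWithinAt_of_hasMFDerivWithinAt {E' : Type*} [NormedAddCommGroup E']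
    [NormedSpace ℝ E'] {f : E' → E} {s : Set E'} {y : E'} {L : E' →L[ℝ] E}
    (h : HasMFDerivWithinAt 𝓘(ℝ, E') 𝓘(ℝ, E) f s y L) : HasFDerivWithinAt f L s y :=
  h.hasFDerivWithinAt

theorem hasFDerivWithinAt_chart_comp {E' : Type*} [NormedAddCommGroup E'] [NormedSpace ℝ E']
    {F : E' → M} {s : Set E'} {y : E'} {D : E' →L[ℝ] E}
    (hF : HasMFDerivWithinAt 𝓘(ℝ, E') I F s y D) {x₀ : M}
    (hx : F y ∈ (extChartAt I x₀).source) :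
    HasFDerivWithinAt (fun z => extChartAt I x₀ (F z)) ((chartDeriv I x₀ (F y)).comp D) s y := by
  have h1 := (mdifferentiableAt_extChartAt (I := I) (x := x₀) (y := F y)
    (by rwa [extChartAt_source] at hx)).hasMFDerivAt
  exact hasFDerivWithinAt_of_hasMFDerivWithinAt
    (HasMFDerivAt.comp_hasMFDerivWithinAt (g := extChartAt I x₀) y h1 hF)

theorem hasMFDerivWithinAt_chart_symm {x₀ : M} {y : E} (hy : y ∈ (extChartAt I x₀).target) :
    HasMFDerivWithinAt 𝓘(ℝ, E) I (extChartAt I x₀).symm (Set.range I) y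
      (chartSymmDeriv (E := E) I x₀ y) :=
  (mdifferentiableWithinAt_extChartAt_symm hy).hasMFDerivWithinAt

/-- The metric in the chart at `x₀`, as a bilinear form depending on the point. -/
def SmoothMetric.chartForm (g : SmoothMetric I M) (x₀ : M) (y : E) : E →L[ℝ] E →L[ℝ] ℝ :=
  (g.form ((extChartAt I x₀).symm y)).bilinearComp (chartSymmDeriv I x₀ y) (chartSymmDeriv I x₀ y)

theorem SmoothMetric.chartForm_apply (g : SmoothMetric I M) (x₀ : M) (y v w : E) :
    g.chartForm x₀ y v w = g.form ((extChartAt I x₀).symm y) (chartSymmDeriv I x₀ y v)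
      (chartSymmDeriv I x₀ y w) := rfl

theorem SmoothMetric.coord_eq [FiniteDimensional ℝ E] (g : SmoothMetric I M) (x₀ : M) :
    g.coord x₀ = fun y => gram (g.chartForm x₀ y) (finBasis ℝ E) := rfl

theorem SmoothMetric.form_symm (g : SmoothMetric I M) (x : M) (v w : E) :
    g.form x v w = g.form x w v := g.symm x v w

theorem SmoothMetric.form_pos (g : SmoothMetric I M) (x : M) (v : E) (hv : v ≠ 0) :
    0 < g.form x v v := g.pos x v hv

theorem SmoothMetric.chartForm_symm (g : SmoothMetric I M) (x₀ : M) (y v w : E) :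
    g.chartForm x₀ y v w = g.chartForm x₀ y w v := g.form_symm _ _ _

theorem SmoothMetric.chartForm_chartDeriv (g : SmoothMetric I M) {x₀ p : M}
    (hp : p ∈ (extChartAt I x₀).source) (v w : E) :
    g.chartForm x₀ (extChartAt I x₀ p) (chartDeriv I x₀ p v) (chartDeriv I x₀ p w)
      = g.form p v w := by
  rw [g.chartForm_apply, chartSymmDeriv_chartDeriv I hp, chartSymmDeriv_chartDeriv I hp,
    (extChartAt I x₀).left_inv hp]

theorem SmoothMetric.chartForm_pos (g : SmoothMetric I M) {x₀ : M} {y : E}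
    (hy : y ∈ (extChartAt I x₀).target) (v : E) (hv : v ≠ 0) : 0 < g.chartForm x₀ y v v := by
  rw [g.chartForm_apply]
  refine g.form_pos _ _ fun h => hv ?_
  have := chartDeriv_chartSymmDeriv I ((extChartAt I x₀).map_target hy) v
  rw [(extChartAt I x₀).right_inv hy, h, map_zero] at this
  exact this.symm

theorem SmoothMetric.det_coord_pos [FiniteDimensional ℝ E] (g : SmoothMetric I M) {x₀ : M} {y : E}
    (hy : y ∈ (extChartAt I x₀).target) : 0 < (g.coord x₀ y).det :=
  det_gram_pos _ (g.chartForm_symm x₀ y) (g.chartForm_pos hy) (finBasis ℝ E).linearIndependent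

/-- The tangent vectors `v` transported by the inverse of a chart form a smooth section. -/
theorem contMDiffWithinAt_chartSymmDeriv {x₀ : M} {y : E} (hy : y ∈ (extChartAt I x₀).target)
    (v : E) : ContMDiffWithinAt 𝓘(ℝ, E) I.tangent ∞
      (fun z => (⟨(extChartAt I x₀).symm z, chartSymmDeriv I x₀ z v⟩ : TangentBundle I M))
      (Set.range I) y := by
  have h := contMDiffOn_extChartAt_symm (I := I) (n := ∞) x₀
  have hmem : (extChartAt I x₀).target ∈ 𝓝[Set.range I] y :=
    extChartAt_target_mem_nhdsWithin_of_mem hy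
  have hu : UniqueMDiffOn 𝓘(ℝ, E) (extChartAt I x₀).target := by
    rw [uniqueMDiffOn_iff_uniqueDiffOn]
    exact uniqueDiffOn_extChartAt_target x₀
  have h2 := h.contMDiffOn_tangentMapWithin (m := ∞) (by simp) hu
  have h3 : ContMDiff 𝓘(ℝ, E) 𝓘(ℝ, E).tangent ∞ (fun z : E => (⟨z, v⟩ : TangentBundle 𝓘(ℝ, E) E)) :=
    contMDiff_vectorSpace_iff_contDiff.2 contDiff_const
  have aux : ∀ z ∈ (extChartAt I x₀).target, mfderivWithin 𝓘(ℝ, E) I (extChartAt I x₀).symm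
      (extChartAt I x₀).target z = chartSymmDeriv I x₀ z := fun z hz =>
    mfderivWithin_subset (extChartAt_target_subset_range x₀) (hu z hz)
      (mdifferentiableWithinAt_extChartAt_symm hz)
  have h4 := (h2 ⟨y, v⟩ hy).comp y (h3.contMDiffAt.contMDiffWithinAt (s := (extChartAt I x₀).target)) fun z hz => hz
  refine (h4.mono_of_mem_nhdsWithin hmem).congr_of_eventuallyEq ?_ ?_
  · filter_upwards [hmem, eventually_mem_nhdsWithin] with z hz hz'
    simp only [Function.comp_def, tangentMapWithin]
    rw [aux z hz]
    rfl
  · simp only [Function.comp_def, tangentMapWithin]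
    rw [aux y hy]
    rfl

/-- The metric is a smooth section of a Hom-bundle. Pulled back along the inverse chart and
contracted with the two transported constant fields, which are smooth sections of the tangent
bundle, it becomes a smooth real function. -/
theorem SmoothMetric.contDiffWithinAt_inChart (g : SmoothMetric I M) {x₀ : M} {y : E}
    (hy : y ∈ (extChartAt I x₀).target) (v w : E) :
    ContDiffWithinAt ℝ ∞ (fun z => g.chartForm x₀ z v w) (Set.range I) y := by
  have hψ := g.contMDiff.contMDiffAt.comp_contMDiffWithinAt y
    ((contMDiffOn_extChartAt_symm (I := I) (n := ∞) x₀ y hy).mono_of_mem_nhdsWithin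
      (extChartAt_target_mem_nhdsWithin_of_mem hy))
  have := ContMDiffWithinAt.clm_bundle_apply₂ (F₁ := E) (F₂ := E) (F₃ := ℝ)
    (E₃ := fun _ : M => ℝ) hψ (contMDiffWithinAt_chartSymmDeriv hy v)
    (contMDiffWithinAt_chartSymmDeriv hy w)
  simp only [Bundle.contMDiffWithinAt_totalSpace] at this
  exact this.2.contDiffWithinAt

theorem SmoothMetric.contDiffWithinAt_chartForm [FiniteDimensional ℝ E] (g : SmoothMetric I M)
    {x₀ : M} {y : E} (hy : y ∈ (extChartAt I x₀).target) :
    ContDiffWithinAt ℝ ∞ (g.chartForm x₀) (Set.range I) y := by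
  have h : ContDiffOn ℝ ∞ (g.chartForm x₀) (extChartAt I x₀).target := by
    rw [contDiffOn_clm_apply]
    intro v
    rw [contDiffOn_clm_apply]
    intro w z hz
    exact (g.contDiffWithinAt_inChart hz v w).mono (extChartAt_target_subset_range x₀)
  exact (h y hy).mono_of_mem_nhdsWithin (extChartAt_target_mem_nhdsWithin_of_mem hy)

theorem SmoothMetric.contDiffWithinAt_coord [FiniteDimensional ℝ E] (g : SmoothMetric I M)
    {x₀ : M} {y : E} (hy : y ∈ (extChartAt I x₀).target) (i j : Fin (finrank ℝ E)) :
    ContDiffWithinAt ℝ ∞ (fun z => g.coord x₀ z i j) (Set.range I) y :=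
  g.contDiffWithinAt_inChart hy _ _

/-- The scalar curvature is computed by any local parametrization `F` of a manifold without
boundary, from the metric `g'` induced by `F`. -/
theorem SmoothMetric.scalarCurvature_eq_of_parametrization [FiniteDimensional ℝ E]
    [I.Boundaryless] (g : SmoothMetric I M)
    {E' : Type*} [NormedAddCommGroup E'] [NormedSpace ℝ E'] [FiniteDimensional ℝ E']
    (hdim : finrank ℝ E' = finrank ℝ E)
    {F : E' → M} {D : E' → E' →L[ℝ] E} {y : E'}
    (hF : ContMDiffAt 𝓘(ℝ, E') I ∞ F y)
    (hD : ∀ᶠ z in 𝓝 y, HasMFDerivAt 𝓘(ℝ, E') I F z (D z))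
    {g' : E' → E' →L[ℝ] E' →L[ℝ] ℝ} {Γ' : E' → E' →L[ℝ] E' →L[ℝ] E'}
    (hg'F : ∀ᶠ z in 𝓝 y, ∀ v w, g' z v w = g.form (F z) (D z v) (D z w))
    (hpos : ∀ᶠ z in 𝓝 y, ∀ v, v ≠ 0 → 0 < g' z v v)
    (hg' : ∀ᶠ z in 𝓝 y, DifferentiableAt ℝ g' z ∧ IsLeviCivita g' Γ' z)
    (dΓ' : DifferentiableAt ℝ Γ' y)
    {ι : Type*} [Fintype ι] [DecidableEq ι] (b : Basis ι ℝ E') :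
    g.scalarCurvature (F y) = metricTrace (g' y) (ricciForm Γ' y) b := by
  set x₀ := F y with hx₀
  have hsrc : ∀ᶠ z in 𝓝 y, F z ∈ (extChartAt I x₀).source :=
    hF.continuousAt.eventually (extChartAt_source_mem_nhds (I := I) x₀)
  -- In the chart at `F y`, which is the one defining the curvature there, the parametrization
  -- becomes a map `φ` of vector spaces with `φ^* (chartForm) = g'`; naturality on vector spaces
  -- then applies.
  set φ : E' → E := fun z => extChartAt I x₀ (F z) with hφdef
  have hφ : ContDiffAt ℝ ∞ φ y := by
    have : ContMDiffAt 𝓘(ℝ, E') 𝓘(ℝ, E) ∞ φ y :=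
      (contMDiffAt_extChartAt' (I := I) (x := x₀) (by rw [hx₀]; exact mem_chart_source _ _)).comp y hF
    exact this.contDiffAt
  have hdφ : ∀ᶠ z in 𝓝 y, fderiv ℝ φ z = (chartDeriv I x₀ (F z)).comp (D z) := by
    filter_upwards [hD, hsrc] with z h1 h2
    have := hasFDerivWithinAt_chart_comp (I := I) (s := univ)
      (h1.hasMFDerivWithinAt) (x₀ := x₀) h2
    exact (hasFDerivWithinAt_univ.1 this).fderiv
  have hpull : ∀ᶠ z in 𝓝 y, ∀ v w,
      g' z v w = g.chartForm x₀ (φ z) (fderiv ℝ φ z v) (fderiv ℝ φ z w) := by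
    filter_upwards [hdφ, hsrc, hg'F] with z h1 h2 h3 v w
    rw [h3, h1]
    exact (g.chartForm_chartDeriv h2 _ _).symm
  have hinj : ∀ᶠ z in 𝓝 y, Function.Bijective (fderiv ℝ φ z) := by
    filter_upwards [hpull, hpos] with z h1 h2
    -- A vector killed by `dφ` has `g'`-length zero; equality of dimensions upgrades injectivity to
    -- bijectivity.
    have : Function.Injective (fderiv ℝ φ z).toLinearMap := by
      rw [← LinearMap.ker_eq_bot, LinearMap.ker_eq_bot']
      intro v hv
      by_contra hne
      have h3 := h2 v hne
      rw [h1] at h3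
      change fderiv ℝ φ z v = 0 at hv
      simp [hv] at h3
    exact ⟨this, (LinearMap.injective_iff_surjective_of_finrank_eq_finrank hdim).1 this⟩
  have hopen : IsOpen (extChartAt I x₀).target := isOpen_extChartAt_target x₀
  have hφy : φ y ∈ (extChartAt I x₀).target := mem_extChartAt_target x₀
  have hG : ∀ z ∈ (extChartAt I x₀).target, ContDiffAt ℝ ∞ (g.chartForm x₀) z := fun z hz =>
    (g.contDiffWithinAt_chartForm hz).contDiffAt (by rw [I.range_eq_univ]; exact univ_mem)
  have hGc : ∀ z ∈ (extChartAt I x₀).target, ∀ i j,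
      ContDiffAt ℝ ∞ (fun z => gram (g.chartForm x₀ z) (finBasis ℝ E) i j) z := fun z hz i j =>
    (g.contDiffWithinAt_coord hz i j).contDiffAt (by rw [I.range_eq_univ]; exact univ_mem)
  rw [SmoothMetric.scalarCurvature, I.range_eq_univ, g.coord_eq,
    scalarCurvatureCoord_eq (hGc _ hφy) (g.det_coord_pos hφy).ne']
  symm
  refine metricTrace_ricciForm_pullback (φ := φ) (g := g.chartForm x₀) (hφ.of_le ?_) ?_ hg' hpull
    hinj (differentiableAt_christoffelTensor (hGc _ hφy) (g.det_coord_pos hφy).ne') dΓ' _ _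
  · exact WithTop.coe_le_coe.2 le_top
  · filter_upwards [hopen.mem_nhds hφy] with z hz
    refine ⟨(hG z hz).differentiableAt (by simp), isLeviCivita_christoffelTensor
      ((hG z hz).differentiableAt (by simp)) (Eventually.of_forall fun z => g.chartForm_symm x₀ z)
      (g.det_coord_pos hz).ne', g.chartForm_symm x₀ z, g.chartForm_pos hz⟩

theorem SmoothMetric.posForm (g : SmoothMetric I M) (x : M) : IsPosForm (g.form x) :=
  ⟨g.form_symm x, g.form_pos x⟩

theorem SmoothMetric.posForm_chartForm (g : SmoothMetric I M) {x₀ : M} {y : E}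
    (hy : y ∈ (extChartAt I x₀).target) : IsPosForm (g.chartForm x₀ y) :=
  ⟨g.chartForm_symm x₀ y, g.chartForm_pos hy⟩

end Chart

/-! ### Counting fibres of locally measure preserving maps. -/

theorem tsum_encard_inter {X : Type*} {A : ℕ → Set X} (hA : Pairwise (Function.onFun Disjoint A))
    (T : Set X) : ∑' n, (((A n ∩ T).encard : ENat) : ENNReal)
      = ((((⋃ n, A n) ∩ T).encard : ENat) : ENNReal) := by
  -- For the discrete σ-algebra the claim is countable additivity of the counting measure.
  let m : MeasurableSpace X := ⊤
  have hm : ∀ s : Set X, MeasurableSet s := fun s => MeasurableSpace.measurableSet_top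
  simp_rw [← fun s => Measure.count_apply (hm s)]
  rw [iUnion_inter, measure_iUnion (fun i j hij => (hA hij).mono inter_subset_left
    inter_subset_left) (fun _ => hm _)]

/-- A countable-to-one map that is locally measure preserving and whose fibres in `S` all have `k`
points pushes the restriction to `S` to `k` times the measure. -/
theorem measure_inter_preimage_eq_mul {X Y : Type*} [MeasurableSpace X] [MeasurableSpace Y]
    {μ : Measure X} {ν : Measure Y} {F : X → Y} {S : Set X} {W : ℕ → Set X} {k : ℕ}
    (hF : ∀ B, MeasurableSet B → MeasurableSet (S ∩ F ⁻¹' B))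
    (hW : ∀ n, MeasurableSet (W n)) (hcover : S ⊆ ⋃ n, W n) (hinj : ∀ n, InjOn F (S ∩ W n))
    (himage : ∀ n A, MeasurableSet A → A ⊆ S ∩ W n → MeasurableSet (F '' A) ∧ ν (F '' A) = μ A)
    (hk : ∀ y, (S ∩ F ⁻¹' {y}).encard = k) {B : Set Y} (hB : MeasurableSet B) :
    μ (S ∩ F ⁻¹' B) = k * ν B := by
  set A : ℕ → Set X := fun n => disjointed W n ∩ (S ∩ F ⁻¹' B) with hA
  have hAm : ∀ n, MeasurableSet (A n) := fun n => (MeasurableSet.disjointed hW n).inter (hF B hB)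
  have hAW : ∀ n, A n ⊆ S ∩ W n := fun n x hx => ⟨hx.2.1, disjointed_subset W n hx.1⟩
  have hAd : Pairwise (Function.onFun Disjoint A) := fun i j hij =>
    ((disjoint_disjointed W) hij).mono inter_subset_left inter_subset_left
  have hAU : ⋃ n, A n = S ∩ F ⁻¹' B := by
    rw [hA, ← iUnion_inter, iUnion_disjointed, inter_eq_right]
    exact inter_subset_left.trans hcover
  -- The set over `B` is cut into disjoint pieces on which `F` is injective. The indicators of their
  -- images add up at `y` to the number of points of the fibre, that is `k` on `B` and `0`
  -- elsewhere; integrating this identity termwise gives the result.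
  have hcount : ∀ y, ∑' n, (F '' A n).indicator (fun _ => (1 : ENNReal)) y
      = B.indicator (fun _ => (k : ENNReal)) y := by
    intro y
    have h1 : ∀ n, (F '' A n).indicator (fun _ => (1 : ENNReal)) y
        = (((A n ∩ F ⁻¹' {y}).encard : ENat) : ENNReal) := by
      intro n
      by_cases hy : y ∈ F '' A n
      · obtain ⟨x, hx, rfl⟩ := hy
        rw [indicator_of_mem (mem_image_of_mem F hx)]
        have : A n ∩ F ⁻¹' {F x} = {x} := by
          ext z
          constructor
          · rintro ⟨hz, hz'⟩
            exact hinj n (hAW n hz) (hAW n hx) hz'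
          · rintro rfl; exact ⟨hx, rfl⟩
        rw [this]; simp
      · rw [indicator_of_notMem hy]
        have : A n ∩ F ⁻¹' {y} = ∅ := by
          ext z
          simp only [mem_inter_iff, mem_preimage, mem_singleton_iff, mem_empty_iff_false, iff_false,
            not_and]
          rintro hz rfl
          exact hy (mem_image_of_mem F hz)
        rw [this]; simp
    simp_rw [h1]
    rw [tsum_encard_inter hAd, hAU]
    by_cases hy : y ∈ B
    · rw [indicator_of_mem hy]
      have : S ∩ F ⁻¹' B ∩ F ⁻¹' {y} = S ∩ F ⁻¹' {y} := by
        ext z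
        simp only [mem_inter_iff, mem_preimage, mem_singleton_iff]
        constructor
        · rintro ⟨⟨h, _⟩, h'⟩; exact ⟨h, h'⟩
        · rintro ⟨h, rfl⟩; exact ⟨⟨h, hy⟩, rfl⟩
      rw [this, hk]
      simp
    · rw [indicator_of_notMem hy]
      have : S ∩ F ⁻¹' B ∩ F ⁻¹' {y} = ∅ := by
        ext z
        simp only [mem_inter_iff, mem_preimage, mem_singleton_iff, mem_empty_iff_false, iff_false]
        rintro ⟨⟨_, h⟩, rfl⟩
        exact hy h
      rw [this]
      simp
  have him : ∀ n, MeasurableSet (F '' A n) ∧ ν (F '' A n) = μ (A n) := fun n =>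
    himage n _ (hAm n) (hAW n)
  rw [← hAU, measure_iUnion hAd hAm]
  have h1 : ∀ n, μ (A n) = ∫⁻ y, (F '' A n).indicator (fun _ => (1 : ENNReal)) y ∂ν := fun n => by
    rw [lintegral_indicator (him n).1, setLIntegral_one, (him n).2]
  simp_rw [h1]
  rw [← lintegral_tsum fun n => (measurable_const.indicator (him n).1).aemeasurable,
    funext hcount, lintegral_indicator hB, setLIntegral_const]

/-! ### The Riemannian measure and the change of variables formula. -/

section Volume

variable {E : Type*} [NormedAddCommGroup E] [NormedSpace ℝ E] [FiniteDimensional ℝ E]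
  {H : Type*} [TopologicalSpace H] {I : ModelWithCorners ℝ E H}
  {M : Type*} [TopologicalSpace M] [ChartedSpace H M] [IsManifold I ∞ M]
  [MeasurableSpace E] [BorelSpace E] [MeasurableSpace M] [BorelSpace M]

/-- The Riemannian volume density induced by a linear map `D` into the tangent space. -/
def volDensity {E' : Type*} [NormedAddCommGroup E'] [NormedSpace ℝ E'] {ι : Type*} [Fintype ι]
    [DecidableEq ι] (B : E →L[ℝ] E →L[ℝ] ℝ) (D : E' →L[ℝ] E) (b : ι → E') : ENNReal :=
  ENNReal.ofReal (Real.sqrt (gram (B.bilinearComp D D) b).det)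

theorem measurableSet_source_inter_preimage (x₀ : M) {B : Set E} (hB : MeasurableSet B) :
    MeasurableSet ((extChartAt I x₀).source ∩ extChartAt I x₀ ⁻¹' B) := by
  have ho : MeasurableSet (extChartAt I x₀).source := (isOpen_extChartAt_source x₀).measurableSet
  have hc := (continuousOn_extChartAt (I := I) x₀).domRestrict
  have := ho.subtype_image (hc.measurable hB)
  convert this using 1
  ext p
  simp [and_comm]

theorem measurableSet_extChartAt_target (x₀ : M) : MeasurableSet (extChartAt I x₀).target := by
  have : (extChartAt I x₀).target = I.symm ⁻¹' (chartAt H x₀).target ∩ range I := by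
    simp [extChartAt, OpenPartialHomeomorph.extend, PartialEquiv.trans_target, inter_comm]
  rw [this]
  exact (I.continuous_symm.isOpen_preimage _ (chartAt H x₀).open_target).measurableSet.inter
    I.isClosed_range.measurableSet

theorem measurableSet_target_inter_preimage (x₀ : M) {A : Set M} (hA : MeasurableSet A) :
    MeasurableSet ((extChartAt I x₀).target ∩ (extChartAt I x₀).symm ⁻¹' A) := by
  have ho := measurableSet_extChartAt_target (I := I) x₀
  have hc := (continuousOn_extChartAt_symm (I := I) x₀).domRestrict
  have := ho.subtype_image (hc.measurable hA)
  convert this using 1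
  ext p
  simp [and_comm]

theorem SmoothMetric.chartVolume_apply (g : SmoothMetric I M) (x₀ : M) {A : Set M}
    (hA : MeasurableSet A) :
    g.chartVolume x₀ A = ∫⁻ y in (extChartAt I x₀).target ∩ (extChartAt I x₀).symm ⁻¹' A,
      volDensity (g.form ((extChartAt I x₀).symm y)) (chartSymmDeriv I x₀ y) (finBasis ℝ E)
        ∂(finBasis ℝ E).addHaar := by
  have ho := measurableSet_extChartAt_target (I := I) x₀
  have hm := measurableSet_target_inter_preimage (I := I) x₀ hA
  have hae : AEMeasurable (extChartAt I x₀).symm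
      (((finBasis ℝ E).addHaar.restrict (extChartAt I x₀).target).withDensity
      fun y => ENNReal.ofReal (Real.sqrt (g.coord x₀ y).det)) :=
    ((continuousOn_extChartAt_symm (I := I) x₀).aemeasurable ho).mono_ac
      (withDensity_absolutelyContinuous _ _)
  rw [SmoothMetric.chartVolume, Measure.map_apply_of_aemeasurable hae hA]
  rw [← measure_inter_add_sdiff _ ho]
  have h0 : (((finBasis ℝ E).addHaar.restrict (extChartAt I x₀).target).withDensity
      fun y => ENNReal.ofReal (Real.sqrt (g.coord x₀ y).det))
      ((extChartAt I x₀).symm ⁻¹' A \ (extChartAt I x₀).target) = 0 := by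
    refine withDensity_absolutelyContinuous _ _ ?_
    refine measure_mono_null (sdiff_subset_compl _ _) ?_
    rw [Measure.restrict_apply ho.compl]
    simp
  rw [h0, add_zero, inter_comm, withDensity_apply _ hm, Measure.restrict_restrict hm,
    inter_assoc, inter_comm _ (extChartAt I x₀).target, ← inter_assoc, inter_self]
  rfl

variable {E' : Type*} [NormedAddCommGroup E'] [NormedSpace ℝ E'] [FiniteDimensional ℝ E']
  [MeasurableSpace E'] [BorelSpace E']

/-- The change of variables formula for a parametrization `F` with values in a chart domain. -/
theorem SmoothMetric.chartVolume_image (g : SmoothMetric I M) {x₀ : M} {F : E' → M}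
    {D : E' → E' →L[ℝ] E} {s : Set E'} (hs : MeasurableSet s)
    (hF : ∀ y ∈ s, HasMFDerivWithinAt 𝓘(ℝ, E') I F s y (D y)) (hinj : InjOn F s)
    (hsrc : ∀ y ∈ s, F y ∈ (extChartAt I x₀).source) {ι : Type*} [Fintype ι] [DecidableEq ι]
    (b : Basis ι ℝ E') (hdim : finrank ℝ E = Fintype.card ι) :
    MeasurableSet (F '' s) ∧ g.chartVolume x₀ (F '' s)
      = ∫⁻ y in s, volDensity (g.form (F y)) (D y) b ∂b.addHaar := by
  classical
  -- The parameter space and the model space differ. The isomorphism `L` matching their bases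
  -- carries one Haar measure to the other and turns `chart ∘ F` into a self-map of `E'`, as the
  -- Jacobian formula requires.
  let e : Fin (finrank ℝ E) ≃ ι := Fintype.equivOfCardEq (by simp [hdim])
  let bE := (finBasis ℝ E).reindex e
  let L : E ≃L[ℝ] E' := (bE.equiv b (Equiv.refl ι)).toContinuousLinearEquiv
  have hLb : ∀ k, L (bE k) = b k := fun k => by simp [L]
  have hLmap : bE.map L.toLinearEquiv = b := by ext k; simp [L]
  set f : E' → E := fun y => extChartAt I x₀ (F y) with hf
  set T : E' → E' →L[ℝ] E' := fun y => (L : E →L[ℝ] E').comp ((chartDeriv I x₀ (F y)).comp (D y))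
  have hfd : ∀ y ∈ s, HasFDerivWithinAt (fun z => L (f z)) (T y) s y := fun y hy =>
    L.hasFDerivAt.comp_hasFDerivWithinAt y (hasFDerivWithinAt_chart_comp (hF y hy) (hsrc y hy))
  have hfinj : InjOn (fun z => L (f z)) s := fun y hy z hz h =>
    hinj hy hz ((extChartAt I x₀).injOn (hsrc y hy) (hsrc z hz) (L.injective h))
  have him : (fun z => L (f z)) '' s = L '' (f '' s) := by rw [image_image]
  have hfs : MeasurableSet (f '' s) := by
    have h1 := measurable_image_of_fderivWithin hs hfd hfinj
    rw [him] at h1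
    have h2 := L.continuous.measurable h1
    rwa [preimage_image_eq _ L.injective] at h2
  have hFs : F '' s = (extChartAt I x₀).source ∩ extChartAt I x₀ ⁻¹' (f '' s) := by
    ext p
    constructor
    · rintro ⟨y, hy, rfl⟩
      exact ⟨hsrc y hy, y, hy, rfl⟩
    · rintro ⟨hp, y, hy, h⟩
      exact ⟨y, hy, (extChartAt I x₀).injOn (hsrc y hy) hp h⟩
  have hmeas : MeasurableSet (F '' s) := by
    rw [hFs]; exact measurableSet_source_inter_preimage x₀ hfs
  refine ⟨hmeas, ?_⟩
  have hpre : (extChartAt I x₀).target ∩ (extChartAt I x₀).symm ⁻¹' (F '' s) = f '' s := by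
    ext z
    constructor
    · rintro ⟨hz, y, hy, h⟩
      refine ⟨y, hy, ?_⟩
      rw [hf]; simp only
      rw [h, (extChartAt I x₀).right_inv hz]
    · rintro ⟨y, hy, rfl⟩
      refine ⟨(extChartAt I x₀).map_source (hsrc y hy), y, hy, ?_⟩
      exact ((extChartAt I x₀).left_inv (hsrc y hy)).symm
  rw [g.chartVolume_apply x₀ hmeas, hpre]
  have hmp : MeasurePreserving L (finBasis ℝ E).addHaar b.addHaar := by
    refine ⟨L.continuous.measurable, ?_⟩
    rw [← Basis.addHaar_reindex (finBasis ℝ E) e, Basis.map_addHaar, ← hLmap]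
  have hemb : MeasurableEmbedding L := L.toHomeomorph.measurableEmbedding
  set w : E → ENNReal := fun z => volDensity (g.form ((extChartAt I x₀).symm z))
    (chartSymmDeriv I x₀ z) (finBasis ℝ E) with hw
  have h1 : ∫⁻ z in f '' s, w z ∂(finBasis ℝ E).addHaar
      = ∫⁻ z in L '' (f '' s), w (L.symm z) ∂b.addHaar := by
    rw [← hmp.setLIntegral_comp_emb hemb]
    simp
  rw [h1, ← him, lintegral_image_eq_lintegral_abs_det_fderiv_mul _ hs hfd hfinj]
  refine setLIntegral_congr_fun hs fun y hy => ?_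
  simp only [ContinuousLinearEquiv.symm_apply_apply, hw]
  rw [volDensity, volDensity, ← ENNReal.ofReal_mul (abs_nonneg _)]
  congr 1
  -- The Gram matrix of the parametrization is `Pᵀ G P`, so the square root of its determinant is
  -- `|det P|` times the density of the chart.
  set P := LinearMap.toMatrix b b (T y).toLinearMap with hP
  have hdet : (T y).det = P.det := (LinearMap.det_toMatrix b _).symm
  have hTb : ∀ i, chartDeriv I x₀ (F y) (D y (b i)) = ∑ k, P k i • bE k := by
    intro i
    apply L.injective
    rw [map_sum]
    simp only [map_smul, hLb]
    have : L (chartDeriv I x₀ (F y) (D y (b i))) = (T y).toLinearMap (b i) := rfl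
    rw [this, hP]
    simp only [LinearMap.toMatrix_apply]
    exact (b.sum_repr _).symm
  have hg1 : gram ((g.form (F y)).bilinearComp (D y) (D y)) b
      = gram (g.chartForm x₀ (f y)) (fun i => ∑ k, P k i • bE k) := by
    ext i j
    simp only [gram_apply, ContinuousLinearMap.bilinearComp_apply]
    rw [← hTb, ← hTb, g.chartForm_chartDeriv (hsrc y hy)]
  have hg2 : (gram (g.chartForm x₀ (f y)) bE).det
      = (gram (g.chartForm x₀ (f y)) (finBasis ℝ E)).det := by
    have : gram (g.chartForm x₀ (f y)) bE
        = (gram (g.chartForm x₀ (f y)) (finBasis ℝ E)).submatrix e.symm e.symm := by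
      ext i j; simp [gram_apply, bE]
    rw [this, Matrix.det_submatrix_equiv_self]
  have hg3 : (g.form ((extChartAt I x₀).symm (f y))).bilinearComp (chartSymmDeriv I x₀ (f y))
      (chartSymmDeriv I x₀ (f y)) = g.chartForm x₀ (f y) := rfl
  rw [hg1, gram_sum_smul, Matrix.det_mul, Matrix.det_mul, Matrix.det_transpose, hg2, hg3, hdet,
    mul_right_comm, Real.sqrt_mul (mul_self_nonneg _), Real.sqrt_mul_self_eq_abs]

/-- Change of variables from the chart at `x₁` to the one at `x₀`. Only the part of `A` inside the
domain of the chart at `x₁` is seen by its measure, which is why an inequality and not an equality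
results; it is enough to identify the supremum of the measures on the domain of `x₀`. -/
theorem SmoothMetric.chartVolume_le (g : SmoothMetric I M) {x₀ : M} (x₁ : M) {A : Set M}
    (hA : MeasurableSet A) (hAs : A ⊆ (extChartAt I x₀).source) :
    g.chartVolume x₁ A ≤ g.chartVolume x₀ A := by
  set s := (extChartAt I x₁).target ∩ (extChartAt I x₁).symm ⁻¹' A
  have h := (g.chartVolume_image (x₀ := x₀) (F := (extChartAt I x₁).symm)
    (D := chartSymmDeriv I x₁) (s := s) (measurableSet_target_inter_preimage x₁ hA)
    (fun y hy => (hasMFDerivWithinAt_chart_symm hy.1).mono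
      (inter_subset_left.trans (extChartAt_target_subset_range x₁)))
    ((extChartAt I x₁).symm.injOn.mono inter_subset_left) (fun y hy => hAs hy.2)
    (finBasis ℝ E) (by simp)).2
  rw [g.chartVolume_apply x₁ hA, ← h]
  refine measure_mono ?_
  rintro _ ⟨y, hy, rfl⟩
  exact hy.2

/-- Measures that agree on the domain of one of them with that one. -/
theorem iSup_measure_apply {X ι : Type*} [MeasurableSpace X] {μ : ι → Measure X} {i : ι}
    {U A : Set X} (hU : MeasurableSet U) (hA : MeasurableSet A) (hAU : A ⊆ U)
    (h : ∀ j B, MeasurableSet B → B ⊆ U → μ j B ≤ μ i B) : (⨆ j, μ j) A = μ i A := by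
  refine le_antisymm ?_ (Measure.le_iff.1 (le_iSup μ i) A hA)
  -- The measure equal to `μ i` on `U` and to the supremum itself off `U` is an upper bound of the
  -- family, hence bounds the supremum.
  have key : ⨆ j, μ j ≤ (μ i).restrict U + (⨆ j, μ j).restrict Uᶜ := by
    refine iSup_le fun j => ?_
    conv_lhs => rw [← Measure.restrict_add_restrict_compl (μ := μ j) hU]
    refine add_le_add (Measure.le_iff.2 fun B hB => ?_)
      (Measure.restrict_mono subset_rfl (le_iSup μ j))
    rw [Measure.restrict_apply hB, Measure.restrict_apply hB]
    exact h j _ (hB.inter hU) inter_subset_right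
  calc (⨆ j, μ j) A ≤ ((μ i).restrict U + (⨆ j, μ j).restrict Uᶜ) A := Measure.le_iff.1 key A hA
    _ = μ i A := by
        rw [Measure.add_apply, Measure.restrict_apply hA, Measure.restrict_apply hA,
          inter_eq_left.2 hAU, (disjoint_compl_right_iff_subset.2 hAU).inter_eq]
        simp

theorem SmoothMetric.volume_eq_chartVolume (g : SmoothMetric I M) {x₀ : M} {A : Set M}
    (hA : MeasurableSet A) (hAs : A ⊆ (extChartAt I x₀).source) :
    g.volume A = g.chartVolume x₀ A :=
  iSup_measure_apply (isOpen_extChartAt_source x₀).measurableSet hA hAs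
    fun x₁ _ hB hBs => g.chartVolume_le x₁ hB hBs

theorem SmoothMetric.volume_image (g : SmoothMetric I M) {x₀ : M} {F : E' → M}
    {D : E' → E' →L[ℝ] E} {s : Set E'} (hs : MeasurableSet s)
    (hF : ∀ y ∈ s, HasMFDerivWithinAt 𝓘(ℝ, E') I F s y (D y)) (hinj : InjOn F s)
    (hsrc : ∀ y ∈ s, F y ∈ (extChartAt I x₀).source) {ι : Type*} [Fintype ι] [DecidableEq ι]
    (b : Basis ι ℝ E') (hdim : finrank ℝ E = Fintype.card ι) :
    MeasurableSet (F '' s) ∧ g.volume (F '' s)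
      = ∫⁻ y in s, volDensity (g.form (F y)) (D y) b ∂b.addHaar := by
  have h := g.chartVolume_image hs hF hinj hsrc b hdim
  refine ⟨h.1, ?_⟩
  rw [g.volume_eq_chartVolume h.1 (image_subset_iff.2 hsrc), h.2]

end Volume

/-! ### Differentials, scalar curvature and Sobolev functions: continuity and measurability. -/

section Regularity

variable {E : Type*} [NormedAddCommGroup E] [NormedSpace ℝ E] [FiniteDimensional ℝ E]
  {H : Type*} [TopologicalSpace H] {I : ModelWithCorners ℝ E H}
  {M : Type*} [TopologicalSpace M] [ChartedSpace H M] [IsManifold I ∞ M]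

/-- The differential of a function, as a map into the dual of the model space. -/
def diffForm (I : ModelWithCorners ℝ E H) (u : M → ℝ) (x : M) : E →L[ℝ] ℝ := differential I u x

theorem diffForm_comp_chartSymmDeriv {u : M → ℝ} {x₀ : M} {y : E}
    (hy : y ∈ (extChartAt I x₀).target)
    (hu : MDifferentiableAt I 𝓘(ℝ, ℝ) u ((extChartAt I x₀).symm y)) :
    (diffForm I u ((extChartAt I x₀).symm y)).comp (chartSymmDeriv I x₀ y)
      = fderivWithin ℝ (fun z => u ((extChartAt I x₀).symm z)) (Set.range I) y := by
  have h := hu.hasMFDerivAt.comp_hasMFDerivWithinAt y (hasMFDerivWithinAt_chart_symm hy)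
  have h2 := hasFDerivWithinAt_of_hasMFDerivWithinAt (E := ℝ) (E' := E)
    (L := (diffForm I u ((extChartAt I x₀).symm y)).comp (chartSymmDeriv I x₀ y)) h
  exact (h2.fderivWithin (I.uniqueDiffOn _ (extChartAt_target_subset_range x₀ hy))).symm

/-- The derivative of the inverse chart as a linear equivalence. -/
def chartSymmEquiv (x₀ : M) {y : E} (hy : y ∈ (extChartAt I x₀).target) : E ≃ₗ[ℝ] E :=
  LinearEquiv.ofInjectiveEndo (chartSymmDeriv I x₀ y).toLinearMap (by
    intro v w hvw
    have h1 := chartDeriv_chartSymmDeriv I ((extChartAt I x₀).map_target hy) v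
    have h2 := chartDeriv_chartSymmDeriv I ((extChartAt I x₀).map_target hy) w
    rw [(extChartAt I x₀).right_inv hy] at h1 h2
    rw [← h1, ← h2]
    exact congrArg _ hvw)

theorem SmoothMetric.dualNormSq_chartForm (g : SmoothMetric I M) {x₀ : M} {y : E}
    (hy : y ∈ (extChartAt I x₀).target) (α : E →L[ℝ] ℝ) :
    dualNormSq (g.chartForm x₀ y) (α.comp (chartSymmDeriv I x₀ y))
      = dualNormSq (g.form ((extChartAt I x₀).symm y)) α :=
  dualNormSq_pullback _ _ (chartSymmEquiv x₀ hy) (fun _ _ => rfl) _ _ (fun _ => rfl)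

theorem contDiffWithinAt_comp_chart_symm {u : M → ℝ} (hu : ContMDiff I 𝓘(ℝ, ℝ) ∞ u) {x₀ : M} {y : E}
    (hy : y ∈ (extChartAt I x₀).target) :
    ContDiffWithinAt ℝ ∞ (fun z => u ((extChartAt I x₀).symm z)) (Set.range I) y := by
  have := hu.contMDiffAt.comp_contMDiffWithinAt y
    ((contMDiffOn_extChartAt_symm (I := I) (n := ∞) x₀ y hy).mono_of_mem_nhdsWithin
      (extChartAt_target_mem_nhdsWithin_of_mem hy))
  exact this.contDiffWithinAt

theorem SmoothMetric.dualNorm_differential_chart (g : SmoothMetric I M) {u : M → ℝ}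
    (hu : ContMDiff I 𝓘(ℝ, ℝ) ∞ u) {x₀ : M} {y : E} (hy : y ∈ (extChartAt I x₀).target) :
    g.dualNorm ((extChartAt I x₀).symm y) (differential I u ((extChartAt I x₀).symm y))
      = covNorm (g.chartForm x₀ y)
        (fderivWithin ℝ (fun z => u ((extChartAt I x₀).symm z)) (Set.range I) y) := by
  rw [covNorm, ← diffForm_comp_chartSymmDeriv hy (hu.mdifferentiableAt (by simp)),
    g.dualNormSq_chartForm hy]
  rfl

/-- A function on the manifold that is continuous in the charts is continuous. -/
theorem continuous_of_charts {X : Type*} [TopologicalSpace X] {f : M → X}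
    (h : ∀ x₀ : M, ∀ y ∈ (extChartAt I x₀).target,
      ContinuousWithinAt (fun z => f ((extChartAt I x₀).symm z)) (extChartAt I x₀).target y) :
    Continuous f := by
  rw [continuous_iff_continuousAt]
  intro x
  have hs : (extChartAt I x).source ∈ 𝓝 x := extChartAt_source_mem_nhds x
  have h1 : ContinuousWithinAt (fun p => f ((extChartAt I x).symm (extChartAt I x p)))
      (extChartAt I x).source x :=
    ContinuousWithinAt.comp (g := fun z => f ((extChartAt I x).symm z)) (f := extChartAt I x)
      (t := (extChartAt I x).target) (h x _ (mem_extChartAt_target x))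
      (continuousOn_extChartAt x x (mem_extChartAt_source x)) (extChartAt I x).mapsTo
  refine (h1.congr (fun p hp => ?_) ?_).continuousAt hs
  · rw [(extChartAt I x).left_inv hp]
  · rw [(extChartAt I x).left_inv (mem_extChartAt_source x)]

theorem SmoothMetric.continuousWithinAt_dualNormSq (g : SmoothMetric I M) {x₀ : M} {y : E}
    (hy : y ∈ (extChartAt I x₀).target) {α : E → E →L[ℝ] ℝ}
    (hα : ContinuousWithinAt α (Set.range I) y) :
    ContinuousWithinAt (fun z => dualNormSq (g.chartForm x₀ z) (α z)) (Set.range I) y := by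
  unfold dualNormSq
  refine tendsto_finsetSum _ fun i _ => tendsto_finsetSum _ fun j _ => ?_
  refine Tendsto.mul (Tendsto.mul ?_ (hα.clm_apply continuousWithinAt_const))
    (hα.clm_apply continuousWithinAt_const)
  exact (contDiffWithinAt_inv_entry (g.contDiffWithinAt_coord hy)
    (g.det_coord_pos hy).ne' i j).continuousWithinAt

theorem SmoothMetric.continuous_dualNorm_differential (g : SmoothMetric I M) {u : M → ℝ}
    (hu : ContMDiff I 𝓘(ℝ, ℝ) ∞ u) : Continuous fun x => g.dualNorm x (differential I u x) := by
  refine continuous_of_charts (I := I) fun x₀ y hy => ?_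
  have h1 : ContinuousWithinAt (fun z => covNorm (g.chartForm x₀ z)
      (fderivWithin ℝ (fun z => u ((extChartAt I x₀).symm z)) (Set.range I) z)) (Set.range I) y :=
    (g.continuousWithinAt_dualNormSq hy
      ((contDiffWithinAt_comp_chart_symm hu hy).fderivWithin_right (m := ∞) I.uniqueDiffOn (by simp)
        (extChartAt_target_subset_range x₀ hy)).continuousWithinAt).sqrt
  refine (h1.mono (extChartAt_target_subset_range x₀)).congr (fun z hz => ?_) ?_
  · exact g.dualNorm_differential_chart hu hz
  · exact g.dualNorm_differential_chart hu hy

theorem hasMFDerivAt_chart_symm [I.Boundaryless] {x₀ : M} {y : E}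
    (hy : y ∈ (extChartAt I x₀).target) :
    HasMFDerivAt 𝓘(ℝ, E) I (extChartAt I x₀).symm y (chartSymmDeriv (E := E) I x₀ y) := by
  have := hasMFDerivWithinAt_chart_symm (I := I) hy
  rw [I.range_eq_univ] at this
  exact hasMFDerivWithinAt_univ.1 this

theorem hasMFDerivAt_comp_chart_symm [I.Boundaryless] {E₁ : Type*} [NormedAddCommGroup E₁]
    [NormedSpace ℝ E₁] {H₁ : Type*} [TopologicalSpace H₁] {I₁ : ModelWithCorners ℝ E₁ H₁}
    {M₁ : Type*} [TopologicalSpace M₁] [ChartedSpace H₁ M₁] {x₀ : M} {y : E}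
    (hy : y ∈ (extChartAt I x₀).target) {f : M → M₁} {L : E →L[ℝ] E₁}
    (hf : HasMFDerivAt I I₁ f ((extChartAt I x₀).symm y) L) :
    HasMFDerivAt 𝓘(ℝ, E) I₁ (fun z => f ((extChartAt I x₀).symm z)) y
      (L.comp (chartSymmDeriv (E := E) I x₀ y) : E →L[ℝ] E₁) :=
  hf.comp y (hasMFDerivAt_chart_symm hy)

section Boundaryless

variable [I.Boundaryless]

theorem contMDiffAt_chart_symm {x₀ : M} {y : E} (hy : y ∈ (extChartAt I x₀).target) :
    ContMDiffAt 𝓘(ℝ, E) I ∞ (extChartAt I x₀).symm y :=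
  (contMDiffOn_extChartAt_symm (I := I) (n := ∞) x₀).contMDiffAt
    ((isOpen_extChartAt_target x₀).mem_nhds hy)

/-- Facts about the metric in a chart that are used to compute the scalar curvature. -/
theorem SmoothMetric.eventually_chartForm (g : SmoothMetric I M) {x₀ : M} {y : E}
    (hy : y ∈ (extChartAt I x₀).target) :
    ∀ᶠ z in 𝓝 y, DifferentiableAt ℝ (g.chartForm x₀) z ∧
      IsLeviCivita (g.chartForm x₀) (christoffelTensor (g.coord x₀)) z := by
  filter_upwards [(isOpen_extChartAt_target x₀).mem_nhds hy] with z hz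
  have h1 : DifferentiableAt ℝ (g.chartForm x₀) z :=
    ((g.contDiffWithinAt_chartForm hz).contDiffAt
      (by rw [I.range_eq_univ]; exact univ_mem)).differentiableAt (by simp)
  exact ⟨h1, isLeviCivita_christoffelTensor h1
    (Eventually.of_forall fun z => g.chartForm_symm x₀ z) (g.det_coord_pos hz).ne'⟩

theorem SmoothMetric.contDiffAt_coord (g : SmoothMetric I M) {x₀ : M} {y : E}
    (hy : y ∈ (extChartAt I x₀).target) (i j : Fin (finrank ℝ E)) :
    ContDiffAt ℝ ∞ (fun z => g.coord x₀ z i j) y :=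
  (g.contDiffWithinAt_coord hy i j).contDiffAt (by rw [I.range_eq_univ]; exact univ_mem)

/-- The scalar curvature of a manifold that is locally isometric to another one. -/
theorem SmoothMetric.scalarCurvature_comp {E₁ : Type*} [NormedAddCommGroup E₁] [NormedSpace ℝ E₁]
    [FiniteDimensional ℝ E₁] {H₁ : Type*} [TopologicalSpace H₁] {I₁ : ModelWithCorners ℝ E₁ H₁}
    [I₁.Boundaryless] {M₁ : Type*} [TopologicalSpace M₁] [ChartedSpace H₁ M₁] [IsManifold I₁ ∞ M₁]
    (hdim : finrank ℝ E = finrank ℝ E₁)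
    (g₁ : SmoothMetric I₁ M₁) (g : SmoothMetric I M) {π : M → M₁} (hπ : ContMDiff I I₁ ∞ π)
    {D : M → E →L[ℝ] E₁} (hD : ∀ x, HasMFDerivAt I I₁ π x (D x))
    (hiso : ∀ x v w, g.form x v w = g₁.form (π x) (D x v) (D x w)) (x₀ : M) {y : E}
    (hy : y ∈ (extChartAt I x₀).target) :
    g₁.scalarCurvature (π ((extChartAt I x₀).symm y))
      = scalarCurvatureCoord univ (g.coord x₀) y := by
  have ht := (isOpen_extChartAt_target (I := I) x₀).mem_nhds hy
  have h2 := g₁.scalarCurvature_eq_of_parametrization hdim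
    (F := fun z => π ((extChartAt I x₀).symm z)) (y := y)
    (D := fun z => ((D ((extChartAt I x₀).symm z)).comp (chartSymmDeriv (E := E) I x₀ z) :
      E →L[ℝ] E₁))
    (hπ.contMDiffAt.comp y (contMDiffAt_chart_symm hy)) ?_ (g' := g.chartForm x₀)
    (Γ' := christoffelTensor (g.coord x₀)) ?_ ?_ (g.eventually_chartForm hy)
    (differentiableAt_christoffelTensor (G := g.coord x₀) (g.contDiffAt_coord hy) (g.det_coord_pos hy).ne')
    (finBasis ℝ E)
  · rw [h2]
    exact (scalarCurvatureCoord_eq (g := g.chartForm x₀) (g.contDiffAt_coord hy)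
      (g.det_coord_pos hy).ne').symm
  · filter_upwards [ht] with z hz
    exact hasMFDerivAt_comp_chart_symm hz (hD _)
  · refine Eventually.of_forall fun z v w => ?_
    rw [g.chartForm_apply, hiso]
    rfl
  · filter_upwards [ht] with z hz using g.chartForm_pos hz

/-- The identity is a local isometry, so a fixed chart gives the same values as the chart preferred
at each point. Without this, not even continuity of the scalar curvature would be clear, since the
preferred chart may jump. -/
theorem SmoothMetric.scalarCurvature_chart (g : SmoothMetric I M) (x₀ : M) {y : E}
    (hy : y ∈ (extChartAt I x₀).target) :
    g.scalarCurvature ((extChartAt I x₀).symm y) = scalarCurvatureCoord univ (g.coord x₀) y :=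
  g.scalarCurvature_comp rfl g (π := id) contMDiff_id
    (D := fun _ => ContinuousLinearMap.id ℝ E) (fun x => hasMFDerivAt_id x) (fun _ _ _ => rfl) x₀ hy

theorem SmoothMetric.continuous_scalarCurvature (g : SmoothMetric I M) :
    Continuous g.scalarCurvature := by
  refine continuous_of_charts (I := I) fun x₀ y hy => ?_
  have h1 := (contDiffWithinAt_scalarCurvatureCoord uniqueDiffOn_univ (mem_univ y)
    (fun i j => (g.contDiffAt_coord hy i j).contDiffWithinAt)
    (g.det_coord_pos hy).ne').continuousWithinAt
  refine (h1.mono (subset_univ _)).congr (fun z hz => ?_) ?_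
  · exact g.scalarCurvature_chart x₀ hz
  · exact g.scalarCurvature_chart x₀ hy

theorem SmoothMetric.boundaryMeasure_eq_zero [MeasurableSpace E] [BorelSpace E] [MeasurableSpace M]
    (g : SmoothMetric I M) : g.boundaryMeasure = 0 := by
  have : I.boundary M = ∅ := ModelWithCorners.Boundaryless.boundary_eq_empty
  rw [SmoothMetric.boundaryMeasure, this, Measure.restrict_empty]

end Boundaryless

section Sobolev

variable [MeasurableSpace E] [BorelSpace E] [MeasurableSpace M] [BorelSpace M]
  {g : SmoothMetric I M}

theorem aestronglyMeasurable_of_contMDiff {u : M → ℝ} (hu : ContMDiff I 𝓘(ℝ, ℝ) ∞ u)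
    (μ : Measure M) : AEStronglyMeasurable u μ :=
  hu.continuous.measurable.aestronglyMeasurable

theorem SobolevH1.aestronglyMeasurable (u : SobolevH1 g) :
    AEStronglyMeasurable u.toFun g.volume := by
  obtain ⟨v, hv, h1, -⟩ := u.exists_approx
  have := (aestronglyMeasurable_of_contMDiff (hv 0) g.volume).sub (h1 0).1
  exact this.congr (Eventually.of_forall fun x => by simp)

theorem SobolevH1.abs_dualNorm_sub_le (u : SobolevH1 g) (v : M → ℝ) (x : M) :
    |g.dualNorm x (differential I v x) - g.dualNorm x (u.diff x)|
      ≤ g.dualNorm x (differential I v x - u.diff x) :=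
  abs_covNorm_sub_le (g.posForm x) _ _

/-- Convergence in `L²` implies convergence in measure, hence almost everywhere along a subsequence.
Two successive extractions serve the functions and the norms of the differentials. The limits of the
norms give measurability of `|du|`, those of the functions allow Fatou's lemma. -/
theorem SobolevH1.exists_tendsto_ae (u : SobolevH1 g) : ∃ v : ℕ → M → ℝ,
    (∀ j, ContMDiff I 𝓘(ℝ, ℝ) ∞ (v j)) ∧
    (∀ j, MemLp (fun x => v j x - u.toFun x) 2 g.volume) ∧
    (∀ j, MemLp (fun x => g.dualNorm x (differential I (v j) x - u.diff x)) 2 g.volume) ∧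
    Tendsto (fun j => eLpNorm (fun x => v j x - u.toFun x) 2 g.volume) atTop (𝓝 0) ∧
    Tendsto (fun j => eLpNorm (fun x => g.dualNorm x (differential I (v j) x - u.diff x)) 2
      g.volume) atTop (𝓝 0) ∧
    (∀ᵐ x ∂g.volume, Tendsto (fun j => v j x) atTop (𝓝 (u.toFun x))) ∧
    ∀ᵐ x ∂g.volume, Tendsto (fun j => g.dualNorm x (differential I (v j) x)) atTop
      (𝓝 (g.dualNorm x (u.diff x))) := by
  obtain ⟨v, hv, h1, h2, -, t1, t2, -⟩ := u.exists_approx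
  have m1 : TendstoInMeasure g.volume (fun j x => v j x - u.toFun x) atTop (fun _ => 0) :=
    tendstoInMeasure_of_tendsto_eLpNorm two_ne_zero (fun j => (h1 j).1) aestronglyMeasurable_const
      (by simpa only [Pi.sub_def, sub_zero] using t1)
  obtain ⟨a, ha, hae⟩ := m1.exists_seq_tendsto_ae
  have m2 : TendstoInMeasure g.volume
      (fun j x => g.dualNorm x (differential I (v (a j)) x - u.diff x)) atTop (fun _ => 0) :=
    tendstoInMeasure_of_tendsto_eLpNorm two_ne_zero (fun j => (h2 _).1) aestronglyMeasurable_const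
      (by simpa only [Pi.sub_def, sub_zero, Function.comp_def] using t2.comp ha.tendsto_atTop)
  obtain ⟨b, hb, hbe⟩ := m2.exists_seq_tendsto_ae
  refine ⟨fun j => v (a (b j)), fun j => hv _, fun j => h1 _, fun j => h2 _,
    t1.comp (ha.comp hb).tendsto_atTop, t2.comp (ha.comp hb).tendsto_atTop, ?_, ?_⟩
  · filter_upwards [hae] with x hx
    have := (hx.comp hb.tendsto_atTop).add_const (u.toFun x)
    simpa using this
  · filter_upwards [hbe] with x hx
    rw [tendsto_iff_norm_sub_tendsto_zero]
    exact squeeze_zero (fun j => norm_nonneg _) (fun j => u.abs_dualNorm_sub_le _ x) hx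

theorem SobolevH1.aestronglyMeasurable_dualNorm (u : SobolevH1 g) :
    AEStronglyMeasurable (fun x => g.dualNorm x (u.diff x)) g.volume := by
  obtain ⟨v, hv, -, -, -, -, -, h⟩ := u.exists_tendsto_ae
  exact aestronglyMeasurable_of_tendsto_ae atTop (fun j =>
    (g.continuous_dualNorm_differential (hv j)).measurable.aestronglyMeasurable) h

end Sobolev

end Regularity

/-! ### Riemannian coverings and the comparison of Yamabe constants. -/

section CoveringVolume

variable {E : Type*} [NormedAddCommGroup E] [NormedSpace ℝ E] [FiniteDimensional ℝ E]
  {H : Type*} [TopologicalSpace H] {I : ModelWithCorners ℝ E H} [I.Boundaryless]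
  {M : Type*} [TopologicalSpace M] [ChartedSpace H M] [IsManifold I ∞ M]
  {M' : Type*} [TopologicalSpace M'] [ChartedSpace H M'] [IsManifold I ∞ M']
  {g : SmoothMetric I M} {g' : SmoothMetric I M'} {k : ℕ} {π : M' → M}

/-- The derivative of a map between manifolds, as a map of model spaces. -/
def derivMap (I : ModelWithCorners ℝ E H) (π : M' → M) (y : M') : E →L[ℝ] E := mfderiv I I π y

namespace IsRiemannianCovering

theorem hasMFDerivAt (h : IsRiemannianCovering k π g' g) (y : M') :
    HasMFDerivAt I I π y (derivMap (E := E) I π y : E →L[ℝ] E) :=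
  (h.contMDiff.mdifferentiableAt (by simp)).hasMFDerivAt

theorem form_eq (h : IsRiemannianCovering k π g' g) (y : M') (v w : E) :
    g'.form y v w = g.form (π y) (derivMap I π y v) (derivMap I π y w) :=
  (h.isometric y v w).symm

/-- The derivative of a Riemannian covering as a linear equivalence. -/
def derivEquiv (h : IsRiemannianCovering k π g' g) (y : M') : E ≃ₗ[ℝ] E :=
  LinearEquiv.ofInjectiveEndo (derivMap I π y).toLinearMap (by
    rw [← LinearMap.ker_eq_bot, LinearMap.ker_eq_bot']
    intro v hv
    by_contra hne
    have h1 := g'.form_pos y v hne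
    rw [h.form_eq] at h1
    change derivMap I π y v = 0 at hv
    simp [hv] at h1)

theorem dualNorm_comp (h : IsRiemannianCovering k π g' g) (y : M') (α : E →L[ℝ] ℝ) :
    covNorm (g'.form y) (α.comp (derivMap I π y)) = covNorm (g.form (π y)) α := by
  unfold covNorm
  rw [dualNormSq_pullback (g.form (π y)) (g'.form y) (h.derivEquiv y) (h.form_eq y) α
    (α.comp (derivMap I π y)) (fun _ => rfl)]

theorem scalarCurvature_eq (h : IsRiemannianCovering k π g' g) (y : M') :
    g.scalarCurvature (π y) = g'.scalarCurvature y := by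
  have h1 := g.scalarCurvature_comp rfl g' h.contMDiff h.hasMFDerivAt h.form_eq y
    (mem_extChartAt_target (I := I) y)
  have h2 := g'.scalarCurvature_chart y (mem_extChartAt_target (I := I) y)
  rw [extChartAt_to_inv] at h1 h2
  rw [h1, h2]

/-- A neighbourhood on which a local isometry is injective and seen by charts. -/
theorem exists_nhds (h : IsRiemannianCovering k π g' g) (y : M') : ∃ W : Set M', IsOpen W ∧ y ∈ W ∧
    InjOn π W ∧ W ⊆ (extChartAt I y).source ∧ MapsTo π W (extChartAt I (π y)).source := by
  obtain ⟨e, hy, he⟩ := h.isCoveringMap.isLocalHomeomorph y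
  refine ⟨e.source ∩ ((extChartAt I y).source ∩ π ⁻¹' (extChartAt I (π y)).source),
    e.open_source.inter ((isOpen_extChartAt_source y).inter
      ((isOpen_extChartAt_source _).preimage h.contMDiff.continuous)),
    ⟨hy, mem_extChartAt_source y, mem_extChartAt_source (I := I) (π y)⟩, ?_,
    fun z hz => hz.2.1, fun z hz => hz.2.2⟩
  rw [he]
  exact e.injOn.mono inter_subset_left

/-- Finitely many such neighbourhoods cover a covering of a compact manifold. -/
theorem exists_finite_cover (h : IsRiemannianCovering k π g' g) [CompactSpace M]
    {W : M' → Set M'} (hW : ∀ y, IsOpen (W y) ∧ y ∈ W y) :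
    ∃ t : Set M', t.Finite ∧ univ ⊆ ⋃ y ∈ t, W y := by
  have loc : ∀ x : M, ∃ U : Set M, IsOpen U ∧ x ∈ U ∧
      ∃ t : Set M', t.Finite ∧ π ⁻¹' U ⊆ ⋃ y ∈ t, W y := by
    intro x
    have hfin : Finite (π ⁻¹' {x}) :=
      Set.finite_coe_iff.2 (Set.finite_of_encard_eq_coe (h.encard_fiber x))
    obtain ⟨hd, U, hxU, hU, -, Φ, hΦ⟩ := h.isCoveringMap x
    -- Shrink the evenly covered neighbourhood so that on every sheet the points over it stay in the
    -- set `W` chosen at the fibre point of that sheet; finiteness of the fibre keeps the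
    -- intersection open.
    let V : Set U := ⋂ i : π ⁻¹' {x}, (fun u : U => (Φ.symm (u, i) : M')) ⁻¹'
      W (Φ.symm (⟨x, hxU⟩, i) : M')
    have hV : IsOpen V := isOpen_iInter_of_finite fun i => (hW _).1.preimage
      (continuous_subtype_val.comp (Φ.symm.continuous.comp (by fun_prop)))
    refine ⟨Subtype.val '' V, hU.isOpenMap_subtype_val _ hV, ⟨⟨x, hxU⟩, ?_, rfl⟩,
      Set.range fun i : π ⁻¹' {x} => (Φ.symm (⟨x, hxU⟩, i) : M'), Set.finite_range _, ?_⟩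
    · exact mem_iInter.2 fun i => (hW _).2
    · rintro p ⟨u, hu, hup⟩
      have hp : p ∈ π ⁻¹' U := by rw [mem_preimage, ← hup]; exact u.2
      have h1 : (Φ ⟨p, hp⟩).1 = u := Subtype.ext (by rw [hΦ, hup])
      have h2 := mem_iInter.1 hu (Φ ⟨p, hp⟩).2
      rw [← h1, mem_preimage] at h2
      simp only [Prod.mk.eta, Homeomorph.symm_apply_apply] at h2
      exact mem_biUnion (mem_range_self _) h2
  choose U hU hxU t ht hcov using loc
  obtain ⟨s, hs⟩ := isCompact_univ.elim_finite_subcover U hU fun x _ => mem_iUnion.2 ⟨x, hxU x⟩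
  refine ⟨⋃ x ∈ s, t x, s.finite_toSet.biUnion fun x _ => ht x, fun p _ => ?_⟩
  obtain ⟨x, hx, hpx⟩ := mem_iUnion₂.1 (hs (mem_univ (π p)))
  obtain ⟨y, hy, hpy⟩ := mem_iUnion₂.1 (hcov x hpx)
  exact mem_biUnion (mem_biUnion hx hy) hpy

end IsRiemannianCovering

theorem exists_nat_cover {X : Type*} {P : Set X → Prop} (h0 : P ∅) {ι : Type*} {t : Set ι}
    (ht : t.Countable) {W : ι → Set X} (hW : ∀ i ∈ t, P (W i)) {S : Set X}
    (hS : S ⊆ ⋃ i ∈ t, W i) : ∃ V : ℕ → Set X, (∀ n, P (V n)) ∧ S ⊆ ⋃ n, V n := by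
  -- The empty set is added so that the family is nonempty and can be enumerated.
  obtain ⟨f, hf⟩ := ((ht.image W).insert ∅).exists_eq_range (insert_nonempty _ _)
  refine ⟨f, fun n => ?_, fun x hx => ?_⟩
  · have : f n ∈ insert ∅ (W '' t) := hf ▸ mem_range_self n
    rcases this with h | ⟨i, hi, h⟩
    · rw [h]; exact h0
    · rw [← h]; exact hW i hi
  · obtain ⟨i, hi, hxi⟩ := mem_iUnion₂.1 (hS hx)
    have : W i ∈ range f := hf ▸ mem_insert_of_mem _ (mem_image_of_mem W hi)
    obtain ⟨n, hn⟩ := this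
    exact mem_iUnion.2 ⟨n, hn ▸ hxi⟩

variable [MeasurableSpace E] [BorelSpace E] [MeasurableSpace M] [BorelSpace M]
  [MeasurableSpace M'] [BorelSpace M']

namespace IsRiemannianCovering

/-- The inverse chart followed by `π` is a parametrization of `π '' A` with the same density as the
inverse chart alone, because `π` is isometric. -/
theorem volume_image (h : IsRiemannianCovering k π g' g) {y : M'} {x : M} {A : Set M'}
    (hA : MeasurableSet A) (hinj : InjOn π A) (hy : A ⊆ (extChartAt I y).source)
    (hx : MapsTo π A (extChartAt I x).source) :
    MeasurableSet (π '' A) ∧ g.volume (π '' A) = g'.volume A := by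
  set s := (extChartAt I y).target ∩ (extChartAt I y).symm ⁻¹' A with hs
  have him : (fun z => π ((extChartAt I y).symm z)) '' s = π '' A := by
    ext p
    constructor
    · rintro ⟨z, hz, rfl⟩
      exact mem_image_of_mem π hz.2
    · rintro ⟨q, hq, rfl⟩
      refine ⟨extChartAt I y q, ⟨(extChartAt I y).map_source (hy hq), ?_⟩, ?_⟩
      · rw [mem_preimage, (extChartAt I y).left_inv (hy hq)]; exact hq
      · simp only [(extChartAt I y).left_inv (hy hq)]
  have key := g.volume_image (x₀ := x) (F := fun z => π ((extChartAt I y).symm z))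
    (D := fun z => ((derivMap I π ((extChartAt I y).symm z)).comp
      (chartSymmDeriv (E := E) I y z) : E →L[ℝ] E)) (s := s)
    (measurableSet_target_inter_preimage y hA)
    (fun z hz => (hasMFDerivAt_comp_chart_symm hz.1 (h.hasMFDerivAt _)).hasMFDerivWithinAt)
    (fun z hz w hw hzw => (extChartAt I y).symm.injOn hz.1 hw.1 (hinj hz.2 hw.2 hzw))
    (fun z hz => hx hz.2) (finBasis ℝ E) (by simp)
  rw [him] at key
  refine ⟨key.1, ?_⟩
  rw [key.2, g'.volume_eq_chartVolume hA hy, g'.chartVolume_apply y hA]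
  refine lintegral_congr fun z => ?_
  unfold volDensity
  congr 4
  ext v w
  simp only [ContinuousLinearMap.bilinearComp_apply, ContinuousLinearMap.comp_apply, h.form_eq]

/-- Finitely many open sets on which `π` is injective and measure preserving cover `M'`, so the
count of fibres in `measure_inter_preimage_eq_mul` applies with `S = univ`. -/
theorem map_volume (h : IsRiemannianCovering k π g' g) [CompactSpace M] :
    Measure.map π g'.volume = (k : ENNReal) • g.volume := by
  choose W hWo hyW hWi hWs hWm using h.exists_nhds
  obtain ⟨t, ht, htW⟩ := h.exists_finite_cover fun y => ⟨hWo y, hyW y⟩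
  obtain ⟨V, hV, hVc⟩ := exists_nat_cover (P := fun V : Set M' => MeasurableSet V ∧ InjOn π V ∧
    ∀ A, MeasurableSet A → A ⊆ V → MeasurableSet (π '' A) ∧ g.volume (π '' A) = g'.volume A)
    ⟨MeasurableSet.empty, injOn_empty π, fun A _ hA => by simp [subset_empty_iff.1 hA]⟩
    ht.countable (W := W) (fun y _ => ⟨(hWo y).measurableSet, hWi y, fun A hA hAW =>
      h.volume_image hA ((hWi y).mono hAW) (hAW.trans (hWs y)) ((hWm y).mono_left hAW)⟩) htW
  have hmeas : Measurable π := h.contMDiff.continuous.measurable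
  ext B hB
  rw [Measure.map_apply hmeas hB, Measure.smul_apply, smul_eq_mul, ← univ_inter (π ⁻¹' B)]
  refine measure_inter_preimage_eq_mul
    (fun B hB => MeasurableSet.univ.inter (hmeas hB)) (fun n => (hV n).1) hVc
    (fun n => (hV n).2.1.mono inter_subset_right) (fun n A hA hAV =>
      (hV n).2.2 A hA (hAV.trans inter_subset_right)) (fun x => ?_) hB
  rw [univ_inter]
  exact h.encard_fiber x

theorem integral_comp (h : IsRiemannianCovering k π g' g) [CompactSpace M] {f : M → ℝ}
    (hf : AEStronglyMeasurable f g.volume) :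
    ∫ y, f (π y) ∂g'.volume = k * ∫ x, f x ∂g.volume := by
  have hmeas : Measurable π := h.contMDiff.continuous.measurable
  have h1 : AEStronglyMeasurable f (Measure.map π g'.volume) := by
    rw [h.map_volume]; exact hf.smul_measure _
  rw [← integral_map hmeas.aemeasurable h1, h.map_volume, integral_smul_measure]
  simp

theorem memLp_comp (h : IsRiemannianCovering k π g' g) [CompactSpace M] {f : M → ℝ}
    (hf : MemLp f 2 g.volume) (c : ℝ) : MemLp (fun y => c * f (π y)) 2 g'.volume := by
  have hmeas : Measurable π := h.contMDiff.continuous.measurable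
  have h1 : MemLp f 2 (Measure.map π g'.volume) := by
    rw [h.map_volume]; exact hf.smul_measure (by simp)
  exact (h1.comp_of_map hmeas.aemeasurable).const_mul c

theorem tendsto_eLpNorm_comp (h : IsRiemannianCovering k π g' g) [CompactSpace M] (hk : 1 ≤ k)
    {f : ℕ → M → ℝ} (hf : ∀ j, MemLp (f j) 2 g.volume)
    (ht : Tendsto (fun j => eLpNorm (f j) 2 g.volume) atTop (𝓝 0)) (c : ℝ) :
    Tendsto (fun j => eLpNorm (fun y => c * f j (π y)) 2 g'.volume) atTop (𝓝 0) := by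
  have hmeas : Measurable π := h.contMDiff.continuous.measurable
  have h1 : ∀ j, eLpNorm (fun y => c * f j (π y)) 2 g'.volume
      = ‖c‖ₑ * ((k : ENNReal) ^ (1 / (2 : ENNReal)).toReal * eLpNorm (f j) 2 g.volume) := by
    intro j
    have h2 : AEStronglyMeasurable (f j) (Measure.map π g'.volume) := by
      rw [h.map_volume]; exact (hf j).1.smul_measure _
    have h3 : eLpNorm (fun y => f j (π y)) 2 g'.volume
        = eLpNorm (f j) 2 (Measure.map π g'.volume) :=
      (eLpNorm_map_measure h2 hmeas.aemeasurable).symm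
    have h4 : eLpNorm (fun y => c * f j (π y)) 2 g'.volume
        = ‖c‖ₑ * eLpNorm (fun y => f j (π y)) 2 g'.volume :=
      eLpNorm_const_smul c (fun y => f j (π y)) 2 g'.volume
    rw [h4, h3, h.map_volume,
      eLpNorm_smul_measure_of_ne_zero (by exact_mod_cast (by omega : k ≠ 0)), smul_eq_mul]
  simp_rw [h1]
  have h5 := ENNReal.Tendsto.const_mul (a := (k : ENNReal) ^ (1 / (2 : ENNReal)).toReal) ht
    (Or.inr (ENNReal.rpow_ne_top_of_nonneg (by positivity) (by simp)))
  have h6 := ENNReal.Tendsto.const_mul (a := ‖c‖ₑ) h5 (Or.inr enorm_ne_top)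
  simpa using h6

theorem diffForm_comp (h : IsRiemannianCovering k π g' g) {v : M → ℝ}
    (hv : ContMDiff I 𝓘(ℝ, ℝ) ∞ v) (c : ℝ) (y : M') :
    diffForm I (fun y => c * v (π y)) y = c • (diffForm I v (π y)).comp (derivMap I π y) := by
  have h1 : HasMFDerivAt I 𝓘(ℝ, ℝ) v (π y) (diffForm (E := E) I v (π y) : E →L[ℝ] ℝ) :=
    (hv.mdifferentiableAt (by simp)).hasMFDerivAt
  have h2 := HasMFDerivAt.comp y h1 (h.hasMFDerivAt y)
  have h3 := h2.const_smul c
  exact h3.mfderiv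

/-- The pullback of a covector. -/
def pullbackCovector (I : ModelWithCorners ℝ E H) (π : M' → M) (y : M') (α : E →L[ℝ] ℝ) : E →L[ℝ] ℝ :=
  α.comp (derivMap I π y)

theorem covNorm_pullbackCovector (h : IsRiemannianCovering k π g' g) (y : M') (c : ℝ)
    (α : E →L[ℝ] ℝ) : covNorm (g'.form y) (c • pullbackCovector I π y α)
      = |c| * covNorm (g.form (π y)) α := by
  rw [covNorm_smul (g'.posForm y), ← h.dualNorm_comp y]
  rfl

theorem covNorm_diffForm_sub (h : IsRiemannianCovering k π g' g) {v : M → ℝ}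
    (hv : ContMDiff I 𝓘(ℝ, ℝ) ∞ v) (c : ℝ) (y : M') (α : E →L[ℝ] ℝ) :
    covNorm (g'.form y) (diffForm I (fun y => c * v (π y)) y - c • pullbackCovector I π y α)
      = |c| * covNorm (g.form (π y)) (diffForm I v (π y) - α) := by
  rw [← h.covNorm_pullbackCovector, h.diffForm_comp hv]
  congr 1
  ext w
  simp [pullbackCovector, mul_sub]

/-- The pullback of `c u` to a covering. -/
def pullback (h : IsRiemannianCovering k π g' g) [CompactSpace M] (hk : 1 ≤ k) (c : ℝ)
    (u : SobolevH1 g) : SobolevH1 g' where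
  toFun y := c * u.toFun (π y)
  diff y := (c • pullbackCovector (E := E) I π y (u.diff (π y)) : E →L[ℝ] ℝ)
  trace _ := 0
  exists_approx := by
    obtain ⟨v, hv, h1, h2, -, t1, t2, -⟩ := u.exists_approx
    have e1 : ∀ j, (fun y => c * v j (π y) - c * u.toFun (π y))
        = fun y => c * (fun x => v j x - u.toFun x) (π y) := fun j => by
      ext y; ring
    have e2 : ∀ j, (fun y => covNorm (g'.form y) (diffForm I (fun y => c * v j (π y)) y
        - c • pullbackCovector (E := E) I π y (u.diff (π y))))
        = fun y => |c| * (fun x => g.dualNorm x (differential I (v j) x - u.diff x)) (π y) :=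
      fun j => funext fun y => h.covNorm_diffForm_sub (hv j) c y (u.diff (π y))
    refine ⟨fun j y => c * v j (π y), fun j => ?_, fun j => ?_, fun j => ?_, fun j => ?_, ?_, ?_, ?_⟩
    · exact contMDiff_const.mul ((hv j).comp h.contMDiff)
    · rw [e1]; exact h.memLp_comp (h1 j) c
    · have := h.memLp_comp (h2 j) |c|
      rw [← e2] at this
      exact this
    · rw [g'.boundaryMeasure_eq_zero]; simp
    · simp_rw [e1]; exact h.tendsto_eLpNorm_comp hk h1 t1 c
    · have := h.tendsto_eLpNorm_comp hk h2 t2 |c|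
      simp_rw [← e2] at this
      exact this
    · rw [g'.boundaryMeasure_eq_zero]; simp

theorem integral_mul_sq_comp (h : IsRiemannianCovering k π g' g) [CompactSpace M] {f d : M → ℝ}
    (hf : AEStronglyMeasurable f g.volume) (hd : AEStronglyMeasurable d g.volume) (c : ℝ) :
    ∫ y, f (π y) * (c * d (π y)) ^ 2 ∂g'.volume = c ^ 2 * (k * ∫ x, f x * d x ^ 2 ∂g.volume) := by
  have hm : AEStronglyMeasurable (fun x => f x * d x ^ 2) g.volume :=
    (hf.aemeasurable.mul (hd.aemeasurable.pow_const 2)).aestronglyMeasurable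
  rw [← h.integral_comp hm, ← integral_const_mul]
  congr 1
  ext y
  ring

theorem energy_pullback (h : IsRiemannianCovering k π g' g) [CompactSpace M] (hk : 1 ≤ k) (c : ℝ)
    (u : SobolevH1 g) : energy g' (h.pullback hk c u) = c ^ 2 * k * energy g u := by
  have hd : ∀ y, g'.dualNorm y ((h.pullback hk c u).diff y) = |c| * g.dualNorm (π y) (u.diff (π y)) := by
    exact fun y => h.covNorm_pullbackCovector y c (u.diff (π y))
  have hu : ∀ y, (h.pullback hk c u).toFun y = c * u.toFun (π y) := fun _ => rfl
  unfold energy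
  simp only [g.boundaryMeasure_eq_zero, g'.boundaryMeasure_eq_zero, integral_zero_measure, mul_zero,
    add_zero, hd, hu]
  set a : ℝ := 4 * ((finrank ℝ E : ℝ) - 1) / ((finrank ℝ E : ℝ) - 2)
  have e1 : ∫ y, a * (|c| * g.dualNorm (π y) (u.diff (π y))) ^ 2 ∂g'.volume
      = c ^ 2 * (k * ∫ x, a * g.dualNorm x (u.diff x) ^ 2 ∂g.volume) := by
    rw [← sq_abs c]
    exact h.integral_mul_sq_comp (f := fun _ => a) aestronglyMeasurable_const
      u.aestronglyMeasurable_dualNorm |c|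
  have e2 : ∫ y, g'.scalarCurvature y * (c * u.toFun (π y)) ^ 2 ∂g'.volume
      = c ^ 2 * (k * ∫ x, g.scalarCurvature x * u.toFun x ^ 2 ∂g.volume) := by
    simp_rw [← h.scalarCurvature_eq]
    exact h.integral_mul_sq_comp g.continuous_scalarCurvature.measurable.aestronglyMeasurable
      u.aestronglyMeasurable c
  rw [e1, e2]
  ring

/-- Each competitor on `M` lifts to one on `M'` whose energy is `k^(2/n)` times as large. Both
boundary measures vanish, so only the exponent `p` occurs in the constraint and a single scaling
factor suffices. -/
theorem yamabeConstant_ge (h : IsRiemannianCovering k π g' g) [CompactSpace M] (hk : 1 ≤ k)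
    {n : ℕ} (hn : 3 ≤ n) (hdim : finrank ℝ E = n) (t : ℝ) :
    yamabeConstant t g' / (((k : ℝ) ^ ((2 : ℝ) / n) : ℝ) : EReal) ≤ yamabeConstant t g := by
  have hk0 : (0 : ℝ) < k := by exact_mod_cast hk
  have hn3 : (3 : ℝ) ≤ n := by exact_mod_cast hn
  have hK : (0 : ℝ) < (k : ℝ) ^ ((2 : ℝ) / n) := Real.rpow_pos_of_pos hk0 _
  unfold yamabeConstant genYamabeConstant
  refine le_iInf₂ fun u hu => ?_
  rw [EReal.div_le_iff_le_mul (by exact_mod_cast hK) (EReal.coe_ne_top _)]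
  set p : ℝ := 2 * n / (n - 2) with hp
  have hn2 : (n : ℝ) - 2 ≠ 0 := by linarith
  have hp0 : 0 < p := by have : (0:ℝ) < n - 2 := by linarith
                         positivity
  -- Chosen so that `c^p k = 1`; then `c² k = k^(1 - 2/p) = k^(2/n)`.
  set c : ℝ := (k : ℝ) ^ (-1 / p) with hc
  have hc0 : 0 < c := Real.rpow_pos_of_pos hk0 _
  refine (iInf₂_le (h.pullback hk c u) ?_).trans ?_
  · simp only [constraintSet, mem_ofPred_eq, g.boundaryMeasure_eq_zero, g'.boundaryMeasure_eq_zero,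
      integral_zero_measure, mul_zero, add_zero, hdim, ← hp] at hu ⊢
    have hu' : ∀ y, (h.pullback hk c u).toFun y = c * u.toFun (π y) := fun _ => rfl
    refine ⟨?_, ?_⟩
    · rw [← hu.1]
      congr 1
      have hm : AEStronglyMeasurable (fun x => |u.toFun x| ^ p) g.volume :=
        ((continuous_abs.measurable.comp_aemeasurable
          u.aestronglyMeasurable.aemeasurable).pow_const p).aestronglyMeasurable
      have e1 : ∀ y, |(h.pullback hk c u).toFun y| ^ p = c ^ p * |u.toFun (π y)| ^ p := by
        intro y
        rw [hu', abs_mul, Real.mul_rpow (abs_nonneg _) (abs_nonneg _), abs_of_pos hc0]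
      simp_rw [e1]
      rw [integral_const_mul, h.integral_comp hm, ← mul_assoc]
      have : c ^ p * k = 1 := by
        rw [hc, ← Real.rpow_mul hk0.le, div_mul_cancel₀ _ hp0.ne', Real.rpow_neg_one,
          inv_mul_cancel₀ hk0.ne']
      rw [this, one_mul]
    · have hmeas : Measurable π := h.contMDiff.continuous.measurable
      have h1 : ∀ᵐ x ∂(Measure.map π g'.volume), 0 < u.toFun x := by
        rw [h.map_volume]
        exact Measure.ae_smul_measure hu.2 _
      filter_upwards [ae_of_ae_map hmeas.aemeasurable h1] with y hy
      exact mul_pos hc0 hy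
  · rw [h.energy_pullback, ← EReal.coe_mul]
    have : c ^ 2 * k = (k : ℝ) ^ ((2 : ℝ) / n) := by
      rw [hc, ← Real.rpow_natCast, ← Real.rpow_mul hk0.le]
      nth_rewrite 2 [← Real.rpow_one (k : ℝ)]
      rw [← Real.rpow_add hk0]
      congr 1
      rw [hp]
      have : (n : ℝ) ≠ 0 := by linarith
      field_simp
      push_cast
      ring
    rw [this]

end IsRiemannianCovering

end CoveringVolume

/-! ### Metrics induced by immersions into a Euclidean space. -/

section Immersion

variable {E : Type*} [NormedAddCommGroup E] [NormedSpace ℝ E] [FiniteDimensional ℝ E]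
  {H : Type*} [TopologicalSpace H] {I : ModelWithCorners ℝ E H}
  {M : Type*} [TopologicalSpace M] [ChartedSpace H M] [IsManifold I ∞ M]
  {V : Type*} [NormedAddCommGroup V] [InnerProductSpace ℝ V]

theorem contMDiffAt_inner_comp (φ : M → E →L[ℝ] V) {x₀ : M} (h : ContMDiffAt I 𝓘(ℝ, E →L[ℝ] V) ∞ φ x₀) :
    ContMDiffAt I 𝓘(ℝ, E →L[ℝ] E →L[ℝ] ℝ) ∞
      (fun x => ((innerSL ℝ).bilinearComp (φ x) (φ x) : E →L[ℝ] E →L[ℝ] ℝ)) x₀ := by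
  have : ContDiff ℝ ∞ (fun L : E →L[ℝ] V =>
      ((innerSL ℝ).bilinearComp L L : E →L[ℝ] E →L[ℝ] ℝ)) := by
    unfold ContinuousLinearMap.bilinearComp
    refine (ContinuousLinearMap.flipₗᵢ ℝ E E ℝ).contDiff.comp (ContDiff.clm_comp ?_ contDiff_id)
    exact (ContinuousLinearMap.flipₗᵢ ℝ E V ℝ).contDiff.comp (contDiff_const.clm_comp contDiff_id)
  exact this.contMDiff.contMDiffAt.comp x₀ h

/-- The derivative of a map into a vector space. -/
def derivV (I : ModelWithCorners ℝ E H) (Φ : M → V) (x : M) : E →L[ℝ] V := mfderiv I 𝓘(ℝ, V) Φ x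

/-- The form induced by a map into a Euclidean space. -/
def inducedForm (I : ModelWithCorners ℝ E H) (Φ : M → V) (x : M) : E →L[ℝ] E →L[ℝ] ℝ :=
  (innerSL ℝ).bilinearComp (derivV I Φ x) (derivV I Φ x)

theorem inducedForm_apply (Φ : M → V) (x : M) (v w : E) :
    inducedForm I Φ x v w = inner ℝ (derivV I Φ x v) (derivV I Φ x w) := rfl

theorem inducedForm_symm (Φ : M → V) (x : M) (v w : E) :
    inducedForm I Φ x v w = inducedForm I Φ x w v := by
  rw [inducedForm_apply, inducedForm_apply, real_inner_comm]

theorem inducedForm_pos {Φ : M → V} {x : M} (h : ∀ v : E, derivV I Φ x v = 0 → v = 0) (v : E)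
    (hv : v ≠ 0) : 0 < inducedForm I Φ x v v :=
  real_inner_self_pos.2 fun h0 => hv (h v h0)

theorem isVonNBounded_of_injective {L : E →L[ℝ] V} (hL : ∀ v, L v = 0 → v = 0) :
    Bornology.IsVonNBounded ℝ {v : E | inner ℝ (L v) (L v) < 1} := by
  obtain ⟨K, hK, hL'⟩ := (L : E →ₗ[ℝ] V).exists_antilipschitzWith
    (LinearMap.ker_eq_bot'.2 hL)
  rw [NormedSpace.isVonNBounded_iff, isBounded_iff_forall_norm_le]
  refine ⟨K, fun v hv => ?_⟩
  rw [mem_ofPred_eq, real_inner_self_eq_norm_sq] at hv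
  have h1 : ‖L v‖ ≤ 1 := by nlinarith [norm_nonneg (L v)]
  have h2 := hL'.le_mul_norm_sub (x := v) (y := 0)
  simp only [ContinuousLinearMap.coe_coe, map_zero, add_zero, norm_neg] at h2
  exact h2.trans (mul_le_of_le_one_right K.2 h1)

theorem isVonNBounded_inducedForm {Φ : M → V} {x : M} (h : ∀ v : E, derivV I Φ x v = 0 → v = 0) :
    Bornology.IsVonNBounded ℝ {v : E | inducedForm I Φ x v v < 1} :=
  isVonNBounded_of_injective h

/-- In the trivialisation at `x₀` the induced form is the inner product composed twice with the
derivative of `Φ` in tangent coordinates, which depends smoothly on the point. The rest of the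
argument identifies the two trivialisations. -/
theorem contMDiff_pullback_inner {Φ : M → V} (hΦ : ContMDiff I 𝓘(ℝ, V) ∞ Φ) :
    ContMDiff I (I.prod 𝓘(ℝ, E →L[ℝ] E →L[ℝ] ℝ)) ∞ (fun x => Bundle.TotalSpace.mk' (E →L[ℝ] E →L[ℝ] ℝ)
      (E := fun x : M => TangentSpace I x →L[ℝ] TangentSpace I x →L[ℝ] ℝ) x
      (inducedForm (E := E) I Φ x : E →L[ℝ] E →L[ℝ] ℝ)) := by
  intro x₀
  rw [contMDiffAt_hom_bundle]
  refine ⟨contMDiffAt_id, ?_⟩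
  have h := contMDiffAt_inner_comp _ ((hΦ x₀).mfderiv_const (m := ∞) (by simp))
  refine h.congr_of_eventuallyEq ?_
  filter_upwards [(chartAt H x₀).open_source.mem_nhds (mem_chart_source H x₀)] with x hx
  ext v w
  have hx' : x ∈ (trivializationAt E (TangentSpace I) x₀).baseSet := by simpa using hx
  have key : ∀ v : E, inTangentCoordinates I 𝓘(ℝ, V) id Φ (mfderiv I 𝓘(ℝ, V) Φ) x₀ x v
      = derivV I Φ x ((trivializationAt E (TangentSpace I) x₀).symm x v) := by
    intro v
    have e3 := inTangentCoordinates_eq (I := I) (I' := 𝓘(ℝ, V)) id Φ (fun z => derivV I Φ z) (x₀ := x₀) (x := x) hx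
      (mem_chart_source V (Φ x))
    have e4 := congrArg (fun T => T v) (TangentBundle.symmL_trivializationAt_eq_core (𝕜 := ℝ) (I := I) hx)
    rw [Bundle.Trivialization.symmL_apply _ hx'] at e4
    rw [tangentBundleCore_coordChange_model_space] at e3
    refine (congrArg (fun T => T v) e3).trans ?_
    change derivV I Φ x _ = derivV I Φ x _
    exact congrArg (derivV I Φ x) e4.symm
  have e1 := inCoordinates_apply_eq₂ (𝕜 := ℝ) (x₀ := x₀) (x := x) (F₁ := E) (E₁ := fun x : M => TangentSpace I x) (F₂ := E)
    (E₂ := fun x : M => TangentSpace I x) (F₃ := ℝ) (E₃ := fun _ : M => ℝ)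
    (ϕ := inducedForm (E := E) I Φ x) (v := v) (w := w) hx' hx' (mem_univ _)
  have e0 : ∀ r : ℝ, (trivializationAt ℝ (fun _ : M => ℝ) x₀).linearMapAt ℝ x r = r := fun r =>
    congrArg (fun T => T r) (Bundle.Trivial.linearMapAt_trivialization (𝕜 := ℝ) (B := M) (F := ℝ) x)
  refine (e1.trans (e0 _)).trans ?_
  have e2 : inner ℝ (derivV I Φ x ((trivializationAt E (TangentSpace I) x₀).symm x v))
     (derivV I Φ x ((trivializationAt E (TangentSpace I) x₀).symm x w))
     = inner ℝ (inTangentCoordinates I 𝓘(ℝ, V) id Φ (mfderiv I 𝓘(ℝ, V) Φ) x₀ x v) (inTangentCoordinates I 𝓘(ℝ, V) id Φ (mfderiv I 𝓘(ℝ, V) Φ) x₀ x w) := by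
    rw [key, key]
  exact e2

/-- The metric induced by an immersion into a Euclidean space. -/
def SmoothMetric.ofImmersion (Φ : M → V) (hΦ : ContMDiff I 𝓘(ℝ, V) ∞ Φ)
    (hinj : ∀ (x : M) (v : E), derivV I Φ x v = 0 → v = 0) : SmoothMetric I M where
  inner x := (inducedForm (E := E) I Φ x : E →L[ℝ] E →L[ℝ] ℝ)
  symm x := inducedForm_symm (E := E) Φ x
  pos x := inducedForm_pos (E := E) (hinj x)
  isVonNBounded x := isVonNBounded_inducedForm (E := E) (hinj x)
  contMDiff := contMDiff_pullback_inner hΦ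

end Immersion

/-! ### The cylinder metric on punctured Euclidean space and its curvature. -/

section Cylinder

variable {W : Type*} [NormedAddCommGroup W] [InnerProductSpace ℝ W]

variable (W) in
/-- The inner product of a Euclidean space as a bilinear form. -/
def euclForm : W →L[ℝ] W →L[ℝ] ℝ :=
  (innerSL ℝ).bilinearComp (ContinuousLinearMap.id ℝ W) (ContinuousLinearMap.id ℝ W)

theorem euclForm_apply (v w : W) : euclForm W v w = inner ℝ v w := rfl

/-- The metric `|dx|² / |x|²` of the cylinder, on the complement of the origin. -/
def cylForm (x : W) : W →L[ℝ] W →L[ℝ] ℝ := (‖x‖ ^ 2)⁻¹ • euclForm W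

theorem cylForm_apply (x v w : W) : cylForm x v w = (‖x‖ ^ 2)⁻¹ * inner ℝ v w := rfl

variable (W) in
/-- The trilinear map `⟨x, u⟩ v + ⟨x, v⟩ u - ⟨u, v⟩ x`. -/
def cylTensor : W →L[ℝ] W →L[ℝ] W →L[ℝ] W :=
  let A : W →L[ℝ] W →L[ℝ] W →L[ℝ] W :=
    ((ContinuousLinearMap.smulRightL ℝ W (W →L[ℝ] W)).flip (ContinuousLinearMap.id ℝ W)).comp (euclForm W)
  A + (ContinuousLinearMap.flipₗᵢ ℝ W W W).toContinuousLinearEquiv.toContinuousLinearMap.comp A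
    - ((ContinuousLinearMap.smulRightL ℝ W W).comp (euclForm W)).flip

theorem cylTensor_apply (x u v : W) : cylTensor W x u v
    = (inner ℝ x u : ℝ) • v + (inner ℝ x v : ℝ) • u - (inner ℝ u v : ℝ) • x := rfl

/-- The Levi-Civita connection of the cylinder. -/
def cylChristoffel (x : W) : W →L[ℝ] W →L[ℝ] W := -(‖x‖ ^ 2)⁻¹ • cylTensor W x

theorem hasFDerivAt_inv_norm_sq {x : W} (hx : x ≠ 0) :
    HasFDerivAt (fun y : W => (‖y‖ ^ 2)⁻¹) ((-2 * ((‖x‖ ^ 2)⁻¹) ^ 2) • euclForm W x) x := by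
  have h1 : HasFDerivAt (fun y : W => ‖y‖ ^ 2) (2 • (innerSL ℝ x)) x :=
    (hasStrictFDerivAt_norm_sq x).hasFDerivAt
  have h2 := (hasDerivAt_inv (x := ‖x‖ ^ 2) (by positivity)).comp_hasFDerivAt x h1
  refine h2.congr_fderiv ?_
  ext v
  simp [euclForm_apply]
  ring

theorem hasFDerivAt_cylForm {x : W} (hx : x ≠ 0) : HasFDerivAt (cylForm (W := W))
    (((-2 * ((‖x‖ ^ 2)⁻¹) ^ 2) • euclForm W x).smulRight (euclForm W)) x :=
  (hasFDerivAt_inv_norm_sq hx).smul_const (euclForm W)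

theorem hasFDerivAt_cylChristoffel {x : W} (hx : x ≠ 0) : HasFDerivAt (cylChristoffel (W := W))
    (-((‖x‖ ^ 2)⁻¹ • cylTensor W
      + ((-2 * ((‖x‖ ^ 2)⁻¹) ^ 2) • euclForm W x).smulRight (cylTensor W x))) x := by
  have h := ((hasFDerivAt_inv_norm_sq hx).smul (cylTensor W).hasFDerivAt).neg
  refine (h.congr_of_eventuallyEq ?_)
  exact Eventually.of_forall fun y => by simp [cylChristoffel]

theorem isLeviCivita_cyl {x : W} (hx : x ≠ 0) : IsLeviCivita cylForm cylChristoffel x := by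
  intro u v w
  rw [(hasFDerivAt_cylForm hx).fderiv]
  simp only [ContinuousLinearMap.smulRight_apply, _root_.smul_apply, euclForm_apply,
    cylForm_apply, cylChristoffel, cylTensor_apply, smul_eq_mul, inner_smul_left, inner_add_left,
    inner_sub_left, neg_smul, inner_neg_left, _root_.neg_apply, RCLike.conj_to_real]
  rw [real_inner_comm w x, real_inner_comm v u]
  ring

variable [FiniteDimensional ℝ W]

/-- The Ricci form is the trace of an endomorphism, so it can be taken in a Euclidean orthonormal
basis although the metric is not Euclidean. The value is `n - 2` times the part of the metric
orthogonal to the radial direction, as expected for `ℝ × S^(n-1)`. -/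
theorem ricciForm_cyl {x : W} (hx : x ≠ 0) (v w : W) : ricciForm cylChristoffel x v w
    = ((finrank ℝ W : ℝ) - 2) * ((‖x‖ ^ 2)⁻¹ * inner ℝ v w
      - ((‖x‖ ^ 2)⁻¹) ^ 2 * (inner ℝ x v * inner ℝ x w)) := by
  have hN : ‖x‖ ^ 2 ≠ 0 := by positivity
  set b := stdOrthonormalBasis ℝ W
  rw [ricciForm_apply, LinearMap.trace_eq_sum_inner _ b]
  have hxx : (inner ℝ x x : ℝ) = ‖x‖ ^ 2 := real_inner_self_eq_norm_sq x
  have s1 : ∀ y z : W, ∑ i, (inner ℝ (b i) y : ℝ) * inner ℝ (b i) z = inner ℝ y z := fun y z => by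
    rw [← b.sum_inner_mul_inner y z]
    exact Finset.sum_congr rfl fun i _ => by rw [real_inner_comm]
  have s2 : ∀ i, (inner ℝ (b i) (b i) : ℝ) = 1 := fun i => by
    rw [real_inner_self_eq_norm_sq, b.norm_eq_one, one_pow]
  set M := (‖x‖ ^ 2)⁻¹ with hM
  have hMN : M * ‖x‖ ^ 2 = 1 := inv_mul_cancel₀ hN
  have key : ∀ i, (inner ℝ (b i) (curvEnd cylChristoffel x v w (b i)) : ℝ)
      = (M * inner ℝ v w - M ^ 2 * (inner ℝ x v * inner ℝ x w))
        - M * (inner ℝ (b i) v * inner ℝ (b i) w)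
        + M ^ 2 * (inner ℝ x w) * (inner ℝ (b i) x * inner ℝ (b i) v)
        + M ^ 2 * (inner ℝ x v) * (inner ℝ (b i) x * inner ℝ (b i) w)
        - M ^ 2 * (inner ℝ v w) * (inner ℝ (b i) x * inner ℝ (b i) x) := by
    intro i
    rw [curvEnd_apply, (hasFDerivAt_cylChristoffel hx).fderiv]
    simp only [ContinuousLinearMap.smulRight_apply, _root_.smul_apply, euclForm_apply,
      _root_.add_apply, _root_.neg_apply, cylChristoffel, cylTensor_apply,
      smul_eq_mul, inner_smul_right, inner_add_right, inner_sub_right, neg_smul, inner_neg_right,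
      ← hM, s2, hxx, real_inner_comm (b i) x, real_inner_comm (b i) v,
      real_inner_comm v x, real_inner_comm w x]
    linear_combination (-M * inner ℝ v w + M * inner ℝ (b i) v * inner ℝ (b i) w) * hMN
  simp_rw [key]
  simp only [Finset.sum_add_distrib, Finset.sum_sub_distrib, ← Finset.mul_sum, s1, Finset.sum_const,
    Finset.card_univ, Fintype.card_fin, nsmul_eq_mul, hxx]
  linear_combination (-M * (inner ℝ v w)) * hMN

theorem gram_cylForm {ι : Type*} [Fintype ι] [DecidableEq ι] (b : OrthonormalBasis ι ℝ W) (x : W) :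
    gram (cylForm x) b = (‖x‖ ^ 2)⁻¹ • (1 : Matrix ι ι ℝ) := by
  ext i j
  rw [gram_apply, cylForm_apply, orthonormal_iff_ite.1 b.orthonormal]
  simp [Matrix.one_apply]

theorem inv_gram_cylForm {ι : Type*} [Fintype ι] [DecidableEq ι] (b : OrthonormalBasis ι ℝ W) {x : W}
    (hx : x ≠ 0) : (gram (cylForm x) b)⁻¹ = (‖x‖ ^ 2) • (1 : Matrix ι ι ℝ) := by
  rw [gram_cylForm]
  refine Matrix.inv_eq_right_inv ?_
  rw [smul_mul_smul_comm, inv_mul_cancel₀ (by positivity), one_smul, one_mul]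

theorem sqrt_det_gram_cylForm {ι : Type*} [Fintype ι] [DecidableEq ι] (b : OrthonormalBasis ι ℝ W)
    (x : W) : Real.sqrt (gram (cylForm x) b).det = (‖x‖ ^ finrank ℝ W)⁻¹ := by
  rw [gram_cylForm, Matrix.det_smul, Matrix.det_one, mul_one, finrank_eq_card_basis b.toBasis,
    ← inv_pow, ← pow_mul, mul_comm, pow_mul, Real.sqrt_sq (by positivity), inv_pow]

theorem norm_sq_eq_sum {ι : Type*} [Fintype ι] (b : OrthonormalBasis ι ℝ W) (α : W →L[ℝ] ℝ) :
    ‖α‖ ^ 2 = ∑ i, α (b i) ^ 2 := by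
  obtain ⟨y, rfl⟩ := (InnerProductSpace.toDual ℝ W).surjective α
  rw [LinearIsometryEquiv.norm_map, ← b.sum_sq_inner_left y]
  simp [InnerProductSpace.toDual_apply_apply]

theorem covNorm_cylForm {x : W} (hx : x ≠ 0) (α : W →L[ℝ] ℝ) :
    covNorm (cylForm x) α = ‖x‖ * ‖α‖ := by
  set b := stdOrthonormalBasis ℝ W
  unfold covNorm
  rw [dualNormSq_eq (cylForm x) α b.toBasis, OrthonormalBasis.coe_toBasis, inv_gram_cylForm b hx]
  simp only [Matrix.smul_apply, Matrix.one_apply, smul_eq_mul, mul_ite, mul_one, mul_zero,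
    ite_mul, zero_mul, Finset.sum_ite_eq, Finset.mem_univ, if_true]
  have : ∑ i, ‖x‖ ^ 2 * α (b i) * α (b i) = (‖x‖ * ‖α‖) ^ 2 := by
    rw [mul_pow, norm_sq_eq_sum b, Finset.mul_sum]
    exact Finset.sum_congr rfl fun i _ => by ring
  rw [this, Real.sqrt_sq (by positivity)]

theorem scalarTrace_cyl {x : W} (hx : x ≠ 0) :
    metricTrace (cylForm x) (ricciForm cylChristoffel x) (stdOrthonormalBasis ℝ W)
      = ((finrank ℝ W : ℝ) - 1) * ((finrank ℝ W : ℝ) - 2) := by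
  have hN : ‖x‖ ^ 2 ≠ 0 := by positivity
  set b := stdOrthonormalBasis ℝ W
  unfold metricTrace
  simp only [inv_gram_cylForm b hx, Matrix.smul_apply, Matrix.one_apply, smul_eq_mul, mul_ite, mul_one, mul_zero,
    ite_mul, zero_mul, Finset.sum_ite_eq, Finset.mem_univ, if_true, ricciForm_cyl hx]
  have s1 : ∑ i, (inner ℝ x (b i) : ℝ) * inner ℝ x (b i) = ‖x‖ ^ 2 := by
    rw [← real_inner_self_eq_norm_sq, ← b.sum_inner_mul_inner x x]
    exact Finset.sum_congr rfl fun i _ => by rw [real_inner_comm]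
  have s2 : ∀ i, (inner ℝ (b i) (b i) : ℝ) = 1 := fun i => by
    rw [real_inner_self_eq_norm_sq, b.norm_eq_one, one_pow]
  simp only [s2, mul_sub, Finset.sum_sub_distrib, ← Finset.mul_sum, s1, Finset.sum_const,
    Finset.card_univ, Fintype.card_fin, nsmul_eq_mul]
  field_simp

end Cylinder

/-! ### The product of projective space with a circle as a quotient of punctured Euclidean space. -/

section ProjCircle

variable {m : ℕ}

/-- The unit circle. -/
abbrev Circle2 : Type := Metric.sphere (0 : EuclideanSpace ℝ (Fin 2)) 1

/-- The product of the real projective space with the circle. -/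
abbrev ProjCircle (m : ℕ) : Type := RealProjectiveSpace m × Circle2

/-- The standard parametrization of the circle. -/
def circleVec (θ : ℝ) : EuclideanSpace ℝ (Fin 2) := WithLp.toLp 2 ![Real.cos θ, Real.sin θ]

theorem circleVec_mem (θ : ℝ) : circleVec θ ∈ Metric.sphere (0 : EuclideanSpace ℝ (Fin 2)) 1 := by
  simp [circleVec, EuclideanSpace.norm_eq, Fin.sum_univ_two, Real.cos_sq_add_sin_sq]

/-- The standard parametrization of the circle. -/
def circlePoint (θ : ℝ) : Circle2 := ⟨circleVec θ, circleVec_mem θ⟩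

theorem contDiff_circleVec : ContDiff ℝ ∞ circleVec := by
  rw [contDiff_euclidean]
  intro i
  fin_cases i
  · exact Real.contDiff_cos
  · exact Real.contDiff_sin

theorem contMDiff_circlePoint : ContMDiff 𝓘(ℝ, ℝ) (𝓡 1) ∞ circlePoint :=
  haveI : Fact (finrank ℝ (EuclideanSpace ℝ (Fin 2)) = 1 + 1) := ⟨finrank_euclideanSpace_fin⟩
  contDiff_circleVec.contMDiff.codRestrict_sphere circleVec_mem

theorem circlePoint_surjective : Function.Surjective circlePoint := by
  rintro ⟨w, hw⟩
  have h : w 0 ^ 2 + w 1 ^ 2 = 1 := by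
    have := mem_sphere_zero_iff_norm.1 hw
    rw [EuclideanSpace.norm_eq, Real.sqrt_eq_one] at this
    simpa [Fin.sum_univ_two] using this
  obtain ⟨θ, h1, h2⟩ : ∃ θ, Real.cos θ = w 0 ∧ Real.sin θ = w 1 := by
    have hn : ‖(⟨w 0, w 1⟩ : ℂ)‖ = 1 := by
      rw [Complex.norm_eq_sqrt_sq_add_sq, h, Real.sqrt_one]
    have h0 : (⟨w 0, w 1⟩ : ℂ) ≠ 0 := by
      intro h0; rw [h0] at hn; simp at hn
    exact ⟨Complex.arg ⟨w 0, w 1⟩, by rw [Complex.cos_arg h0, hn, div_one],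
      by rw [Complex.sin_arg, hn, div_one]⟩
  refine ⟨θ, Subtype.ext ?_⟩
  ext i
  fin_cases i
  · exact h1
  · exact h2

theorem circlePoint_eq_iff (a b : ℝ) :
    circlePoint a = circlePoint b ↔ ∃ k : ℤ, a = b + k * (2 * Real.pi) := by
  constructor
  · intro h
    have h' := congrArg (fun p : Circle2 => (p : EuclideanSpace ℝ (Fin 2))) h
    have h1 : Real.cos a = Real.cos b := congrArg (fun w : EuclideanSpace ℝ (Fin 2) => w 0) h'
    have h2 : Real.sin a = Real.sin b := congrArg (fun w : EuclideanSpace ℝ (Fin 2) => w 1) h'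
    obtain ⟨k, hk⟩ := Real.Angle.angle_eq_iff_two_pi_dvd_sub.1 (Real.Angle.cos_sin_inj h1 h2)
    exact ⟨k, by linarith⟩
  · rintro ⟨k, rfl⟩
    unfold circlePoint circleVec
    simp only [Real.cos_add_int_mul_two_pi, Real.sin_add_int_mul_two_pi]

open Classical in
/-- The line through a vector (and some line, for the zero vector). -/
def toProj (x : EuclideanSpace ℝ (Fin (m + 1))) : RealProjectiveSpace m :=
  RealProjectiveSpace.mk (if h : x.ofLp ≠ 0 then ⟨x.ofLp, h⟩ else ⟨fun _ => 1, fun h => by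
    simpa using congrFun h 0⟩)

theorem ofLp_ne {x : EuclideanSpace ℝ (Fin (m + 1))} (hx : x ≠ 0) : x.ofLp ≠ 0 := by
  simpa using hx

theorem toProj_of_ne {x : EuclideanSpace ℝ (Fin (m + 1))} (hx : x ≠ 0) :
    toProj x = RealProjectiveSpace.mk ⟨x.ofLp, ofLp_ne hx⟩ := by
  unfold toProj
  rw [dif_pos (ofLp_ne hx)]

theorem toProj_eq_iff {x y : EuclideanSpace ℝ (Fin (m + 1))} (hx : x ≠ 0) (hy : y ≠ 0) :
    toProj x = toProj y ↔ ∃ a : ℝ, a • y = x := by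
  rw [toProj_of_ne hx, toProj_of_ne hy, RealProjectiveSpace.mk_eq_iff]
  refine exists_congr fun a => ?_
  constructor
  · intro h; ext i; exact congrFun h i
  · rintro rfl; rfl

theorem exists_toProj_eq (p : RealProjectiveSpace m) : ∃ x, x ≠ 0 ∧ toProj x = p := by
  obtain ⟨v, rfl⟩ := RealProjectiveSpace.mk_surjective p
  have h : (WithLp.toLp 2 v.1 : EuclideanSpace ℝ (Fin (m + 1))) ≠ 0 := by
    simpa using v.2
  exact ⟨WithLp.toLp 2 v.1, h, by rw [toProj_of_ne h]⟩

theorem contMDiffAt_toProj {x : EuclideanSpace ℝ (Fin (m + 1))} (hx : x ≠ 0) :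
    ContMDiffAt 𝓘(ℝ, EuclideanSpace ℝ (Fin (m + 1))) (𝓡 m) ∞ toProj x := by
  have hev : ∀ᶠ y in 𝓝 x, y ≠ 0 := isOpen_ne.mem_nhds hx
  obtain ⟨i, hi⟩ : ∃ i, chartAt (EuclideanSpace ℝ (Fin m)) (toProj x)
      = RealProjectiveSpace.affineChart i := ⟨_, rfl⟩
  have hxi : x i ≠ 0 := by
    have h := mem_chart_source (EuclideanSpace ℝ (Fin m)) (toProj x)
    rw [hi, toProj_of_ne hx] at h
    exact (RealProjectiveSpace.mk_mem_affineSource i _).1 h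
  rw [contMDiffAt_iff]
  constructor
  · rw [continuousAt_def]
    intro A hA
    have hc : ContinuousOn (toProj (m := m)) {y | y ≠ 0} := by
      rw [continuousOn_iff_continuous_domRestrict]
      have : ({y | y ≠ 0} : Set (EuclideanSpace ℝ (Fin (m + 1)))).domRestrict toProj
          = fun y => RealProjectiveSpace.mk ⟨y.1.ofLp, ofLp_ne y.2⟩ := by
        ext y
        exact toProj_of_ne y.2
      rw [this]
      exact RealProjectiveSpace.isQuotientMap_mk.continuous.comp
        (Continuous.subtype_mk ((PiLp.continuous_ofLp 2 _).comp continuous_subtype_val) _)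
    exact (hc.continuousAt hev) hA
  · simp only [extChartAt, hi, mfld_simps, contDiffWithinAt_univ, chartAt_self_eq]
    have h1 : ContDiffAt ℝ ∞ (fun y : EuclideanSpace ℝ (Fin (m + 1)) =>
        (WithLp.toLp 2 fun j => y (i.succAbove j) / y i : EuclideanSpace ℝ (Fin m))) x := by
      rw [contDiffAt_euclidean]
      intro j
      exact ContDiffAt.div (by fun_prop) (by fun_prop) hxi
    refine h1.congr_of_eventuallyEq ?_
    filter_upwards [hev] with y hy
    change RealProjectiveSpace.affineChart i (toProj y) = _
    rw [toProj_of_ne hy]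
    rfl

/-- The covering `x ↦ ([x], e^{i log |x| / r})` of `ℝP^m × S¹` by the punctured Euclidean space. -/
def cover (r : ℝ) (x : EuclideanSpace ℝ (Fin (m + 1))) : ProjCircle m :=
  (toProj x, circlePoint (Real.log ‖x‖ / r))

theorem contMDiffAt_cover (r : ℝ) {x : EuclideanSpace ℝ (Fin (m + 1))} (hx : x ≠ 0) :
    ContMDiffAt 𝓘(ℝ, EuclideanSpace ℝ (Fin (m + 1))) ((𝓡 m).prod (𝓡 1)) ∞ (cover r) x := by
  refine (contMDiffAt_toProj hx).prodMk (contMDiff_circlePoint.contMDiffAt.comp x ?_)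
  exact (((contDiffAt_norm ℝ hx).log (norm_ne_zero_iff.2 hx)).div_const r).contMDiffAt

/-- Equal lines mean that the vectors differ by a real factor, and equal points of the circle mean
that the logarithm of its absolute value lies in `2πrℤ`. The deck group is thus generated by `-1`
and the dilation by `e^{2πr}`. -/
theorem cover_eq_iff {r : ℝ} (hr : 0 < r) {x y : EuclideanSpace ℝ (Fin (m + 1))} (hx : x ≠ 0)
    (hy : y ≠ 0) : cover r x = cover r y ↔ ∃ (k : ℤ) (σ : ℝ), (σ = 1 ∨ σ = -1) ∧
      x = (σ * Real.exp (k * (2 * Real.pi * r))) • y := by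
  have hy0 : 0 < ‖y‖ := norm_pos_iff.2 hy
  unfold cover
  rw [Prod.mk.injEq, toProj_eq_iff hx hy, circlePoint_eq_iff]
  constructor
  · rintro ⟨⟨a, rfl⟩, k, hk⟩
    have ha : a ≠ 0 := fun h => hx (by rw [h, zero_smul])
    have ha' : 0 < |a| := abs_pos.2 ha
    have h1 : |a| = Real.exp (k * (2 * Real.pi * r)) := by
      rw [norm_smul, Real.norm_eq_abs, Real.log_mul ha'.ne' hy0.ne'] at hk
      rw [← Real.exp_log ha']
      congr 1
      field_simp at hk
      linarith
    rcases abs_cases a with ⟨h2, -⟩ | ⟨h2, -⟩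
    · exact ⟨k, 1, Or.inl rfl, by rw [← h1, h2, one_mul]⟩
    · exact ⟨k, -1, Or.inr rfl, by rw [← h1, h2]; simp⟩
  · rintro ⟨k, σ, hσ, rfl⟩
    refine ⟨⟨_, rfl⟩, k, ?_⟩
    have h1 : |σ| = 1 := by rcases hσ with rfl | rfl <;> simp
    rw [norm_smul, norm_mul, Real.norm_eq_abs, h1, one_mul, Real.norm_eq_abs, Real.abs_exp,
      Real.log_mul (Real.exp_ne_zero _) hy0.ne', Real.log_exp]
    field_simp
    ring

theorem cover_surjective {r : ℝ} (hr : 0 < r) (p : ProjCircle m) : ∃ x, x ≠ 0 ∧ cover r x = p := by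
  obtain ⟨p, w⟩ := p
  obtain ⟨x, hx, rfl⟩ := exists_toProj_eq p
  obtain ⟨θ, rfl⟩ := circlePoint_surjective w
  have hx0 : 0 < ‖x‖ := norm_pos_iff.2 hx
  have hne : (Real.exp (r * θ) / ‖x‖) ≠ 0 := by positivity
  refine ⟨(Real.exp (r * θ) / ‖x‖) • x, smul_ne_zero hne hx, ?_⟩
  unfold cover
  rw [(toProj_eq_iff (smul_ne_zero hne hx) hx).2 ⟨_, rfl⟩, norm_smul, Real.norm_of_nonneg (by positivity),
    div_mul_cancel₀ _ hx0.ne', Real.log_exp, mul_div_cancel_left₀ _ hr.ne']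

/-- The entries of the projection matrix `x xᵀ / |x|²`, up to the factor `√2`. -/
def projEntry (i j : Fin (m + 1)) : RealProjectiveSpace m → ℝ :=
  Projectivization.lift (fun v => v.1 i * v.1 j / (Real.sqrt 2 * ∑ k, v.1 k ^ 2)) (by
    rintro ⟨a, ha⟩ ⟨b, hb⟩ t (rfl : a = t • b)
    have ht : t ≠ 0 := by rintro rfl; simp at ha
    simp only [Pi.smul_apply, smul_eq_mul, mul_pow, ← Finset.mul_sum]
    rw [show t * b i * (t * b j) = t ^ 2 * (b i * b j) by ring,
      show Real.sqrt 2 * (t ^ 2 * ∑ k, b k ^ 2) = t ^ 2 * (Real.sqrt 2 * ∑ k, b k ^ 2) by ring,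
      mul_div_mul_left _ _ (pow_ne_zero 2 ht)])

theorem projEntry_mk (i j : Fin (m + 1)) (v : {v : Fin (m + 1) → ℝ // v ≠ 0}) :
    projEntry i j (RealProjectiveSpace.mk v)
      = v.1 i * v.1 j / (Real.sqrt 2 * ∑ k, v.1 k ^ 2) := rfl

theorem projEntry_toProj (i j : Fin (m + 1)) {x : EuclideanSpace ℝ (Fin (m + 1))} (hx : x ≠ 0) :
    projEntry i j (toProj x) = (Real.sqrt 2)⁻¹ * ((‖x‖ ^ 2)⁻¹ * (x i * x j)) := by
  rw [toProj_of_ne hx, projEntry_mk, EuclideanSpace.real_norm_sq_eq, div_eq_inv_mul, mul_inv, mul_assoc]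

theorem contMDiff_projEntry (i j : Fin (m + 1)) : ContMDiff (𝓡 m) 𝓘(ℝ, ℝ) ∞ (projEntry i j) := by
  intro p
  obtain ⟨l, hl⟩ : ∃ l, chartAt (EuclideanSpace ℝ (Fin m)) p
      = RealProjectiveSpace.affineChart l := ⟨_, rfl⟩
  have hvec : ContDiff ℝ ∞ fun y => (RealProjectiveSpace.affineVec (m := m) l y).1 := by
    rw [contDiff_pi]
    intro j
    rcases Fin.eq_self_or_eq_succAbove l j with rfl | ⟨l, rfl⟩
    · simpa [RealProjectiveSpace.affineVec] using contDiff_const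
    · simp only [RealProjectiveSpace.affineVec, Fin.insertNth_apply_succAbove]
      fun_prop
  have hvec' := fun j => (contDiff_pi.1 hvec) j
  have hQ : ContDiff ℝ ∞ fun y => projEntry i j
      (RealProjectiveSpace.mk (RealProjectiveSpace.affineVec (m := m) l y)) := by
    simp only [projEntry_mk]
    refine ((hvec' i).mul (hvec' j)).div (contDiff_const.mul
      (ContDiff.sum fun k _ => (hvec' k).pow 2)) fun y => ?_
    have : 0 < ∑ k, (RealProjectiveSpace.affineVec (m := m) l y).1 k ^ 2 := by
      obtain ⟨k, hk⟩ := Function.ne_iff.1 (RealProjectiveSpace.affineVec (m := m) l y).2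
      exact Finset.sum_pos' (fun _ _ => sq_nonneg _) ⟨k, Finset.mem_univ _, by have : _ ≠ (0 : ℝ) := hk; positivity⟩
    positivity
  have h1 := (hQ.contMDiff.contMDiffAt.comp p (contMDiffAt_extChartAt (I := 𝓡 m) (x := p)))
  refine h1.congr_of_eventuallyEq ?_
  filter_upwards [(chartAt (EuclideanSpace ℝ (Fin m)) p).open_source.mem_nhds (mem_chart_source _ p)]
    with q hq
  have h2 := (chartAt (EuclideanSpace ℝ (Fin m)) p).left_inv hq
  rw [hl] at h2
  simp only [Function.comp_apply, extChartAt, hl, mfld_simps]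
  exact congrArg (projEntry i j) h2.symm

variable (m) in
/-- The Euclidean space in which `ℝP^m × S¹` is embedded. -/
abbrev Ambient : Type := EuclideanSpace ℝ ((Fin (m + 1) × Fin (m + 1)) ⊕ Fin 2)

/-- The embedding of `ℝP^m × S¹`, with a circle of radius `r`, into a Euclidean space. -/
def embed (r : ℝ) (p : ProjCircle m) : Ambient m :=
  WithLp.toLp 2 (Sum.elim (fun ij => projEntry ij.1 ij.2 p.1)
    (fun i => r * (p.2 : EuclideanSpace ℝ (Fin 2)) i))

theorem contMDiff_embed (r : ℝ) : ContMDiff ((𝓡 m).prod (𝓡 1)) 𝓘(ℝ, Ambient m) ∞ (embed (m := m) r) := by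
  have : Fact (finrank ℝ (EuclideanSpace ℝ (Fin 2)) = 1 + 1) := ⟨finrank_euclideanSpace_fin⟩
  have h : ContMDiff ((𝓡 m).prod (𝓡 1)) 𝓘(ℝ, (Fin (m + 1) × Fin (m + 1)) ⊕ Fin 2 → ℝ) ∞
      (fun p : ProjCircle m => Sum.elim (fun ij : Fin (m + 1) × Fin (m + 1) => projEntry ij.1 ij.2 p.1)
        (fun i => r * (p.2 : EuclideanSpace ℝ (Fin 2)) i)) := by
    rw [contMDiff_pi_space]
    rintro (⟨i, j⟩ | i)
    · exact (contMDiff_projEntry i j).comp contMDiff_fst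
    · have h1 : ContMDiff (𝓡 1) 𝓘(ℝ, EuclideanSpace ℝ (Fin 2)) ∞
          (fun w : Circle2 => (w : EuclideanSpace ℝ (Fin 2))) := contMDiff_coe_sphere
      have h2 : ContDiff ℝ ∞ fun w : EuclideanSpace ℝ (Fin 2) => r * w i := by fun_prop
      exact h2.contMDiff.comp (h1.comp contMDiff_snd)
  have h2 : ContDiff ℝ ∞ (WithLp.toLp 2 : ((Fin (m + 1) × Fin (m + 1)) ⊕ Fin 2 → ℝ) → Ambient m) :=
    PiLp.contDiff_toLp
  exact h2.contMDiff.comp h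

theorem hasFDerivAt_component {ι W : Type*} [Fintype ι] [NormedAddCommGroup W] [NormedSpace ℝ W]
    {f : W → EuclideanSpace ℝ ι} {f' : W →L[ℝ] EuclideanSpace ℝ ι} {x : W} (h : HasFDerivAt f f' x)
    {i : ι} {l : W →L[ℝ] ℝ} (hl : HasFDerivAt (fun y => f y i) l x) (v : W) : f' v i = l v := by
  have := ((EuclideanSpace.proj (𝕜 := ℝ) i).hasFDerivAt (x := f x)).comp x h
  exact congrArg (fun T : W →L[ℝ] ℝ => T v) (this.unique hl)

/-- The matrix `x xᵀ / |x|²` moves with `√2` times the angular speed of `x`, which the factor `1/√2`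
corrects. The circle of radius `r`, run through at angle `log|x| / r`, contributes the radial part.
Together they give `|dx|² / |x|²`, whatever `r` is. -/
theorem inner_embed_cover {r : ℝ} (hr : 0 < r) {x : EuclideanSpace ℝ (Fin (m + 1))} (hx : x ≠ 0)
    {L : EuclideanSpace ℝ (Fin (m + 1)) →L[ℝ] Ambient m}
    (hL : HasFDerivAt (fun y => embed r (cover r y)) L x) (v w : EuclideanSpace ℝ (Fin (m + 1))) :
    inner ℝ (L v) (L w) = cylForm x v w := by
  have hev : ∀ᶠ y in 𝓝 x, y ≠ 0 := isOpen_ne.mem_nhds hx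
  have hN : ‖x‖ ^ 2 ≠ 0 := by positivity
  set M := (‖x‖ ^ 2)⁻¹ with hM
  have hMN : M * ‖x‖ ^ 2 = 1 := inv_mul_cancel₀ hN
  have c1 : ∀ v i j, L v (Sum.inl (i, j)) = (Real.sqrt 2)⁻¹ * (M * (v i * x j + x i * v j)
      - 2 * M ^ 2 * inner ℝ x v * (x i * x j)) := by
    intro v i j
    have p : ∀ i : Fin (m + 1), HasFDerivAt (fun y : EuclideanSpace ℝ (Fin (m + 1)) => y i)
        (EuclideanSpace.proj i : EuclideanSpace ℝ (Fin (m + 1)) →L[ℝ] ℝ) x := fun i =>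
      (EuclideanSpace.proj (𝕜 := ℝ) i).hasFDerivAt
    have h := ((hasFDerivAt_inv_norm_sq hx).mul ((p i).mul (p j))).const_mul (Real.sqrt 2)⁻¹
    have h' := h.congr_of_eventuallyEq (f₁ := fun y => embed r (cover r y) (Sum.inl (i, j)))
      (by filter_upwards [hev] with y hy using projEntry_toProj i j hy)
    rw [hasFDerivAt_component hL h' v]
    simp [euclForm_apply, ← hM]
    ring
  have hlog : HasFDerivAt (fun y : EuclideanSpace ℝ (Fin (m + 1)) => Real.log ‖y‖ / r)
      ((M / r) • euclForm _ x) x := by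
    have h1 : HasFDerivAt (fun y : EuclideanSpace ℝ (Fin (m + 1)) => ‖y‖ ^ 2) (2 • (innerSL ℝ x)) x :=
      (hasStrictFDerivAt_norm_sq x).hasFDerivAt
    have h2 := (h1.log hN).const_mul (1 / (2 * r))
    refine (h2.congr_of_eventuallyEq (Eventually.of_forall fun y => ?_)).congr_fderiv ?_
    · simp only [Real.log_pow]
      field_simp
      push_cast
      ring
    · ext v
      simp [euclForm_apply, ← hM]
      field_simp
  set θ := Real.log ‖x‖ / r with hθ
  have c2 : ∀ v, L v (Sum.inr 0) = -(Real.sin θ * (M * inner ℝ x v)) := by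
    intro v
    have h := (hlog.cos).const_mul r
    rw [hasFDerivAt_component hL (i := Sum.inr 0) (h : HasFDerivAt
      (fun y => r * Real.cos (Real.log ‖y‖ / r)) _ x) v]
    simp [euclForm_apply, ← hθ]
    field_simp
  have c3 : ∀ v, L v (Sum.inr 1) = Real.cos θ * (M * inner ℝ x v) := by
    intro v
    have h := (hlog.sin).const_mul r
    rw [hasFDerivAt_component hL (i := Sum.inr 1) (h : HasFDerivAt
      (fun y => r * Real.sin (Real.log ‖y‖ / r)) _ x) v]
    simp [euclForm_apply, ← hθ]
    field_simp
  rw [PiLp.inner_apply, Fintype.sum_sum_type, Fin.sum_univ_two, Fintype.sum_prod_type]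
  simp only [RCLike.inner_apply, conj_trivial, c1, c2, c3]
  have s : ∀ y z : EuclideanSpace ℝ (Fin (m + 1)), ∑ i, y i * z i = inner ℝ y z := fun y z => by
    simp [PiLp.inner_apply, mul_comm]
  have h2 : (Real.sqrt 2)⁻¹ * (Real.sqrt 2)⁻¹ = 1 / 2 := by
    rw [← mul_inv, Real.mul_self_sqrt (by norm_num)]; norm_num
  have e : ∀ i j, (Real.sqrt 2)⁻¹ * (M * (w i * x j + x i * w j) - 2 * M ^ 2 * inner ℝ x w * (x i * x j))
      * ((Real.sqrt 2)⁻¹ * (M * (v i * x j + x i * v j) - 2 * M ^ 2 * inner ℝ x v * (x i * x j)))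
      = (1 / 2) * (M ^ 2 * ((v i * w i) * (x j * x j)) + M ^ 2 * ((v i * x i) * (w j * x j))
        + M ^ 2 * ((x i * w i) * (v j * x j)) + M ^ 2 * ((x i * x i) * (v j * w j))
        - 2 * M ^ 3 * inner ℝ x w * ((v i * x i) * (x j * x j))
        - 2 * M ^ 3 * inner ℝ x w * ((x i * x i) * (v j * x j))
        - 2 * M ^ 3 * inner ℝ x v * ((w i * x i) * (x j * x j))
        - 2 * M ^ 3 * inner ℝ x v * ((x i * x i) * (w j * x j))
        + 4 * M ^ 4 * inner ℝ x v * inner ℝ x w * ((x i * x i) * (x j * x j))) := by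
    intro i j
    rw [← h2]
    ring
  simp only [e, Finset.sum_add_distrib, Finset.sum_sub_distrib, ← Finset.mul_sum, ← Finset.sum_mul, s,
    cylForm_apply, real_inner_self_eq_norm_sq, real_inner_comm x v, real_inner_comm x w, ← hM]
  linear_combination (M * inner ℝ v w + M ^ 2 * inner ℝ x v * inner ℝ x w
    * (-4 + 2 * (M * ‖x‖ ^ 2 + 1))) * hMN
    + M ^ 2 * inner ℝ x v * inner ℝ x w * Real.sin_sq_add_cos_sq θ

/-- The derivative of the covering. -/
def coverDeriv (r : ℝ) (x : EuclideanSpace ℝ (Fin (m + 1))) :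
    EuclideanSpace ℝ (Fin (m + 1)) →L[ℝ] EuclideanSpace ℝ (Fin m) × EuclideanSpace ℝ (Fin 1) :=
  mfderiv 𝓘(ℝ, EuclideanSpace ℝ (Fin (m + 1))) ((𝓡 m).prod (𝓡 1)) (cover r) x

theorem hasMFDerivAt_cover (r : ℝ) {x : EuclideanSpace ℝ (Fin (m + 1))} (hx : x ≠ 0) :
    HasMFDerivAt 𝓘(ℝ, EuclideanSpace ℝ (Fin (m + 1))) ((𝓡 m).prod (𝓡 1)) (cover r) x
      (coverDeriv r x : EuclideanSpace ℝ (Fin (m + 1)) →L[ℝ]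
        EuclideanSpace ℝ (Fin m) × EuclideanSpace ℝ (Fin 1)) :=
  ((contMDiffAt_cover r hx).mdifferentiableAt (by simp)).hasMFDerivAt

/-- The derivative of the embedding. -/
def embedDeriv (r : ℝ) (p : ProjCircle m) :
    EuclideanSpace ℝ (Fin m) × EuclideanSpace ℝ (Fin 1) →L[ℝ] Ambient m :=
  derivV ((𝓡 m).prod (𝓡 1)) (embed r) p

theorem hasFDerivAt_embed_cover (r : ℝ) {x : EuclideanSpace ℝ (Fin (m + 1))} (hx : x ≠ 0) :
    HasFDerivAt (fun y => embed r (cover r y)) ((embedDeriv r (cover r x)).comp (coverDeriv r x)) x := by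
  have h1 : HasMFDerivAt ((𝓡 m).prod (𝓡 1)) 𝓘(ℝ, Ambient m) (embed r) (cover r x)
      (embedDeriv r (cover r x) : EuclideanSpace ℝ (Fin m) × EuclideanSpace ℝ (Fin 1) →L[ℝ] Ambient m) :=
    ((contMDiff_embed r).mdifferentiableAt (by simp)).hasMFDerivAt
  exact (HasMFDerivAt.comp x h1 (hasMFDerivAt_cover r hx)).hasFDerivAt

theorem inner_embedDeriv_coverDeriv {r : ℝ} (hr : 0 < r) {x : EuclideanSpace ℝ (Fin (m + 1))}
    (hx : x ≠ 0) (v w : EuclideanSpace ℝ (Fin (m + 1))) :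
    inner ℝ (embedDeriv r (cover r x) (coverDeriv r x v)) (embedDeriv r (cover r x) (coverDeriv r x w))
      = cylForm x v w :=
  inner_embed_cover hr hx (hasFDerivAt_embed_cover r hx) v w

theorem cylForm_pos {W : Type*} [NormedAddCommGroup W] [InnerProductSpace ℝ W] {x : W} (hx : x ≠ 0)
    {v : W} (hv : v ≠ 0) : 0 < cylForm x v v := by
  rw [cylForm_apply, real_inner_self_eq_norm_sq]
  positivity

theorem coverDeriv_injective {r : ℝ} (hr : 0 < r) {x : EuclideanSpace ℝ (Fin (m + 1))}
    (hx : x ≠ 0) : Function.Injective (coverDeriv r x) := by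
  rw [injective_iff_map_eq_zero]
  intro v hv
  by_contra hne
  have := inner_embedDeriv_coverDeriv hr hx v v
  rw [hv, map_zero, inner_zero_left] at this
  exact (cylForm_pos hx hne).ne this

theorem finrank_projCircle : finrank ℝ (EuclideanSpace ℝ (Fin m) × EuclideanSpace ℝ (Fin 1)) = m + 1 := by
  simp

/-- The derivative of the covering as a linear equivalence. -/
def coverEquiv {r : ℝ} (hr : 0 < r) {x : EuclideanSpace ℝ (Fin (m + 1))} (hx : x ≠ 0) :
    EuclideanSpace ℝ (Fin (m + 1)) ≃ₗ[ℝ] EuclideanSpace ℝ (Fin m) × EuclideanSpace ℝ (Fin 1) :=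
  LinearEquiv.ofInjectiveOfFinrankEq (coverDeriv r x).toLinearMap (coverDeriv_injective hr hx)
    (by rw [finrank_projCircle, finrank_euclideanSpace_fin])

/-- Every point is covered and the derivative of the covering is bijective by dimension, so the
kernel can be tested upstairs, where the induced form is the positive cylinder form. -/
theorem embedDeriv_injective {r : ℝ} (hr : 0 < r) (p : ProjCircle m)
    (v : EuclideanSpace ℝ (Fin m) × EuclideanSpace ℝ (Fin 1)) (h : embedDeriv r p v = 0) : v = 0 := by
  obtain ⟨x, hx, rfl⟩ := cover_surjective hr p
  obtain ⟨w, rfl⟩ := (coverEquiv hr hx).surjective v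
  by_contra hne
  have h1 := inner_embedDeriv_coverDeriv hr hx w w
  have h2 : embedDeriv r (cover r x) (coverDeriv r x w) = 0 := h
  rw [h2, inner_zero_left] at h1
  refine (cylForm_pos hx (v := w) ?_).ne h1
  rintro rfl
  exact hne (map_zero _)

/-- The product metric on `ℝP^m × S¹`, with a circle of radius `r`. -/
def projCircleMetric (m : ℕ) {r : ℝ} (hr : 0 < r) : SmoothMetric ((𝓡 m).prod (𝓡 1)) (ProjCircle m) :=
  SmoothMetric.ofImmersion (embed r) (contMDiff_embed r) (embedDeriv_injective hr)

theorem projCircleMetric_form {r : ℝ} (hr : 0 < r) {x : EuclideanSpace ℝ (Fin (m + 1))}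
    (hx : x ≠ 0) (v w : EuclideanSpace ℝ (Fin (m + 1))) :
    (projCircleMetric m hr).form (cover r x) (coverDeriv r x v) (coverDeriv r x w) = cylForm x v w :=
  inner_embedDeriv_coverDeriv hr hx v w

/-- The covering is an isometric local parametrization, so the scalar curvature is that of the
cylinder, `(n-1)(n-2)` with `n = m + 1`; the length of the circle plays no role. -/
theorem scalarCurvature_projCircleMetric {r : ℝ} (hr : 0 < r) (p : ProjCircle m) :
    (projCircleMetric m hr).scalarCurvature p = m * (m - 1) := by
  obtain ⟨x, hx, rfl⟩ := cover_surjective hr p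
  have hev : ∀ᶠ y in 𝓝 x, y ≠ 0 := isOpen_ne.mem_nhds hx
  have h := (projCircleMetric m hr).scalarCurvature_eq_of_parametrization
    (by rw [finrank_projCircle, finrank_euclideanSpace_fin]) (contMDiffAt_cover r hx)
    (D := coverDeriv r) (hev.mono fun z hz => hasMFDerivAt_cover r hz)
    (g' := cylForm) (Γ' := cylChristoffel)
    (hev.mono fun z hz v w => (projCircleMetric_form hr hz v w).symm)
    (hev.mono fun z hz v hv => cylForm_pos hz hv)
    (hev.mono fun z hz => ⟨(hasFDerivAt_cylForm hz).differentiableAt, isLeviCivita_cyl hz⟩)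
    (hasFDerivAt_cylChristoffel hx).differentiableAt (stdOrthonormalBasis ℝ _).toBasis
  rw [h, OrthonormalBasis.coe_toBasis, scalarTrace_cyl hx, finrank_euclideanSpace_fin]
  push_cast
  ring

theorem dualNorm_projCircleMetric {r : ℝ} (hr : 0 < r) {x : EuclideanSpace ℝ (Fin (m + 1))}
    (hx : x ≠ 0) (α : EuclideanSpace ℝ (Fin m) × EuclideanSpace ℝ (Fin 1) →L[ℝ] ℝ) :
    covNorm ((projCircleMetric m hr).form (cover r x)) α = ‖x‖ * ‖α.comp (coverDeriv r x)‖ := by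
  rw [← covNorm_cylForm hx]
  unfold covNorm
  rw [dualNormSq_pullback ((projCircleMetric m hr).form (cover r x)) (cylForm x) (coverEquiv hr hx)
    (fun v w => (projCircleMetric_form hr hx v w).symm) α (α.comp (coverDeriv r x)) (fun _ => rfl)]

end ProjCircle

/-! ### Integration over the product by means of annuli. -/

section CoverVolume

variable {m : ℕ}

/-- The Riemannian measure of the cylinder. -/
def cylMeasure (m : ℕ) : Measure (EuclideanSpace ℝ (Fin (m + 1))) :=
  volume.withDensity fun x => ENNReal.ofReal (‖x‖ ^ (m + 1))⁻¹

/-- The annulus `a ≤ log |x| < b`. -/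
def annulus (m : ℕ) (a b : ℝ) : Set (EuclideanSpace ℝ (Fin (m + 1))) :=
  {x | x ≠ 0 ∧ a ≤ Real.log ‖x‖ ∧ Real.log ‖x‖ < b}

theorem measurableSet_annulus (a b : ℝ) : MeasurableSet (annulus m a b) := by
  have h : Measurable fun x : EuclideanSpace ℝ (Fin (m + 1)) => Real.log ‖x‖ :=
    Real.measurable_log.comp measurable_norm
  exact (measurableSet_singleton 0).compl.inter
    ((h measurableSet_Ici).inter (h measurableSet_Iio))

theorem continuousOn_cover (r : ℝ) : ContinuousOn (cover (m := m) r) {x | x ≠ 0} := fun _ hx =>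
  (contMDiffAt_cover r hx).continuousAt.continuousWithinAt

theorem measurableSet_inter_preimage_cover (r : ℝ) {S : Set (EuclideanSpace ℝ (Fin (m + 1)))}
    (hS : MeasurableSet S) (hS0 : ∀ x ∈ S, x ≠ 0) {B : Set (ProjCircle m)} (hB : MeasurableSet B) :
    MeasurableSet (S ∩ cover r ⁻¹' B) := by
  have h : Measurable (S.domRestrict (cover r)) :=
    (continuousOn_iff_continuous_domRestrict.1 ((continuousOn_cover r).mono hS0)).measurable
  have := hS.subtype_image (h hB)
  convert this using 1
  ext x
  simp [domRestrict, and_comm]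

theorem volDensity_cover {r : ℝ} (hr : 0 < r) {x : EuclideanSpace ℝ (Fin (m + 1))} (hx : x ≠ 0) :
    volDensity ((projCircleMetric m hr).form (cover r x)) (coverDeriv r x)
      (EuclideanSpace.basisFun (Fin (m + 1)) ℝ).toBasis = ENNReal.ofReal (‖x‖ ^ (m + 1))⁻¹ := by
  have h : ((projCircleMetric m hr).form (cover r x)).bilinearComp (coverDeriv r x) (coverDeriv r x)
      = cylForm x := by
    ext v w
    exact projCircleMetric_form hr hx v w
  unfold volDensity
  rw [h, OrthonormalBasis.coe_toBasis, sqrt_det_gram_cylForm, finrank_euclideanSpace_fin]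

theorem volume_image_cover {r : ℝ} (hr : 0 < r) {S : Set (EuclideanSpace ℝ (Fin (m + 1)))}
    (hS : MeasurableSet S) (hS0 : ∀ x ∈ S, x ≠ 0) (hinj : InjOn (cover r) S) {p : ProjCircle m}
    (hp : ∀ x ∈ S, cover r x ∈ (extChartAt ((𝓡 m).prod (𝓡 1)) p).source) :
    MeasurableSet (cover r '' S) ∧
      (projCircleMetric m hr).volume (cover r '' S) = cylMeasure m S := by
  have h := (projCircleMetric m hr).volume_image (x₀ := p) (D := coverDeriv r) hS
    (fun y hy => (hasMFDerivAt_cover r (hS0 y hy)).hasMFDerivWithinAt) hinj hp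
    (EuclideanSpace.basisFun (Fin (m + 1)) ℝ).toBasis (by rw [finrank_projCircle, Fintype.card_fin])
  refine ⟨h.1, h.2.trans ?_⟩
  rw [cylMeasure, withDensity_apply _ hS, OrthonormalBasis.addHaar_eq_volume]
  exact setLIntegral_congr_fun hS fun x hx => volDensity_cover hr (hS0 x hx)

/-- A set on which the covering is injective. -/
def sheet (r : ℝ) (y : EuclideanSpace ℝ (Fin (m + 1))) : Set (EuclideanSpace ℝ (Fin (m + 1))) :=
  {x | x ≠ 0 ∧ 0 < inner ℝ x y ∧ |Real.log ‖x‖ - Real.log ‖y‖| < Real.pi * r ∧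
    cover r x ∈ (extChartAt ((𝓡 m).prod (𝓡 1)) (cover r y)).source}

theorem sheet_mem_nhds {r : ℝ} (hr : 0 < r) {y : EuclideanSpace ℝ (Fin (m + 1))} (hy : y ≠ 0) :
    sheet r y ∈ 𝓝 y := by
  have h1 : ∀ᶠ x in 𝓝 y, x ≠ 0 := isOpen_ne.mem_nhds hy
  have h2 : ∀ᶠ x in 𝓝 y, 0 < (inner ℝ x y : ℝ) :=
    (continuous_id.inner continuous_const).continuousAt.eventually_const_lt
      (real_inner_self_pos.2 hy)
  have hl : ContinuousAt (fun x : EuclideanSpace ℝ (Fin (m + 1)) => |Real.log ‖x‖ - Real.log ‖y‖|) y :=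
    ((continuous_norm.continuousAt.log (norm_ne_zero_iff.2 hy)).sub continuousAt_const).abs
  have h3 : ∀ᶠ x in 𝓝 y, |Real.log ‖x‖ - Real.log ‖y‖| < Real.pi * r := by
    refine hl.eventually_lt_const ?_
    change |Real.log ‖y‖ - Real.log ‖y‖| < _
    rw [sub_self, abs_zero]
    exact mul_pos Real.pi_pos hr
  have h4 : ∀ᶠ x in 𝓝 y, cover r x ∈ (extChartAt ((𝓡 m).prod (𝓡 1)) (cover r y)).source :=
    (contMDiffAt_cover r hy).continuousAt.eventually_mem (extChartAt_source_mem_nhds _)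
  filter_upwards [h1, h2, h3, h4] with x a b c d using ⟨a, b, c, d⟩

/-- Two points of a sheet with the same image differ by a sign and a dilation `e^{2πrk}`. The common
half-space excludes the sign `-1`, and logarithms within `πr` of a common centre force `|k| < 1`. -/
theorem injOn_sheet {r : ℝ} (hr : 0 < r) (y : EuclideanSpace ℝ (Fin (m + 1))) :
    InjOn (cover r) (sheet r y) := by
  rintro x ⟨hx, hx1, hx2, -⟩ z ⟨hz, hz1, hz2, -⟩ h
  obtain ⟨k, σ, hσ, rfl⟩ := (cover_eq_iff hr hx hz).1 h
  have hz0 : 0 < ‖z‖ := norm_pos_iff.2 hz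
  have hσ1 : |σ| = 1 := by rcases hσ with rfl | rfl <;> simp
  have hσ' : σ = 1 := by
    rcases hσ with rfl | rfl
    · rfl
    · rw [real_inner_smul_left] at hx1
      nlinarith [mul_pos (Real.exp_pos (k * (2 * Real.pi * r))) hz1]
  rw [norm_smul, norm_mul, Real.norm_eq_abs, hσ1, one_mul, Real.norm_eq_abs, Real.abs_exp,
    Real.log_mul (Real.exp_ne_zero _) hz0.ne', Real.log_exp] at hx2
  have hpr : 0 < Real.pi * r := mul_pos Real.pi_pos hr
  have hk : |(k : ℝ)| < 1 := by
    rw [abs_lt] at hx2 hz2 ⊢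
    constructor <;> nlinarith
  have hk0 : k = 0 := by
    have : |k| < 1 := by exact_mod_cast hk
    exact Int.abs_lt_one_iff.1 this
  subst hσ'
  subst hk0
  simp

/-- A half-open interval of length `2πr` contains one representative of `log|y|` modulo `2πr`, so
dilations contribute a single point up to sign, and the antipodal map doubles it. -/
theorem encard_annulus_inter_fiber {r : ℝ} (hr : 0 < r) (a : ℝ) (p : ProjCircle m) :
    (annulus m a (a + 2 * Real.pi * r) ∩ cover r ⁻¹' {p}).encard = 2 := by
  obtain ⟨y, hy, rfl⟩ := cover_surjective hr p
  have hy0 : 0 < ‖y‖ := norm_pos_iff.2 hy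
  have hL : 0 < 2 * Real.pi * r := by positivity
  obtain ⟨k, hk, hku⟩ := existsUnique_add_zsmul_mem_Ico hL (Real.log ‖y‖) a
  simp only [zsmul_eq_mul] at hk hku
  set z := Real.exp (k * (2 * Real.pi * r)) • y with hz
  have hz0 : z ≠ 0 := smul_ne_zero (Real.exp_ne_zero _) hy
  have hlog : ∀ (j : ℤ) (σ : ℝ), (σ = 1 ∨ σ = -1) →
      Real.log ‖(σ * Real.exp (j * (2 * Real.pi * r))) • y‖ = Real.log ‖y‖ + j * (2 * Real.pi * r) := by
    intro j σ hσ
    have hσ1 : |σ| = 1 := by rcases hσ with rfl | rfl <;> simp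
    rw [norm_smul, norm_mul, Real.norm_eq_abs, hσ1, one_mul, Real.norm_eq_abs, Real.abs_exp,
      Real.log_mul (Real.exp_ne_zero _) hy0.ne', Real.log_exp, add_comm]
  have : annulus m a (a + 2 * Real.pi * r) ∩ cover r ⁻¹' {cover r y} = {z, -z} := by
    ext x
    constructor
    · rintro ⟨⟨hx, hx1, hx2⟩, hx3⟩
      obtain ⟨j, σ, hσ, rfl⟩ := (cover_eq_iff hr hx hy).1 hx3
      rw [hlog j σ hσ] at hx1 hx2
      have hj : j = k := hku j ⟨hx1, hx2⟩
      subst hj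
      rcases hσ with rfl | rfl
      · left; rw [one_mul]
      · right; rw [mem_singleton_iff, hz, neg_one_mul, neg_smul]
    · have aux : ∀ σ : ℝ, (σ = 1 ∨ σ = -1) → (σ * Real.exp (k * (2 * Real.pi * r))) • y ∈
          annulus m a (a + 2 * Real.pi * r) ∩ cover r ⁻¹' {cover r y} := by
        intro σ hσ
        have h0 : (σ * Real.exp (k * (2 * Real.pi * r))) • y ≠ 0 := by
          refine smul_ne_zero (mul_ne_zero ?_ (Real.exp_ne_zero _)) hy
          rcases hσ with rfl | rfl <;> norm_num
        refine ⟨⟨h0, ?_⟩, (cover_eq_iff hr h0 hy).2 ⟨k, σ, hσ, rfl⟩⟩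
        rw [hlog k σ hσ]
        exact hk
      rintro (rfl | rfl)
      · have := aux 1 (Or.inl rfl)
        rwa [one_mul] at this
      · have := aux (-1) (Or.inr rfl)
        rwa [neg_one_mul, neg_smul] at this
  rw [this, encard_pair]
  intro h
  have : (2 : ℝ) • z = 0 := by rw [two_smul]; nth_rewrite 1 [h]; simp
  exact hz0 ((smul_eq_zero.1 this).resolve_left two_ne_zero)

theorem cylMeasure_annulus_inter {r : ℝ} (hr : 0 < r) (a : ℝ) {B : Set (ProjCircle m)}
    (hB : MeasurableSet B) : cylMeasure m (annulus m a (a + 2 * Real.pi * r) ∩ cover r ⁻¹' B)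
      = 2 * (projCircleMetric m hr).volume B := by
  have hS := measurableSet_annulus (m := m) a (a + 2 * Real.pi * r)
  have hint : ∀ y : EuclideanSpace ℝ (Fin (m + 1)), y ≠ 0 → y ∈ interior (sheet r y) := fun y hy =>
    mem_interior_iff_mem_nhds.2 (sheet_mem_nhds hr hy)
  obtain ⟨t, ht0, ht, htS⟩ : ∃ t : Set (EuclideanSpace ℝ (Fin (m + 1))), t ⊆ {x | x ≠ 0} ∧ t.Countable ∧
      {x | x ≠ 0} ⊆ ⋃ y ∈ t, interior (sheet r y) := by
    obtain ⟨t, h1, h2, h3⟩ := TopologicalSpace.countable_cover_nhdsWithin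
      (s := {x : EuclideanSpace ℝ (Fin (m + 1)) | x ≠ 0}) (f := fun y => interior (sheet r y))
      (fun y hy => mem_nhdsWithin_of_mem_nhds (isOpen_interior.mem_nhds (hint y hy)))
    exact ⟨t, h1, h2, h3⟩
  obtain ⟨V, hV, hVc⟩ := exists_nat_cover (P := fun V : Set (EuclideanSpace ℝ (Fin (m + 1))) =>
      MeasurableSet V ∧ ∃ y, V ⊆ sheet r y) ⟨MeasurableSet.empty, 0, empty_subset _⟩ ht
    (fun y _ => ⟨isOpen_interior.measurableSet, y, interior_subset⟩) htS
  refine Eq.trans (b := ((2 : ℕ) : ENNReal) * (projCircleMetric m hr).volume B) ?_ (by norm_num)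
  refine measure_inter_preimage_eq_mul
    (fun B hB => measurableSet_inter_preimage_cover r hS (fun x hx => hx.1) hB)
    (fun n => (hV n).1) (fun x hx => hVc hx.1) (fun n => ?_) (fun n A hA hAV => ?_)
    (fun p => encard_annulus_inter_fiber hr a p) hB
  · obtain ⟨y, hy⟩ := (hV n).2
    exact (injOn_sheet hr y).mono (inter_subset_right.trans hy)
  · obtain ⟨y, hy⟩ := (hV n).2
    have hA' : A ⊆ sheet r y := hAV.trans (inter_subset_right.trans hy)
    exact volume_image_cover hr hA (fun x hx => (hA' hx).1) ((injOn_sheet hr y).mono hA')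
      (fun x hx => (hA' hx).2.2.2)

theorem aemeasurable_cover (r : ℝ) {S : Set (EuclideanSpace ℝ (Fin (m + 1)))} (hS : MeasurableSet S)
    (hS0 : ∀ x ∈ S, x ≠ 0) : AEMeasurable (cover r) ((cylMeasure m).restrict S) :=
  ((continuousOn_cover r).mono hS0).aemeasurable hS

theorem map_cover {r : ℝ} (hr : 0 < r) (a : ℝ) :
    Measure.map (cover r) ((cylMeasure m).restrict (annulus m a (a + 2 * Real.pi * r)))
      = (2 : ENNReal) • (projCircleMetric m hr).volume := by
  have hS := measurableSet_annulus (m := m) a (a + 2 * Real.pi * r)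
  ext B hB
  rw [Measure.map_apply_of_aemeasurable (aemeasurable_cover r hS fun x hx => hx.1) hB,
    Measure.restrict_apply' hS, inter_comm, cylMeasure_annulus_inter hr a hB]
  rfl

theorem setIntegral_cover {r : ℝ} (hr : 0 < r) (a : ℝ) {f : ProjCircle m → ℝ} (hf : Continuous f) :
    ∫ x in annulus m a (a + 2 * Real.pi * r), f (cover r x) ∂(cylMeasure m)
      = 2 * ∫ p, f p ∂(projCircleMetric m hr).volume := by
  have hS := measurableSet_annulus (m := m) a (a + 2 * Real.pi * r)
  rw [← integral_map (aemeasurable_cover r hS fun x hx => hx.1) hf.measurable.aestronglyMeasurable,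
    map_cover hr, integral_smul_measure]
  simp

end CoverVolume

/-! ### Compact manifolds have finite volume. -/

section FiniteVolume

variable {E : Type*} [NormedAddCommGroup E] [NormedSpace ℝ E] [FiniteDimensional ℝ E]
  {H : Type*} [TopologicalSpace H] {I : ModelWithCorners ℝ E H}
  {M : Type*} [TopologicalSpace M] [ChartedSpace H M] [IsManifold I ∞ M]
  [MeasurableSpace E] [BorelSpace E] [MeasurableSpace M] [BorelSpace M]

theorem SmoothMetric.continuousWithinAt_det_coord (g : SmoothMetric I M) {x₀ : M} {y : E}
    (hy : y ∈ (extChartAt I x₀).target) :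
    ContinuousWithinAt (fun z => (g.coord x₀ z).det) (Set.range I) y :=
  (contDiffWithinAt_det fun i j => g.contDiffWithinAt_coord hy i j).continuousWithinAt

theorem SmoothMetric.isFiniteMeasure_volume [CompactSpace M] (g : SmoothMetric I M) :
    IsFiniteMeasure g.volume := by
  refine ⟨isCompact_univ.measure_lt_top_of_nhdsWithin fun x _ => ?_⟩
  rw [nhdsWithin_univ]
  set y := extChartAt I x x
  have hc := g.continuousWithinAt_det_coord (mem_extChartAt_target (I := I) x)
  obtain ⟨ε, hε, hb⟩ := Metric.mem_nhdsWithin_iff.1 (hc.eventually_lt_const (lt_add_one _))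
  have hU := measurableSet_source_inter_preimage (I := I) x (Metric.isOpen_ball (x := y) (ε := ε)).measurableSet
  refine ⟨(extChartAt I x).source ∩ extChartAt I x ⁻¹' Metric.ball y ε,
    inter_mem (extChartAt_source_mem_nhds x)
      ((continuousAt_extChartAt x).preimage_mem_nhds (Metric.ball_mem_nhds y hε)), ?_⟩
  rw [g.volume_eq_chartVolume hU inter_subset_left, g.chartVolume_apply x hU]
  refine lt_of_le_of_lt (setLIntegral_mono' (g := fun _ => ENNReal.ofReal
    (Real.sqrt ((g.coord x y).det + 1))) (measurableSet_target_inter_preimage x hU) fun z hz => ?_) ?_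
  · have hz2 : z ∈ Metric.ball y ε := by
      have := hz.2.2
      rwa [mem_preimage, (extChartAt I x).right_inv hz.1] at this
    exact ENNReal.ofReal_le_ofReal (Real.sqrt_le_sqrt
      (hb ⟨hz2, extChartAt_target_subset_range x hz.1⟩).le)
  · rw [setLIntegral_const]
    refine ENNReal.mul_lt_top ENNReal.ofReal_lt_top (lt_of_le_of_lt (measure_mono ?_)
      (Metric.isBounded_ball (x := y) (r := ε)).measure_lt_top)
    intro z hz
    have := hz.2.2
    rwa [mem_preimage, (extChartAt I x).right_inv hz.1] at this

theorem SmoothMetric.integrable_of_continuous [CompactSpace M] (g : SmoothMetric I M) {f : M → ℝ}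
    (hf : Continuous f) : Integrable f g.volume := by
  have := g.isFiniteMeasure_volume
  obtain ⟨C, hC⟩ := isCompact_univ.exists_bound_of_continuousOn hf.continuousOn
  exact Integrable.of_bound hf.measurable.aestronglyMeasurable C
    (Eventually.of_forall fun x => hC x (mem_univ x))

end FiniteVolume

instance {m : ℕ} : CompactSpace (RealProjectiveSpace m) := by
  have h : (univ : Set (RealProjectiveSpace m)) = toProj '' Metric.sphere 0 1 := by
    refine (eq_univ_of_forall fun p => ?_).symm
    obtain ⟨x, hx, rfl⟩ := exists_toProj_eq p
    have hx0 : ‖x‖ ≠ 0 := norm_ne_zero_iff.2 hx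
    have hne : ‖x‖⁻¹ • x ≠ 0 := smul_ne_zero (inv_ne_zero hx0) hx
    refine ⟨‖x‖⁻¹ • x, ?_, (toProj_eq_iff hne hx).2 ⟨_, rfl⟩⟩
    rw [mem_sphere_zero_iff_norm, norm_smul, norm_inv, norm_norm, inv_mul_cancel₀ hx0]
  refine ⟨?_⟩
  rw [h]
  refine (isCompact_sphere _ _).image_of_continuousOn fun x hx => ?_
  exact (contMDiffAt_toProj (Metric.ne_of_mem_sphere hx one_ne_zero)).continuousAt.continuousWithinAt

/-! ### The Emden–Fowler transform between `ℝⁿ` and the cylinder. -/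

section EmdenFowler

variable {W : Type*} [NormedAddCommGroup W] [InnerProductSpace ℝ W] [FiniteDimensional ℝ W]
  [MeasurableSpace W] [BorelSpace W]

/-- The divergence of `ψ(x) x` has integral zero. -/
theorem integral_divergence_smul {ψ : W → ℝ} (hψ : ContDiff ℝ 1 ψ) (hc : HasCompactSupport ψ) :
    ∫ x, ((finrank ℝ W : ℝ) * ψ x + fderiv ℝ ψ x x) = 0 := by
  set b := stdOrthonormalBasis ℝ W
  have hψc := hψ.continuous
  have hd : ∀ v, Continuous fun x => fderiv ℝ ψ x v := fun v =>
    (hψ.continuous_fderiv (by simp)).clm_apply continuous_const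
  have hdc : ∀ v, HasCompactSupport fun x => fderiv ℝ ψ x v := fun v =>
    (hc.fderiv (𝕜 := ℝ)).mono fun x hx h => hx (by simp [h])
  have hbi : ∀ i, Continuous fun x => (inner ℝ (b i) x : ℝ) := fun i =>
    continuous_const.inner continuous_id
  have hint : ∀ i, Integrable fun x => (inner ℝ (b i) x : ℝ) * fderiv ℝ ψ x (b i) := fun i =>
    ((hbi i).mul (hd _)).integrable_of_hasCompactSupport (hdc _).mul_left
  have hψi : Integrable ψ := hψc.integrable_of_hasCompactSupport hc
  have hf : ∀ i x, HasFDerivAt (fun x => (inner ℝ (b i) x : ℝ)) (innerSL ℝ (b i)) x := fun i x =>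
    (innerSL ℝ (b i)).hasFDerivAt
  -- Integration by parts in the direction `b i` against the coordinate function, whose derivative
  -- in that direction is `1`.
  have key : ∀ i, ∫ x, (inner ℝ (b i) x : ℝ) * fderiv ℝ ψ x (b i) = -∫ x, ψ x := by
    intro i
    have e : ∀ x, fderiv ℝ (fun x => (inner ℝ (b i) x : ℝ)) x (b i) = 1 := fun x => by
      rw [(hf i x).fderiv, innerSL_apply_apply, real_inner_self_eq_norm_sq, b.norm_eq_one, one_pow]
    have h := integral_mul_fderiv_eq_neg_fderiv_mul_of_integrable (μ := (volume : Measure W))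
      (f := fun x => (inner ℝ (b i) x : ℝ)) (g := ψ) (v := b i)
      (by simpa only [e, one_mul] using hψi) (hint i)
      (((hbi i).mul hψc).integrable_of_hasCompactSupport hc.mul_left)
      (fun x _ => (hf i x).differentiableAt) (fun x _ => hψ.differentiable (by simp) x)
    simpa only [e, one_mul] using h
  have hsum : ∀ x, fderiv ℝ ψ x x = ∑ i, (inner ℝ (b i) x : ℝ) * fderiv ℝ ψ x (b i) := fun x => by
    conv_lhs => rw [← b.sum_repr' x, map_sum]
    simp only [map_smul, smul_eq_mul, b.sum_repr' x]
  simp_rw [hsum]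
  rw [integral_add (hψi.const_mul _) (integrable_finsetSum _ fun i _ => hint i), integral_const_mul,
    integral_finsetSum _ fun i _ => hint i]
  simp [key]

end EmdenFowler

section EmdenFowlerTransform

variable {W : Type*} [NormedAddCommGroup W] [InnerProductSpace ℝ W]

theorem contDiff_of_eventually_zero {f : W → ℝ} (h : ∀ x, x ≠ 0 → ContDiffAt ℝ ∞ f x)
    (h0 : ∀ᶠ x in 𝓝 0, f x = 0) : ContDiff ℝ ∞ f := by
  rw [contDiff_iff_contDiffAt]
  intro x
  by_cases hx : x = 0
  · subst hx
    exact contDiffAt_const.congr_of_eventuallyEq h0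
  · exact h x hx

theorem hasFDerivAt_norm_sq_rpow (s : ℝ) {x : W} (hx : x ≠ 0) :
    HasFDerivAt (fun y : W => (‖y‖ ^ 2) ^ s) ((2 * s * (‖x‖ ^ 2) ^ (s - 1)) • euclForm W x) x := by
  have hN : ‖x‖ ^ 2 ≠ 0 := by positivity
  have h1 : HasFDerivAt (fun y : W => ‖y‖ ^ 2) (2 • (innerSL ℝ x)) x :=
    (hasStrictFDerivAt_norm_sq x).hasFDerivAt
  refine (h1.rpow_const (p := s) (Or.inl hN)).congr_fderiv ?_
  ext v
  simp [euclForm_apply]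
  ring

theorem contDiffAt_norm_sq_rpow (s : ℝ) {x : W} (hx : x ≠ 0) :
    ContDiffAt ℝ ∞ (fun y : W => (‖y‖ ^ 2) ^ s) x :=
  ContDiffAt.rpow_const_of_ne (contDiff_norm_sq ℝ).contDiffAt (by positivity)

theorem norm_sq_rpow_neg (n : ℕ) (x : W) : (‖x‖ ^ 2) ^ (-(n : ℝ) / 2) = (‖x‖ ^ n)⁻¹ := by
  rw [← Real.rpow_natCast_mul (norm_nonneg x),
    show ((2 : ℕ) : ℝ) * (-(n : ℝ) / 2) = -(n : ℝ) by push_cast; ring,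
    Real.rpow_neg (norm_nonneg x), Real.rpow_natCast]

theorem norm_add_smul_euclForm_sq [FiniteDimensional ℝ W] (α : W →L[ℝ] ℝ) (c : ℝ) (x : W) :
    ‖α + c • euclForm W x‖ ^ 2 = ‖α‖ ^ 2 + 2 * c * α x + c ^ 2 * ‖x‖ ^ 2 := by
  obtain ⟨y, rfl⟩ := (InnerProductSpace.toDual ℝ W).surjective α
  have h : InnerProductSpace.toDual ℝ W y + c • euclForm W x
      = InnerProductSpace.toDual ℝ W (y + c • x) := by
    ext v
    simp [euclForm_apply, InnerProductSpace.toDual_apply_apply]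
  rw [h, LinearIsometryEquiv.norm_map, LinearIsometryEquiv.norm_map, norm_add_sq_real,
    InnerProductSpace.toDual_apply_apply, inner_smul_right, norm_smul, mul_pow, Real.norm_eq_abs,
    sq_abs]
  ring

/-- The Emden–Fowler transform `|x|^{-(n-2)/2} w`, `n = dim W`. -/
def emdenFowler (w : W → ℝ) (x : W) : ℝ := (‖x‖ ^ 2) ^ (-((finrank ℝ W : ℝ) - 2) / 4) * w x

variable {w : W → ℝ}

theorem contDiff_emdenFowler (hw : ContDiff ℝ ∞ w) (h0 : ∀ᶠ x in 𝓝 0, w x = 0) :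
    ContDiff ℝ ∞ (emdenFowler w) :=
  contDiff_of_eventually_zero (fun _ hx => (contDiffAt_norm_sq_rpow _ hx).mul hw.contDiffAt)
    (h0.mono fun x hx => by rw [emdenFowler, hx, mul_zero])

theorem norm_fderiv_emdenFowler_sq [FiniteDimensional ℝ W] (hw : ContDiff ℝ ∞ w) {x : W}
    (hx : x ≠ 0) : ‖fderiv ℝ (emdenFowler w) x‖ ^ 2
      = (‖x‖ ^ finrank ℝ W)⁻¹ * (‖x‖ ^ 2 * ‖fderiv ℝ w x‖ ^ 2
        - ((finrank ℝ W : ℝ) - 2) * (w x * fderiv ℝ w x x)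
        + (((finrank ℝ W : ℝ) - 2) / 2) ^ 2 * w x ^ 2) := by
  set n := finrank ℝ W
  set s : ℝ := -((n : ℝ) - 2) / 4 with hs
  have hq : 0 < ‖x‖ ^ 2 := by positivity
  have hd : fderiv ℝ (emdenFowler w) x = (‖x‖ ^ 2) ^ s •
      (fderiv ℝ w x + (2 * s * w x * (‖x‖ ^ 2)⁻¹) • euclForm W x) := by
    have h := (hasFDerivAt_norm_sq_rpow s hx).mul (hw.differentiable (by simp) x).hasFDerivAt
    rw [show fderiv ℝ (emdenFowler w) x = _ from h.fderiv, Real.rpow_sub_one hq.ne']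
    ext v
    simp [euclForm_apply]
    ring
  have hs2 : ((‖x‖ ^ 2) ^ s) ^ 2 = ‖x‖ ^ 2 * (‖x‖ ^ n)⁻¹ := by
    rw [← norm_sq_rpow_neg, ← Real.rpow_natCast, ← Real.rpow_mul hq.le]
    nth_rewrite 2 [← Real.rpow_one (‖x‖ ^ 2)]
    rw [← Real.rpow_add hq]
    congr 1
    rw [hs]
    push_cast
    ring
  rw [hd, norm_smul, mul_pow, norm_add_smul_euclForm_sq, Real.norm_eq_abs, sq_abs, hs2, hs]
  field_simp
  ring

variable [FiniteDimensional ℝ W] [MeasurableSpace W] [BorelSpace W]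

/-- The cross term `w dw(x)` in the pointwise formula, with its weight `|x|^(-n)`, is half the
divergence of `|x|^(-n) w² x`, so it integrates to zero. What remains is the cylinder energy: `a
((n-2)/2)² = (n-1)(n-2)` is the scalar curvature term. -/
theorem integral_norm_fderiv_emdenFowler_sq (hn : 1 ≤ finrank ℝ W) (hw : ContDiff ℝ ∞ w)
    (hc : HasCompactSupport w) (h0 : ∀ᶠ x in 𝓝 0, w x = 0) :
    ∫ x, ‖fderiv ℝ (emdenFowler w) x‖ ^ 2 = ∫ x, (‖x‖ ^ finrank ℝ W)⁻¹ *
      (‖x‖ ^ 2 * ‖fderiv ℝ w x‖ ^ 2 + (((finrank ℝ W : ℝ) - 2) / 2) ^ 2 * w x ^ 2) := by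
  set n := finrank ℝ W with hn'
  set ψ : W → ℝ := fun x => (‖x‖ ^ 2) ^ (-(n : ℝ) / 2) * w x ^ 2 with hψdef
  have hψ : ContDiff ℝ ∞ ψ :=
    contDiff_of_eventually_zero (fun _ hx => (contDiffAt_norm_sq_rpow _ hx).mul (hw.contDiffAt.pow 2))
      (h0.mono fun x hx => by simp [hψdef, hx])
  have hψc : HasCompactSupport ψ := hc.mono fun x hx h => hx (by simp [hψdef, h])
  have hdiv := integral_divergence_smul (hψ.of_le (by simp)) hψc
  rw [← hn'] at hdiv
  have hψx : ∀ x, x ≠ 0 → (n : ℝ) * ψ x + fderiv ℝ ψ x x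
      = 2 * ((‖x‖ ^ n)⁻¹ * (w x * fderiv ℝ w x x)) := by
    intro x hx
    have hq : ‖x‖ ^ 2 ≠ 0 := by positivity
    have h := (hasFDerivAt_norm_sq_rpow (-(n : ℝ) / 2) hx).mul
      ((hw.differentiable (by simp) x).hasFDerivAt.pow 2)
    rw [show fderiv ℝ ψ x = _ from h.fderiv, ← norm_sq_rpow_neg, Real.rpow_sub_one hq]
    simp [euclForm_apply, hψdef]
    field_simp
    ring
  have hE := contDiff_emdenFowler hw h0
  have hEc : HasCompactSupport (emdenFowler w) := hc.mono fun x hx h => hx (by simp [emdenFowler, h])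
  have i1 : Integrable fun x => ‖fderiv ℝ (emdenFowler w) x‖ ^ 2 :=
    ((hE.continuous_fderiv (by simp)).norm.pow 2).integrable_of_hasCompactSupport
      ((hEc.fderiv (𝕜 := ℝ)).mono fun x hx h => hx (by simp [h]))
  have i2 : Integrable fun x => (n : ℝ) * ψ x + fderiv ℝ ψ x x := by
    refine ((continuous_const.mul hψ.continuous).add ((hψ.continuous_fderiv (by simp)).clm_apply
      continuous_id)).integrable_of_hasCompactSupport ?_
    exact hψc.mul_left.add ((hψc.fderiv (𝕜 := ℝ)).mono fun x hx h => hx (by simp [h]))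
  have key : ∀ x, (‖x‖ ^ n)⁻¹ * (‖x‖ ^ 2 * ‖fderiv ℝ w x‖ ^ 2 + (((n : ℝ) - 2) / 2) ^ 2 * w x ^ 2)
      = ‖fderiv ℝ (emdenFowler w) x‖ ^ 2 + (((n : ℝ) - 2) / 2) * ((n : ℝ) * ψ x + fderiv ℝ ψ x x) := by
    intro x
    -- At the origin both sides vanish: `w` is zero nearby, and the weight is `(0^n)⁻¹ = 0` since `n
    -- ≥ 1`.
    by_cases hx : x = 0
    · subst hx
      have e1 : fderiv ℝ (emdenFowler w) 0 = 0 := by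
        have : emdenFowler w =ᶠ[𝓝 0] fun _ => 0 := h0.mono fun x hx => by
          rw [emdenFowler, hx, mul_zero]
        rw [this.fderiv_eq, fderiv_fun_const]
        rfl
      have e2 : ψ 0 = 0 := by simp [hψdef, h0.self_of_nhds]
      rw [e1, e2, norm_zero, zero_pow (by omega)]
      simp
    · rw [hψx x hx, norm_fderiv_emdenFowler_sq hw hx]
      ring
  simp_rw [key]
  rw [integral_add i1 (i2.const_mul _), integral_const_mul, hdiv, mul_zero, add_zero]

end EmdenFowlerTransform

/-- Cut-off functions on `[0, N]` with uniformly bounded slopes. -/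
theorem exists_cutoff : ∃ C : ℝ, 0 ≤ C ∧ ∀ N : ℝ, 2 ≤ N → ∃ χ : ℝ → ℝ, ContDiff ℝ ∞ χ ∧
    (∀ s, 0 ≤ χ s ∧ χ s ≤ 1) ∧ (∀ s, s ≤ 1 / 4 → χ s = 0) ∧ (∀ s, N - 1 / 4 ≤ s → χ s = 0) ∧
    (∀ s, 1 / 2 ≤ s → s ≤ N - 1 / 2 → χ s = 1) ∧ ∀ s, |deriv χ s| ≤ C := by
  set τ : ℝ → ℝ := fun s => Real.smoothTransition (4 * s - 1) with hτ
  have hτs : ContDiff ℝ ∞ τ := Real.smoothTransition.contDiff.comp (by fun_prop)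
  have h0 : ∀ s, s ≤ 1 / 4 → τ s = 0 := fun s hs => Real.smoothTransition.zero_of_nonpos (by linarith)
  have h1 : ∀ s, 1 / 2 ≤ s → τ s = 1 := fun s hs => Real.smoothTransition.one_of_one_le (by linarith)
  have hb : ∀ s, 0 ≤ τ s ∧ τ s ≤ 1 := fun s =>
    ⟨Real.smoothTransition.nonneg _, Real.smoothTransition.le_one _⟩
  have hdc : Continuous (deriv τ) := hτs.continuous_deriv (by simp)
  obtain ⟨C, hC⟩ := (isCompact_Icc (a := (0 : ℝ)) (b := 1)).exists_bound_of_continuousOn hdc.continuousOn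
  have hd : ∀ s, |deriv τ s| ≤ C := by
    intro s
    by_cases hs : s ∈ Icc (0 : ℝ) 1
    · exact hC s hs
    · have hC0 : 0 ≤ C := (norm_nonneg _).trans (hC 0 (by simp))
      have : deriv τ s = 0 := by
        rcases not_and_or.1 hs with h | h
        · have : τ =ᶠ[𝓝 s] fun _ => 0 := by
            filter_upwards [Iio_mem_nhds (not_le.1 h)] with z hz
            exact h0 z (by have : z < 0 := hz; linarith)
          rw [this.deriv_eq, deriv_const]
        · have : τ =ᶠ[𝓝 s] fun _ => 1 := by
            filter_upwards [Ioi_mem_nhds (not_le.1 h)] with z hz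
            exact h1 z (by have : 1 < z := hz; linarith)
          rw [this.deriv_eq, deriv_const]
      rw [this, abs_zero]
      exact hC0
  have hC0 : 0 ≤ C := (abs_nonneg _).trans (hd 0)
  -- The cut-off is a product of a rising factor and a reflected one, and each contributes at most
  -- `C` to the slope, independently of `N`.
  refine ⟨2 * C, by linarith, fun N hN => ⟨fun s => τ s * τ (N - s), ?_, fun s => ?_, fun s hs => ?_,
    fun s hs => ?_, fun s hs hs' => ?_, fun s => ?_⟩⟩
  · exact hτs.mul (hτs.comp (by fun_prop))
  · exact ⟨mul_nonneg (hb _).1 (hb _).1, mul_le_one₀ (hb _).2 (hb _).1 (hb _).2⟩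
  · simp only [h0 s hs, zero_mul]
  · simp only [h0 (N - s) (by linarith), mul_zero]
  · simp only [h1 s hs, h1 (N - s) (by linarith), mul_one]
  · have hdiff : ∀ z, HasDerivAt τ (deriv τ z) z := fun z =>
      (hτs.differentiable (by simp) z).hasDerivAt
    have h2 : HasDerivAt (fun s => τ (N - s)) (-deriv τ (N - s)) s := by
      have := (hdiff (N - s)).comp s ((hasDerivAt_id s).const_sub N)
      simpa [Function.comp_def] using this
    have e : deriv (fun s => τ s * τ (N - s)) s
        = deriv τ s * τ (N - s) + τ s * -deriv τ (N - s) := ((hdiff s).mul h2).deriv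
    rw [e]
    refine (abs_add_le _ _).trans ?_
    rw [abs_mul, abs_mul, abs_neg, abs_of_nonneg (hb _).1, abs_of_nonneg (hb s).1]
    nlinarith [hd s, hd (N - s), hb s, hb (N - s), abs_nonneg (deriv τ s), abs_nonneg (deriv τ (N - s)),
      mul_le_of_le_one_right (abs_nonneg (deriv τ s)) (hb (N - s)).2,
      mul_le_of_le_one_left (abs_nonneg (deriv τ (N - s))) (hb s).2]

/-- The Sobolev inequality `S (∫ h^p)^{2/p} ≤ ∫ 4(n-1)/(n-2) |∇h|²`, `p = 2n/(n-2)`, for nonnegative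
test functions on `ℝ^n`. -/
def SobolevIneq (n : ℕ) (S : ℝ) : Prop :=
  ∀ h : EuclideanSpace ℝ (Fin n) → ℝ, ContDiff ℝ ∞ h → HasCompactSupport h → (∀ x, 0 ≤ h x) →
    S * (∫ x, h x ^ (2 * (n : ℝ) / (n - 2))) ^ (((n : ℝ) - 2) / n)
      ≤ 4 * ((n : ℝ) - 1) / (n - 2) * ∫ x, ‖fderiv ℝ h x‖ ^ 2

/-! ### Integrals over unions of annuli. -/

section CylIntegral

variable {m : ℕ}

theorem integral_cylMeasure (F : EuclideanSpace ℝ (Fin (m + 1)) → ℝ) :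
    ∫ x, F x ∂(cylMeasure m) = ∫ x, (‖x‖ ^ (m + 1))⁻¹ * F x := by
  rw [cylMeasure, integral_withDensity_eq_integral_toReal_smul (by fun_prop)
    (.of_forall fun _ => ENNReal.ofReal_lt_top)]
  refine integral_congr_ae (.of_forall fun x => ?_)
  simp only [smul_eq_mul]
  rw [ENNReal.toReal_ofReal (by positivity)]

theorem annulus_union {a b c : ℝ} (hab : a ≤ b) (hbc : b ≤ c) :
    annulus m a c = annulus m a b ∪ annulus m b c := by
  ext x
  simp only [annulus, mem_union, Set.mem_ofPred_eq]
  constructor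
  · rintro ⟨h0, h1, h2⟩
    rcases lt_or_ge (Real.log ‖x‖) b with h | h
    · exact .inl ⟨h0, h1, h⟩
    · exact .inr ⟨h0, h, h2⟩
  · rintro (⟨h0, h1, h2⟩ | ⟨h0, h1, h2⟩)
    · exact ⟨h0, h1, h2.trans_le hbc⟩
    · exact ⟨h0, hab.trans h1, h2⟩

theorem annulus_disjoint (a b c : ℝ) : Disjoint (annulus m a b) (annulus m b c) :=
  Set.disjoint_left.2 fun _ h1 h2 => absurd h1.2.2 (not_lt.2 h2.2.1)

theorem annulus_subset {a b c d : ℝ} (hab : c ≤ a) (hbc : b ≤ d) : annulus m a b ⊆ annulus m c d :=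
  fun _ h => ⟨h.1, hab.trans h.2.1, h.2.2.trans_le hbc⟩

theorem sum_setIntegral_annulus {F : EuclideanSpace ℝ (Fin (m + 1)) → ℝ} (a : ℝ) (N : ℕ)
    (hF : IntegrableOn F (annulus m a (a + N)) (cylMeasure m)) :
    ∑ j ∈ Finset.range N, ∫ x in annulus m (a + j) (a + j + 1), F x ∂(cylMeasure m)
      = ∫ x in annulus m a (a + N), F x ∂(cylMeasure m) := by
  induction N with
  | zero =>
    have : annulus m a (a + (0 : ℕ)) = ∅ := by
      ext x
      simp only [annulus, Set.mem_ofPred_eq, mem_empty_iff_false, iff_false]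
      rintro ⟨-, h1, h2⟩
      simp at h2
      linarith
    rw [this]
    simp
  | succ N ih =>
    have h1 : annulus m a (a + (N + 1 : ℕ)) = annulus m a (a + N) ∪ annulus m (a + N) (a + N + 1) := by
      rw [← annulus_union (by simp) (by simp)]
      push_cast
      rw [add_assoc]
    rw [h1] at hF ⊢
    rw [Finset.sum_range_succ, ih hF.left_of_union,
      setIntegral_union (annulus_disjoint _ _ _) (measurableSet_annulus _ _) hF.left_of_union
        hF.right_of_union]

theorem integrableOn_cover {r : ℝ} (hr : 0 < r) (a : ℝ) {f : ProjCircle m → ℝ} (hf : Continuous f) :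
    IntegrableOn (fun x => f (cover r x)) (annulus m a (a + 2 * Real.pi * r)) (cylMeasure m) := by
  have h1 : Integrable f (Measure.map (cover r)
      ((cylMeasure m).restrict (annulus m a (a + 2 * Real.pi * r)))) := by
    rw [map_cover hr a]
    exact ((projCircleMetric m hr).integrable_of_continuous hf).smul_measure (by simp)
  exact h1.comp_aemeasurable (aemeasurable_cover r (measurableSet_annulus _ _) fun x hx => hx.1)

end CylIntegral

/-! ### Lifting a function to one period and cutting it off. -/

section Slice

variable {m : ℕ}

/-- The function `v` on `ℝP^m × S¹`, lifted to `ℝ^{m+1} ∖ 0` and cut off by a function of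
`log |x|`. -/
def slice (r : ℝ) (χ : ℝ → ℝ) (s : ℝ) (v : ProjCircle m → ℝ) (x : EuclideanSpace ℝ (Fin (m + 1))) : ℝ :=
  χ (Real.log ‖x‖ - s) * v (cover r x)

/-- The differential of a function on `ℝP^m × S¹`, as a covector on the model space. -/
abbrev dform (v : ProjCircle m → ℝ) (p : ProjCircle m) :
    EuclideanSpace ℝ (Fin m) × EuclideanSpace ℝ (Fin 1) →L[ℝ] ℝ :=
  diffForm ((𝓡 m).prod (𝓡 1)) v p

theorem hasFDerivAt_comp_cover (r : ℝ) {v : ProjCircle m → ℝ}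
    (hv : ContMDiff ((𝓡 m).prod (𝓡 1)) 𝓘(ℝ, ℝ) ∞ v) {x : EuclideanSpace ℝ (Fin (m + 1))} (hx : x ≠ 0) :
    HasFDerivAt (fun y => v (cover r y)) ((dform v (cover r x)).comp (coverDeriv r x)) x := by
  have h1 : HasMFDerivAt ((𝓡 m).prod (𝓡 1)) 𝓘(ℝ, ℝ) v (cover r x)
      (dform v (cover r x) : EuclideanSpace ℝ (Fin m) × EuclideanSpace ℝ (Fin 1) →L[ℝ] ℝ) :=
    (hv.mdifferentiableAt (by simp)).hasMFDerivAt
  exact (HasMFDerivAt.comp x h1 (hasMFDerivAt_cover r hx)).hasFDerivAt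

theorem hasFDerivAt_log_norm {W : Type*} [NormedAddCommGroup W] [InnerProductSpace ℝ W] {x : W}
    (hx : x ≠ 0) : HasFDerivAt (fun y : W => Real.log ‖y‖) ((‖x‖ ^ 2)⁻¹ • euclForm W x) x := by
  have h1 : HasFDerivAt (fun y : W => ‖y‖ ^ 2) ((2 : ℝ) • euclForm W x) x := by
    convert (hasStrictFDerivAt_norm_sq x).hasFDerivAt using 1
    ext v
    simp [euclForm_apply]
  have h2 := (h1.log (by positivity)).const_mul (1 / 2 : ℝ)
  refine (h2.congr_fderiv ?_).congr_of_eventuallyEq (.of_forall fun y => ?_)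
  · rw [smul_smul, smul_smul]
    congr 1
    ring
  · simp only [Real.log_pow]
    push_cast
    ring

/-- The only delicate point is the origin, where `cover` is not smooth. As `s ≥ 0` and `log|x| ≤ 0`
on the unit ball (with `log 0 = 0`), the cut-off factor vanishes near it. -/
theorem contDiff_slice {r : ℝ} {χ : ℝ → ℝ} (hχ : ContDiff ℝ ∞ χ) {s : ℝ} (hs : 0 ≤ s)
    (hχ0 : ∀ y, y ≤ 1 / 4 → χ y = 0) {v : ProjCircle m → ℝ}
    (hv : ContMDiff ((𝓡 m).prod (𝓡 1)) 𝓘(ℝ, ℝ) ∞ v) :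
    ContDiff ℝ ∞ (slice r χ s v) ∧ ∀ᶠ x in 𝓝 0, slice r χ s v x = 0 := by
  have h0 : ∀ᶠ x in 𝓝 0, slice r χ s v x = 0 := by
    filter_upwards [Metric.ball_mem_nhds (0 : EuclideanSpace ℝ (Fin (m + 1))) one_pos] with x hx
    rw [mem_ball_zero_iff] at hx
    have : Real.log ‖x‖ ≤ 0 := Real.log_nonpos (norm_nonneg x) hx.le
    rw [slice, hχ0 _ (by linarith), zero_mul]
  refine ⟨contDiff_of_eventually_zero (fun x hx => ?_) h0, h0⟩
  have h1 : ContDiffAt ℝ ∞ (fun y => v (cover r y)) x :=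
    (ContMDiffAt.comp x (hv _) (contMDiffAt_cover r hx)).contDiffAt
  have h2 : ContDiffAt ℝ ∞ (fun y : EuclideanSpace ℝ (Fin (m + 1)) => Real.log ‖y‖ - s) x :=
    ((contDiffAt_norm ℝ hx).log (norm_ne_zero_iff.2 hx)).sub contDiffAt_const
  exact (hχ.contDiffAt.comp x h2).mul h1

theorem slice_eq_zero {r : ℝ} {χ : ℝ → ℝ} {s L : ℝ} (hs : 0 ≤ s)
    (hχ0 : ∀ y, y ≤ 1 / 4 → χ y = 0) (hχ1 : ∀ y, L - 1 / 4 ≤ y → χ y = 0) {v : ProjCircle m → ℝ}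
    {x : EuclideanSpace ℝ (Fin (m + 1))} (hx : x ∉ annulus m s (s + L)) :
    slice r χ s v x = 0 := by
  by_cases h0 : x = 0
  · rw [slice, hχ0 _ (by simp [h0]; linarith), zero_mul]
  rcases lt_or_ge (Real.log ‖x‖) s with h | h
  · rw [slice, hχ0 _ (by linarith), zero_mul]
  · have h1 : s + L ≤ Real.log ‖x‖ := not_lt.1 fun h2 => hx ⟨h0, h, h2⟩
    rw [slice, hχ1 _ (by linarith), zero_mul]

theorem hasCompactSupport_slice {r : ℝ} {χ : ℝ → ℝ} {s L : ℝ} (hs : 0 ≤ s)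
    (hχ0 : ∀ y, y ≤ 1 / 4 → χ y = 0) (hχ1 : ∀ y, L - 1 / 4 ≤ y → χ y = 0) {v : ProjCircle m → ℝ} :
    HasCompactSupport (slice r χ s v) := by
  refine HasCompactSupport.intro (isCompact_closedBall 0 (Real.exp (s + L))) fun x hx => ?_
  refine slice_eq_zero hs hχ0 hχ1 fun h => hx ?_
  rw [mem_closedBall_zero_iff]
  exact (Real.log_le_iff_le_exp (norm_pos_iff.2 h.1)).1 h.2.2.le

/-- The factor `|x|` converts Euclidean norms of covectors into norms for the cylinder metric. There
`log|x|` has unit gradient and the lift of `v` has the gradient norm of `v`; the bound is the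
product rule. -/
theorem norm_fderiv_slice_le {r : ℝ} (hr : 0 < r) {χ : ℝ → ℝ} (hχ : ContDiff ℝ ∞ χ) (s : ℝ)
    {v : ProjCircle m → ℝ} (hv : ContMDiff ((𝓡 m).prod (𝓡 1)) 𝓘(ℝ, ℝ) ∞ v) (hv0 : ∀ p, 0 ≤ v p)
    {x : EuclideanSpace ℝ (Fin (m + 1))} (hx : x ≠ 0) (h0 : 0 ≤ χ (Real.log ‖x‖ - s)) :
    ‖x‖ * ‖fderiv ℝ (slice r χ s v) x‖ ≤ |deriv χ (Real.log ‖x‖ - s)| * v (cover r x)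
      + χ (Real.log ‖x‖ - s)
        * covNorm ((projCircleMetric m hr).form (cover r x)) (dform v (cover r x)) := by
  have h1 := hasFDerivAt_comp_cover r hv hx
  have h2 : HasFDerivAt (fun y : EuclideanSpace ℝ (Fin (m + 1)) => χ (Real.log ‖y‖ - s))
      (deriv χ (Real.log ‖x‖ - s) • ((‖x‖ ^ 2)⁻¹ • euclForm _ x)) x :=
    (hχ.differentiable (by simp)).differentiableAt.hasDerivAt.comp_hasFDerivAt x
      ((hasFDerivAt_log_norm hx).sub_const s)
  have h3 : fderiv ℝ (slice r χ s v) x = _ := (h2.mul h1).fderiv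
  rw [h3, dualNorm_projCircleMetric hr hx]
  have hxp := norm_pos_iff.2 hx
  have h4 : ‖euclForm (EuclideanSpace ℝ (Fin (m + 1))) x‖ ≤ ‖x‖ :=
    ContinuousLinearMap.opNorm_le_bound _ (norm_nonneg x) fun y => by
      rw [euclForm_apply]; exact norm_inner_le_norm x y
  calc _ ≤ ‖x‖ * (χ (Real.log ‖x‖ - s) * ‖(dform v (cover r x)).comp (coverDeriv r x)‖
        + v (cover r x) * (|deriv χ (Real.log ‖x‖ - s)| * ((‖x‖ ^ 2)⁻¹ * ‖x‖))) := by
        gcongr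
        refine (norm_add_le _ _).trans (add_le_add ?_ ?_)
        · rw [norm_smul, Real.norm_eq_abs, abs_of_nonneg h0]
        · rw [norm_smul, norm_smul, norm_smul, Real.norm_eq_abs, abs_of_nonneg (hv0 _),
            Real.norm_eq_abs, Real.norm_eq_abs, abs_of_nonneg (by positivity : 0 ≤ (‖x‖ ^ 2)⁻¹)]
          have := hv0 (cover r x)
          gcongr
    _ = _ := by
        field_simp
        ring

end Slice

/-! ### Energy and mass of a slice, with the loss in the collars. -/

section SliceEnergy

variable {m : ℕ}

/-- A cutoff function between `0` and `L`, with slope at most `C`. -/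
structure IsCutoff (C L : ℝ) (χ : ℝ → ℝ) : Prop where
  contDiff : ContDiff ℝ ∞ χ
  nonneg : ∀ s, 0 ≤ χ s
  le_one : ∀ s, χ s ≤ 1
  eq_zero_left : ∀ s, s ≤ 1 / 4 → χ s = 0
  eq_zero_right : ∀ s, L - 1 / 4 ≤ s → χ s = 0
  eq_one : ∀ s, 1 / 2 ≤ s → s ≤ L - 1 / 2 → χ s = 1
  abs_deriv_le : ∀ s, |deriv χ s| ≤ C

theorem IsCutoff.deriv_eq_zero {C L : ℝ} {χ : ℝ → ℝ} (h : IsCutoff C L χ) {s : ℝ} (h1 : χ s = 1) :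
    deriv χ s = 0 :=
  IsLocalMax.deriv_eq_zero (.of_forall fun y => by rw [h1]; exact h.le_one y)

variable {r : ℝ} (hr : 0 < r) {v : ProjCircle m → ℝ} {C L s : ℝ} {χ : ℝ → ℝ}

/-- The norm of the differential of a function on `ℝP^m × S¹`. -/
def gradNorm (hr : 0 < r) (v : ProjCircle m → ℝ) (p : ProjCircle m) : ℝ :=
  covNorm ((projCircleMetric m hr).form p) (dform v p)

theorem continuous_gradNorm (hv : ContMDiff ((𝓡 m).prod (𝓡 1)) 𝓘(ℝ, ℝ) ∞ v) :
    Continuous (gradNorm hr v) :=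
  (projCircleMetric m hr).continuous_dualNorm_differential hv

theorem gradNorm_nonneg (p : ProjCircle m) : 0 ≤ gradNorm hr v p := Real.sqrt_nonneg _

/-- The part of the annulus on which the cutoff function is not constant. -/
def collar (m : ℕ) (s L : ℝ) : Set (EuclideanSpace ℝ (Fin (m + 1))) :=
  annulus m s (s + 1) ∪ annulus m (s + L - 1) (s + L)

theorem IsCutoff.eq_one_of_notMem (h : IsCutoff C L χ) {x : EuclideanSpace ℝ (Fin (m + 1))}
    (hx : x ∈ annulus m s (s + L)) (hx' : x ∉ collar m s L) : χ (Real.log ‖x‖ - s) = 1 := by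
  have h1 : s + 1 ≤ Real.log ‖x‖ := not_lt.1 fun h2 => hx' (.inl ⟨hx.1, hx.2.1, h2⟩)
  have h2 : Real.log ‖x‖ < s + L - 1 := not_le.1 fun h2 => hx' (.inr ⟨hx.1, h2, hx.2.2⟩)
  exact h.eq_one _ (by linarith) (by linarith)

/-- Away from the collars `χ = 1` is maximal, so `χ' = 0` and the density is that of `v`. On the
collars the gradient is at most `C v + |∇v|`, and `(C v + |∇v|)² ≤ 2 C² v² + 2 |∇v|²`; one `|∇v|²`
belongs to the main term, the remainder to the error. -/
theorem slice_energyDensity_le (h : IsCutoff C L χ)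
    (hv : ContMDiff ((𝓡 m).prod (𝓡 1)) 𝓘(ℝ, ℝ) ∞ v) (hv0 : ∀ p, 0 ≤ v p) (κ : ℝ)
    {x : EuclideanSpace ℝ (Fin (m + 1))} (hx : x ∈ annulus m s (s + L)) :
    ‖x‖ ^ 2 * ‖fderiv ℝ (slice r χ s v) x‖ ^ 2 + κ ^ 2 * slice r χ s v x ^ 2
      ≤ (gradNorm hr v (cover r x) ^ 2 + κ ^ 2 * v (cover r x) ^ 2)
        + (collar m s L).indicator
          (fun x => gradNorm hr v (cover r x) ^ 2 + 2 * C ^ 2 * v (cover r x) ^ 2) x := by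
  have h1 := norm_fderiv_slice_le hr h.contDiff s hv hv0 hx.1 (h.nonneg (Real.log ‖x‖ - s))
  have hd := gradNorm_nonneg hr (v := v) (cover r x)
  change _ ≤ _ + _ * gradNorm hr v (cover r x) at h1
  have hv' := hv0 (cover r x)
  have h2 : slice r χ s v x ^ 2 ≤ v (cover r x) ^ 2 := by
    rw [slice, mul_pow]
    exact mul_le_of_le_one_left (sq_nonneg _) (pow_le_one₀ (h.nonneg _) (h.le_one _))
  have h3 : κ ^ 2 * slice r χ s v x ^ 2 ≤ κ ^ 2 * v (cover r x) ^ 2 :=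
    mul_le_mul_of_nonneg_left h2 (sq_nonneg κ)
  rw [← mul_pow]
  by_cases hc : x ∈ collar m s L
  · rw [indicator_of_mem hc]
    have h4 : ‖x‖ * ‖fderiv ℝ (slice r χ s v) x‖ ≤ C * v (cover r x) + gradNorm hr v (cover r x) :=
      h1.trans (add_le_add (mul_le_mul_of_nonneg_right (h.abs_deriv_le _) hv')
        (mul_le_of_le_one_left hd (h.le_one _)))
    have h5 := pow_le_pow_left₀ (by positivity) h4 2
    nlinarith [sq_nonneg (C * v (cover r x) - gradNorm hr v (cover r x))]
  · rw [indicator_of_notMem hc, add_zero]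
    have h4 := h.eq_one_of_notMem hx hc
    rw [h.deriv_eq_zero h4, h4, abs_zero, zero_mul, zero_add, one_mul] at h1
    have h5 := pow_le_pow_left₀ (by positivity) h1 2
    linarith

theorem measurableSet_collar : MeasurableSet (collar m s L) :=
  (measurableSet_annulus _ _).union (measurableSet_annulus _ _)

theorem collar_subset (hL : 2 ≤ L) : collar m s L ⊆ annulus m s (s + L) :=
  union_subset (annulus_subset le_rfl (by linarith)) (annulus_subset (by linarith) le_rfl)

theorem setIntegral_collar (hL : 2 ≤ L) {F : EuclideanSpace ℝ (Fin (m + 1)) → ℝ}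
    (hF : IntegrableOn F (annulus m s (s + L)) (cylMeasure m)) :
    ∫ x in collar m s L, F x ∂(cylMeasure m) = ∫ x in annulus m s (s + 1), F x ∂(cylMeasure m)
      + ∫ x in annulus m (s + L - 1) (s + L), F x ∂(cylMeasure m) := by
  have hd : Disjoint (annulus m s (s + 1)) (annulus m (s + L - 1) (s + L)) :=
    Set.disjoint_left.2 fun x h1 h2 => by
      have := h1.2.2
      have := h2.2.1
      linarith
  have h1 : IntegrableOn F (collar m s L) (cylMeasure m) := hF.mono_set (collar_subset hL)
  exact setIntegral_union hd (measurableSet_annulus _ _) h1.left_of_union h1.right_of_union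

/-- The energy of the test function on `ℝ^n` given by a slice. -/
theorem integral_slice_energy_le (h : IsCutoff C L χ) (hs : 0 ≤ s) (hL : 2 ≤ L)
    (hrL : 2 * Real.pi * r = L)
    (hv : ContMDiff ((𝓡 m).prod (𝓡 1)) 𝓘(ℝ, ℝ) ∞ v) (hv0 : ∀ p, 0 ≤ v p) :
    ∫ x, ‖fderiv ℝ (emdenFowler (slice r χ s v)) x‖ ^ 2
      ≤ 2 * (∫ p, (gradNorm hr v p ^ 2 + (((m : ℝ) - 1) / 2) ^ 2 * v p ^ 2)
          ∂(projCircleMetric m hr).volume)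
        + ∫ x in collar m s L, (gradNorm hr v (cover r x) ^ 2 + 2 * C ^ 2 * v (cover r x) ^ 2)
          ∂(cylMeasure m) := by
  have hfin : finrank ℝ (EuclideanSpace ℝ (Fin (m + 1))) = m + 1 := finrank_euclideanSpace_fin
  have hvc := hv.continuous
  have hgc := continuous_gradNorm hr hv
  obtain ⟨hsm, h0⟩ := contDiff_slice (r := r) h.contDiff hs h.eq_zero_left hv
  rw [integral_norm_fderiv_emdenFowler_sq (by rw [hfin]; omega) hsm
    (hasCompactSupport_slice hs h.eq_zero_left h.eq_zero_right) h0, hfin, ← integral_cylMeasure]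
  have hκ : (((m + 1 : ℕ) : ℝ) - 2) / 2 = ((m : ℝ) - 1) / 2 := by push_cast; ring
  rw [hκ]
  set κ : ℝ := ((m : ℝ) - 1) / 2
  have hA : ∀ x ∉ annulus m s (s + L),
      ‖x‖ ^ 2 * ‖fderiv ℝ (slice r χ s v) x‖ ^ 2 + κ ^ 2 * slice r χ s v x ^ 2 = 0 := by
    intro x hx
    have h1 := slice_eq_zero (r := r) (v := v) hs h.eq_zero_left h.eq_zero_right hx
    have h2 : fderiv ℝ (slice r χ s v) x = 0 := by
      -- The slice is nonnegative, hence minimal where it vanishes; this covers the boundary of the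
      -- annulus and the origin at once.
      apply IsLocalMin.fderiv_eq_zero
      refine .of_forall fun y => ?_
      rw [h1]
      exact mul_nonneg (h.nonneg _) (hv0 _)
    rw [h1, h2]
    simp
  rw [← setIntegral_eq_integral_of_forall_compl_eq_zero hA, ← setIntegral_cover hr s (by fun_prop),
    hrL]
  have hI : ∀ f : ProjCircle m → ℝ, Continuous f →
      IntegrableOn (fun x => f (cover r x)) (annulus m s (s + L)) (cylMeasure m) := fun f hf => by
    rw [← hrL]; exact integrableOn_cover hr s hf
  have i0 := hI (fun p => gradNorm hr v p ^ 2 + κ ^ 2 * v p ^ 2) (by fun_prop)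
  have i1 := hI (fun p => gradNorm hr v p ^ 2 + 2 * C ^ 2 * v p ^ 2) (by fun_prop)
  have e1 : ∫ x in collar m s L, (gradNorm hr v (cover r x) ^ 2 + 2 * C ^ 2 * v (cover r x) ^ 2)
      ∂(cylMeasure m) = ∫ x in annulus m s (s + L), (collar m s L).indicator
          (fun x => gradNorm hr v (cover r x) ^ 2 + 2 * C ^ 2 * v (cover r x) ^ 2) x
          ∂(cylMeasure m) := by
    rw [setIntegral_indicator measurableSet_collar, inter_eq_right.2 (collar_subset hL)]
  rw [e1, ← integral_add i0 (i1.indicator measurableSet_collar)]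
  refine integral_mono_of_nonneg (.of_forall fun x => by positivity)
    (i0.add (i1.indicator measurableSet_collar)) ?_
  filter_upwards [ae_restrict_mem (measurableSet_annulus _ _)] with x hx
  exact slice_energyDensity_le hr h hv hv0 κ hx

theorem emdenFowler_nonneg {W : Type*} [NormedAddCommGroup W] [InnerProductSpace ℝ W] {w : W → ℝ}
    (hw : ∀ x, 0 ≤ w x) (x : W) : 0 ≤ emdenFowler w x :=
  mul_nonneg (Real.rpow_nonneg (sq_nonneg _) _) (hw x)

/-- The critical exponent: `(n-2)/2 · 2n/(n-2) = n`, so the `L^p` mass of the transform on `ℝⁿ` is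
the `L^p` mass of `w` for the cylinder measure. -/
theorem emdenFowler_rpow {W : Type*} [NormedAddCommGroup W] [InnerProductSpace ℝ W] {w : W → ℝ}
    (hn : 2 < finrank ℝ W) {x : W} (hx : 0 ≤ w x) :
    emdenFowler w x ^ (2 * (finrank ℝ W : ℝ) / (finrank ℝ W - 2))
      = (‖x‖ ^ finrank ℝ W)⁻¹ * w x ^ (2 * (finrank ℝ W : ℝ) / (finrank ℝ W - 2)) := by
  have h2 : (2 : ℝ) < finrank ℝ W := by exact_mod_cast hn
  have h3 : (finrank ℝ W : ℝ) - 2 ≠ 0 := by linarith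
  rw [emdenFowler, Real.mul_rpow (Real.rpow_nonneg (sq_nonneg _) _) hx,
    ← Real.rpow_mul (sq_nonneg _), ← norm_sq_rpow_neg]
  congr 2
  field_simp
  ring

/-- The mass of the test function on `ℝ^n` given by a slice. -/
theorem le_integral_slice_rpow (hm : 2 ≤ m) (h : IsCutoff C L χ) (hs : 0 ≤ s) (hL : 2 ≤ L)
    (hrL : 2 * Real.pi * r = L)
    (hv : ContMDiff ((𝓡 m).prod (𝓡 1)) 𝓘(ℝ, ℝ) ∞ v) (hv0 : ∀ p, 0 ≤ v p) {q : ℝ}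
    (hq : q = 2 * ((m + 1 : ℕ) : ℝ) / ((m + 1 : ℕ) - 2)) :
    2 * (∫ p, v p ^ q ∂(projCircleMetric m hr).volume)
        - ∫ x in collar m s L, v (cover r x) ^ q ∂(cylMeasure m)
      ≤ ∫ x, emdenFowler (slice r χ s v) x ^ q := by
  have hfin : finrank ℝ (EuclideanSpace ℝ (Fin (m + 1))) = m + 1 := finrank_euclideanSpace_fin
  have hm' : (2 : ℝ) ≤ m := by exact_mod_cast hm
  have hq0 : 0 < q := by
    rw [hq]; push_cast
    exact div_pos (by positivity) (by linarith)
  have hvc := hv.continuous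
  have hvq : Continuous fun p => v p ^ q := hvc.rpow_const fun p => .inr hq0.le
  have hsl : ∀ x, 0 ≤ slice r χ s v x := fun x => mul_nonneg (h.nonneg _) (hv0 _)
  have e1 : ∀ x, emdenFowler (slice r χ s v) x ^ q = (‖x‖ ^ (m + 1))⁻¹ * slice r χ s v x ^ q := by
    intro x
    have := emdenFowler_rpow (W := EuclideanSpace ℝ (Fin (m + 1))) (by rw [hfin]; omega) (hsl x)
    rw [hfin] at this
    rw [hq]
    exact this
  simp only [e1]
  rw [← integral_cylMeasure]
  have hA : ∀ x ∉ annulus m s (s + L), slice r χ s v x ^ q = 0 := fun x hx => by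
    rw [slice_eq_zero hs h.eq_zero_left h.eq_zero_right hx, Real.zero_rpow hq0.ne']
  rw [← setIntegral_eq_integral_of_forall_compl_eq_zero hA, ← setIntegral_cover hr s hvq, hrL]
  have i0 : IntegrableOn (fun x => v (cover r x) ^ q) (annulus m s (s + L)) (cylMeasure m) := by
    rw [← hrL]; exact integrableOn_cover hr s hvq
  have e2 : ∫ x in collar m s L, v (cover r x) ^ q ∂(cylMeasure m)
      = ∫ x in annulus m s (s + L), (collar m s L).indicator (fun x => v (cover r x) ^ q) x
          ∂(cylMeasure m) := by
    rw [setIntegral_indicator measurableSet_collar, inter_eq_right.2 (collar_subset hL)]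
  rw [e2, ← integral_sub i0 (i0.indicator measurableSet_collar)]
  have hle : ∀ x, slice r χ s v x ^ q ≤ v (cover r x) ^ q := fun x =>
    Real.rpow_le_rpow (hsl x) (mul_le_of_le_one_left (hv0 _) (h.le_one _)) hq0.le
  have hcont : Continuous (slice r χ s v) :=
    (contDiff_slice (r := r) h.contDiff hs h.eq_zero_left hv).1.continuous
  have i1 : IntegrableOn (fun x => slice r χ s v x ^ q) (annulus m s (s + L)) (cylMeasure m) := by
    refine Integrable.mono' i0
      (hcont.rpow_const fun p => .inr hq0.le).aestronglyMeasurable (.of_forall fun x => ?_)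
    rw [Real.norm_eq_abs, abs_of_nonneg (Real.rpow_nonneg (hsl x) _)]
    exact hle x
  refine integral_mono_ae (i0.sub (i0.indicator measurableSet_collar)) i1 ?_
  filter_upwards [ae_restrict_mem (measurableSet_annulus _ _)] with x hx
  by_cases hc : x ∈ collar m s L
  · simp only [indicator_of_mem hc, sub_self]
    exact Real.rpow_nonneg (hsl x) _
  · simp only [indicator_of_notMem hc, sub_zero]
    rw [slice, h.eq_one_of_notMem hx hc, one_mul]

/-- As `j` runs through `N` integers, the lower collars tile one period, and so do the upper ones.
Each period covers the product twice, whence `4`: a bound for the sum of all errors that does not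
grow with the number of cuts. -/
theorem sum_setIntegral_collar {N : ℕ} (hN : 2 ≤ N) (hrN : 2 * Real.pi * r = N)
    {f : ProjCircle m → ℝ} (hf : Continuous f) :
    ∑ j ∈ Finset.range N, ∫ x in collar m j N, f (cover r x) ∂(cylMeasure m)
      = 4 * ∫ p, f p ∂(projCircleMetric m hr).volume := by
  have hN' : (2 : ℝ) ≤ N := by exact_mod_cast hN
  have hI : ∀ s : ℝ, IntegrableOn (fun x => f (cover r x)) (annulus m s (s + N)) (cylMeasure m) :=
    fun s => by rw [← hrN]; exact integrableOn_cover hr s hf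
  have e1 : ∀ j ∈ Finset.range N, ∫ x in collar m j N, f (cover r x) ∂(cylMeasure m)
      = ∫ x in annulus m (0 + j) (0 + j + 1), f (cover r x) ∂(cylMeasure m)
        + ∫ x in annulus m ((N - 1) + j) ((N - 1) + j + 1), f (cover r x) ∂(cylMeasure m) := by
    intro j _
    rw [setIntegral_collar hN' (hI j)]
    congr 3 <;> congr 1 <;> ring
  rw [Finset.sum_congr rfl e1, Finset.sum_add_distrib, sum_setIntegral_annulus _ _ (hI 0),
    sum_setIntegral_annulus _ _ (hI (N - 1)), ← hrN, setIntegral_cover hr _ hf,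
    setIntegral_cover hr _ hf]
  ring

end SliceEnergy

/-! ### Passage to the limit in integrals. -/

section Limits

variable {α : Type*} [MeasurableSpace α] {μ : Measure α}

theorem tendsto_integral_sq {f : ℕ → α → ℝ} {f' : α → ℝ} (hf : ∀ j, MemLp (f j) 2 μ)
    (hf' : MemLp f' 2 μ) (h : Tendsto (fun j => eLpNorm (fun x => f j x - f' x) 2 μ) atTop (𝓝 0)) :
    Tendsto (fun j => ∫ x, f j x ^ 2 ∂μ) atTop (𝓝 (∫ x, f' x ^ 2 ∂μ)) := by
  have key : ∀ {k : α → ℝ} (hk : MemLp k 2 μ), ∫ x, k x ^ 2 ∂μ = ‖hk.toLp k‖ ^ 2 := by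
    intro k hk
    have h0 : 0 ≤ ∫ x, k x ^ 2 ∂μ := integral_nonneg fun x => sq_nonneg _
    rw [Lp.norm_toLp, hk.eLpNorm_eq_integral_rpow_norm two_ne_zero ENNReal.ofNat_ne_top,
      ENNReal.toReal_ofReal (by positivity)]
    simp only [ENNReal.toReal_ofNat, Real.rpow_two, Real.norm_eq_abs, sq_abs]
    rw [← Real.rpow_two, ← Real.rpow_mul h0]
    norm_num
  simp only [key hf']
  simp only [fun j => key (hf j)]
  exact ((Lp.tendsto_Lp_iff_tendsto_eLpNorm'' f hf f' hf').2 h).norm.pow 2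

/-- Fatou's lemma for the real-valued integral. The limit need not be assumed integrable: the bounds
on the approximating integrals control its lower integral. -/
theorem integral_le_of_tendsto_ae {f : ℕ → α → ℝ} {f' : α → ℝ} {b : ℕ → ℝ} {b' : ℝ}
    (hf : ∀ j, Integrable (f j) μ) (hf0 : ∀ j x, 0 ≤ f j x)
    (h : ∀ᵐ x ∂μ, Tendsto (fun j => f j x) atTop (𝓝 (f' x))) (hb : ∀ j, ∫ x, f j x ∂μ ≤ b j)
    (hb' : Tendsto b atTop (𝓝 b')) : ∫ x, f' x ∂μ ≤ b' := by
  have hpos : 0 ≤ b' := ge_of_tendsto' hb' fun j => (integral_nonneg (hf0 j)).trans (hb j)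
  have hm : AEStronglyMeasurable f' μ := aestronglyMeasurable_of_tendsto_ae atTop (fun j => (hf j).1) h
  have h0 : 0 ≤ᵐ[μ] f' := by
    filter_upwards [h] with x hx
    exact ge_of_tendsto' hx fun j => hf0 j x
  rw [integral_eq_lintegral_of_nonneg_ae h0 hm]
  refine ENNReal.toReal_le_of_le_ofReal hpos ?_
  calc ∫⁻ x, ENNReal.ofReal (f' x) ∂μ
      = ∫⁻ x, liminf (fun j => ENNReal.ofReal (f j x)) atTop ∂μ := by
        refine lintegral_congr_ae ?_
        filter_upwards [h] with x hx
        exact ((ENNReal.continuous_ofReal.tendsto _).comp hx).liminf_eq.symm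
    _ ≤ liminf (fun j => ∫⁻ x, ENNReal.ofReal (f j x) ∂μ) atTop :=
        lintegral_liminf_le' fun j => (hf j).1.aemeasurable.ennreal_ofReal
    _ ≤ liminf (fun j => ENNReal.ofReal (b j)) atTop := by
        refine liminf_le_liminf (.of_forall fun j => ?_)
        rw [← ofReal_integral_eq_lintegral_ofReal (hf j) (.of_forall (hf0 j))]
        exact ENNReal.ofReal_le_ofReal (hb j)
    _ = ENNReal.ofReal b' := ((ENNReal.continuous_ofReal.tendsto _).comp hb').liminf_eq

end Limits

/-! ### Averaging the Sobolev inequality over the position of the cut. -/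

section Averaging

variable {m : ℕ} {r : ℝ}

/-- For `0 ≤ y ≤ 1` and `θ ≤ 1` one has `1 - y ≤ (1 - y)^θ`. The left side is affine in the lost
mass `x`, so the inequalities for the different cuts can be added. -/
theorem rpow_sub_le {P x θ : ℝ} (hx0 : 0 ≤ x) (hxP : x ≤ P) (hθ0 : 0 < θ) (hθ : θ ≤ 1) :
    P ^ θ - P ^ θ / P * x ≤ (P - x) ^ θ := by
  rcases (hx0.trans hxP).eq_or_lt with rfl | hP
  · rw [Real.zero_rpow hθ0.ne', zero_div, zero_mul, sub_zero]
    exact Real.rpow_nonneg (by linarith) _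
  · have h1 : P - x = P * (1 - x / P) := by field_simp
    have h2 : x / P ≤ 1 := (div_le_one hP).2 hxP
    have h3 : 0 ≤ x / P := by positivity
    rw [h1, Real.mul_rpow hP.le (by linarith)]
    calc P ^ θ - P ^ θ / P * x = P ^ θ * (1 - x / P) := by ring
      _ ≤ _ := by
        gcongr
        exact Real.self_le_rpow_of_le_one (by linarith) (by linarith) hθ

/-- The Sobolev inequality of `ℝ^n`, for smooth functions on `ℝP^{n-1} × S¹` with a circle of length
`N`, up to an error which tends to `0` with `1 / N`. -/
theorem SobolevIneq.le_of_smooth {S C : ℝ} (hS : SobolevIneq (m + 1) S) (hS0 : 0 ≤ S) (hm : 2 ≤ m)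
    {N : ℕ} (hN : 2 ≤ N) {χ : ℝ → ℝ} (h : IsCutoff C N χ) (hr : 0 < r) (hrN : 2 * Real.pi * r = N)
    {v : ProjCircle m → ℝ} (hv : ContMDiff ((𝓡 m).prod (𝓡 1)) 𝓘(ℝ, ℝ) ∞ v) (hv0 : ∀ p, 0 ≤ v p)
    {q θ : ℝ} (hq : q = 2 * ((m + 1 : ℕ) : ℝ) / ((m + 1 : ℕ) - 2))
    (hθ : θ = (((m + 1 : ℕ) : ℝ) - 2) / (m + 1 : ℕ)) :
    S * (2 * ∫ p, v p ^ q ∂(projCircleMetric m hr).volume) ^ θ * (N - 2)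
      ≤ (2 * N + 4 * (1 + 8 * C ^ 2)) * (4 * (m : ℝ) / (m - 1)
          * (∫ p, gradNorm hr v p ^ 2 ∂(projCircleMetric m hr).volume)
        + m * (m - 1) * ∫ p, v p ^ 2 ∂(projCircleMetric m hr).volume) := by
  have hm' : (2 : ℝ) ≤ m := by exact_mod_cast hm
  have hN' : (2 : ℝ) ≤ N := by exact_mod_cast hN
  have hq0 : 0 < q := by
    rw [hq]; push_cast
    exact div_pos (by positivity) (by linarith)
  have hθ0 : 0 < θ := by
    rw [hθ]; push_cast
    exact div_pos (by linarith) (by positivity)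
  have hθ1 : θ ≤ 1 := by
    rw [hθ]; push_cast
    exact (div_le_one (by positivity)).2 (by linarith)
  have ha : 4 * (((m + 1 : ℕ) : ℝ) - 1) / ((m + 1 : ℕ) - 2) = 4 * (m : ℝ) / (m - 1) := by
    push_cast
    congr 1 <;> ring
  have hvc := hv.continuous
  have hgc := continuous_gradNorm hr hv
  have hvq : Continuous fun p => v p ^ q := hvc.rpow_const fun p => .inr hq0.le
  set g := projCircleMetric m hr
  set a : ℝ := 4 * (m : ℝ) / (m - 1) with hadef
  have ha0 : 0 ≤ a := div_nonneg (by positivity) (by linarith)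
  set P : ℝ := 2 * ∫ p, v p ^ q ∂g.volume with hP
  have hP0 : 0 ≤ P := mul_nonneg zero_le_two (integral_nonneg fun p => Real.rpow_nonneg (hv0 p) _)
  set mass : ℕ → ℝ := fun j => ∫ x in collar m j N, v (cover r x) ^ q ∂(cylMeasure m) with hmass
  set err : ℕ → ℝ := fun j => ∫ x in collar m j N,
    (gradNorm hr v (cover r x) ^ 2 + 2 * C ^ 2 * v (cover r x) ^ 2) ∂(cylMeasure m) with herr
  set I0 : ℝ := ∫ p, (gradNorm hr v p ^ 2 + (((m : ℝ) - 1) / 2) ^ 2 * v p ^ 2) ∂g.volume with hI0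
  have hmass0 : ∀ j, 0 ≤ mass j := fun j => integral_nonneg fun x => Real.rpow_nonneg (hv0 _) _
  have hmassP : ∀ j : ℕ, mass j ≤ P := by
    intro j
    rw [hP, ← setIntegral_cover hr j hvq]
    refine setIntegral_mono_set (integrableOn_cover hr _ hvq)
      (.of_forall fun x => Real.rpow_nonneg (hv0 _) _) ?_
    rw [hrN]
    exact (collar_subset hN').eventuallyLE
  -- The Sobolev inequality for the transform of the slice starting at `j`; `P` is the mass of one
  -- full period.
  have hj : ∀ j : ℕ, S * (P ^ θ - P ^ θ / P * mass j) ≤ a * (2 * I0 + err j) := by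
    intro j
    have hj0 : (0 : ℝ) ≤ j := j.cast_nonneg
    obtain ⟨hsm, h0⟩ := contDiff_slice (r := r) h.contDiff hj0 h.eq_zero_left hv
    have hcs : HasCompactSupport (emdenFowler (slice r χ j v)) :=
      (hasCompactSupport_slice hj0 h.eq_zero_left h.eq_zero_right).mul_left
    have h1 := hS _ (contDiff_emdenFowler hsm h0) hcs
      (emdenFowler_nonneg fun x => mul_nonneg (h.nonneg _) (hv0 _))
    rw [ha, ← hq, ← hθ] at h1
    have h2 := le_integral_slice_rpow hr hm h hj0 hN' hrN hv hv0 hq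
    have h3 := integral_slice_energy_le hr h hj0 hN' hrN hv hv0
    calc S * (P ^ θ - P ^ θ / P * mass j) ≤ S * (P - mass j) ^ θ := by
          gcongr
          exact rpow_sub_le (hmass0 j) (hmassP j) hθ0 hθ1
      _ ≤ S * (∫ x, emdenFowler (slice r χ j v) x ^ q) ^ θ := by
          gcongr
          exact sub_nonneg.2 (hmassP j)
      _ ≤ a * (2 * I0 + err j) := h1.trans (mul_le_mul_of_nonneg_left h3 ha0)
  -- Summed over the `N` cuts, the collar masses give `2P` in all, which turns `N P^θ` into `(N - 2)
  -- P^θ`, and the energy errors are four integrals over the product.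
  have hsum := Finset.sum_le_sum (s := Finset.range N) fun j _ => hj j
  have hsm : ∑ j ∈ Finset.range N, mass j = 2 * P := by
    rw [hP, hmass, sum_setIntegral_collar hr hN hrN hvq]
    ring
  have i1 : Integrable (fun p => gradNorm hr v p ^ 2) g.volume :=
    g.integrable_of_continuous (by fun_prop)
  have i2 : Integrable (fun p => v p ^ 2) g.volume := g.integrable_of_continuous (by fun_prop)
  have hse : ∑ j ∈ Finset.range N, err j = 4 * ((∫ p, gradNorm hr v p ^ 2 ∂g.volume)
      + 2 * C ^ 2 * ∫ p, v p ^ 2 ∂g.volume) := by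
    rw [herr, sum_setIntegral_collar hr hN hrN
      (f := fun p => gradNorm hr v p ^ 2 + 2 * C ^ 2 * v p ^ 2) (by fun_prop),
      integral_add i1 (i2.const_mul _), integral_const_mul]
  have hI0' : I0 = (∫ p, gradNorm hr v p ^ 2 ∂g.volume)
      + (((m : ℝ) - 1) / 2) ^ 2 * ∫ p, v p ^ 2 ∂g.volume := by
    rw [hI0, integral_add i1 (i2.const_mul _), integral_const_mul]
  rw [← Finset.mul_sum, Finset.sum_sub_distrib, ← Finset.mul_sum, hsm, ← Finset.mul_sum,
    Finset.sum_add_distrib, hse, hI0', Finset.sum_const, Finset.sum_const, Finset.card_range,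
    nsmul_eq_mul, nsmul_eq_mul] at hsum
  have hPP : P ^ θ / P * (2 * P) = 2 * P ^ θ := by
    rcases hP0.eq_or_lt with h0 | h0
    · rw [← h0, Real.zero_rpow hθ0.ne']; simp
    · field_simp
  rw [hPP] at hsum
  have hG0 : 0 ≤ ∫ p, gradNorm hr v p ^ 2 ∂g.volume := integral_nonneg fun p => sq_nonneg _
  have hV0 : 0 ≤ ∫ p, v p ^ 2 ∂g.volume := integral_nonneg fun p => sq_nonneg _
  set G := ∫ p, gradNorm hr v p ^ 2 ∂g.volume
  set V := ∫ p, v p ^ 2 ∂g.volume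
  have haκ : a * (((m : ℝ) - 1) / 2) ^ 2 = m * (m - 1) := by
    have : (m : ℝ) - 1 ≠ 0 := by linarith
    rw [hadef]
    field_simp
    ring
  -- Here `m ≥ 2` enters: the zeroth order term of the energy has coefficient at least `1/4`, so the
  -- error `2 C² ∫ v²` is bounded by `8 C²` times the energy term.
  have hκ : 1 / 4 ≤ (((m : ℝ) - 1) / 2) ^ 2 := by nlinarith
  set κ2 : ℝ := (((m : ℝ) - 1) / 2) ^ 2
  rw [← haκ]
  have h5 : G + 2 * C ^ 2 * V ≤ (1 + 8 * C ^ 2) * (G + κ2 * V) := by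
    nlinarith [mul_nonneg (sq_nonneg C) hG0, mul_nonneg (mul_nonneg (sq_nonneg C) hV0)
      (sub_nonneg.2 hκ),  mul_nonneg (by linarith : 0 ≤ κ2) hV0]
  calc S * P ^ θ * (N - 2) = S * (N * P ^ θ - 2 * P ^ θ) := by ring
    _ ≤ a * (N * (2 * (G + κ2 * V)) + 4 * (G + 2 * C ^ 2 * V)) := hsum
    _ ≤ a * (N * (2 * (G + κ2 * V)) + 4 * ((1 + 8 * C ^ 2) * (G + κ2 * V))) := by gcongr
    _ = _ := by ring

end Averaging

/-! ### From nonnegative smooth functions to Sobolev functions. -/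

section SmoothAbs

/-- A smooth approximation, from above, of the absolute value. -/
def smoothAbs (ε s : ℝ) : ℝ := Real.sqrt (s ^ 2 + ε ^ 2)

variable {ε : ℝ} (hε : 0 < ε)
include hε

theorem contDiff_smoothAbs : ContDiff ℝ ∞ (smoothAbs ε) :=
  ContDiff.sqrt (by fun_prop) fun x => by positivity

theorem abs_deriv_smoothAbs_le (s : ℝ) : |deriv (smoothAbs ε) s| ≤ 1 := by
  have hpos : 0 < s ^ 2 + ε ^ 2 := by positivity
  have h1 : HasDerivAt (fun s => s ^ 2 + ε ^ 2) (2 * s) s := by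
    simpa using (hasDerivAt_pow 2 s).add_const (ε ^ 2)
  have h2 : deriv (smoothAbs ε) s = _ := (h1.sqrt hpos.ne').deriv
  rw [h2, abs_div, abs_of_pos (by positivity : 0 < 2 * √(s ^ 2 + ε ^ 2)), div_le_one (by positivity),
    abs_mul, abs_two]
  gcongr
  exact Real.abs_le_sqrt (by nlinarith)

end SmoothAbs

/-! ### The lower bound for the Yamabe invariant of the product. -/

section Approximation

variable {m : ℕ} {r : ℝ}

theorem dform_comp {f : ℝ → ℝ} (hf : ContDiff ℝ ∞ f) {v : ProjCircle m → ℝ}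
    (hv : ContMDiff ((𝓡 m).prod (𝓡 1)) 𝓘(ℝ, ℝ) ∞ v) (p : ProjCircle m) :
    dform (fun p => f (v p)) p = deriv f (v p) • dform v p := by
  have h1 : HasMFDerivAt ((𝓡 m).prod (𝓡 1)) 𝓘(ℝ, ℝ) v p
      (dform v p : EuclideanSpace ℝ (Fin m) × EuclideanSpace ℝ (Fin 1) →L[ℝ] ℝ) :=
    (hv.mdifferentiableAt (by simp)).hasMFDerivAt
  have h2 : HasMFDerivAt 𝓘(ℝ, ℝ) 𝓘(ℝ, ℝ) f (v p) (ContinuousLinearMap.toSpanSingleton ℝ (deriv f (v p))) :=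
    (hf.differentiable (by simp)).differentiableAt.hasDerivAt.hasFDerivAt.hasMFDerivAt
  have h3 : dform (fun p => f (v p)) p = (ContinuousLinearMap.toSpanSingleton ℝ (deriv f (v p))).comp
      (dform v p) := (HasMFDerivAt.comp p h2 h1).mfderiv
  rw [h3]
  ext x
  · simp [mul_comm]
  · simp [mul_comm]

theorem gradNorm_comp_le (hr : 0 < r) {f : ℝ → ℝ} (hf : ContDiff ℝ ∞ f) (hf1 : ∀ s, |deriv f s| ≤ 1)
    {v : ProjCircle m → ℝ} (hv : ContMDiff ((𝓡 m).prod (𝓡 1)) 𝓘(ℝ, ℝ) ∞ v) (p : ProjCircle m) :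
    gradNorm hr (fun p => f (v p)) p ≤ gradNorm hr v p := by
  rw [gradNorm, dform_comp hf hv, covNorm_smul ((projCircleMetric m hr).posForm p)]
  exact mul_le_of_le_one_left (gradNorm_nonneg hr p) (hf1 _)

variable {hr : 0 < r}

theorem tendsto_integral_gradNorm_sq {u : SobolevH1 (projCircleMetric m hr)}
    {v : ℕ → ProjCircle m → ℝ} (hv : ∀ j, ContMDiff ((𝓡 m).prod (𝓡 1)) 𝓘(ℝ, ℝ) ∞ (v j))
    (h2 : ∀ j, MemLp (fun x => (projCircleMetric m hr).dualNorm x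
      (differential ((𝓡 m).prod (𝓡 1)) (v j) x - u.diff x)) 2 (projCircleMetric m hr).volume)
    (t2 : Tendsto (fun j => eLpNorm (fun x => (projCircleMetric m hr).dualNorm x
      (differential ((𝓡 m).prod (𝓡 1)) (v j) x - u.diff x)) 2 (projCircleMetric m hr).volume)
      atTop (𝓝 0)) :
    Tendsto (fun j => ∫ p, gradNorm hr (v j) p ^ 2 ∂(projCircleMetric m hr).volume) atTop
      (𝓝 (∫ p, (projCircleMetric m hr).dualNorm p (u.diff p) ^ 2 ∂(projCircleMetric m hr).volume)) := by
  revert u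
  set g := projCircleMetric m hr
  intro u h2 t2
  have := g.isFiniteMeasure_volume
  have m1 : ∀ j, MemLp (gradNorm hr (v j)) 2 g.volume := fun j =>
    (memLp_two_iff_integrable_sq (continuous_gradNorm hr (hv j)).measurable.aestronglyMeasurable).2
      (g.integrable_of_continuous ((continuous_gradNorm hr (hv j)).pow 2))
  have hle : ∀ j p, ‖gradNorm hr (v j) p - g.dualNorm p (u.diff p)‖
      ≤ g.dualNorm p (differential ((𝓡 m).prod (𝓡 1)) (v j) p - u.diff p) := fun j p =>
    u.abs_dualNorm_sub_le (v j) p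
  have m2 : MemLp (fun p => gradNorm hr (v 0) p - g.dualNorm p (u.diff p)) 2 g.volume :=
    (h2 0).mono' ((m1 0).1.sub u.aestronglyMeasurable_dualNorm) (.of_forall (hle 0))
  have m3 : MemLp (fun p => g.dualNorm p (u.diff p)) 2 g.volume := by
    have := (m1 0).sub m2
    simpa [Pi.sub_def] using this
  refine tendsto_integral_sq m1 m3 ?_
  refine tendsto_of_tendsto_of_tendsto_of_le_of_le tendsto_const_nhds t2 (fun _ => zero_le) fun j => ?_
  exact eLpNorm_mono_real (hle j)

theorem tendsto_integral_sq_toFun {u : SobolevH1 (projCircleMetric m hr)}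
    {v : ℕ → ProjCircle m → ℝ} (hv : ∀ j, ContMDiff ((𝓡 m).prod (𝓡 1)) 𝓘(ℝ, ℝ) ∞ (v j))
    (h1 : ∀ j, MemLp (fun x => v j x - u.toFun x) 2 (projCircleMetric m hr).volume)
    (t1 : Tendsto (fun j => eLpNorm (fun x => v j x - u.toFun x) 2 (projCircleMetric m hr).volume)
      atTop (𝓝 0)) :
    Tendsto (fun j => ∫ p, v j p ^ 2 ∂(projCircleMetric m hr).volume) atTop
      (𝓝 (∫ p, u.toFun p ^ 2 ∂(projCircleMetric m hr).volume)) := by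
  revert u
  set g := projCircleMetric m hr
  intro u h1 t1
  have m1 : ∀ j, MemLp (v j) 2 g.volume := fun j =>
    (memLp_two_iff_integrable_sq (hv j).continuous.measurable.aestronglyMeasurable).2
      (g.integrable_of_continuous ((hv j).continuous.pow 2))
  have m3 : MemLp u.toFun 2 g.volume := by
    have := (m1 0).sub (h1 0)
    simpa [Pi.sub_def] using this
  exact tendsto_integral_sq m1 m3 t1

theorem energy_projCircle (u : SobolevH1 (projCircleMetric m hr)) :
    energy _ u = 4 * (m : ℝ) / (m - 1)
        * (∫ p, (projCircleMetric m hr).dualNorm p (u.diff p) ^ 2 ∂(projCircleMetric m hr).volume)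
      + m * (m - 1) * ∫ p, u.toFun p ^ 2 ∂(projCircleMetric m hr).volume := by
  simp only [energy, scalarCurvature_projCircleMetric, SmoothMetric.boundaryMeasure_eq_zero,
    integral_zero_measure, mul_zero, add_zero, integral_const_mul]
  rw [finrank_projCircle]
  congr 3
  · push_cast; ring
  · push_cast; ring

/-- Smooth approximations of `u` may change sign, so they are replaced by `√(v² + ε²)`: smooth,
nonnegative, with no larger gradient, and converging to `|u|`. The quadratic terms converge by `L²`
convergence, the critical power is handled by Fatou's lemma, so no embedding of `H¹` in `L^p` is
needed. -/
theorem SobolevIneq.le_energy {S C : ℝ} (hS : SobolevIneq (m + 1) S) (hS0 : 0 ≤ S) (hm : 2 ≤ m)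
    {N : ℕ} (hN : 2 < N) {χ : ℝ → ℝ} (h : IsCutoff C N χ) (hrN : 2 * Real.pi * r = N)
    (u : SobolevH1 (projCircleMetric m hr))
    {q θ : ℝ} (hq : q = 2 * ((m + 1 : ℕ) : ℝ) / ((m + 1 : ℕ) - 2))
    (hθ : θ = (((m + 1 : ℕ) : ℝ) - 2) / (m + 1 : ℕ)) :
    S * (2 * ∫ p, |u.toFun p| ^ q ∂(projCircleMetric m hr).volume) ^ θ * (N - 2)
      ≤ (2 * N + 4 * (1 + 8 * C ^ 2)) * energy _ u := by
  have hm' : (2 : ℝ) ≤ m := by exact_mod_cast hm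
  have hN' : (2 : ℝ) < N := by exact_mod_cast hN
  have hq0 : 0 < q := by
    rw [hq]; push_cast
    exact div_pos (by positivity) (by linarith)
  have hθ0 : 0 < θ := by
    rw [hθ]; push_cast
    exact div_pos (by linarith) (by positivity)
  have ha0 : (0 : ℝ) ≤ 4 * (m : ℝ) / (m - 1) := div_nonneg (by positivity) (by linarith)
  have hb0 : (0 : ℝ) ≤ m * (m - 1) := mul_nonneg (by linarith) (by linarith)
  rw [energy_projCircle]
  revert u
  set g := projCircleMetric m hr
  intro u
  set K : ℝ := 2 * N + 4 * (1 + 8 * C ^ 2)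
  have hK : 0 ≤ K := by positivity
  set a : ℝ := 4 * (m : ℝ) / (m - 1)
  set b : ℝ := m * (m - 1)
  rcases hS0.eq_or_lt with rfl | hSpos
  · rw [zero_mul, zero_mul]
    have h1 : 0 ≤ ∫ p, g.dualNorm p (u.diff p) ^ 2 ∂g.volume := integral_nonneg fun _ => sq_nonneg _
    have h2 : 0 ≤ ∫ p, u.toFun p ^ 2 ∂g.volume := integral_nonneg fun _ => sq_nonneg _
    positivity
  obtain ⟨v, hv, h1, h2, t1, t2, hae, -⟩ := u.exists_tendsto_ae
  have c1 := tendsto_integral_gradNorm_sq hv h2 t2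
  have c2 := tendsto_integral_sq_toFun hv h1 t1
  set ε : ℕ → ℝ := fun j => 1 / ((j : ℝ) + 1) with hεdef
  have hε : ∀ j, 0 < ε j := fun j => by positivity
  have hεt : Tendsto ε atTop (𝓝 0) := tendsto_one_div_add_atTop_nhds_zero_nat
  set V := g.volume.real univ
  set Q : ℕ → ℝ := fun j => a * (∫ p, gradNorm hr (v j) p ^ 2 ∂g.volume)
    + b * ((∫ p, v j p ^ 2 ∂g.volume) + ε j ^ 2 * V) with hQ
  have hfin := g.isFiniteMeasure_volume
  have hw : ∀ j, ContMDiff ((𝓡 m).prod (𝓡 1)) 𝓘(ℝ, ℝ) ∞ (fun p => smoothAbs (ε j) (v j p)) :=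
    fun j => (contDiff_smoothAbs (hε j)).contMDiff.comp (hv j)
  have hw0 : ∀ j p, 0 ≤ smoothAbs (ε j) (v j p) := fun j p => Real.sqrt_nonneg _
  have hbound : ∀ j, S * (2 * ∫ p, smoothAbs (ε j) (v j p) ^ q ∂g.volume) ^ θ * (N - 2)
      ≤ K * Q j := by
    intro j
    refine (hS.le_of_smooth hS0 hm hN.le h hr hrN (hw j) (hw0 j) hq hθ).trans ?_
    refine mul_le_mul_of_nonneg_left (add_le_add (mul_le_mul_of_nonneg_left ?_ ha0)
      (mul_le_mul_of_nonneg_left (le_of_eq ?_) hb0)) hK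
    · refine integral_mono (g.integrable_of_continuous ((continuous_gradNorm hr (hw j)).pow 2))
        (g.integrable_of_continuous ((continuous_gradNorm hr (hv j)).pow 2)) fun p => ?_
      exact pow_le_pow_left₀ (gradNorm_nonneg hr p) (gradNorm_comp_le hr (contDiff_smoothAbs (hε j))
        (abs_deriv_smoothAbs_le (hε j)) (hv j) p) 2
    · have e1 : ∀ p, smoothAbs (ε j) (v j p) ^ 2 = v j p ^ 2 + ε j ^ 2 := fun p =>
        Real.sq_sqrt (by positivity)
      simp only [e1]
      have i1 : Integrable (fun p => v j p ^ 2) g.volume :=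
        g.integrable_of_continuous ((hv j).continuous.pow 2)
      rw [integral_add i1 (integrable_const _), integral_const, smul_eq_mul, mul_comm V]
  have hQt : Tendsto Q atTop (𝓝 (a * (∫ p, g.dualNorm p (u.diff p) ^ 2 ∂g.volume)
      + b * ∫ p, u.toFun p ^ 2 ∂g.volume)) := by
    have := (c1.const_mul a).add ((c2.add ((hεt.pow 2).mul_const V)).const_mul b)
    simpa using this
  set Q' := a * (∫ p, g.dualNorm p (u.diff p) ^ 2 ∂g.volume) + b * ∫ p, u.toFun p ^ 2 ∂g.volume
  have hSN : 0 < S * (N - 2) := mul_pos hSpos (by linarith)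
  -- Solved for the mass, the inequality becomes an upper bound that converges, the form needed for
  -- Fatou's lemma. This divides by `S (N - 2)`, hence the separate treatment of `S = 0`.
  have hmass : ∀ j, ∫ p, smoothAbs (ε j) (v j p) ^ q ∂g.volume
      ≤ (K * Q j / (S * (N - 2))) ^ (θ⁻¹) / 2 := by
    intro j
    have h0 : 0 ≤ ∫ p, smoothAbs (ε j) (v j p) ^ q ∂g.volume :=
      integral_nonneg fun p => Real.rpow_nonneg (hw0 j p) _
    have h3 : (2 * ∫ p, smoothAbs (ε j) (v j p) ^ q ∂g.volume) ^ θ ≤ K * Q j / (S * (N - 2)) := by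
      rw [le_div_iff₀ hSN]
      linarith [hbound j]
    have h4 := Real.rpow_le_rpow (by positivity) h3 (inv_nonneg.2 hθ0.le)
    rw [← Real.rpow_mul (by positivity), mul_inv_cancel₀ hθ0.ne', Real.rpow_one] at h4
    linarith
  have hcont : ∀ j, Continuous fun p => smoothAbs (ε j) (v j p) ^ q := fun j =>
    (hw j).continuous.rpow_const fun p => .inr hq0.le
  have hlim := integral_le_of_tendsto_ae (f' := fun p => |u.toFun p| ^ q)
    (fun j => g.integrable_of_continuous (hcont j)) (fun j p => Real.rpow_nonneg (hw0 j p) _) ?_ hmass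
    (((hQt.const_mul K).div_const (S * (N - 2))).rpow_const (.inr (inv_nonneg.2 hθ0.le))
      |>.div_const 2)
  · have hQ0 : 0 ≤ Q' := by
      have h1 : 0 ≤ ∫ p, g.dualNorm p (u.diff p) ^ 2 ∂g.volume := integral_nonneg fun _ => sq_nonneg _
      have h2 : 0 ≤ ∫ p, u.toFun p ^ 2 ∂g.volume := integral_nonneg fun _ => sq_nonneg _
      positivity
    have h0 : 0 ≤ ∫ p, |u.toFun p| ^ q ∂g.volume :=
      integral_nonneg fun p => Real.rpow_nonneg (abs_nonneg _) _
    have h3 : 2 * ∫ p, |u.toFun p| ^ q ∂g.volume ≤ (K * Q' / (S * (N - 2))) ^ (θ⁻¹) := by linarith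
    have h4 := Real.rpow_le_rpow (by positivity) h3 hθ0.le
    rw [← Real.rpow_mul (by positivity), inv_mul_cancel₀ hθ0.ne', Real.rpow_one,
      le_div_iff₀ hSN] at h4
    linarith
  · filter_upwards [hae] with p hp
    have h3 : Tendsto (fun j => smoothAbs (ε j) (v j p)) atTop (𝓝 |u.toFun p|) := by
      have := ((hp.pow 2).add (hεt.pow 2)).sqrt
      simpa [smoothAbs, Real.sqrt_sq_eq_abs] using this
    exact h3.rpow_const (.inr hq0.le)

theorem mem_constraintSet_projCircle {t : ℝ} {u : SobolevH1 (projCircleMetric m hr)}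
    (hu : u ∈ constraintSet t (1 - t) (projCircleMetric m hr)) :
    t * ∫ p, |u.toFun p| ^ (2 * ((m + 1 : ℕ) : ℝ) / ((m + 1 : ℕ) - 2))
      ∂(projCircleMetric m hr).volume = 1 := by
  have h := hu.1
  rw [SmoothMetric.boundaryMeasure_eq_zero, integral_zero_measure, mul_zero, add_zero,
    finrank_projCircle] at h
  exact h

variable (m) in
-- With `t = 0` and no boundary the constraint is `0 = 1`. The infimum over the empty set is `⊤`,
-- for any one metric.
theorem yamabeInvariant_projCircle_zero :
    yamabeInvariant ((𝓡 m).prod (𝓡 1)) (ProjCircle m) 0 = ⊤ := by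
  refine top_le_iff.1 (le_trans ?_ (le_iSup _ (projCircleMetric m one_pos)))
  refine le_iInf₂ fun u hu => ?_
  have := mem_constraintSet_projCircle hu
  simp at this

/-- The Sobolev inequality of `ℝ^n` gives a lower bound of the Yamabe invariant of
`ℝP^{n-1} × S¹`. -/
theorem SobolevIneq.le_yamabeInvariant {S : ℝ} (hS : SobolevIneq (m + 1) S) (hS0 : 0 ≤ S)
    (hm : 2 ≤ m) {t : ℝ} (ht : 0 < t) :
    ((S * (2 / t) ^ ((((m + 1 : ℕ) : ℝ) - 2) / (m + 1 : ℕ)) / 2 : ℝ) : EReal)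
      ≤ yamabeInvariant ((𝓡 m).prod (𝓡 1)) (ProjCircle m) t := by
  obtain ⟨C, hC, hcut⟩ := exists_cutoff
  set θ : ℝ := (((m + 1 : ℕ) : ℝ) - 2) / (m + 1 : ℕ) with hθ
  set K : ℝ := 4 * (1 + 8 * C ^ 2)
  have hK : 0 ≤ K := by positivity
  -- Circles of length `N + 3`, which exceeds `2` for all `N`. The constraint gives `∫ u^p = 1/t`,
  -- and the factor `(L - 2) / (2L + K)` tends to `1/2`.
  have key : ∀ N : ℕ, ((S * (2 / t) ^ θ * (((N + 3 : ℕ) - 2) / (2 * (N + 3 : ℕ) + K)) : ℝ) : EReal)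
      ≤ yamabeInvariant ((𝓡 m).prod (𝓡 1)) (ProjCircle m) t := by
    intro N
    have hN2 : 2 < N + 3 := by omega
    generalize N + 3 = L at hN2
    have hL : (2 : ℝ) < L := by exact_mod_cast hN2
    obtain ⟨χ, h1, h2, h3, h4, h5, h6⟩ := hcut L hL.le
    have hχ : IsCutoff C L χ :=
      ⟨h1, fun s => (h2 s).1, fun s => (h2 s).2, h3, h4, h5, h6⟩
    have hr : (0 : ℝ) < L / (2 * Real.pi) := by positivity
    have hrL : 2 * Real.pi * (L / (2 * Real.pi)) = L := by field_simp
    refine le_trans ?_ (le_iSup _ (projCircleMetric m hr))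
    refine le_iInf₂ fun u hu => ?_
    have hmass := mem_constraintSet_projCircle hu
    have h := hS.le_energy hS0 hm hN2 hχ hrL u rfl hθ
    rw [eq_div_of_mul_eq ht.ne' ((mul_comm _ _).trans hmass), mul_one_div] at h
    rw [EReal.coe_le_coe_iff, mul_div_assoc', div_le_iff₀ (by positivity)]
    linarith
  refine le_of_tendsto' (x := atTop) ?_ key
  refine (continuous_coe_real_ereal.tendsto _).comp ?_
  rw [mul_div_assoc, div_eq_mul_one_div (_ ^ θ), ← mul_assoc]
  refine Tendsto.const_mul _ ?_
  have h1 : Tendsto (fun N : ℕ => ((N + 3 : ℕ) : ℝ)) atTop atTop :=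
    tendsto_natCast_atTop_atTop.comp (tendsto_add_atTop_nat 3)
  refine Tendsto.comp (g := fun x : ℝ => (x - 2) / (2 * x + K)) ?_ h1
  have h2 : Tendsto (fun x : ℝ => (1 - 2 * x⁻¹) / (2 + K * x⁻¹)) atTop (𝓝 (1 / 2)) := by
    have h3 : Tendsto (fun x : ℝ => x⁻¹) atTop (𝓝 0) := tendsto_inv_atTop_zero
    have := (tendsto_const_nhds (x := (1 : ℝ))).sub (h3.const_mul 2) |>.div
      ((tendsto_const_nhds (x := (2 : ℝ))).add (h3.const_mul K)) (by norm_num)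
    simpa [Pi.div_def] using this
  refine h2.congr' ?_
  filter_upwards [eventually_gt_atTop 0] with x hx
  field_simp

end Approximation

/-! ### Integrals by means of a parametrization. -/

section Parametrization

variable {E : Type*} [NormedAddCommGroup E] [NormedSpace ℝ E] [FiniteDimensional ℝ E]
  {H : Type*} [TopologicalSpace H] {I : ModelWithCorners ℝ E H}
  {M : Type*} [TopologicalSpace M] [ChartedSpace H M] [IsManifold I ∞ M]
  [MeasurableSpace E] [BorelSpace E] [MeasurableSpace M] [BorelSpace M]
  {E' : Type*} [NormedAddCommGroup E'] [NormedSpace ℝ E'] [FiniteDimensional ℝ E']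
  [MeasurableSpace E'] [BorelSpace E']

/-- The parametrization pushes the measure with density `w` to the restriction of the volume to its
image: checked on sets by the change of variables, then transferred to integrals. -/
theorem SmoothMetric.integral_eq_of_parametrization (g : SmoothMetric I M) {x₀ : M} {F : E' → M}
    {D : E' → E' →L[ℝ] E} {s : Set E'} (hs : MeasurableSet s)
    (hF : ∀ y ∈ s, HasMFDerivWithinAt 𝓘(ℝ, E') I F s y (D y)) (hinj : InjOn F s)
    (hsrc : ∀ y ∈ s, F y ∈ (extChartAt I x₀).source) {ι : Type*} [Fintype ι] [DecidableEq ι]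
    (b : Basis ι ℝ E') (hdim : finrank ℝ E = Fintype.card ι) {w : E' → ℝ} (hw : ContinuousOn w s)
    (hw0 : ∀ y ∈ s, 0 ≤ w y)
    (hvol : ∀ y ∈ s, volDensity (g.form (F y)) (D y) b = ENNReal.ofReal (w y))
    {G : M → ℝ} (hG : Measurable G) (hG0 : ∀ x, x ∉ F '' s → G x = 0) :
    ∫ x, G x ∂g.volume = ∫ y in s, w y * G (F y) ∂b.addHaar := by
  have hFc : ContinuousOn F s := fun y hy => (hF y hy).1
  have hmeas : ∀ B, MeasurableSet B → MeasurableSet (s ∩ F ⁻¹' B) := fun B hB => by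
    have : Measurable (s.domRestrict F) := (continuousOn_iff_continuous_domRestrict.1 hFc).measurable
    have h2 := MeasurableSet.subtype_image hs (this hB)
    convert h2 using 1
    ext y
    simp [Set.domRestrict, and_comm]
  have himage := g.volume_image hs hF hinj hsrc b hdim
  have hwm : AEMeasurable (fun y => ENNReal.ofReal (w y)) (b.addHaar.restrict s) :=
    (hw.aemeasurable hs).ennreal_ofReal
  have hmap : Measure.map F ((b.addHaar.restrict s).withDensity fun y => ENNReal.ofReal (w y))
      = g.volume.restrict (F '' s) := by
    have hFm : AEMeasurable F ((b.addHaar.restrict s).withDensity fun y => ENNReal.ofReal (w y)) :=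
      (hFc.aemeasurable hs).mono_ac (withDensity_absolutelyContinuous _ _)
    ext B hB
    rw [Measure.map_apply_of_aemeasurable hFm hB, Measure.restrict_apply hB]
    have hsub : s ∩ F ⁻¹' B ⊆ s := inter_subset_left
    have h1 := (g.volume_image (hmeas B hB) (fun y hy => (hF y hy.1).mono hsub) (hinj.mono hsub)
      (fun y hy => hsrc y hy.1) b hdim).2
    rw [image_inter_preimage, inter_comm] at h1
    rw [h1, ← setLIntegral_congr_fun (hmeas B hB) (fun y hy => (hvol y hy.1).symm)]
    have hnull : NullMeasurableSet (F ⁻¹' B) (b.addHaar.restrict s) :=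
      (hFc.aemeasurable hs).nullMeasurableSet_preimage hB
    rw [withDensity_apply₀ _ hnull, Measure.restrict_restrict₀ hnull, inter_comm]
  rw [← setIntegral_eq_integral_of_forall_compl_eq_zero hG0, ← hmap,
    integral_map ((hFc.aemeasurable hs).mono_ac (withDensity_absolutelyContinuous _ _))
      hG.aestronglyMeasurable,
    integral_withDensity_eq_integral_toReal_smul₀ hwm (.of_forall fun _ => ENNReal.ofReal_lt_top)]
  refine setIntegral_congr_fun hs fun y hy => ?_
  simp only [smul_eq_mul]
  rw [ENNReal.toReal_ofReal (hw0 y hy)]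

end Parametrization

/-! ### Freezing coefficients under rescaling. -/

section Rescale

variable {W : Type*} [NormedAddCommGroup W] [NormedSpace ℝ W] [FiniteDimensional ℝ W]
  [MeasurableSpace W] [BorelSpace W] {μ : Measure W} [IsFiniteMeasureOnCompacts μ]

/-- Dominated convergence. The support of `f` lies in a ball of some radius `R`; for `δ ≤ 1` the
points `δ • x` with `x` in it stay in the compact part of the cone inside this ball, where `c` is
bounded, and they tend to `0`. -/
theorem tendsto_setIntegral_rescale {s : Set W} (hs : IsClosed s) (h0 : (0 : W) ∈ s)
    (hcone : ∀ δ : ℝ, 0 < δ → ∀ x ∈ s, δ • x ∈ s) {c f : W → ℝ} (hc : ContinuousOn c s)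
    (hf : Continuous f) (hfc : HasCompactSupport f) :
    Tendsto (fun δ : ℝ => ∫ x in s, c (δ • x) * f x ∂μ) (𝓝[>] 0) (𝓝 (c 0 * ∫ x in s, f x ∂μ)) := by
  obtain ⟨R, hR⟩ := hfc.isBounded.subset_closedBall 0
  have hK : IsCompact (Metric.closedBall (0 : W) R ∩ s) := (isCompact_closedBall 0 R).inter_right hs
  obtain ⟨C, hC⟩ := hK.exists_bound_of_continuousOn (hc.mono inter_subset_right)
  rw [← integral_const_mul]
  have hint : Integrable f μ := hf.integrable_of_hasCompactSupport hfc
  refine tendsto_integral_filter_of_dominated_convergence (fun x => C * ‖f x‖) ?_ ?_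
    (hint.norm.const_mul C).integrableOn ?_
  · filter_upwards [self_mem_nhdsWithin] with δ hδ
    have hcδ : ContinuousOn (fun x => c (δ • x)) s :=
      hc.comp (by fun_prop) fun x hx => hcone δ hδ x hx
    exact (hcδ.mul hf.continuousOn).aestronglyMeasurable hs.measurableSet
  · have h1 : ∀ᶠ δ : ℝ in 𝓝[>] 0, δ ≤ 1 :=
      nhdsWithin_le_nhds (Iic_mem_nhds one_pos)
    filter_upwards [self_mem_nhdsWithin, h1] with δ hδ hδ1
    filter_upwards [ae_restrict_mem hs.measurableSet] with x hx
    rw [norm_mul]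
    by_cases hfx : f x = 0
    · simp [hfx]
    · refine mul_le_mul_of_nonneg_right (hC _ ⟨?_, hcone δ hδ x hx⟩) (norm_nonneg _)
      have h2 := hR (subset_tsupport f hfx)
      rw [mem_closedBall_zero_iff] at h2 ⊢
      rw [norm_smul, Real.norm_eq_abs, abs_of_pos hδ]
      exact (mul_le_of_le_one_left (norm_nonneg x) hδ1).trans h2
  · filter_upwards [ae_restrict_mem hs.measurableSet] with x hx
    refine Tendsto.mul_const _ ?_
    have h2 : Tendsto (fun δ : ℝ => δ • x) (𝓝[>] 0) (𝓝[s] 0) := by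
      refine tendsto_nhdsWithin_iff.2 ⟨?_, ?_⟩
      · have : Tendsto (fun δ : ℝ => δ • x) (𝓝 0) (𝓝 ((0 : ℝ) • x)) :=
          (continuous_id.smul continuous_const).tendsto 0
        rw [zero_smul] at this
        exact this.mono_left nhdsWithin_le_nhds
      · filter_upwards [self_mem_nhdsWithin] with δ hδ
        exact hcone δ hδ x hx
    exact (hc 0 h0).tendsto.comp h2

end Rescale

/-! ### Lower order terms and normalisation of test functions. -/

section Normalisation

/-- A bound of `∫ f u²` for a function `u` that is a small constant outside of a small set; it does
not need the integrability of `f`. -/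
theorem abs_integral_mul_sq_le {α : Type*} [MeasurableSpace α] {μ : Measure α} {f u : α → ℝ}
    {A : Set α} {C K η : ℝ} (hA : MeasurableSet A) (hμA : μ A < ⊤) (hη : 0 < η) (hu : Measurable u)
    (hu1 : ∀ x, η ≤ u x) (hu2 : ∀ x, u x ≤ K) (huA : ∀ x, x ∉ A → u x = η)
    (hC : 0 ≤ C) (hf : ∀ x ∈ A, |f x| ≤ C) :
    |∫ x, f x * u x ^ 2 ∂μ| ≤ C * K ^ 2 * μ.real A + η ^ 2 * |∫ x, f x ∂μ| := by
  have hbound : 0 ≤ C * K ^ 2 * μ.real A + η ^ 2 * |∫ x, f x ∂μ| := by positivity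
  by_cases hint : Integrable (fun x => f x * u x ^ 2) μ
  · have hpos : ∀ x, 0 < u x := fun x => hη.trans_le (hu1 x)
    -- As `u ≥ η > 0`, integrability of `f u²` forces that of `f`, so the constant background can be
    -- split off. If `f u²` is not integrable, its integral is `0` by convention and the bound is
    -- trivial.
    have hfi : Integrable f μ := by
      have h1 : Integrable (fun x => ((u x ^ 2)⁻¹) * (f x * u x ^ 2)) μ := by
        refine hint.bdd_mul (c := (η ^ 2)⁻¹) ((hu.pow_const 2).inv).aestronglyMeasurable
          (.of_forall fun x => ?_)
        have := hpos x
        rw [Real.norm_eq_abs, abs_of_pos (by positivity)]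
        have := hu1 x
        gcongr
      refine h1.congr (.of_forall fun x => ?_)
      have := (hpos x).ne'
      field_simp
    have h2 : Integrable (fun x => f x * u x ^ 2 - η ^ 2 * f x) μ := hint.sub (hfi.const_mul _)
    have h3 : ∫ x, f x * u x ^ 2 ∂μ
        = (∫ x, (f x * u x ^ 2 - η ^ 2 * f x) ∂μ) + η ^ 2 * ∫ x, f x ∂μ := by
      rw [integral_sub hint (hfi.const_mul _), integral_const_mul]
      ring
    have h4 : |∫ x, (f x * u x ^ 2 - η ^ 2 * f x) ∂μ| ≤ C * K ^ 2 * μ.real A := by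
      have h5 : Integrable (A.indicator fun _ => C * K ^ 2) μ :=
        (integrable_indicator_iff hA).2 (integrableOn_const hμA.ne)
      have h6 := norm_integral_le_of_norm_le (f := fun x => f x * u x ^ 2 - η ^ 2 * f x) h5
        (.of_forall fun x => ?_)
      · rw [integral_indicator_const _ hA, smul_eq_mul, mul_comm] at h6
        exact h6
      · by_cases hx : x ∈ A
        · rw [indicator_of_mem hx]
          have e : f x * u x ^ 2 - η ^ 2 * f x = f x * (u x ^ 2 - η ^ 2) := by ring
          rw [e, norm_mul, Real.norm_eq_abs, Real.norm_eq_abs]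
          have h7 : η ^ 2 ≤ u x ^ 2 := pow_le_pow_left₀ hη.le (hu1 x) 2
          have h8 : u x ^ 2 ≤ K ^ 2 := pow_le_pow_left₀ (hpos x).le (hu2 x) 2
          rw [abs_of_nonneg (sub_nonneg.2 h7)]
          have := hf x hx
          have : u x ^ 2 - η ^ 2 ≤ K ^ 2 := by nlinarith
          have : 0 ≤ u x ^ 2 - η ^ 2 := by linarith
          gcongr
        · rw [indicator_of_notMem hx, huA x hx]
          simp [mul_comm]
    rw [h3]
    refine (abs_add_le _ _).trans ?_
    rw [abs_mul, abs_of_nonneg (sq_nonneg η)]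
    linarith
  · rw [integral_undef hint, abs_zero]
    exact hbound

/-- The constraint mixes the two exponents `p` and `q`, so the factor is found by the intermediate
value theorem on `[0, a^(-1/p)]`. Dropping the nonnegative boundary term gives `c^p ≤ a⁻¹`: the
boundary mass can only shrink `c`. -/
theorem exists_scale {a b p q : ℝ} (ha : 0 < a) (hb : 0 ≤ b) (hp : 0 < p) (hq : 0 < q) :
    ∃ c, 0 < c ∧ c ^ p * a + c ^ q * b = 1 ∧ c ^ p ≤ a⁻¹ := by
  have hcont : ContinuousOn (fun c : ℝ => c ^ p * a + c ^ q * b) (Icc 0 ((a⁻¹) ^ p⁻¹)) := by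
    have h1 : Continuous fun c : ℝ => c ^ p := continuous_id.rpow_const fun c => .inr hp.le
    have h2 : Continuous fun c : ℝ => c ^ q := continuous_id.rpow_const fun c => .inr hq.le
    exact ((h1.mul continuous_const).add (h2.mul continuous_const)).continuousOn
  have h0 : (0 : ℝ) ≤ (a⁻¹) ^ p⁻¹ := by positivity
  have hmem : (1 : ℝ) ∈ Icc ((0 : ℝ) ^ p * a + (0 : ℝ) ^ q * b)
      (((a⁻¹) ^ p⁻¹) ^ p * a + ((a⁻¹) ^ p⁻¹) ^ q * b) := by
    rw [Real.zero_rpow hp.ne', Real.zero_rpow hq.ne', ← Real.rpow_mul (by positivity),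
      inv_mul_cancel₀ hp.ne', Real.rpow_one, inv_mul_cancel₀ ha.ne']
    refine ⟨by simp, ?_⟩
    have : 0 ≤ ((a⁻¹) ^ p⁻¹) ^ q * b := by positivity
    linarith
  obtain ⟨c, hc, hc1⟩ := intermediate_value_Icc h0 hcont hmem
  have hc1 : c ^ p * a + c ^ q * b = 1 := hc1
  have hc0 : 0 < c := by
    refine hc.1.lt_of_ne fun h => ?_
    rw [← h, Real.zero_rpow hp.ne', Real.zero_rpow hq.ne'] at hc1
    simp at hc1
  refine ⟨c, hc0, hc1, ?_⟩
  have h2 : 0 ≤ c ^ q * b := by positivity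
  rw [← one_div, le_div_iff₀ ha]
  linarith

end Normalisation

/-! ### Upper bounds of Yamabe constants by smooth functions. -/

section SmoothTestFunctions

variable {E : Type*} [NormedAddCommGroup E] [NormedSpace ℝ E] [FiniteDimensional ℝ E]
  {H : Type*} [TopologicalSpace H] {I : ModelWithCorners ℝ E H}
  {M : Type*} [TopologicalSpace M] [ChartedSpace H M] [IsManifold I ∞ M]
  [MeasurableSpace E] [BorelSpace E] [MeasurableSpace M]

/-- A smooth function as an element of the Sobolev space. -/
def SobolevH1.ofSmooth (g : SmoothMetric I M) (u : M → ℝ) (hu : ContMDiff I 𝓘(ℝ, ℝ) ∞ u) :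
    SobolevH1 g where
  toFun := u
  diff := differential I u
  trace := u
  exists_approx := by
    have h0 : ∀ x, g.dualNorm x (differential I u x - differential I u x) = 0 := fun x => by
      rw [sub_self]
      exact covNorm_zero (g.posForm x)
    refine ⟨fun _ => u, fun _ => hu, ?_⟩
    simp only [h0]
    simp

theorem dualNorm_differential_const_mul (g : SmoothMetric I M) {u : M → ℝ}
    (hu : ContMDiff I 𝓘(ℝ, ℝ) ∞ u) {c : ℝ} (hc : 0 ≤ c) (x : M) :
    g.dualNorm x (differential I (fun y => c * u y) x) = c * g.dualNorm x (differential I u x) := by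
  have h2 : HasMFDerivAt 𝓘(ℝ, ℝ) 𝓘(ℝ, ℝ) (fun s : ℝ => c * s) (u x)
      (c • ContinuousLinearMap.id ℝ ℝ) :=
    ((hasFDerivAt_id (u x)).const_mul c).hasMFDerivAt
  have h1 : HasMFDerivAt I 𝓘(ℝ, ℝ) u x (diffForm (E := E) I u x : E →L[ℝ] ℝ) :=
    (hu.mdifferentiableAt (by simp)).hasMFDerivAt
  have h3 : (diffForm I (fun y => c * u y) x : E →L[ℝ] ℝ) = c • diffForm I u x := by
    have h4 : diffForm I (fun y => c * u y) x
        = (c • ContinuousLinearMap.id ℝ ℝ).comp (diffForm I u x) := (HasMFDerivAt.comp x h2 h1).mfderiv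
    rw [h4]
    ext v
    simp
  change covNorm (g.form x) (diffForm I (fun y => c * u y) x) = c * covNorm (g.form x) (diffForm I u x)
  rw [h3, covNorm_smul (g.posForm x), abs_of_nonneg hc]

theorem energy_ofSmooth_const_mul (g : SmoothMetric I M) {u : M → ℝ}
    (hu : ContMDiff I 𝓘(ℝ, ℝ) ∞ u) {c : ℝ} (hc : 0 ≤ c)
    (hcu : ContMDiff I 𝓘(ℝ, ℝ) ∞ fun x => c * u x) :
    energy g (SobolevH1.ofSmooth g _ hcu) = c ^ 2 * energy g (SobolevH1.ofSmooth g u hu) := by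
  have key : ∀ (μ : Measure M) (f : M → ℝ), ∫ x, f x * (c * u x) ^ 2 ∂μ
      = c ^ 2 * ∫ x, f x * u x ^ 2 ∂μ := fun μ f => by
    rw [← integral_const_mul]
    congr 1
    ext x
    ring
  have key' : ∀ k : ℝ, ∫ x, k * (c * g.dualNorm x (differential I u x)) ^ 2 ∂g.volume
      = c ^ 2 * ∫ x, k * g.dualNorm x (differential I u x) ^ 2 ∂g.volume := fun k => by
    rw [← integral_const_mul]
    congr 1
    ext x
    ring
  simp only [energy, SobolevH1.ofSmooth, dualNorm_differential_const_mul g hu hc, key, key']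
  ring

/-- The upper bound of a Yamabe constant by a positive smooth test function. -/
theorem yamabeConstant_le_of_smooth (g : SmoothMetric I M) {t : ℝ} (ht : 0 < t) (ht1 : t ≤ 1)
    (hn : 3 ≤ finrank ℝ E) {u : M → ℝ} (hu : ContMDiff I 𝓘(ℝ, ℝ) ∞ u) (hu0 : ∀ x, 0 < u x)
    {A Q : ℝ} (hA : 0 < A)
    (hAu : A ≤ ∫ x, u x ^ (2 * (finrank ℝ E : ℝ) / (finrank ℝ E - 2)) ∂g.volume)
    (hQ : energy g (SobolevH1.ofSmooth g u hu) ≤ Q) (hQ0 : 0 ≤ Q) :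
    yamabeConstant t g ≤ ((Q / (t * A) ^ (((finrank ℝ E : ℝ) - 2) / finrank ℝ E) : ℝ) : EReal) := by
  have hn' : (3 : ℝ) ≤ finrank ℝ E := by exact_mod_cast hn
  set n : ℝ := (finrank ℝ E : ℝ) with hndef
  have hp : 0 < 2 * n / (n - 2) := div_pos (by linarith) (by linarith)
  have hq : 0 < 2 * (n - 1) / (n - 2) := div_pos (by linarith) (by linarith)
  set p := 2 * n / (n - 2) with hpdef
  set q := 2 * (n - 1) / (n - 2)
  have hB : 0 ≤ (1 - t) * ∫ x, u x ^ q ∂g.boundaryMeasure :=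
    mul_nonneg (by linarith) (integral_nonneg fun x => Real.rpow_nonneg (hu0 x).le _)
  have hA' : 0 < t * ∫ x, u x ^ p ∂g.volume := mul_pos ht (hA.trans_le hAu)
  obtain ⟨c, hc, hc1, hc2⟩ := exists_scale hA' hB hp hq
  have hcu : ContMDiff I 𝓘(ℝ, ℝ) ∞ fun x => c * u x :=
    ((contDiff_const.mul contDiff_id : ContDiff ℝ ∞ fun s : ℝ => c * s)).contMDiff.comp hu
  have hpow : ∀ (s : ℝ) (x : M), |c * u x| ^ s = c ^ s * u x ^ s := fun s x => by
    rw [abs_of_pos (mul_pos hc (hu0 x)), Real.mul_rpow hc.le (hu0 x).le]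
  have hmem : SobolevH1.ofSmooth g _ hcu ∈ constraintSet t (1 - t) g := by
    refine ⟨?_, .of_forall fun x => mul_pos hc (hu0 x)⟩
    change t * (∫ x, |c * u x| ^ p ∂g.volume) + (1 - t) * (∫ x, |c * u x| ^ q ∂g.boundaryMeasure) = 1
    simp only [hpow]
    rw [integral_const_mul, integral_const_mul]
    refine Eq.trans ?_ hc1
    ring
  refine (iInf₂_le _ hmem).trans (EReal.coe_le_coe_iff.2 ?_)
  rw [energy_ofSmooth_const_mul g hu hc.le hcu]
  -- `(n-2)/n = 2/p`, so a bound on `c^p` becomes one on `c²`.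
  have hcsq : c ^ 2 ≤ ((t * A) ^ ((n - 2) / n))⁻¹ := by
    have e1 : c ^ 2 = (c ^ p) ^ ((n - 2) / n) := by
      rw [← Real.rpow_mul hc.le, ← Real.rpow_two]
      congr 1
      rw [hpdef]
      have : n - 2 ≠ 0 := by linarith
      have : n ≠ 0 := by linarith
      field_simp
    have h1 : c ^ p ≤ (t * A)⁻¹ := hc2.trans (by gcongr)
    rw [e1, ← Real.inv_rpow (by positivity)]
    refine Real.rpow_le_rpow (by positivity) h1 (div_nonneg (by linarith) (by linarith))
  calc c ^ 2 * energy g (SobolevH1.ofSmooth g u hu) ≤ c ^ 2 * Q := by gcongr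
    _ ≤ ((t * A) ^ ((n - 2) / n))⁻¹ * Q := by gcongr
    _ = Q / (t * A) ^ ((n - 2) / n) := by rw [inv_mul_eq_div]

end SmoothTestFunctions

/-! ### Volume and boundary measure of small balls in a chart. -/

section SmallBalls

variable {E : Type*} [NormedAddCommGroup E] [NormedSpace ℝ E] [FiniteDimensional ℝ E]
  {H : Type*} [TopologicalSpace H] {I : ModelWithCorners ℝ E H}
  {M : Type*} [TopologicalSpace M] [ChartedSpace H M] [IsManifold I ∞ M]

theorem exists_abs_le_of_continuousWithinAt {f : E → ℝ} {s : Set E} {y₀ : E}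
    (h : ContinuousWithinAt f s y₀) : ∃ C, 0 ≤ C ∧ ∃ r, 0 < r ∧ ∀ y ∈ s, ‖y - y₀‖ ≤ r → |f y| ≤ C := by
  have h1 := h.abs.eventually_lt_const (lt_add_one |f y₀|)
  obtain ⟨ε, hε, hb⟩ := Metric.mem_nhdsWithin_iff.1 h1
  refine ⟨|f y₀| + 1, by positivity, ε / 2, by positivity, fun y hy hyr => ?_⟩
  refine le_of_lt (hb ⟨?_, hy⟩)
  rw [Metric.mem_ball, dist_eq_norm]
  linarith

variable [MeasurableSpace E] [BorelSpace E] [MeasurableSpace M] [BorelSpace M]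

theorem SmoothMetric.exists_volume_ball_le (g : SmoothMetric I M) {x₀ : M} {y₀ : E}
    (hy₀ : y₀ ∈ (extChartAt I x₀).target) : ∃ C, 0 ≤ C ∧ ∃ r, 0 < r ∧ ∀ ρ, 0 ≤ ρ → ρ ≤ r →
      g.volume ((extChartAt I x₀).source ∩ extChartAt I x₀ ⁻¹' Metric.closedBall y₀ ρ)
        ≤ ENNReal.ofReal (C * ρ ^ finrank ℝ E) := by
  obtain ⟨C, hC, r, hr, hb⟩ :=
    exists_abs_le_of_continuousWithinAt (g.continuousWithinAt_det_coord hy₀)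
  set μ := (finBasis ℝ E).addHaar
  refine ⟨Real.sqrt C * (μ (Metric.ball 0 1)).toReal, by positivity, r, hr, fun ρ hρ hρr => ?_⟩
  have hU := measurableSet_source_inter_preimage (I := I) x₀
    (Metric.isClosed_closedBall (x := y₀) (ε := ρ)).measurableSet
  rw [g.volume_eq_chartVolume hU inter_subset_left, g.chartVolume_apply x₀ hU]
  have hsub : (extChartAt I x₀).target ∩ (extChartAt I x₀).symm ⁻¹' ((extChartAt I x₀).source ∩
      extChartAt I x₀ ⁻¹' Metric.closedBall y₀ ρ) ⊆ Metric.closedBall y₀ ρ := by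
    intro z hz
    have := hz.2.2
    rwa [mem_preimage, (extChartAt I x₀).right_inv hz.1] at this
  calc _ ≤ ∫⁻ _ in (extChartAt I x₀).target ∩ (extChartAt I x₀).symm ⁻¹'
        ((extChartAt I x₀).source ∩ extChartAt I x₀ ⁻¹' Metric.closedBall y₀ ρ),
        ENNReal.ofReal (Real.sqrt C) ∂μ := by
        refine setLIntegral_mono' (measurableSet_target_inter_preimage x₀ hU) fun z hz => ?_
        refine ENNReal.ofReal_le_ofReal (Real.sqrt_le_sqrt ((le_abs_self _).trans
          (hb z (extChartAt_target_subset_range x₀ hz.1) ?_)))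
        have := hsub hz
        rw [mem_closedBall_iff_norm] at this
        exact this.trans hρr
    _ ≤ ENNReal.ofReal (Real.sqrt C) * μ (Metric.closedBall y₀ ρ) := by
        rw [setLIntegral_const]
        gcongr
    _ = _ := by
        rw [Measure.addHaar_closedBall _ _ hρ, ← ENNReal.ofReal_toReal
          (Metric.isBounded_ball (x := (0 : E)) (r := 1)).measure_lt_top.ne,
          ← ENNReal.ofReal_mul (by positivity), ← ENNReal.ofReal_mul (by positivity)]
        rw [ENNReal.toReal_ofReal ENNReal.toReal_nonneg]
        congr 1
        ring

theorem SmoothMetric.exists_chartBoundaryMeasure_le (g : SmoothMetric I M) {x₀ : M} {y₀ : E}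
    (hy₀ : y₀ ∈ (extChartAt I x₀).target) (hk : y₀ ∈ LinearMap.ker (boundaryCovector I))
    (hker : ∀ z ∈ LinearMap.ker (boundaryCovector I), z ∈ Set.range I) :
    ∃ C, 0 ≤ C ∧ ∃ r, 0 < r ∧ ∀ ρ, 0 ≤ ρ → ρ ≤ r → ∀ A, MeasurableSet A →
      (∀ z ∈ LinearMap.ker (boundaryCovector I), (extChartAt I x₀).symm z ∈ A → ‖z - y₀‖ ≤ ρ) →
      g.chartBoundaryMeasure x₀ A
        ≤ ENNReal.ofReal (C * ρ ^ finrank ℝ (LinearMap.ker (boundaryCovector I))) := by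
  set b := finBasis ℝ (LinearMap.ker (boundaryCovector I)) with hb
  set dens : E → ℝ := fun y => Matrix.det (Matrix.of fun i j => g.inChart x₀ y (b i : E) (b j : E))
    with hdens
  have hc : ContinuousWithinAt dens (Set.range I) y₀ := by
    refine (contDiffWithinAt_det (n := ∞) fun i j => ?_).continuousWithinAt
    exact g.contDiffWithinAt_inChart hy₀ (b i : E) (b j : E)
  obtain ⟨C, hC, r, hr, hbd⟩ := exists_abs_le_of_continuousWithinAt hc
  set μ := b.addHaar
  refine ⟨Real.sqrt C * (μ (Metric.ball 0 1)).toReal, by positivity, r, hr,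
    fun ρ hρ hρr A hA hAz => ?_⟩
  set y' : LinearMap.ker (boundaryCovector I) := ⟨y₀, hk⟩
  set f : LinearMap.ker (boundaryCovector I) → M := fun z => (extChartAt I x₀).symm (z : E)
  have hsub : f ⁻¹' A ⊆ Metric.closedBall y' ρ := fun z hz => by
    rw [mem_closedBall_iff_norm]
    exact hAz z z.2 hz
  have hmc : MeasurableSet (Metric.closedBall y' ρ) := Metric.isClosed_closedBall.measurableSet
  have h1 : g.chartBoundaryMeasure x₀ A ≤ ∫⁻ z in Metric.closedBall y' ρ,
      ENNReal.ofReal (Real.sqrt (dens (z : E))) ∂μ := by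
    have h2 : g.chartBoundaryMeasure x₀ = Measure.map f
      ((μ.restrict {z | (z : E) ∈ (extChartAt I x₀).target}).withDensity
        fun z => ENNReal.ofReal (Real.sqrt (dens (z : E)))) := rfl
    rw [h2]
    -- `Measure.map` is zero for a map that is not almost everywhere measurable, so the upper bound
    -- holds in either case.
    by_cases hf : AEMeasurable f ((μ.restrict {z | (z : E) ∈ (extChartAt I x₀).target}).withDensity
        fun z => ENNReal.ofReal (Real.sqrt (dens (z : E))))
    · rw [Measure.map_apply_of_aemeasurable hf hA]
      refine (measure_mono hsub).trans ?_
      rw [withDensity_apply _ hmc]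
      exact lintegral_mono' (Measure.restrict_mono_measure Measure.restrict_le_self _) le_rfl
    · rw [Measure.map_of_not_aemeasurable hf]
      simp
  refine h1.trans ?_
  calc _ ≤ ∫⁻ _ in Metric.closedBall y' ρ, ENNReal.ofReal (Real.sqrt C) ∂μ := by
        refine setLIntegral_mono' hmc fun z hz => ?_
        refine ENNReal.ofReal_le_ofReal (Real.sqrt_le_sqrt ((le_abs_self _).trans
          (hbd z (hker z z.2) ?_)))
        rw [mem_closedBall_iff_norm] at hz
        exact le_trans hz hρr
    _ = ENNReal.ofReal (Real.sqrt C) * μ (Metric.closedBall y' ρ) := setLIntegral_const _ _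
    _ = _ := by
        rw [Measure.addHaar_closedBall _ _ hρ, ← ENNReal.ofReal_toReal
          (Metric.isBounded_ball (x := (0 : LinearMap.ker (boundaryCovector I)))
            (r := 1)).measure_lt_top.ne,
          ← ENNReal.ofReal_mul (by positivity), ← ENNReal.ofReal_mul (by positivity)]
        rw [ENNReal.toReal_ofReal ENNReal.toReal_nonneg]
        congr 1
        ring

end SmallBalls

/-! ### The two stereographic charts of the hemisphere. -/

section HemisphereCharts

variable {n : ℕ} [NeZero n]

theorem range_halfSpaceModel : Set.range (𝓡∂ n) = {y : EuclideanSpace ℝ (Fin n) | 0 ≤ y 0} :=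
  range_modelWithCornersEuclideanHalfSpace n

/-- The covector is an arbitrary choice, but the choice satisfies its specification because the
zeroth coordinate does; only its sign, and hence its kernel, matter. -/
theorem boundaryCovector_nonneg_iff (y : EuclideanSpace ℝ (Fin n)) :
    0 ≤ boundaryCovector (𝓡∂ n) y ↔ 0 ≤ y 0 := by
  have h : Set.range (𝓡∂ n) = {y | 0 ≤ boundaryCovector (𝓡∂ n) y} :=
    Classical.epsilon_spec (p := fun ℓ : EuclideanSpace ℝ (Fin n) →ₗ[ℝ] ℝ =>
      Set.range (𝓡∂ n) = {y | 0 ≤ ℓ y})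
      ⟨(EuclideanSpace.proj (0 : Fin n) : EuclideanSpace ℝ (Fin n) →L[ℝ] ℝ).toLinearMap,
        range_halfSpaceModel⟩
  rw [range_halfSpaceModel] at h
  exact (Set.ext_iff.1 h y).symm

theorem mem_ker_boundaryCovector_iff (y : EuclideanSpace ℝ (Fin n)) :
    y ∈ LinearMap.ker (boundaryCovector (𝓡∂ n)) ↔ y 0 = 0 := by
  have h1 := boundaryCovector_nonneg_iff y
  have h2 := boundaryCovector_nonneg_iff (-y)
  rw [map_neg, PiLp.neg_apply, neg_nonneg, neg_nonneg] at h2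
  rw [LinearMap.mem_ker]
  constructor
  · intro h
    exact le_antisymm (h2.1 h.le) (h1.1 h.ge)
  · intro h
    exact le_antisymm (h2.2 h.le) (h1.2 h.ge)

theorem boundaryCovector_ne_zero : boundaryCovector (𝓡∂ n) ≠ 0 := by
  intro h
  have h1 := (mem_ker_boundaryCovector_iff (EuclideanSpace.single (0 : Fin n) (1 : ℝ))).1
    (by rw [h]; simp)
  simp at h1

theorem le_finrank_ker_boundaryCovector :
    n - 1 ≤ finrank ℝ (LinearMap.ker (boundaryCovector (𝓡∂ n))) := by
  have h := LinearMap.finrank_range_add_finrank_ker (boundaryCovector (𝓡∂ n))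
  have h1 : finrank ℝ (LinearMap.range (boundaryCovector (𝓡∂ n))) ≤ 1 := by
    simpa using Submodule.finrank_le (LinearMap.range (boundaryCovector (𝓡∂ n)))
  rw [finrank_euclideanSpace_fin] at h
  omega

theorem chartAt_hemisphere {p : Hemisphere n} (hp : p.1.2 ≠ 1) :
    chartAt (EuclideanHalfSpace n) p = Hemisphere.stereoChart 1 (one_pow 2) := by
  have h : Hemisphere.centre p = 1 := if_neg hp
  change Hemisphere.stereoChart (Hemisphere.centre p) (Hemisphere.centre_sq p) = _
  congr

theorem chartAt_hemisphere_of_eq {p : Hemisphere n} (hp : p.1.2 = 1) :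
    chartAt (EuclideanHalfSpace n) p = Hemisphere.stereoChart (-1) (by norm_num) := by
  have h : Hemisphere.centre p = -1 := if_pos hp
  change Hemisphere.stereoChart (Hemisphere.centre p) (Hemisphere.centre_sq p) = _
  congr

/-- The stereographic projection from the point `(0, 1)`, with junk value `0` there. -/
def stereo (p : Hemisphere n) : EuclideanSpace ℝ (Fin n) := (1 - p.1.2)⁻¹ • p.1.1

theorem extChartAt_hemisphere {p : Hemisphere n} (hp : p.1.2 ≠ 1) (q : Hemisphere n) :
    extChartAt (𝓡∂ n) p q = stereo q := by
  rw [extChartAt, chartAt_hemisphere hp]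
  change (1 - 1 * q.1.2)⁻¹ • q.1.1 = _
  rw [one_mul, stereo]

theorem extChartAt_hemisphere_congr {p q : Hemisphere n} (hp : p.1.2 ≠ 1) (hq : q.1.2 ≠ 1) :
    extChartAt (𝓡∂ n) p = extChartAt (𝓡∂ n) q := by
  rw [extChartAt, extChartAt, chartAt_hemisphere hp, chartAt_hemisphere hq]

theorem extChartAt_hemisphere_source {p : Hemisphere n} (hp : p.1.2 ≠ 1) :
    (extChartAt (𝓡∂ n) p).source = {q | q.1.2 ≠ 1} := by
  rw [extChartAt_source, chartAt_hemisphere hp]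
  ext q
  change 1 * q.1.2 ≠ 1 ↔ _
  rw [one_mul]
  rfl

theorem extChartAt_hemisphere_target (p : Hemisphere n) :
    (extChartAt (𝓡∂ n) p).target = Set.range (𝓡∂ n) := by
  rw [extChartAt_target]
  have : (chartAt (EuclideanHalfSpace n) p).target = univ := rfl
  rw [this, preimage_univ, univ_inter]

theorem stereo_extChartAt_symm_of_eq {p : Hemisphere n} (hp : p.1.2 = 1)
    {y : EuclideanSpace ℝ (Fin n)} (hy : 0 ≤ y 0) (h0 : y ≠ 0) :
    stereo ((extChartAt (𝓡∂ n) p).symm y) = (1 / ‖y‖) ^ 2 • y := by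
  have h1 : (𝓡∂ n).symm y = ⟨y, hy⟩ := (𝓡∂ n).left_inv ⟨y, hy⟩
  rw [extChartAt, chartAt_hemisphere_of_eq hp]
  change stereo (Hemisphere.stereoInv (-1) (by norm_num) ((𝓡∂ n).symm y)) = _
  rw [h1]
  change (1 - -1 * ((‖y‖ ^ 2 - 1) / (‖y‖ ^ 2 + 1)))⁻¹ • (2 / (‖y‖ ^ 2 + 1)) • y = _
  rw [smul_smul]
  congr 1
  have := norm_pos_iff.2 h0
  have e : 1 - -1 * ((‖y‖ ^ 2 - 1) / (‖y‖ ^ 2 + 1)) = 2 * ‖y‖ ^ 2 / (‖y‖ ^ 2 + 1) := by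
    field_simp
    ring
  rw [e]
  field_simp

theorem norm_stereo_sq {p : Hemisphere n} (hp : p.1.2 ≠ 1) :
    ‖stereo p‖ ^ 2 = (1 + p.1.2) / (1 - p.1.2) := by
  have h1 : ‖p.1.1‖ ^ 2 = (1 - p.1.2) * (1 + p.1.2) := by
    have := p.2.1
    linear_combination this
  have h2 : 1 - p.1.2 ≠ 0 := fun h => hp (by linarith)
  rw [stereo, norm_smul, mul_pow, h1, Real.norm_eq_abs, sq_abs]
  field_simp

/-- All points except `(0, 1)` share one preferred chart, so the curvature, defined through the
chart at each point, is there one coordinate function composed with `stereo`. Naturality at boundary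
points is thereby avoided. -/
theorem scalarCurvature_hemisphere (g : SmoothMetric (𝓡∂ n) (Hemisphere n)) {p₀ p : Hemisphere n}
    (hp₀ : p₀.1.2 ≠ 1) (hp : p.1.2 ≠ 1) : g.scalarCurvature p
      = scalarCurvatureCoord (Set.range (𝓡∂ n)) (g.coord p₀) (stereo p) := by
  have h : g.coord p = g.coord p₀ := by
    funext y
    unfold SmoothMetric.coord SmoothMetric.inChart
    rw [extChartAt_hemisphere_congr hp hp₀]
  rw [SmoothMetric.scalarCurvature, h, extChartAt_hemisphere hp]

theorem meanCurvature_hemisphere (g : SmoothMetric (𝓡∂ n) (Hemisphere n)) {p₀ p : Hemisphere n}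
    (hp₀ : p₀.1.2 ≠ 1) (hp : p.1.2 ≠ 1) : g.meanCurvature p
      = meanCurvatureCoord (Set.range (𝓡∂ n)) (g.coord p₀) (boundaryCovector (𝓡∂ n)) (stereo p) := by
  have h : g.coord p = g.coord p₀ := by
    funext y
    unfold SmoothMetric.coord SmoothMetric.inChart
    rw [extChartAt_hemisphere_congr hp hp₀]
  rw [SmoothMetric.meanCurvature, h, extChartAt_hemisphere hp]

end HemisphereCharts

/-! ### Bounds on small caps around a boundary point. -/

section Cap

variable {n : ℕ} [NeZero n]

/-- The point `(0, 1)` of the equator. -/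
def northPole (n : ℕ) [NeZero n] : Hemisphere n := ⟨(0, 1), by simp, by simp⟩

theorem stereo_eq_zero {p : Hemisphere n} (hp : p.1.2 = 1) : stereo p = 0 := by
  rw [stereo, hp]
  simp

/-- A neighbourhood of the point with stereographic coordinates `y₀`. -/
def cap (y₀ : EuclideanSpace ℝ (Fin n)) (ρ : ℝ) : Set (Hemisphere n) :=
  {p | p.1.2 ≠ 1 ∧ ‖stereo p - y₀‖ ≤ ρ}

theorem cap_eq {p₀ : Hemisphere n} (hp₀ : p₀.1.2 ≠ 1) (y₀ : EuclideanSpace ℝ (Fin n)) (ρ : ℝ) :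
    cap y₀ ρ = (extChartAt (𝓡∂ n) p₀).source ∩ extChartAt (𝓡∂ n) p₀ ⁻¹' Metric.closedBall y₀ ρ := by
  rw [extChartAt_hemisphere_source hp₀]
  ext p
  simp only [cap, mem_inter_iff, mem_preimage, mem_closedBall_iff_norm, extChartAt_hemisphere hp₀,
    Set.mem_ofPred_eq]

theorem measurableSet_cap {p₀ : Hemisphere n} (hp₀ : p₀.1.2 ≠ 1) (y₀ : EuclideanSpace ℝ (Fin n))
    (ρ : ℝ) : MeasurableSet (cap y₀ ρ) := by
  rw [cap_eq hp₀]
  exact measurableSet_source_inter_preimage _ Metric.isClosed_closedBall.measurableSet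

theorem chartBoundaryMeasure_congr (g : SmoothMetric (𝓡∂ n) (Hemisphere n)) {p q : Hemisphere n}
    (h : extChartAt (𝓡∂ n) p = extChartAt (𝓡∂ n) q) :
    g.chartBoundaryMeasure p = g.chartBoundaryMeasure q := by
  unfold SmoothMetric.chartBoundaryMeasure SmoothMetric.inChart
  rw [h]

/-- Only two charts occur as preferred charts, so the supremum of measures is at most a sum of two.
This crude bound replaces a change of variables on the boundary. -/
theorem boundaryMeasure_le (g : SmoothMetric (𝓡∂ n) (Hemisphere n)) {p₀ : Hemisphere n}
    (hp₀ : p₀.1.2 ≠ 1) :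
    g.boundaryMeasure ≤ g.chartBoundaryMeasure p₀ + g.chartBoundaryMeasure (northPole n) := by
  refine Measure.restrict_le_self.trans (iSup_le fun p => ?_)
  by_cases hp : p.1.2 = 1
  · rw [chartBoundaryMeasure_congr g (p := p) (q := northPole n)]
    · exact Measure.le_add_left le_rfl
    · rw [extChartAt, extChartAt, chartAt_hemisphere_of_eq hp, chartAt_hemisphere_of_eq rfl]
  · rw [chartBoundaryMeasure_congr g (extChartAt_hemisphere_congr hp hp₀)]
    exact Measure.le_add_right le_rfl

/-- The transition between the two charts is the inversion `z ↦ z / |z|²`. It fixes the unit vector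
`y₀`, and near it distorts distances by the factor `|z| ≤ 2`. This is why the concentration point is
taken on the unit sphere: a cap is a small ball in both charts. -/
theorem norm_sub_le_of_inversion {W : Type*} [NormedAddCommGroup W] [InnerProductSpace ℝ W]
    {z y₀ : W} (hz : z ≠ 0) (hy₀ : ‖y₀‖ = 1) {ρ : ℝ} (hρ : ρ ≤ 1 / 2)
    (h : ‖(1 / ‖z‖) ^ 2 • z - y₀‖ ≤ ρ) : ‖z - y₀‖ ≤ 2 * ρ := by
  have hz0 := norm_pos_iff.2 hz
  have h1 := dist_div_norm_sq_smul hz (norm_ne_zero_iff.1 (by rw [hy₀]; exact one_ne_zero)) 1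
  rw [hy₀, div_one, one_pow, one_smul, mul_one, dist_eq_norm, dist_eq_norm] at h1
  have h2 : ‖(1 / ‖z‖) ^ 2 • z‖ = ‖z‖⁻¹ := by
    rw [norm_smul, Real.norm_eq_abs, abs_of_nonneg (by positivity)]
    field_simp
  have h3 : 1 / 2 ≤ ‖z‖⁻¹ := by
    rw [← h2]
    have := norm_sub_norm_le y₀ ((1 / ‖z‖) ^ 2 • z)
    rw [hy₀, norm_sub_rev] at this
    linarith
  have h4 : ‖z‖ ≤ 2 := by
    rw [one_div] at h3
    exact (inv_le_inv₀ two_pos hz0).1 h3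
  have h5 : ‖z - y₀‖ = ‖z‖ * ‖(1 / ‖z‖) ^ 2 • z - y₀‖ := by
    rw [h1]
    field_simp
  rw [h5]
  have := norm_nonneg ((1 / ‖z‖) ^ 2 • z - y₀)
  nlinarith

theorem exists_boundaryMeasure_cap_le (g : SmoothMetric (𝓡∂ n) (Hemisphere n)) {p₀ : Hemisphere n}
    (hp₀ : p₀.1.2 ≠ 1) {y₀ : EuclideanSpace ℝ (Fin n)} (hy₀ : ‖y₀‖ = 1) (hy₀0 : y₀ 0 = 0) :
    ∃ C, 0 ≤ C ∧ ∃ r, 0 < r ∧ ∀ ρ, 0 ≤ ρ → ρ ≤ r →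
      g.boundaryMeasure (cap y₀ ρ) ≤ ENNReal.ofReal (C * ρ ^ (n - 1)) := by
  have hk := (mem_ker_boundaryCovector_iff y₀).2 hy₀0
  have hrange : ∀ z : EuclideanSpace ℝ (Fin n), z 0 = 0 → z ∈ Set.range (𝓡∂ n) := fun z hz => by
    rw [range_halfSpaceModel]; exact hz.ge
  have hker : ∀ z ∈ LinearMap.ker (boundaryCovector (𝓡∂ n)), z ∈ Set.range (𝓡∂ n) := fun z hz =>
    hrange z ((mem_ker_boundaryCovector_iff z).1 hz)
  have ht : ∀ p : Hemisphere n, y₀ ∈ (extChartAt (𝓡∂ n) p).target := fun p => by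
    rw [extChartAt_hemisphere_target]; exact hrange y₀ hy₀0
  obtain ⟨C₁, hC₁, r₁, hr₁, h₁⟩ := g.exists_chartBoundaryMeasure_le (ht p₀) hk hker
  obtain ⟨C₂, hC₂, r₂, hr₂, h₂⟩ := g.exists_chartBoundaryMeasure_le (ht (northPole n)) hk hker
  have hfin := le_finrank_ker_boundaryCovector (n := n)
  set d := finrank ℝ (LinearMap.ker (boundaryCovector (𝓡∂ n)))
  refine ⟨(C₁ + C₂) * 2 ^ (n - 1), by positivity, min (min r₁ (r₂ / 2)) (1 / 2), by positivity,
    fun ρ hρ hρr => ?_⟩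
  have hρ₁ : ρ ≤ r₁ := hρr.trans ((min_le_left _ _).trans (min_le_left _ _))
  have hρ₂ : 2 * ρ ≤ r₂ := by
    have := hρr.trans ((min_le_left _ _).trans (min_le_right _ _))
    linarith
  have hρ₃ : ρ ≤ 1 / 2 := hρr.trans (min_le_right _ _)
  have hm := measurableSet_cap hp₀ y₀ ρ
  have e₁ := h₁ ρ hρ hρ₁ _ hm fun z hz hzc => by
    have h := hzc.2
    rwa [← extChartAt_hemisphere hp₀, (extChartAt (𝓡∂ n) p₀).right_inv
      (by rw [extChartAt_hemisphere_target]; exact hker z hz)] at h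
  have e₂ := h₂ (2 * ρ) (by linarith) hρ₂ _ hm fun z hz hzc => by
    have h := hzc.2
    have hz0 : z ≠ 0 := by
      rintro rfl
      apply hzc.1
      have h0 : extChartAt (𝓡∂ n) (northPole n) (northPole n) = 0 := by
        rw [extChartAt, chartAt_hemisphere_of_eq rfl]
        change (1 - -1 * (1 : ℝ))⁻¹ • (0 : EuclideanSpace ℝ (Fin n)) = 0
        rw [smul_zero]
      rw [← h0, (extChartAt (𝓡∂ n) (northPole n)).left_inv (mem_extChartAt_source _)]
      rfl
    rw [stereo_extChartAt_symm_of_eq rfl ((mem_ker_boundaryCovector_iff z).1 hz).ge hz0] at h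
    exact norm_sub_le_of_inversion hz0 hy₀ hρ₃ h
  have hpow : ∀ x : ℝ, 0 ≤ x → x ≤ 2 * ρ → x ^ d ≤ 2 ^ (n - 1) * ρ ^ (n - 1) := fun x hx hx' =>
    (pow_le_pow_of_le_one hx (by linarith) hfin).trans (by
      rw [← mul_pow]
      exact pow_le_pow_left₀ hx hx' _)
  calc g.boundaryMeasure (cap y₀ ρ)
      ≤ g.chartBoundaryMeasure p₀ (cap y₀ ρ) + g.chartBoundaryMeasure (northPole n) (cap y₀ ρ) :=
        boundaryMeasure_le g hp₀ _
    _ ≤ ENNReal.ofReal (C₁ * ρ ^ d) + ENNReal.ofReal (C₂ * (2 * ρ) ^ d) := add_le_add e₁ e₂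
    _ = ENNReal.ofReal (C₁ * ρ ^ d + C₂ * (2 * ρ) ^ d) :=
        (ENNReal.ofReal_add (by positivity) (by positivity)).symm
    _ ≤ _ := by
        refine ENNReal.ofReal_le_ofReal ?_
        have i₁ := mul_le_mul_of_nonneg_left (hpow ρ hρ (by linarith)) hC₁
        have i₂ := mul_le_mul_of_nonneg_left (hpow (2 * ρ) (by linarith) le_rfl) hC₂
        linarith

/-- The sum is the squared dual norm of `ℓ`, a sum of squares in an orthonormal basis that vanishes
only for `ℓ = 0`. -/
theorem sum_gradCoord_pos (g : SmoothMetric (𝓡∂ n) (Hemisphere n)) {p₀ : Hemisphere n}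
    {y₀ : EuclideanSpace ℝ (Fin n)} (hy₀ : y₀ ∈ (extChartAt (𝓡∂ n) p₀).target)
    {ℓ : EuclideanSpace ℝ (Fin n) →ₗ[ℝ] ℝ} (hℓ : ℓ ≠ 0) :
    0 < ∑ i, gradCoord (g.coord p₀) ℓ y₀ i * ℓ (finBasis ℝ _ i) := by
  set α : EuclideanSpace ℝ (Fin n) →L[ℝ] ℝ := LinearMap.toContinuousLinearMap ℓ with hα
  have h1 : ∑ i, gradCoord (g.coord p₀) ℓ y₀ i * ℓ (finBasis ℝ _ i)
      = dualNormSq (g.chartForm p₀ y₀) α := by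
    simp only [gradCoord, dualNormSq, Finset.sum_mul, g.coord_eq]
    refine Finset.sum_congr rfl fun i _ => Finset.sum_congr rfl fun j _ => ?_
    simp only [hα, LinearMap.coe_toContinuousLinearMap']
    ring
  obtain ⟨e, he⟩ := exists_orthonormal_basis (g.chartForm p₀ y₀) (g.chartForm_symm p₀ y₀)
    (g.chartForm_pos hy₀)
  rw [h1, dualNormSq_eq_sum_sq he]
  refine lt_of_le_of_ne (Finset.sum_nonneg fun i _ => sq_nonneg _) fun h => hℓ (e.ext fun i => ?_)
  have h2 := (Finset.sum_eq_zero_iff_of_nonneg fun i _ => sq_nonneg (α (e i))).1 h.symm i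
    (Finset.mem_univ i)
  exact pow_eq_zero_iff two_ne_zero |>.1 h2

/-- The bounds which make the lower order terms of the energy of a concentrated function small. -/
theorem exists_cap_bounds (g : SmoothMetric (𝓡∂ n) (Hemisphere n)) {p₀ : Hemisphere n}
    (hp₀ : p₀.1.2 ≠ 1) {y₀ : EuclideanSpace ℝ (Fin n)} (hy₀ : ‖y₀‖ = 1) (hy₀0 : y₀ 0 = 0) :
    ∃ C, 0 ≤ C ∧ ∃ r, 0 < r ∧ ∀ ρ, 0 ≤ ρ → ρ ≤ r →
      g.volume (cap y₀ ρ) ≤ ENNReal.ofReal (C * ρ ^ n) ∧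
      g.boundaryMeasure (cap y₀ ρ) ≤ ENNReal.ofReal (C * ρ ^ (n - 1)) ∧
      ∀ p ∈ cap y₀ ρ, |g.scalarCurvature p| ≤ C ∧ |g.meanCurvature p| ≤ C := by
  have hyr : y₀ ∈ Set.range (𝓡∂ n) := by rw [range_halfSpaceModel]; exact hy₀0.ge
  have hy : y₀ ∈ (extChartAt (𝓡∂ n) p₀).target := by rwa [extChartAt_hemisphere_target]
  obtain ⟨C₁, hC₁, r₁, hr₁, h₁⟩ := g.exists_volume_ball_le hy
  obtain ⟨C₂, hC₂, r₂, hr₂, h₂⟩ := exists_boundaryMeasure_cap_le g hp₀ hy₀ hy₀0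
  obtain ⟨C₃, hC₃, r₃, hr₃, h₃⟩ := exists_abs_le_of_continuousWithinAt
    (contDiffWithinAt_scalarCurvatureCoord (𝓡∂ n).uniqueDiffOn hyr
      (fun i j => g.contDiffWithinAt_coord hy i j) (g.det_coord_pos hy).ne').continuousWithinAt
  obtain ⟨C₄, hC₄, r₄, hr₄, h₄⟩ := exists_abs_le_of_continuousWithinAt
    (contDiffWithinAt_meanCurvatureCoord (𝓡∂ n).uniqueDiffOn hyr
      (fun i j => g.contDiffWithinAt_coord hy i j) (g.det_coord_pos hy).ne' _
      (sum_gradCoord_pos g hy boundaryCovector_ne_zero)).continuousWithinAt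
  refine ⟨C₁ + C₂ + C₃ + C₄, by positivity, min (min r₁ r₂) (min r₃ r₄), by positivity,
    fun ρ hρ hρr => ⟨?_, ?_, fun p hp => ?_⟩⟩
  · rw [cap_eq hp₀]
    have h := h₁ ρ hρ (hρr.trans ((min_le_left _ _).trans (min_le_left _ _)))
    rw [finrank_euclideanSpace_fin] at h
    refine h.trans (ENNReal.ofReal_le_ofReal (mul_le_mul_of_nonneg_right ?_ (by positivity)))
    linarith
  · refine (h₂ ρ hρ (hρr.trans ((min_le_left _ _).trans (min_le_right _ _)))).trans
      (ENNReal.ofReal_le_ofReal (mul_le_mul_of_nonneg_right ?_ (by positivity)))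
    linarith
  · have hpr : stereo p ∈ Set.range (𝓡∂ n) := by
      rw [← extChartAt_hemisphere hp₀]
      exact extChartAt_target_subset_range p₀ ((extChartAt (𝓡∂ n) p₀).map_source
        (by rw [extChartAt_hemisphere_source hp₀]; exact hp.1))
    rw [scalarCurvature_hemisphere g hp₀ hp.1, meanCurvature_hemisphere g hp₀ hp.1]
    have i₃ := h₃ _ hpr (hp.2.trans (hρr.trans ((min_le_right _ _).trans (min_le_left _ _))))
    have i₄ := h₄ _ hpr (hp.2.trans (hρr.trans ((min_le_right _ _).trans (min_le_right _ _))))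
    constructor <;> linarith

end Cap

/-! ### Continuity of Gram matrices and their inverses. -/

section ContinuousGram

variable {X E : Type*} [TopologicalSpace X] [NormedAddCommGroup E] [NormedSpace ℝ E]
  {ι : Type*} [Fintype ι] [DecidableEq ι] {B : X → E →L[ℝ] E →L[ℝ] ℝ} {s : Set X} {v : ι → E}

theorem continuousOn_gram (h : ∀ i j, ContinuousOn (fun z => B z (v i) (v j)) s) :
    ContinuousOn (fun z => gram (B z) v) s :=
  continuousOn_pi.2 fun i => continuousOn_pi.2 fun j => h i j

theorem continuousOn_det_gram (h : ∀ i j, ContinuousOn (fun z => B z (v i) (v j)) s) :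
    ContinuousOn (fun z => (gram (B z) v).det) s :=
  (continuous_id.matrix_det).comp_continuousOn (continuousOn_gram h)

theorem continuousOn_inv_gram (h : ∀ i j, ContinuousOn (fun z => B z (v i) (v j)) s)
    (hdet : ∀ z ∈ s, (gram (B z) v).det ≠ 0) (i j : ι) :
    ContinuousOn (fun z => (gram (B z) v)⁻¹ i j) s := by
  simp only [Matrix.inv_def, Ring.inverse_eq_inv', Matrix.smul_apply, smul_eq_mul]
  exact ((continuousOn_det_gram h).inv₀ hdet).mul
    (((continuous_id.matrix_adjugate).matrix_elem i j).comp_continuousOn (continuousOn_gram h))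

end ContinuousGram

/-! ### Functions concentrated at a boundary point. -/

section Zoom

variable {n : ℕ} [NeZero n]

/-- The function `k`, concentrated at the point with stereographic coordinates `y₀`. -/
def zoom (T : EuclideanSpace ℝ (Fin n) ≃L[ℝ] EuclideanSpace ℝ (Fin n)) (y₀ : EuclideanSpace ℝ (Fin n))
    (k : EuclideanSpace ℝ (Fin n) → ℝ) (δ : ℝ) (p : Hemisphere n) : ℝ :=
  k (δ⁻¹ • T.symm (stereo p - y₀))

variable {T : EuclideanSpace ℝ (Fin n) ≃L[ℝ] EuclideanSpace ℝ (Fin n)}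
  {y₀ : EuclideanSpace ℝ (Fin n)} {k : EuclideanSpace ℝ (Fin n) → ℝ} {δ ρ : ℝ}

theorem norm_sub_le_of_zoom_ne_zero (hδ : 0 < δ) (hρ : ∀ x, k x ≠ 0 → ‖x‖ ≤ ρ) {p : Hemisphere n}
    (h : zoom T y₀ k δ p ≠ 0) :
    ‖stereo p - y₀‖ ≤ ‖(T : EuclideanSpace ℝ (Fin n) →L[ℝ] EuclideanSpace ℝ (Fin n))‖ * (δ * ρ) := by
  have h1 := hρ _ h
  have h2 : stereo p - y₀ = (T : EuclideanSpace ℝ (Fin n) →L[ℝ] EuclideanSpace ℝ (Fin n))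
      (δ • (δ⁻¹ • T.symm (stereo p - y₀))) := by
    rw [smul_inv_smul₀ hδ.ne']
    exact (T.apply_symm_apply _).symm
  rw [h2]
  refine (ContinuousLinearMap.le_opNorm _ _).trans ?_
  rw [norm_smul, Real.norm_eq_abs, abs_of_pos hδ]
  gcongr

variable (hy₀ : ‖y₀‖ = 1) (hδ : 0 < δ) (hρ : ∀ x, k x ≠ 0 → ‖x‖ ≤ ρ)
  (hsmall : ‖(T : EuclideanSpace ℝ (Fin n) →L[ℝ] EuclideanSpace ℝ (Fin n))‖ * (δ * ρ) < 1)

include hy₀ hδ hρ hsmall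

/-- At `(0, 1)` the default value of `stereo` is `0`, at distance `1` from `y₀` and so outside the
small support. -/
theorem mem_cap_of_zoom_ne_zero {p : Hemisphere n} (h : zoom T y₀ k δ p ≠ 0) :
    p ∈ cap y₀ (‖(T : EuclideanSpace ℝ (Fin n) →L[ℝ] EuclideanSpace ℝ (Fin n))‖ * (δ * ρ)) := by
  have h1 := norm_sub_le_of_zoom_ne_zero hδ hρ h
  refine ⟨fun hp => ?_, h1⟩
  rw [stereo_eq_zero hp, zero_sub, norm_neg, hy₀] at h1
  linarith

/-- Where the last coordinate exceeds `3/5`, `|stereo|² = (1+s)/(1-s) ≥ 4`, while the support lies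
within distance less than `1` of a unit vector. So the function extends smoothly by zero over the
centre of the projection. -/
theorem eventually_zoom_eq_zero {p : Hemisphere n} (hp : p.1.2 = 1) :
    ∀ᶠ q in 𝓝 p, zoom T y₀ k δ q = 0 := by
  have hc : Continuous fun q : Hemisphere n => q.1.2 := by fun_prop
  have h1 : ∀ᶠ q : Hemisphere n in 𝓝 p, 3 / 5 < q.1.2 :=
    hc.continuousAt.eventually_const_lt (by change 3 / 5 < p.1.2; rw [hp]; norm_num)
  filter_upwards [h1] with q hq
  by_contra h
  obtain ⟨hq1, hq2⟩ := mem_cap_of_zoom_ne_zero hy₀ hδ hρ hsmall h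
  have h2 : q.1.2 < 1 := by
    refine lt_of_le_of_ne ?_ hq1
    have := q.2.1
    nlinarith [sq_nonneg ‖q.1.1‖]
  have h3 : (2 : ℝ) ^ 2 ≤ ‖stereo q‖ ^ 2 := by
    rw [norm_stereo_sq hq1, le_div_iff₀ (by linarith)]
    linarith
  have h4 : 2 ≤ ‖stereo q‖ := le_of_sq_le_sq h3 (norm_nonneg _)
  have := norm_sub_norm_le (stereo q) y₀
  linarith

theorem contMDiff_zoom (hk : ContDiff ℝ ∞ k) :
    ContMDiff (𝓡∂ n) 𝓘(ℝ, ℝ) ∞ (zoom T y₀ k δ) := by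
  intro p
  by_cases hp : p.1.2 = 1
  · exact contMDiffAt_const.congr_of_eventuallyEq (eventually_zoom_eq_zero hy₀ hδ hρ hsmall hp)
  · have h1 : ContMDiffAt (𝓡∂ n) 𝓘(ℝ, EuclideanSpace ℝ (Fin n)) ∞ stereo p := by
      have := contMDiffAt_extChartAt (I := 𝓡∂ n) (n := ∞) (x := p)
      refine this.congr_of_eventuallyEq (.of_forall fun q => (extChartAt_hemisphere hp q).symm)
    have h2 : ContDiff ℝ ∞ fun y : EuclideanSpace ℝ (Fin n) => k (δ⁻¹ • T.symm (y - y₀)) :=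
      hk.comp ((T.symm.contDiff.comp (contDiff_id.sub contDiff_const)).const_smul _)
    exact h2.contMDiff.contMDiffAt.comp p h1

end Zoom

/-! ### Scaled coordinates at the concentration point. -/

section ZoomParam

variable {n : ℕ} [NeZero n] (g : SmoothMetric (𝓡∂ n) (Hemisphere n)) (p₀ : Hemisphere n)
  (T : EuclideanSpace ℝ (Fin n) ≃L[ℝ] EuclideanSpace ℝ (Fin n)) (y₀ : EuclideanSpace ℝ (Fin n))

/-- The half-space, in the coordinates given by `T`. -/
def tiltedHalfSpace : Set (EuclideanSpace ℝ (Fin n)) := {x | 0 ≤ T x 0}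

/-- The metric in the coordinates `x ↦ y₀ + T x`. -/
def tiltedForm (z : EuclideanSpace ℝ (Fin n)) :
    EuclideanSpace ℝ (Fin n) →L[ℝ] EuclideanSpace ℝ (Fin n) →L[ℝ] ℝ :=
  (g.chartForm p₀ (y₀ + T z)).bilinearComp
    (T : EuclideanSpace ℝ (Fin n) →L[ℝ] EuclideanSpace ℝ (Fin n))
    (T : EuclideanSpace ℝ (Fin n) →L[ℝ] EuclideanSpace ℝ (Fin n))

/-- The inverse chart, with the coordinates scaled by `δ`. -/
def zoomParam (δ : ℝ) (x : EuclideanSpace ℝ (Fin n)) : Hemisphere n :=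
  (extChartAt (𝓡∂ n) p₀).symm (y₀ + T (δ • x))

variable {g p₀ T y₀}

theorem tiltedForm_apply (z v w : EuclideanSpace ℝ (Fin n)) :
    tiltedForm g p₀ T y₀ z v w = g.chartForm p₀ (y₀ + T z) (T v) (T w) := rfl

theorem isClosed_tiltedHalfSpace : IsClosed (tiltedHalfSpace T) :=
  isClosed_le continuous_const (by fun_prop)

theorem smul_mem_tiltedHalfSpace {δ : ℝ} (hδ : 0 < δ) {x : EuclideanSpace ℝ (Fin n)}
    (hx : x ∈ tiltedHalfSpace T) : δ • x ∈ tiltedHalfSpace T := by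
  change 0 ≤ T (δ • x) 0
  rw [map_smul, PiLp.smul_apply, smul_eq_mul]
  exact mul_nonneg hδ.le hx

variable (hy₀0 : y₀ 0 = 0)
include hy₀0

theorem add_mem_range_iff {x : EuclideanSpace ℝ (Fin n)} :
    y₀ + T x ∈ Set.range (𝓡∂ n) ↔ x ∈ tiltedHalfSpace T := by
  rw [range_halfSpaceModel]
  change 0 ≤ (y₀ + T x) 0 ↔ _
  rw [PiLp.add_apply, hy₀0, zero_add]
  rfl

theorem add_mem_target_iff {x : EuclideanSpace ℝ (Fin n)} :
    y₀ + T x ∈ (extChartAt (𝓡∂ n) p₀).target ↔ x ∈ tiltedHalfSpace T := by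
  rw [extChartAt_hemisphere_target, add_mem_range_iff hy₀0]

theorem continuousOn_tiltedForm_apply (v w : EuclideanSpace ℝ (Fin n)) :
    ContinuousOn (fun z => tiltedForm g p₀ T y₀ z v w) (tiltedHalfSpace T) := by
  have key : ∀ f : EuclideanSpace ℝ (Fin n) → ℝ, ContinuousOn f (Set.range (𝓡∂ n)) →
      ContinuousOn (fun z => f (y₀ + T z)) (tiltedHalfSpace T) := fun f hf =>
    hf.comp (by fun_prop) fun x hx => (add_mem_range_iff hy₀0).2 hx
  simp only [tiltedForm_apply]
  refine key (fun y => g.chartForm p₀ y (T v) (T w)) fun y hy => ?_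
  exact (g.contDiffWithinAt_inChart (by rwa [extChartAt_hemisphere_target])
    (T v) (T w)).continuousWithinAt

theorem posForm_tiltedForm {z : EuclideanSpace ℝ (Fin n)} (hz : z ∈ tiltedHalfSpace T) :
    IsPosForm (tiltedForm g p₀ T y₀ z) := by
  have h := g.posForm_chartForm ((add_mem_target_iff (p₀ := p₀) hy₀0).2 hz)
  refine ⟨fun v w => ?_, fun v hv => ?_⟩
  · rw [tiltedForm_apply, tiltedForm_apply, h.symm]
  · rw [tiltedForm_apply]
    exact h.pos _ ((map_ne_zero_iff _ T.injective).2 hv)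

/-- The density of the volume in the coordinates `x ↦ y₀ + T x`. -/
def tiltedDensity (g : SmoothMetric (𝓡∂ n) (Hemisphere n)) (p₀ : Hemisphere n)
    (T : EuclideanSpace ℝ (Fin n) ≃L[ℝ] EuclideanSpace ℝ (Fin n)) (y₀ z : EuclideanSpace ℝ (Fin n)) : ℝ :=
  Real.sqrt (gram (tiltedForm g p₀ T y₀ z) (EuclideanSpace.basisFun (Fin n) ℝ).toBasis).det

theorem continuousOn_tiltedDensity :
    ContinuousOn (tiltedDensity g p₀ T y₀) (tiltedHalfSpace T) :=
  (continuousOn_det_gram fun _ _ => continuousOn_tiltedForm_apply hy₀0 _ _).sqrt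

theorem continuousOn_tilted_inv (i j : Fin n) : ContinuousOn
    (fun z => (gram (tiltedForm g p₀ T y₀ z) (EuclideanSpace.basisFun (Fin n) ℝ).toBasis)⁻¹ i j)
    (tiltedHalfSpace T) := by
  refine continuousOn_inv_gram (fun _ _ => continuousOn_tiltedForm_apply hy₀0 _ _) (fun z hz => ?_) i j
  have h := posForm_tiltedForm (g := g) (p₀ := p₀) hy₀0 hz
  exact (det_gram_pos _ h.symm h.pos (EuclideanSpace.basisFun (Fin n) ℝ).toBasis.linearIndependent).ne'

variable {δ : ℝ} (hδ : 0 < δ)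
include hδ

theorem hasMFDerivWithinAt_zoomParam {x : EuclideanSpace ℝ (Fin n)} (hx : x ∈ tiltedHalfSpace T) :
    HasMFDerivWithinAt 𝓘(ℝ, EuclideanSpace ℝ (Fin n)) (𝓡∂ n) (zoomParam p₀ T y₀ δ)
      (tiltedHalfSpace T) x ((chartSymmDeriv (𝓡∂ n) p₀ (y₀ + T (δ • x))).comp
        (δ • (T : EuclideanSpace ℝ (Fin n) →L[ℝ] EuclideanSpace ℝ (Fin n))) :
          EuclideanSpace ℝ (Fin n) →L[ℝ] EuclideanSpace ℝ (Fin n)) := by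
  have h1 := hasMFDerivWithinAt_chart_symm (I := 𝓡∂ n) (x₀ := p₀)
    ((add_mem_target_iff (p₀ := p₀) hy₀0).2 (smul_mem_tiltedHalfSpace hδ hx))
  have h2 : HasFDerivAt (fun x => y₀ + T (δ • x))
      (δ • (T : EuclideanSpace ℝ (Fin n) →L[ℝ] EuclideanSpace ℝ (Fin n))) x := by
    have e : (fun x => y₀ + T (δ • x)) = fun x => y₀ + (δ • (T : EuclideanSpace ℝ (Fin n) →L[ℝ]
      EuclideanSpace ℝ (Fin n))) x := by ext1 x; simp
    rw [e]
    exact (ContinuousLinearMap.hasFDerivAt _).const_add _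
  exact HasMFDerivWithinAt.comp x h1 h2.hasFDerivWithinAt.hasMFDerivWithinAt
    fun z hz => (add_mem_range_iff hy₀0).2 (smul_mem_tiltedHalfSpace hδ hz)

theorem extChartAt_zoomParam {x : EuclideanSpace ℝ (Fin n)} (hx : x ∈ tiltedHalfSpace T) :
    extChartAt (𝓡∂ n) p₀ (zoomParam p₀ T y₀ δ x) = y₀ + T (δ • x) :=
  (extChartAt (𝓡∂ n) p₀).right_inv
    ((add_mem_target_iff (p₀ := p₀) hy₀0).2 (smul_mem_tiltedHalfSpace hδ hx))

theorem injOn_zoomParam : InjOn (zoomParam p₀ T y₀ δ) (tiltedHalfSpace T) := by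
  intro x hx x' hx' h
  have h1 := extChartAt_zoomParam (p₀ := p₀) hy₀0 hδ hx
  rw [h, extChartAt_zoomParam (p₀ := p₀) hy₀0 hδ hx'] at h1
  exact (smul_right_injective _ hδ.ne' (T.injective (add_left_cancel h1))).symm

theorem volDensity_zoomParam {x : EuclideanSpace ℝ (Fin n)} :
    volDensity (g.form (zoomParam p₀ T y₀ δ x)) ((chartSymmDeriv (𝓡∂ n) p₀ (y₀ + T (δ • x))).comp
        (δ • (T : EuclideanSpace ℝ (Fin n) →L[ℝ] EuclideanSpace ℝ (Fin n))))
      (EuclideanSpace.basisFun (Fin n) ℝ).toBasis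
      = ENNReal.ofReal (δ ^ n * tiltedDensity g p₀ T y₀ (δ • x)) := by
  unfold volDensity
  congr 1
  have h : gram ((g.form (zoomParam p₀ T y₀ δ x)).bilinearComp
      ((chartSymmDeriv (𝓡∂ n) p₀ (y₀ + T (δ • x))).comp
        (δ • (T : EuclideanSpace ℝ (Fin n) →L[ℝ] EuclideanSpace ℝ (Fin n))))
      ((chartSymmDeriv (𝓡∂ n) p₀ (y₀ + T (δ • x))).comp
        (δ • (T : EuclideanSpace ℝ (Fin n) →L[ℝ] EuclideanSpace ℝ (Fin n)))))
      (EuclideanSpace.basisFun (Fin n) ℝ).toBasis = (δ ^ 2) • gram (tiltedForm g p₀ T y₀ (δ • x))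
        (EuclideanSpace.basisFun (Fin n) ℝ).toBasis := by
    ext i j
    simp only [gram, Matrix.of_apply, Matrix.smul_apply, ContinuousLinearMap.bilinearComp_apply,
      ContinuousLinearMap.comp_apply, _root_.smul_apply, map_smul, smul_eq_mul, tiltedForm,
      SmoothMetric.chartForm_apply, zoomParam]
    ring
  rw [h, Matrix.det_smul, tiltedDensity, Fintype.card_fin, ← pow_mul, mul_comm 2 n, pow_mul,
    Real.sqrt_mul (by positivity), Real.sqrt_sq (by positivity)]

end ZoomParam

/-! ### Mass and Dirichlet energy in scaled coordinates. -/

section ZoomIntegrals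

variable {n : ℕ} [NeZero n]

instance : CompactSpace (Hemisphere n) := by
  refine isCompact_iff_compactSpace.1 (Metric.isCompact_of_isClosed_isBounded ?_ ?_)
  · have h0 : Continuous fun p : EuclideanSpace ℝ (Fin n) × ℝ => p.1 0 :=
      (PiLp.continuous_apply 2 _ 0).comp continuous_fst
    have h1 : Continuous fun p : EuclideanSpace ℝ (Fin n) × ℝ => ‖p.1‖ ^ 2 + p.2 ^ 2 := by fun_prop
    exact (isClosed_eq h1 continuous_const).inter (isClosed_le continuous_const h0)
  · refine (Metric.isBounded_closedBall (x := (0 : EuclideanSpace ℝ (Fin n) × ℝ)) (r := 1)).subset ?_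
    intro p hp
    have h1 := hp.1
    rw [mem_closedBall_zero_iff, Prod.norm_def, sup_le_iff]
    constructor
    · nlinarith [norm_nonneg p.1, sq_nonneg p.2]
    · rw [Real.norm_eq_abs, abs_le]
      constructor <;> nlinarith [sq_nonneg ‖p.1‖]

variable {g : SmoothMetric (𝓡∂ n) (Hemisphere n)} {p₀ : Hemisphere n}
  {T : EuclideanSpace ℝ (Fin n) ≃L[ℝ] EuclideanSpace ℝ (Fin n)} {y₀ : EuclideanSpace ℝ (Fin n)}
  {k : EuclideanSpace ℝ (Fin n) → ℝ} {δ ρ : ℝ} (hp₀ : p₀.1.2 ≠ 1) (hy₀0 : y₀ 0 = 0) (hδ : 0 < δ)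
include hp₀ hy₀0 hδ

theorem zoom_zoomParam {x : EuclideanSpace ℝ (Fin n)} (hx : x ∈ tiltedHalfSpace T) :
    zoom T y₀ k δ (zoomParam p₀ T y₀ δ x) = k x := by
  rw [zoom, ← extChartAt_hemisphere hp₀, extChartAt_zoomParam hy₀0 hδ hx, add_sub_cancel_left,
    T.symm_apply_apply, inv_smul_smul₀ hδ.ne']

theorem eq_one_of_notMem_image {p : Hemisphere n}
    (hp : p ∉ zoomParam p₀ T y₀ δ '' tiltedHalfSpace T) : p.1.2 = 1 := by
  by_contra h
  apply hp
  have hsrc : p ∈ (extChartAt (𝓡∂ n) p₀).source := by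
    rw [extChartAt_hemisphere_source hp₀]; exact h
  have h1 : y₀ + T (T.symm (stereo p - y₀)) = extChartAt (𝓡∂ n) p₀ p := by
    rw [T.apply_symm_apply, add_sub_cancel, extChartAt_hemisphere hp₀]
  have h2 : T.symm (stereo p - y₀) ∈ tiltedHalfSpace T := by
    rw [← add_mem_target_iff (p₀ := p₀) hy₀0, h1]
    exact (extChartAt (𝓡∂ n) p₀).map_source hsrc
  refine ⟨δ⁻¹ • T.symm (stereo p - y₀), smul_mem_tiltedHalfSpace (inv_pos.2 hδ) h2, ?_⟩
  rw [zoomParam, smul_inv_smul₀ hδ.ne', h1]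
  exact (extChartAt (𝓡∂ n) p₀).left_inv hsrc

/-- The scaled inverse chart reaches every point but `(0, 1)`, and the integrand vanishes there, so
one parametrization computes the whole integral. -/
theorem integral_zoomParam {G : Hemisphere n → ℝ} (hG : Measurable G)
    (hG0 : ∀ p : Hemisphere n, p.1.2 = 1 → G p = 0) : ∫ p, G p ∂g.volume
      = δ ^ n * ∫ x in tiltedHalfSpace T, tiltedDensity g p₀ T y₀ (δ • x) * G (zoomParam p₀ T y₀ δ x) := by
  have hfin : finrank ℝ (EuclideanSpace ℝ (Fin n)) = Fintype.card (Fin n) := by simp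
  have hcont : ContinuousOn (fun x => δ ^ n * tiltedDensity g p₀ T y₀ (δ • x)) (tiltedHalfSpace T) :=
    continuousOn_const.mul ((continuousOn_tiltedDensity hy₀0).comp (by fun_prop)
      fun x hx => smul_mem_tiltedHalfSpace hδ hx)
  have h := g.integral_eq_of_parametrization (x₀ := p₀) isClosed_tiltedHalfSpace.measurableSet
    (fun x hx => hasMFDerivWithinAt_zoomParam hy₀0 hδ hx) (injOn_zoomParam hy₀0 hδ)
    (fun x hx => (extChartAt (𝓡∂ n) p₀).map_target
      ((add_mem_target_iff (p₀ := p₀) hy₀0).2 (smul_mem_tiltedHalfSpace hδ hx)))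
    (EuclideanSpace.basisFun (Fin n) ℝ).toBasis hfin hcont
    (fun x _ => mul_nonneg (by positivity) (Real.sqrt_nonneg _))
    (fun x _ => volDensity_zoomParam hy₀0 hδ) hG
    fun p hp => hG0 p (eq_one_of_notMem_image hp₀ hy₀0 hδ hp)
  rw [h, OrthonormalBasis.addHaar_eq_volume, ← integral_const_mul]
  congr 1
  ext x
  ring

/-- In the scaled coordinates the function is `k + η`; shrinking by `δ` multiplies its differential
by `δ⁻¹`, and the constant `η` drops out. -/
theorem dualNorm_differential_zoom (hk : ContDiff ℝ ∞ k) {η : ℝ}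
    (hu : ContMDiff (𝓡∂ n) 𝓘(ℝ, ℝ) ∞ fun p => zoom T y₀ k δ p + η)
    {x : EuclideanSpace ℝ (Fin n)} (hx : x ∈ tiltedHalfSpace T) :
    g.dualNorm (zoomParam p₀ T y₀ δ x) (differential (𝓡∂ n) (fun p => zoom T y₀ k δ p + η)
        (zoomParam p₀ T y₀ δ x)) ^ 2
      = (δ ^ 2)⁻¹ * dualNormSq (tiltedForm g p₀ T y₀ (δ • x)) (fderiv ℝ k x) := by
  have hy := (add_mem_target_iff (p₀ := p₀) hy₀0).2 (smul_mem_tiltedHalfSpace hδ hx)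
  have hyr := (add_mem_range_iff hy₀0).2 (smul_mem_tiltedHalfSpace hδ hx)
  have hpos := g.posForm_chartForm hy
  set y := y₀ + T (δ • x) with hydef
  have h1 := g.dualNorm_differential_chart hu hy
  have hx' : δ⁻¹ • T.symm (y - y₀) = x := by
    rw [hydef, add_sub_cancel_left, T.symm_apply_apply, inv_smul_smul₀ hδ.ne']
  have h2 : HasFDerivAt (fun z => k (δ⁻¹ • T.symm (z - y₀)) + η)
      (δ⁻¹ • (fderiv ℝ k x).comp (T.symm : EuclideanSpace ℝ (Fin n) →L[ℝ] EuclideanSpace ℝ (Fin n))) y := by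
    have hkd : HasFDerivAt k (fderiv ℝ k x) (δ⁻¹ • T.symm (y - y₀)) := by
      rw [hx']
      exact (hk.differentiable (by simp)).differentiableAt.hasFDerivAt
    have hin : HasFDerivAt (fun z => δ⁻¹ • T.symm (z - y₀))
        (δ⁻¹ • (T.symm : EuclideanSpace ℝ (Fin n) →L[ℝ] EuclideanSpace ℝ (Fin n))) y :=
      (((T.symm : EuclideanSpace ℝ (Fin n) →L[ℝ] EuclideanSpace ℝ (Fin n)).hasFDerivAt).comp y
        ((hasFDerivAt_id y).sub_const y₀)).const_smul δ⁻¹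
    refine ((hkd.comp y hin).add_const η).congr_fderiv ?_
    ext v
    simp
  have h3 : fderivWithin ℝ (fun z => zoom T y₀ k δ ((extChartAt (𝓡∂ n) p₀).symm z) + η)
      (Set.range (𝓡∂ n)) y = δ⁻¹ • (fderiv ℝ k x).comp
        (T.symm : EuclideanSpace ℝ (Fin n) →L[ℝ] EuclideanSpace ℝ (Fin n)) := by
    have e : ∀ z ∈ Set.range (𝓡∂ n), zoom T y₀ k δ ((extChartAt (𝓡∂ n) p₀).symm z) + η
        = k (δ⁻¹ • T.symm (z - y₀)) + η := fun z hz => by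
      rw [zoom, ← extChartAt_hemisphere hp₀, (extChartAt (𝓡∂ n) p₀).right_inv
        (by rwa [extChartAt_hemisphere_target])]
    rw [fderivWithin_congr e (e y hyr)]
    exact h2.hasFDerivWithinAt.fderivWithin ((𝓡∂ n).uniqueDiffOn y hyr)
  have h4 : dualNormSq (tiltedForm g p₀ T y₀ (δ • x)) (fderiv ℝ k x)
      = dualNormSq (g.chartForm p₀ y) ((fderiv ℝ k x).comp
        (T.symm : EuclideanSpace ℝ (Fin n) →L[ℝ] EuclideanSpace ℝ (Fin n))) :=
    dualNormSq_pullback _ _ T.toLinearEquiv (fun v w => rfl) _ _ fun v => by simp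
  rw [h3] at h1
  rw [h4, ← covNorm_sq hpos]
  have h5 : g.dualNorm (zoomParam p₀ T y₀ δ x) (differential (𝓡∂ n) (fun p => zoom T y₀ k δ p + η)
      (zoomParam p₀ T y₀ δ x)) = covNorm (g.chartForm p₀ y) (δ⁻¹ • (fderiv ℝ k x).comp
        (T.symm : EuclideanSpace ℝ (Fin n) →L[ℝ] EuclideanSpace ℝ (Fin n))) := h1
  rw [h5, covNorm_smul hpos, mul_pow, abs_of_pos (inv_pos.2 hδ), inv_pow]

/-- The mass of a concentrated function. -/
theorem integral_zoom_rpow (hy₀ : ‖y₀‖ = 1) (hk : ContDiff ℝ ∞ k) (hρ : ∀ x, k x ≠ 0 → ‖x‖ ≤ ρ)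
    (hsmall : ‖(T : EuclideanSpace ℝ (Fin n) →L[ℝ] EuclideanSpace ℝ (Fin n))‖ * (δ * ρ) < 1)
    {q : ℝ} (hq : 0 < q) : ∫ p, zoom T y₀ k δ p ^ q ∂g.volume
      = δ ^ n * ∫ x in tiltedHalfSpace T, tiltedDensity g p₀ T y₀ (δ • x) * k x ^ q := by
  have hc := (contMDiff_zoom (T := T) hy₀ hδ hρ hsmall hk).continuous
  rw [integral_zoomParam hp₀ hy₀0 hδ (hc.rpow_const fun _ => .inr hq.le).measurable]
  · congr 1
    refine setIntegral_congr_fun isClosed_tiltedHalfSpace.measurableSet fun x hx => ?_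
    simp only [zoom_zoomParam hp₀ hy₀0 hδ hx]
  · intro p hp
    rw [(eventually_zoom_eq_zero hy₀ hδ hρ hsmall hp).self_of_nhds, Real.zero_rpow hq.ne']

/-- The Dirichlet energy of a concentrated function. -/
theorem integral_dualNorm_zoom_sq (hy₀ : ‖y₀‖ = 1) (hk : ContDiff ℝ ∞ k)
    (hρ : ∀ x, k x ≠ 0 → ‖x‖ ≤ ρ)
    (hsmall : ‖(T : EuclideanSpace ℝ (Fin n) →L[ℝ] EuclideanSpace ℝ (Fin n))‖ * (δ * ρ) < 1)
    {η : ℝ} (hu : ContMDiff (𝓡∂ n) 𝓘(ℝ, ℝ) ∞ fun p => zoom T y₀ k δ p + η) :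
    ∫ p, g.dualNorm p (differential (𝓡∂ n) (fun p => zoom T y₀ k δ p + η) p) ^ 2 ∂g.volume
      = δ ^ n * ((δ ^ 2)⁻¹ * ∫ x in tiltedHalfSpace T, tiltedDensity g p₀ T y₀ (δ • x)
        * dualNormSq (tiltedForm g p₀ T y₀ (δ • x)) (fderiv ℝ k x)) := by
  rw [integral_zoomParam
    (G := fun p => g.dualNorm p (differential (𝓡∂ n) (fun p => zoom T y₀ k δ p + η) p) ^ 2)
    hp₀ hy₀0 hδ ((g.continuous_dualNorm_differential hu).pow 2).measurable]
  · congr 1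
    rw [← integral_const_mul]
    refine setIntegral_congr_fun isClosed_tiltedHalfSpace.measurableSet fun x hx => ?_
    simp only [dualNorm_differential_zoom hp₀ hy₀0 hδ hk hu hx]
    ring
  · intro p hp
    have h1 : (fun p => zoom T y₀ k δ p + η) =ᶠ[𝓝 p] fun _ => η := by
      filter_upwards [eventually_zoom_eq_zero (T := T) hy₀ hδ hρ hsmall hp] with q hq
      rw [hq, zero_add]
    have h2 : diffForm (𝓡∂ n) (fun p => zoom T y₀ k δ p + η) p = 0 := by
      have h3 : diffForm (𝓡∂ n) (fun p => zoom T y₀ k δ p + η) p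
        = diffForm (𝓡∂ n) (fun _ => η) p := h1.mfderiv_eq
      rw [h3]
      exact mfderiv_const
    change covNorm (g.form p) (diffForm (𝓡∂ n) (fun p => zoom T y₀ k δ p + η) p) ^ 2 = 0
    rw [h2, covNorm_zero (g.posForm p), zero_pow two_ne_zero]

end ZoomIntegrals

/-! ### The limits as the scale tends to zero. -/

section ZoomLimits

variable {n : ℕ} [NeZero n]
variable {g : SmoothMetric (𝓡∂ n) (Hemisphere n)} {p₀ : Hemisphere n}
  {T : EuclideanSpace ℝ (Fin n) ≃L[ℝ] EuclideanSpace ℝ (Fin n)} {y₀ : EuclideanSpace ℝ (Fin n)}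
  (hy₀0 : y₀ 0 = 0) (hT : ∀ v w, g.chartForm p₀ y₀ (T v) (T w) = inner ℝ v w)
include hy₀0 hT

omit hy₀0 in
theorem gram_tiltedForm_zero :
    gram (tiltedForm g p₀ T y₀ 0) (EuclideanSpace.basisFun (Fin n) ℝ).toBasis = 1 := by
  ext i j
  rw [gram_apply, tiltedForm_apply, map_zero, add_zero, hT, OrthonormalBasis.coe_toBasis,
    orthonormal_iff_ite.1 (EuclideanSpace.basisFun (Fin n) ℝ).orthonormal, Matrix.one_apply]

theorem tendsto_mass {f : EuclideanSpace ℝ (Fin n) → ℝ} (hf : Continuous f)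
    (hfc : HasCompactSupport f) :
    Tendsto (fun δ : ℝ => ∫ x in tiltedHalfSpace T, tiltedDensity g p₀ T y₀ (δ • x) * f x) (𝓝[>] 0)
      (𝓝 (∫ x in tiltedHalfSpace T, f x)) := by
  have h := tendsto_setIntegral_rescale (μ := volume) isClosed_tiltedHalfSpace
    (by simp [tiltedHalfSpace] : (0 : EuclideanSpace ℝ (Fin n)) ∈ tiltedHalfSpace T)
    (fun δ hδ x hx => smul_mem_tiltedHalfSpace hδ hx) (continuousOn_tiltedDensity (g := g) (p₀ := p₀) hy₀0)
    hf hfc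
  have h0 : tiltedDensity g p₀ T y₀ 0 = 1 := by
    rw [tiltedDensity, gram_tiltedForm_zero hT, Matrix.det_one, Real.sqrt_one]
  rwa [h0, one_mul] at h

/-- Written in components, the density is a finite sum of coefficients depending on `δ • x` times
products of partial derivatives of `k`. Each coefficient freezes at the origin, where `T` makes the
metric Euclidean. -/
theorem tendsto_dirichlet {k : EuclideanSpace ℝ (Fin n) → ℝ} (hk : ContDiff ℝ ∞ k)
    (hkc : HasCompactSupport k) :
    Tendsto (fun δ : ℝ => ∫ x in tiltedHalfSpace T, tiltedDensity g p₀ T y₀ (δ • x)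
        * dualNormSq (tiltedForm g p₀ T y₀ (δ • x)) (fderiv ℝ k x)) (𝓝[>] 0)
      (𝓝 (∫ x in tiltedHalfSpace T, ‖fderiv ℝ k x‖ ^ 2)) := by
  set b := EuclideanSpace.basisFun (Fin n) ℝ with hb
  set c : Fin n → Fin n → EuclideanSpace ℝ (Fin n) → ℝ := fun i j z =>
    tiltedDensity g p₀ T y₀ z * (gram (tiltedForm g p₀ T y₀ z) b.toBasis)⁻¹ i j with hc
  set f : Fin n → Fin n → EuclideanSpace ℝ (Fin n) → ℝ := fun i j x =>
    fderiv ℝ k x (b i) * fderiv ℝ k x (b j) with hf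
  have hfd : Continuous (fderiv ℝ k) := hk.continuous_fderiv (by simp)
  have hfc : ∀ i j, Continuous (f i j) := fun i j => by fun_prop
  have hfs : ∀ i j, HasCompactSupport (f i j) := fun i j =>
    (hkc.fderiv_apply (𝕜 := ℝ) (b i)).mul_right
  have hcc : ∀ i j, ContinuousOn (c i j) (tiltedHalfSpace T) := fun i j =>
    (continuousOn_tiltedDensity hy₀0).mul (continuousOn_tilted_inv hy₀0 i j)
  have hlim : ∀ i j, Tendsto (fun δ : ℝ => ∫ x in tiltedHalfSpace T, c i j (δ • x) * f i j x) (𝓝[>] 0)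
      (𝓝 (c i j 0 * ∫ x in tiltedHalfSpace T, f i j x)) := fun i j =>
    tendsto_setIntegral_rescale (μ := volume) isClosed_tiltedHalfSpace
      (by simp [tiltedHalfSpace] : (0 : EuclideanSpace ℝ (Fin n)) ∈ tiltedHalfSpace T)
      (fun δ hδ x hx => smul_mem_tiltedHalfSpace hδ hx) (hcc i j) (hfc i j) (hfs i j)
  have hsum := tendsto_finsetSum Finset.univ fun i _ => tendsto_finsetSum Finset.univ fun j _ => hlim i j
  have hfi : ∀ i j, IntegrableOn (f i j) (tiltedHalfSpace T) := fun i j =>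
    ((hfc i j).integrable_of_hasCompactSupport (hfs i j)).integrableOn
  have hval : ∑ i, ∑ j, c i j 0 * ∫ x in tiltedHalfSpace T, f i j x
      = ∫ x in tiltedHalfSpace T, ‖fderiv ℝ k x‖ ^ 2 := by
    have h0 : ∀ i j, c i j 0 = if i = j then 1 else 0 := fun i j => by
      simp only [hc]
      rw [tiltedDensity, gram_tiltedForm_zero hT, Matrix.det_one, Real.sqrt_one, inv_one, one_mul,
        Matrix.one_apply]
    simp only [h0, ite_mul, one_mul, zero_mul, Finset.sum_ite_eq, Finset.mem_univ, if_true]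
    rw [← integral_finsetSum _ fun i _ => hfi i i]
    refine integral_congr_ae (.of_forall fun x => ?_)
    simp only [hf]
    rw [norm_sq_eq_sum b]
    exact Finset.sum_congr rfl fun i _ => (sq _).symm
  rw [← hval]
  refine hsum.congr' ?_
  filter_upwards [self_mem_nhdsWithin] with δ hδ
  have hint : ∀ i j, IntegrableOn (fun x => c i j (δ • x) * f i j x) (tiltedHalfSpace T) := by
    intro i j
    have hcδ : ContinuousOn (fun x => c i j (δ • x) * f i j x) (tiltedHalfSpace T) :=
      ((hcc i j).comp (by fun_prop) fun x hx => smul_mem_tiltedHalfSpace hδ hx).mul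
        (hfc i j).continuousOn
    have h1 : IntegrableOn (fun x => c i j (δ • x) * f i j x)
        (tsupport (f i j) ∩ tiltedHalfSpace T) :=
      (hcδ.mono inter_subset_right).integrableOn_compact
        (IsCompact.inter_right (hfs i j) isClosed_tiltedHalfSpace)
    refine h1.of_forall_sdiff_eq_zero isClosed_tiltedHalfSpace.measurableSet fun x hx => ?_
    have : f i j x = 0 := by
      by_contra h
      exact hx.2 ⟨subset_tsupport _ h, hx.1⟩
    rw [this, mul_zero]
  simp only [← integral_finsetSum _ fun j _ => hint _ j]
  rw [← integral_finsetSum _ fun i _ => integrable_finsetSum _ fun j _ => hint i j]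
  refine integral_congr_ae (.of_forall fun x => ?_)
  simp only [hc, hf]
  rw [dualNormSq_eq _ _ b.toBasis, Finset.mul_sum]
  refine Finset.sum_congr rfl fun i _ => ?_
  rw [Finset.mul_sum]
  refine Finset.sum_congr rfl fun j _ => ?_
  simp only [OrthonormalBasis.coe_toBasis]
  ring

end ZoomLimits

/-! ### The Yamabe constant of the hemisphere against Sobolev quotients of a half-space. -/

section Concentration

variable {n : ℕ} [NeZero n]

theorem exists_isometric_frame (B : EuclideanSpace ℝ (Fin n) →L[ℝ] EuclideanSpace ℝ (Fin n) →L[ℝ] ℝ)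
    (hs : ∀ v w, B v w = B w v) (hp : ∀ v, v ≠ 0 → 0 < B v v) :
    ∃ T : EuclideanSpace ℝ (Fin n) ≃L[ℝ] EuclideanSpace ℝ (Fin n),
      ∀ v w, B (T v) (T w) = inner ℝ v w := by
  obtain ⟨e, he⟩ := exists_orthonormal_basis B hs hp
  set b := (EuclideanSpace.basisFun (Fin n) ℝ).toBasis
  set e' := e.reindex (finCongr (finrank_euclideanSpace_fin (𝕜 := ℝ) (n := n)))
  set T := b.equiv e' (Equiv.refl _)
  have key : (LinearMap.mk₂ ℝ (fun v w => B (T v) (T w)) (by simp) (by simp) (by simp) (by simp) :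
      EuclideanSpace ℝ (Fin n) →ₗ[ℝ] EuclideanSpace ℝ (Fin n) →ₗ[ℝ] ℝ)
      = LinearMap.mk₂ ℝ (fun v w => inner ℝ v w) inner_add_left
        (fun c v w => by simp [real_inner_smul_left]) inner_add_right
        (fun c v w => by simp [real_inner_smul_right]) := by
    refine LinearMap.ext_basis b b fun i j => ?_
    rw [LinearMap.mk₂_apply, LinearMap.mk₂_apply]
    have h1 : B (e' i) (e' j) = (1 : Matrix _ _ ℝ) i j := by
      simp only [e', Basis.coe_reindex, Function.comp_apply]
      have := congrFun (congrFun he ((finCongr (finrank_euclideanSpace_fin (𝕜 := ℝ) (n := n))).symm i))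
        ((finCongr (finrank_euclideanSpace_fin (𝕜 := ℝ) (n := n))).symm j)
      rw [gram_apply] at this
      rw [this, Matrix.one_apply, Matrix.one_apply]
      simp
    rw [Basis.equiv_apply, Basis.equiv_apply, Equiv.refl_apply, Equiv.refl_apply, h1,
      OrthonormalBasis.coe_toBasis,
      orthonormal_iff_ite.1 (EuclideanSpace.basisFun (Fin n) ℝ).orthonormal, Matrix.one_apply]
  refine ⟨T.toContinuousLinearEquiv, fun v w => ?_⟩
  exact congrFun (congrArg DFunLike.coe (congrFun (congrArg DFunLike.coe key) v)) w

variable {g : SmoothMetric (𝓡∂ n) (Hemisphere n)} {p₀ : Hemisphere n}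
  {T : EuclideanSpace ℝ (Fin n) ≃L[ℝ] EuclideanSpace ℝ (Fin n)} {y₀ : EuclideanSpace ℝ (Fin n)}
  {k : EuclideanSpace ℝ (Fin n) → ℝ} {ρ : ℝ}

theorem real_cap_le {μ : Measure (Hemisphere n)} {A : Set (Hemisphere n)} {c : ℝ} (hc : 0 ≤ c)
    (h : μ A ≤ ENNReal.ofReal c) : μ.real A ≤ c :=
  ENNReal.toReal_le_of_le_ofReal hc h

/-- The energy of a function concentrated at a boundary point. -/
theorem exists_energy_zoom_le (hn : 3 ≤ n) (hp₀ : p₀.1.2 ≠ 1) (hy₀ : ‖y₀‖ = 1) (hy₀0 : y₀ 0 = 0)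
    (hk : ContDiff ℝ ∞ k) (hk0 : ∀ x, 0 ≤ k x) {K : ℝ} (hkK : ∀ x, k x ≤ K) (hρ0 : 0 ≤ ρ)
    (hρ : ∀ x, k x ≠ 0 → ‖x‖ ≤ ρ) :
    ∃ C, 0 ≤ C ∧ ∃ r, 0 < r ∧ ∀ δ, 0 < δ → δ < r →
      ‖(T : EuclideanSpace ℝ (Fin n) →L[ℝ] EuclideanSpace ℝ (Fin n))‖ * (δ * ρ) < 1 ∧
      ∀ hu : ContMDiff (𝓡∂ n) 𝓘(ℝ, ℝ) ∞ fun p => zoom T y₀ k δ p + δ ^ n,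
        energy g (SobolevH1.ofSmooth g _ hu) ≤ δ ^ (n - 2) * (4 * ((n : ℝ) - 1) / (n - 2) *
          (∫ x in tiltedHalfSpace T, tiltedDensity g p₀ T y₀ (δ • x)
            * dualNormSq (tiltedForm g p₀ T y₀ (δ • x)) (fderiv ℝ k x)) + C * δ) := by
  obtain ⟨C, hC, r, hr, hcap⟩ := exists_cap_bounds g hp₀ hy₀ hy₀0
  set τ := ‖(T : EuclideanSpace ℝ (Fin n) →L[ℝ] EuclideanSpace ℝ (Fin n))‖ with hτ
  have hτ0 : 0 ≤ τ := norm_nonneg _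
  set L := τ * ρ with hL
  have hL0 : 0 ≤ L := mul_nonneg hτ0 hρ0
  have hK0 : 0 ≤ K := (hk0 0).trans (hkK 0)
  have hn1 : (1 : ℝ) ≤ n := by exact_mod_cast (by omega : 1 ≤ n)
  set IR := |∫ p, g.scalarCurvature p ∂g.volume|
  set IH := |∫ p, g.meanCurvature p ∂g.boundaryMeasure|
  set CR := C * (K + 1) ^ 2 * (C * L ^ n) + IR with hCR
  set CH := C * (K + 1) ^ 2 * (C * L ^ (n - 1)) + IH with hCH
  have hIR : 0 ≤ IR := abs_nonneg _
  have hIH : 0 ≤ IH := abs_nonneg _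
  refine ⟨CR + 2 * ((n : ℝ) - 1) * CH, by
    have : 0 ≤ (n : ℝ) - 1 := by linarith
    positivity, min 1 (min (r / (L + 1)) (1 / (L + 1))), by positivity, fun δ hδ hδr => ?_⟩
  rw [lt_min_iff, lt_min_iff, lt_div_iff₀ (by positivity), lt_div_iff₀ (by positivity)] at hδr
  obtain ⟨hδ1, hδ2, hδ3⟩ := hδr
  have hLδ : τ * (δ * ρ) = L * δ := by rw [hL]; ring
  have hsmall : τ * (δ * ρ) < 1 := by rw [hLδ]; nlinarith
  refine ⟨hsmall, fun hu => ?_⟩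
  obtain ⟨hvol, hbd, hcurv⟩ := hcap (L * δ) (by positivity) (by nlinarith)
  set A := cap (n := n) y₀ (L * δ) with hA
  have hAm : MeasurableSet A := measurableSet_cap hp₀ _ _
  have hη : 0 < δ ^ n := by positivity
  have hη1 : δ ^ n ≤ 1 := pow_le_one₀ hδ.le hδ1.le
  have hz0 : ∀ p, 0 ≤ zoom T y₀ k δ p := fun p => hk0 _
  have hum : Measurable fun p => zoom T y₀ k δ p + δ ^ n := hu.continuous.measurable
  have hu1 : ∀ p, δ ^ n ≤ zoom T y₀ k δ p + δ ^ n := fun p => by linarith [hz0 p]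
  have hu2 : ∀ p, zoom T y₀ k δ p + δ ^ n ≤ K + 1 := fun p => add_le_add (hkK _) hη1
  have huA : ∀ p, p ∉ A → zoom T y₀ k δ p + δ ^ n = δ ^ n := fun p hp => by
    rw [add_eq_right]
    by_contra h
    have := mem_cap_of_zoom_ne_zero hy₀ hδ hρ hsmall h
    rw [hLδ] at this
    exact hp this
  -- Orders of magnitude relative to `δ^(n-2)`: the cap has volume of order `δ²` and boundary
  -- measure of order `δ`. The background constant `δ^n`, added because competitors must be
  -- positive, contributes its square, which is at most of order `δ` as well (`e3`).
  have e1 : δ ^ n = δ ^ (n - 2) * δ * δ := by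
    rw [mul_assoc, ← sq, ← pow_add]; congr 1; omega
  have e2 : δ ^ (n - 1) = δ ^ (n - 2) * δ := by
    rw [← pow_succ]; congr 1; omega
  have hd0 : 0 < δ ^ (n - 2) := by positivity
  have e3 : (δ ^ n) ^ 2 ≤ δ ^ (n - 2) * δ := by
    have h4 : (δ ^ n) ^ 2 ≤ δ ^ n := by nlinarith
    have h5 : δ ^ n ≤ δ ^ (n - 2) * δ := by rw [e1]; exact mul_le_of_le_one_right (by positivity) hδ1.le
    exact h4.trans h5
  have hR := abs_integral_mul_sq_le (f := g.scalarCurvature) hAm (hvol.trans_lt ENNReal.ofReal_lt_top)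
    hη hum hu1 hu2 huA hC fun p hp => (hcurv p hp).1
  have hH := abs_integral_mul_sq_le (f := g.meanCurvature) hAm (hbd.trans_lt ENNReal.ofReal_lt_top)
    hη hum hu1 hu2 huA hC fun p hp => (hcurv p hp).2
  have hvr : g.volume.real A ≤ C * L ^ n * (δ ^ (n - 2) * δ) := by
    refine (real_cap_le (by positivity) hvol).trans ?_
    rw [mul_pow, e1, ← mul_assoc]
    refine mul_le_mul_of_nonneg_left (mul_le_of_le_one_right (by positivity) hδ1.le) (by positivity)
  have hbr : g.boundaryMeasure.real A ≤ C * L ^ (n - 1) * (δ ^ (n - 2) * δ) := by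
    refine (real_cap_le (by positivity) hbd).trans (le_of_eq ?_)
    rw [mul_pow, e2, ← mul_assoc]
  have hR' : ∫ p, g.scalarCurvature p * (zoom T y₀ k δ p + δ ^ n) ^ 2 ∂g.volume
      ≤ CR * (δ ^ (n - 2) * δ) := by
    refine (le_abs_self _).trans (hR.trans ?_)
    rw [hCR, add_mul, mul_assoc (C * (K + 1) ^ 2), mul_comm IR]
    exact add_le_add (mul_le_mul_of_nonneg_left hvr (by positivity)) (mul_le_mul_of_nonneg_right e3 hIR)
  have hH' : ∫ p, g.meanCurvature p * (zoom T y₀ k δ p + δ ^ n) ^ 2 ∂g.boundaryMeasure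
      ≤ CH * (δ ^ (n - 2) * δ) := by
    refine (le_abs_self _).trans (hH.trans ?_)
    rw [hCH, add_mul, mul_assoc (C * (K + 1) ^ 2), mul_comm IH]
    exact add_le_add (mul_le_mul_of_nonneg_left hbr (by positivity)) (mul_le_mul_of_nonneg_right e3 hIH)
  have hD := integral_dualNorm_zoom_sq (g := g) hp₀ hy₀0 hδ hy₀ hk hρ hsmall hu
  have hE : energy g (SobolevH1.ofSmooth g _ hu)
      = 4 * ((n : ℝ) - 1) / (n - 2) * (∫ p, g.dualNorm p
          (differential (𝓡∂ n) (fun p => zoom T y₀ k δ p + δ ^ n) p) ^ 2 ∂g.volume)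
        + (∫ p, g.scalarCurvature p * (zoom T y₀ k δ p + δ ^ n) ^ 2 ∂g.volume)
        + 2 * ((n : ℝ) - 1) * ∫ p, g.meanCurvature p * (zoom T y₀ k δ p + δ ^ n) ^ 2 ∂g.boundaryMeasure := by
    rw [← integral_const_mul, energy]
    simp only [finrank_euclideanSpace_fin]
    rfl
  rw [hE, hD]
  have hn1' : 0 ≤ 2 * ((n : ℝ) - 1) := by linarith
  have h6 := mul_le_mul_of_nonneg_left hH' hn1'
  have e4 : δ ^ n * (δ ^ 2)⁻¹ = δ ^ (n - 2) := by
    rw [e1]; field_simp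
  rw [← mul_assoc (δ ^ n), e4]
  linarith

/-- The Yamabe constant of the hemisphere is bounded by the Sobolev quotients of a half-space. -/
theorem yamabeConstant_le_tilted (hn : 3 ≤ n) (hp₀ : p₀.1.2 ≠ 1) (hy₀ : ‖y₀‖ = 1) (hy₀0 : y₀ 0 = 0)
    (hT : ∀ v w, g.chartForm p₀ y₀ (T v) (T w) = inner ℝ v w)
    (hk : ContDiff ℝ ∞ k) (hkc : HasCompactSupport k) (hk0 : ∀ x, 0 ≤ k x) {t : ℝ} (ht : 0 < t)
    (ht1 : t ≤ 1) (hM : 0 < ∫ x in tiltedHalfSpace T, k x ^ (2 * (n : ℝ) / (n - 2))) :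
    yamabeConstant t g ≤ ((4 * ((n : ℝ) - 1) / (n - 2) * (∫ x in tiltedHalfSpace T, ‖fderiv ℝ k x‖ ^ 2)
      / (t * ∫ x in tiltedHalfSpace T, k x ^ (2 * (n : ℝ) / (n - 2))) ^ (((n : ℝ) - 2) / n) : ℝ) : EReal) := by
  have hn3 : (3 : ℝ) ≤ n := by exact_mod_cast hn
  set q := 2 * (n : ℝ) / (n - 2) with hq
  have hq0 : 0 < q := div_pos (by linarith) (by linarith)
  set θ := ((n : ℝ) - 2) / n with hθ
  have hθ0 : 0 < θ := div_pos (by linarith) (by linarith)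
  obtain ⟨K, hK⟩ := hkc.exists_bound_of_continuous hk.continuous
  obtain ⟨ρ, hρ0, hρ'⟩ := (IsCompact.isBounded hkc).subset_ball_lt 0 0
  have hρ : ∀ x, k x ≠ 0 → ‖x‖ ≤ ρ := fun x hx => by
    have := hρ' (subset_tsupport _ hx)
    rw [mem_ball_zero_iff] at this
    exact this.le
  obtain ⟨C, hC, r, hr, hE⟩ := exists_energy_zoom_le (g := g) (T := T) hn hp₀ hy₀ hy₀0 hk hk0
    (fun x => (le_abs_self _).trans (hK x)) hρ0.le hρ
  have hkq : Continuous fun x => k x ^ q := hk.continuous.rpow_const fun _ => .inr hq0.le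
  have hkqc : HasCompactSupport fun x => k x ^ q :=
    hkc.comp_left (g := fun s : ℝ => s ^ q) (Real.zero_rpow hq0.ne')
  have hm := tendsto_mass (g := g) (p₀ := p₀) hy₀0 hT hkq hkqc
  have hd := tendsto_dirichlet (g := g) (p₀ := p₀) hy₀0 hT hk hkc
  set m : ℝ → ℝ := fun δ => ∫ x in tiltedHalfSpace T, tiltedDensity g p₀ T y₀ (δ • x) * k x ^ q
  set d : ℝ → ℝ := fun δ => ∫ x in tiltedHalfSpace T, tiltedDensity g p₀ T y₀ (δ • x)
        * dualNormSq (tiltedForm g p₀ T y₀ (δ • x)) (fderiv ℝ k x) with hd_def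
  set a := 4 * ((n : ℝ) - 1) / (n - 2) with ha
  have ha0 : 0 ≤ a := div_nonneg (by linarith) (by linarith)
  have hδ0 : Tendsto (fun δ : ℝ => δ) (𝓝[>] 0) (𝓝 0) := tendsto_nhdsWithin_of_tendsto_nhds tendsto_id
  have hlim : Tendsto (fun δ => ((a * d δ + C * δ) / (t * m δ) ^ θ)) (𝓝[>] 0)
      (𝓝 ((a * (∫ x in tiltedHalfSpace T, ‖fderiv ℝ k x‖ ^ 2) + C * 0)
        / (t * ∫ x in tiltedHalfSpace T, k x ^ q) ^ θ)) :=
    ((hd.const_mul a).add (hδ0.const_mul C)).div ((hm.const_mul t).rpow_const (.inl (by positivity)))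
      (by positivity)
  rw [mul_zero, add_zero] at hlim
  -- The left side does not depend on `δ`, so it suffices to bound it for all small `δ`.
  refine ge_of_tendsto (continuous_coe_real_ereal.continuousAt.tendsto.comp hlim) ?_
  filter_upwards [self_mem_nhdsWithin, hδ0.eventually (gt_mem_nhds hr), hm.eventually (lt_mem_nhds hM)]
    with δ hδ hδr hmδ
  have hδ : 0 < δ := hδ
  obtain ⟨hsmall, hEδ⟩ := hE δ hδ hδr
  have hz := contMDiff_zoom (T := T) hy₀ hδ hρ hsmall hk
  have hu : ContMDiff (𝓡∂ n) 𝓘(ℝ, ℝ) ∞ fun p => zoom T y₀ k δ p + δ ^ n := hz.add contMDiff_const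
  have hη : 0 < δ ^ n := by positivity
  have hz0 : ∀ p, 0 ≤ zoom T y₀ k δ p := fun p => hk0 _
  have hdd : 0 ≤ d δ := by
    have h1 := integral_dualNorm_zoom_sq (g := g) hp₀ hy₀0 hδ hy₀ hk hρ hsmall hu
    have h2 : 0 ≤ δ ^ n * ((δ ^ 2)⁻¹ * d δ) := h1 ▸ integral_nonneg fun p => sq_nonneg _
    rw [← mul_assoc] at h2
    exact nonneg_of_mul_nonneg_right h2 (by positivity)
  have h := yamabeConstant_le_of_smooth g ht ht1 (by simpa using hn) hu
    (fun p => by linarith [hz0 p]) (A := δ ^ n * m δ) (mul_pos hη hmδ) (by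
      simp only [finrank_euclideanSpace_fin]
      rw [← integral_zoom_rpow hp₀ hy₀0 hδ hy₀ hk hρ hsmall hq0]
      refine integral_mono (g.integrable_of_continuous (hz.continuous.rpow_const fun _ => .inr hq0.le))
        (g.integrable_of_continuous (hu.continuous.rpow_const fun _ => .inr hq0.le)) fun p => ?_
      exact Real.rpow_le_rpow (hz0 p) (by linarith) hq0.le) (hEδ hu) (by positivity)
  refine h.trans (le_of_eq ?_)
  simp only [finrank_euclideanSpace_fin, Function.comp_apply]
  congr 1
  -- Scale invariance: `(δ^n)^θ = δ^(n-2)` cancels the power in front of the energy.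
  have h3 : (t * (δ ^ n * m δ)) ^ θ = δ ^ (n - 2) * (t * m δ) ^ θ := by
    rw [mul_left_comm, Real.mul_rpow hη.le (by positivity), ← Real.rpow_natCast, ← Real.rpow_mul hδ.le,
      ← Real.rpow_natCast, Nat.cast_sub (by omega), hθ, mul_div_cancel₀ _ (by positivity)]
    norm_num
  rw [← hθ, h3, mul_div_mul_left _ _ (by positivity)]

end Concentration

/-! ### Halving a function by a hyperplane. -/

section Halving

variable {W : Type*} [NormedAddCommGroup W] [NormedSpace ℝ W] [FiniteDimensional ℝ W]
  [MeasurableSpace W] [BorelSpace W] {μ : Measure W} [μ.IsAddHaarMeasure] {ℓ : W →L[ℝ] ℝ} {ν : W}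

theorem measure_level_eq_zero (hν : ℓ ν = 1) (s : ℝ) : μ {x | ℓ x = s} = 0 := by
  have h1 : {x | ℓ x = s} = (fun x => x + (-s) • ν) ⁻¹' (LinearMap.ker (ℓ : W →ₗ[ℝ] ℝ) : Set W) := by
    ext x
    simp [hν, add_neg_eq_zero]
  rw [h1, measure_preimage_add_right]
  refine Measure.addHaar_submodule μ _ fun h => ?_
  have : ν ∈ LinearMap.ker (ℓ : W →ₗ[ℝ] ℝ) := h ▸ Submodule.mem_top
  rw [LinearMap.mem_ker] at this
  exact one_ne_zero (hν.symm.trans this)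

theorem setIntegral_add_setIntegral_level (hν : ℓ ν = 1) (s : ℝ) {f : W → ℝ} (hf : Integrable f μ) :
    (∫ x in {x | s ≤ ℓ x}, f x ∂μ) + ∫ x in {x | ℓ x ≤ s}, f x ∂μ = ∫ x, f x ∂μ := by
  have hm : MeasurableSet {x | s ≤ ℓ x} := (isClosed_le continuous_const ℓ.continuous).measurableSet
  rw [← integral_add_compl hm hf]
  congr 1
  refine setIntegral_congr_set ?_
  have h0 : ∀ᵐ x ∂μ, ℓ x ≠ s := by
    rw [ae_iff]
    simpa using measure_level_eq_zero (μ := μ) hν s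
  filter_upwards [h0] with x hx
  refine propext ?_
  change ℓ x ≤ s ↔ ¬ s ≤ ℓ x
  rw [not_le]
  exact ⟨fun h => lt_of_le_of_ne h hx, le_of_lt⟩

theorem continuous_setIntegral_level (hν : ℓ ν = 1) {f : W → ℝ} (hf : Integrable f μ) :
    Continuous fun s : ℝ => ∫ x in {x | s ≤ ℓ x}, f x ∂μ := by
  have hm : ∀ s, MeasurableSet {x | s ≤ ℓ x} := fun s =>
    (isClosed_le continuous_const ℓ.continuous).measurableSet
  simp only [← integral_indicator (hm _)]
  refine continuous_iff_continuousAt.2 fun s₀ => ?_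
  refine continuousAt_of_dominated (bound := fun x => ‖f x‖)
    (.of_forall fun s => hf.aestronglyMeasurable.indicator (hm s))
    (.of_forall fun s => .of_forall fun x => norm_indicator_le_norm_self _ _) hf.norm ?_
  have h0 : ∀ᵐ x ∂μ, ℓ x ≠ s₀ := by
    rw [ae_iff]
    simpa using measure_level_eq_zero (μ := μ) hν s₀
  filter_upwards [h0] with x hx
  rcases lt_or_gt_of_ne hx with h | h
  · have : (fun s : ℝ => indicator {x | s ≤ ℓ x} f x) =ᶠ[𝓝 s₀] fun _ => 0 := by
      filter_upwards [lt_mem_nhds h] with s hs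
      exact indicator_of_notMem (s := {x | s ≤ ℓ x}) (fun h' : s ≤ ℓ x => not_lt_of_ge h' hs) _
    exact continuousAt_const.congr this.symm
  · have : (fun s : ℝ => indicator {x | s ≤ ℓ x} f x) =ᶠ[𝓝 s₀] fun _ => f x := by
      filter_upwards [gt_mem_nhds h] with s hs
      exact indicator_of_mem (s := {x | s ≤ ℓ x}) (show s ≤ ℓ x from hs.le) _
    exact continuousAt_const.congr this.symm

/-- Hyperplanes are null sets, so the mass above level `s` is continuous in `s` and passes from
everything to nothing; some level halves it. The two integrals of `D` add up to the total, so they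
cannot both exceed one half. It is applied to `f = h^p` and `D = |∇h|²`. -/
theorem exists_half_mass (hν : ℓ ν = 1) {f D : W → ℝ} (hf : Continuous f) (hfc : HasCompactSupport f)
    (hf0 : 0 ≤ ∫ x, f x ∂μ) (hD : Integrable D μ) : ∃ s : ℝ,
      (∫ x in {x | s ≤ ℓ x}, f x ∂μ) = (∫ x, f x ∂μ) / 2 ∧
      (∫ x in {x | ℓ x ≤ s}, f x ∂μ) = (∫ x, f x ∂μ) / 2 ∧
      ((∫ x in {x | s ≤ ℓ x}, D x ∂μ) ≤ (∫ x, D x ∂μ) / 2 ∨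
        (∫ x in {x | ℓ x ≤ s}, D x ∂μ) ≤ (∫ x, D x ∂μ) / 2) := by
  have hfi : Integrable f μ := hf.integrable_of_hasCompactSupport hfc
  obtain ⟨R, hR⟩ := (IsCompact.image hfc ℓ.continuous).isBounded.exists_norm_le
  have hsupp : ∀ x, f x ≠ 0 → |ℓ x| ≤ R := fun x hx => hR _ ⟨x, subset_tsupport _ hx, rfl⟩
  have hlow : (∫ x in {x | -R ≤ ℓ x}, f x ∂μ) = ∫ x, f x ∂μ :=
    setIntegral_eq_integral_of_forall_compl_eq_zero fun x hx => by
      by_contra h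
      exact hx (abs_le.1 (hsupp x h)).1
  have hhigh : (∫ x in {x | R + 1 ≤ ℓ x}, f x ∂μ) = 0 :=
    setIntegral_eq_zero_of_forall_eq_zero fun x hx => by
      by_contra h
      have h1 : R + 1 ≤ ℓ x := hx
      linarith [(abs_le.1 (hsupp x h)).2]
  obtain ⟨s, hs⟩ := mem_range_of_exists_le_of_exists_ge
    (continuous_setIntegral_level (μ := μ) hν hfi) (c := (∫ x, f x ∂μ) / 2)
    ⟨R + 1, by simp only [hhigh]; linarith⟩ ⟨-R, by simp only [hlow]; linarith⟩
  have h1 := setIntegral_add_setIntegral_level hν s hfi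
  have h2 := setIntegral_add_setIntegral_level hν s hD
  simp only at hs
  refine ⟨s, hs, by linarith, ?_⟩
  by_contra! h
  linarith [h.1, h.2]

end Halving

/-! ### Moving either side of the hyperplane onto the fixed half-space. -/

section HalfSpaceTransport

variable {n : ℕ}

theorem setIntegral_translate {ℓ : EuclideanSpace ℝ (Fin n) →L[ℝ] ℝ} {ν : EuclideanSpace ℝ (Fin n)}
    (hν : ℓ ν = 1) (s : ℝ) (f : EuclideanSpace ℝ (Fin n) → ℝ) :
    ∫ x in {x | 0 ≤ ℓ x}, f (x + s • ν) = ∫ x in {x | s ≤ ℓ x}, f x := by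
  have hm : ∀ s, MeasurableSet {x | s ≤ ℓ x} := fun s =>
    (isClosed_le continuous_const ℓ.continuous).measurableSet
  rw [← integral_indicator (hm 0), ← integral_indicator (hm s),
    ← integral_add_right_eq_self (fun x => indicator {x | s ≤ ℓ x} f x) (s • ν)]
  congr 1
  ext x
  simp only [indicator_apply, Set.mem_ofPred_eq]
  simp [hν]

theorem setIntegral_reflect {ℓ : EuclideanSpace ℝ (Fin n) →L[ℝ] ℝ} {ν : EuclideanSpace ℝ (Fin n)}
    (hν : ℓ ν = 1) (s : ℝ) (f : EuclideanSpace ℝ (Fin n) → ℝ) :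
    ∫ x in {x | 0 ≤ ℓ x}, f (s • ν - x) = ∫ x in {x | ℓ x ≤ s}, f x := by
  have hm : MeasurableSet {x | 0 ≤ ℓ x} := (isClosed_le continuous_const ℓ.continuous).measurableSet
  have hm' : MeasurableSet {x | ℓ x ≤ s} := (isClosed_le ℓ.continuous continuous_const).measurableSet
  rw [← integral_indicator hm, ← integral_indicator hm',
    ← integral_sub_left_eq_self (fun x => indicator {x | ℓ x ≤ s} f x) volume (s • ν)]
  congr 1
  ext x
  simp only [indicator_apply, Set.mem_ofPred_eq]
  simp [hν]

theorem norm_fderiv_reflect {h : EuclideanSpace ℝ (Fin n) → ℝ} (hh : ContDiff ℝ ∞ h)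
    (c x : EuclideanSpace ℝ (Fin n)) : ‖fderiv ℝ (fun y => h (c - y)) x‖ = ‖fderiv ℝ h (c - x)‖ := by
  have h1 : HasFDerivAt h (fderiv ℝ h (c - x)) (c - x) :=
    (hh.differentiable (by simp)).differentiableAt.hasFDerivAt
  have h2 : HasFDerivAt (fun y => h (c - y)) (-fderiv ℝ h (c - x)) x := by
    refine (h1.comp x ((hasFDerivAt_id x).const_sub c)).congr_fderiv ?_
    ext v
    simp
  rw [h2.fderiv, norm_neg]

end HalfSpaceTransport

/-! ### Comparison of the two invariants. -/

section Comparison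

variable {n : ℕ} [NeZero n]

/-- An orthonormal frame need not preserve the coordinate half-space. The halving argument needs
only some linear form cutting it out and a vector on which that form is `1`. -/
theorem exists_tiltedHalfSpace_eq (T : EuclideanSpace ℝ (Fin n) ≃L[ℝ] EuclideanSpace ℝ (Fin n)) :
    ∃ (ℓ : EuclideanSpace ℝ (Fin n) →L[ℝ] ℝ) (ν : EuclideanSpace ℝ (Fin n)),
      ℓ ν = 1 ∧ tiltedHalfSpace T = {x | 0 ≤ ℓ x} :=
  ⟨(EuclideanSpace.proj (0 : Fin n)).comp
    (T : EuclideanSpace ℝ (Fin n) →L[ℝ] EuclideanSpace ℝ (Fin n)),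
    T.symm (EuclideanSpace.single 0 1), by simp, rfl⟩

theorem integrable_norm_fderiv_sq {h : EuclideanSpace ℝ (Fin n) → ℝ} (hh : ContDiff ℝ ∞ h)
    (hhc : HasCompactSupport h) : Integrable fun x => ‖fderiv ℝ h x‖ ^ 2 := by
  have hc : Continuous fun x => ‖fderiv ℝ h x‖ ^ 2 := (hh.continuous_fderiv (by simp)).norm.pow 2
  refine hc.integrable_of_hasCompactSupport ((hhc.fderiv (𝕜 := ℝ)).mono fun x hx h0 => hx ?_)
  simp only [h0, norm_zero, zero_pow two_ne_zero]

/-- The test function is the better half of `h`: the upper side is translated, the lower one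
reflected by `x ↦ s ν - x`, onto the half-space. Mass is exactly half, energy at most half. -/
theorem yamabeConstant_le_of_frame {g : SmoothMetric (𝓡∂ n) (Hemisphere n)} {p₀ : Hemisphere n}
    {T : EuclideanSpace ℝ (Fin n) ≃L[ℝ] EuclideanSpace ℝ (Fin n)} {y₀ : EuclideanSpace ℝ (Fin n)}
    (hn : 3 ≤ n) (hp₀ : p₀.1.2 ≠ 1) (hy₀ : ‖y₀‖ = 1) (hy₀0 : y₀ 0 = 0)
    (hT : ∀ v w, g.chartForm p₀ y₀ (T v) (T w) = inner ℝ v w)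
    {h : EuclideanSpace ℝ (Fin n) → ℝ} (hh : ContDiff ℝ ∞ h) (hhc : HasCompactSupport h)
    (hh0 : ∀ x, 0 ≤ h x) {t : ℝ} (ht : 0 < t) (ht1 : t ≤ 1)
    (hM : 0 < ∫ x, h x ^ (2 * (n : ℝ) / (n - 2))) :
    yamabeConstant t g ≤ ((4 * ((n : ℝ) - 1) / (n - 2) * ((∫ x, ‖fderiv ℝ h x‖ ^ 2) / 2)
      / (t * ((∫ x, h x ^ (2 * (n : ℝ) / (n - 2))) / 2)) ^ (((n : ℝ) - 2) / n) : ℝ) : EReal) := by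
  have hn3 : (3 : ℝ) ≤ n := by exact_mod_cast hn
  obtain ⟨ℓ, ν, hν, hset⟩ := exists_tiltedHalfSpace_eq T
  set q := 2 * (n : ℝ) / (n - 2) with hq
  have hq0 : 0 < q := div_pos (by linarith) (by linarith)
  have hcq : Continuous fun x => h x ^ q := hh.continuous.rpow_const fun _ => .inr hq0.le
  have hcqc : HasCompactSupport fun x => h x ^ q :=
    hhc.comp_left (g := fun s : ℝ => s ^ q) (Real.zero_rpow hq0.ne')
  have hD := integrable_norm_fderiv_sq hh hhc
  obtain ⟨s, hs1, hs2, hs3⟩ := exists_half_mass hν hcq hcqc hM.le hD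
  have ha0 : 0 ≤ 4 * ((n : ℝ) - 1) / (n - 2) := div_nonneg (by linarith) (by linarith)
  suffices H : ∃ k : EuclideanSpace ℝ (Fin n) → ℝ, ContDiff ℝ ∞ k ∧ HasCompactSupport k ∧
      (∀ x, 0 ≤ k x) ∧ (∫ x in tiltedHalfSpace T, k x ^ q) = (∫ x, h x ^ q) / 2 ∧
      (∫ x in tiltedHalfSpace T, ‖fderiv ℝ k x‖ ^ 2) ≤ (∫ x, ‖fderiv ℝ h x‖ ^ 2) / 2 by
    obtain ⟨k, hk, hkc, hk0, hkM, hkD⟩ := H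
    refine (yamabeConstant_le_tilted hn hp₀ hy₀ hy₀0 hT hk hkc hk0 ht ht1 (by rw [hkM]; positivity)).trans ?_
    rw [hkM, EReal.coe_le_coe_iff]
    gcongr
  rw [hset]
  rcases hs3 with hs3 | hs3
  · refine ⟨fun x => h (x + s • ν), hh.comp (contDiff_id.add contDiff_const),
      hhc.comp_homeomorph (Homeomorph.addRight (s • ν)), fun x => hh0 _, ?_, ?_⟩
    · exact (setIntegral_translate hν s fun x => h x ^ q).trans hs1
    · simp only [fderiv_comp_add_right]
      exact (setIntegral_translate hν s fun x => ‖fderiv ℝ h x‖ ^ 2).trans_le hs3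
  · refine ⟨fun x => h (s • ν - x), hh.comp (contDiff_const.sub contDiff_id),
      hhc.comp_homeomorph (Homeomorph.subLeft (s • ν)), fun x => hh0 _, ?_, ?_⟩
    · exact (setIntegral_reflect hν s fun x => h x ^ q).trans hs2
    · simp only [norm_fderiv_reflect hh]
      exact (setIntegral_reflect hν s fun x => ‖fderiv ℝ h x‖ ^ 2).trans_le hs3

/-- The Yamabe constants of the hemisphere are bounded by the Sobolev quotients of `ℝⁿ`. -/
theorem yamabeConstant_hemisphere_le (g : SmoothMetric (𝓡∂ n) (Hemisphere n)) (hn : 3 ≤ n)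
    {h : EuclideanSpace ℝ (Fin n) → ℝ} (hh : ContDiff ℝ ∞ h) (hhc : HasCompactSupport h)
    (hh0 : ∀ x, 0 ≤ h x) {t : ℝ} (ht : 0 < t) (ht1 : t ≤ 1)
    (hM : 0 < ∫ x, h x ^ (2 * (n : ℝ) / (n - 2))) :
    yamabeConstant t g ≤ ((4 * ((n : ℝ) - 1) / (n - 2) * ((∫ x, ‖fderiv ℝ h x‖ ^ 2) / 2)
      / (t * ((∫ x, h x ^ (2 * (n : ℝ) / (n - 2))) / 2)) ^ (((n : ℝ) - 2) / n) : ℝ) : EReal) := by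
  obtain ⟨p₀, hp₀⟩ : ∃ p₀ : Hemisphere n, p₀.1.2 ≠ 1 :=
    ⟨⟨(0, -1), by simp, by simp⟩, by norm_num⟩
  obtain ⟨y₀, hy₀, hy₀0⟩ : ∃ y₀ : EuclideanSpace ℝ (Fin n), ‖y₀‖ = 1 ∧ y₀ 0 = 0 := by
    refine ⟨EuclideanSpace.single ⟨1, by omega⟩ 1, by simp, ?_⟩
    have : (0 : Fin n) ≠ ⟨1, by omega⟩ := fun h => by
      have := congrArg Fin.val h
      simp at this
    simp [this]
  have hy₀t : y₀ ∈ (extChartAt (𝓡∂ n) p₀).target := by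
    rw [extChartAt_hemisphere_target, range_halfSpaceModel]
    exact hy₀0.ge
  obtain ⟨T, hT⟩ := exists_isometric_frame (g.chartForm p₀ y₀) (g.chartForm_symm p₀ y₀)
    (g.chartForm_pos hy₀t)
  exact yamabeConstant_le_of_frame hn hp₀ hy₀ hy₀0 hT hh hhc hh0 ht ht1 hM

/-- The bound by the quotient of half the energy and half the mass, solved for the energy; the two
halves produce the constants `2` and `t/2`. For `∫ h^p = 0` the inequality is trivial. -/
theorem sobolevIneq_of_le_yamabeConstant (g : SmoothMetric (𝓡∂ n) (Hemisphere n)) (hn : 3 ≤ n)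
    {t : ℝ} (ht : 0 < t) (ht1 : t ≤ 1) {y : ℝ} (hy : (y : EReal) ≤ yamabeConstant t g) :
    SobolevIneq n (2 * y * (t / 2) ^ (((n : ℝ) - 2) / n)) := by
  intro h hh hhc hh0
  have hn3 : (3 : ℝ) ≤ n := by exact_mod_cast hn
  have hθ : 0 < ((n : ℝ) - 2) / n := div_pos (by linarith) (by linarith)
  have ha0 : 0 ≤ 4 * ((n : ℝ) - 1) / (n - 2) := div_nonneg (by linarith) (by linarith)
  have hM0 : 0 ≤ ∫ x, h x ^ (2 * (n : ℝ) / (n - 2)) :=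
    integral_nonneg fun x => Real.rpow_nonneg (hh0 x) _
  rcases hM0.eq_or_lt with hM | hM
  · rw [← hM, Real.zero_rpow hθ.ne', mul_zero]
    exact mul_nonneg ha0 (integral_nonneg fun x => sq_nonneg _)
  have h1 := hy.trans (yamabeConstant_hemisphere_le g hn hh hhc hh0 ht ht1 hM)
  rw [EReal.coe_le_coe_iff, le_div_iff₀ (by positivity), mul_div_left_comm, Real.mul_rpow hM.le (by positivity)] at h1
  linarith

theorem yamabeInvariant_hemisphere_le {m : ℕ} (hm : 2 ≤ m) {t : ℝ} (ht : t ∈ Set.Icc (0 : ℝ) 1) :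
    yamabeInvariant (𝓡∂ (m + 1)) (Hemisphere (m + 1)) t
      ≤ yamabeInvariant ((𝓡 m).prod (𝓡 1)) (ProjCircle m) t := by
  rcases ht.1.eq_or_lt with rfl | ht0
  · rw [yamabeInvariant_projCircle_zero]
    exact le_top
  -- It suffices to treat real `z` below the constant of `g`, so infinite values need no separate
  -- discussion.
  refine iSup_le fun g => EReal.ge_of_forall_gt_iff_ge.1 fun z hz => ?_
  rcases le_or_gt z 0 with hz0 | hz0
  · have h0 : SobolevIneq (m + 1) 0 := fun h _ _ _ => by
      have h3 : (2 : ℝ) ≤ m := by exact_mod_cast hm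
      rw [zero_mul]
      push_cast
      exact mul_nonneg (div_nonneg (by linarith) (by linarith)) (integral_nonneg fun x => sq_nonneg _)
    refine le_trans ?_ (h0.le_yamabeInvariant le_rfl hm ht0)
    rw [EReal.coe_le_coe_iff, zero_mul, zero_div]
    exact hz0
  · have h1 := sobolevIneq_of_le_yamabeConstant g (by omega) ht0 ht.2 hz.le
    refine le_trans (le_of_eq ?_) (h1.le_yamabeInvariant (by positivity) hm ht0)
    congr 1
    -- With `S = 2 z (t/2)^θ` the lower bound `S (2/t)^θ / 2` is exactly `z`.
    rw [mul_assoc, ← Real.mul_rpow (by positivity) (by positivity), div_mul_div_comm, mul_comm t,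
      div_self (by positivity), Real.one_rpow]
    ring

end Comparison

end Yamabe

end

theorem mainTheorem11 (n : ℕ) [NeZero n] (hn : 3 ≤ n) (t : ℝ) (ht : t ∈ Set.Icc (0 : ℝ) 1) :
    (∀ (E : Type*) [NormedAddCommGroup E] [NormedSpace ℝ E] [FiniteDimensional ℝ E]
      [MeasurableSpace E] [BorelSpace E] (_ : Module.finrank ℝ E = n)
      (H : Type*) [TopologicalSpace H] (I : ModelWithCorners ℝ E H) [I.Boundaryless]
      (M : Type*) [TopologicalSpace M] [ChartedSpace H M] [IsManifold I ∞ M] [T2Space M]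
      [CompactSpace M] [MeasurableSpace M] [BorelSpace M]
      (M' : Type*) [TopologicalSpace M'] [ChartedSpace H M'] [IsManifold I ∞ M'] [T2Space M']
      [MeasurableSpace M'] [BorelSpace M']
      (g : Yamabe.SmoothMetric I M) (g' : Yamabe.SmoothMetric I M') (k : ℕ) (_ : 1 ≤ k) (π : M' → M)
      (_ : Yamabe.IsRiemannianCovering k π g' g),
      Yamabe.yamabeConstant t g ≥ Yamabe.yamabeConstant t g' / (((k : ℝ) ^ ((2 : ℝ) / n) : ℝ) : EReal)) ∧
    Yamabe.yamabeInvariant ((𝓡 (n - 1)).prod (𝓡 1))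
        (RealProjectiveSpace (n - 1) × Metric.sphere (0 : EuclideanSpace ℝ (Fin 2)) 1) t
      ≥ Yamabe.yamabeInvariant (𝓡∂ n) (Hemisphere n) t := by
  refine ⟨?_, ?_⟩
  · intro E _ _ _ _ _ hdim H _ I _ M _ _ _ _ _ _ _ M' _ _ _ _ _ _ g g' k hk π h
    exact h.yamabeConstant_ge hk hn hdim t
  · obtain ⟨m, rfl⟩ : ∃ m, n = m + 1 := ⟨n - 1, by omega⟩
    exact Yamabe.yamabeInvariant_hemisphere_le (by omega) ht
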